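/- **Setting.** Let $\Omega\subset\mathbb R^2$ be a bounded polygonal domain, possibly non-Lipschitz (a bounded connected open set whose boundary is a finite union of nondegenerate segments). Let $f$ be continuous on $\Omega\times\mathbb R$ with $f(\cdot;s)\in L_\infty(\Omega)$ for all $s$ (its values at boundary nodes, which enter only through the nodal interpolant below, may be arbitrary), and let $f(x;v)-f(x;w)\ge C_f(v-w)$ for $v\ge w$, $x\in\Omega$, with a constant $C_f\ge0$. Let $0<\varepsilon\le1$, $C_f+\varepsilon^2\ge1$, and let $u\in H^1_0(\Omega)\cap C(\bar\Omega)$, $u=0$ on $\partial\Omega$, be the weak solution of $-\varepsilon^2\Delta u+f(x;u)=0$. Let $\mathcal T$ be a conforming triangulation of $\Omega$ with the node set $\mathcal N$, $S_h$ the space of continuous functions on $\bar\Omega$ that are affine on each triangle and vanish on $\partial\Omega$, $\phi_z$ the hat functions, $w^I=\sum_z w(z)\phi_z$, and let $u_h\in S_h$ satisfy $\varepsilon^2\langle\nabla u_h,\nabla v_h\rangle+\langle f_h^I,v_h\rangle=0$ for all $v_h\in S_h$, where $f_h:=f(\cdot;u_h)$. Write $|||v|||_{\varepsilon;\Omega}=\{\varepsilon^2\|\nabla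 v\|^2_{2;\Omega}+\|v\|^2_{2;\Omega}\}^{1/2}$. For a triangle $T$ let $H_T$ be its longest edge length and $h_T=2|T|/H_T$. For $z\in\mathcal N$ let $\omega_z$ be the union of the (closed) triangles containing $z$, $\mathcal S_z$ the set of edges originating at $z$, $\gamma_z$ the set of those edges in $\mathcal S_z$ that do not lie on $\partial\Omega$, $H_z=\operatorname{diam}\omega_z$, $h_z=|\omega_z|/H_z$. On an interior edge, $[\![\nabla u_h]\!]\cdot\nu$ denotes the sum of the outward normal derivatives of $u_h$ from the two adjacent triangles, and $|[\![\nabla u_h]\!]|$ its modulus; the maximum over an empty $\gamma_z$ is $0$. **Mesh assumptions**, with constants $\alpha_0<\pi$, $K$, $\kappa$, $c_0$, $M$: (a) all angles of all triangles are at most $\alpha_0$; (b) for each $z\in\mathcal N$ there is a rectangle $R_z\supset\omega_z$ with $|R_z|\le K|\omega_z|$, and if $z\in\partial\Omega$ is not a corner of $\Omega$ (a corner is a boundary point near which $\partial\Omega$ is not a straight line), $R_z$ has a side parallel to the edges in $\mathcal S_z$ that lie on $\partial\Omega$; (c) at most $K$ triangles contain any given node. A node $z$ is *anisotropic* if $h_z<c_0H_z$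 and, for all triangles $T\ni z$, $h_T\le Kh_z$, $h_z\le Kh_T$, $H_T\le KH_z$ and $H_z\le KH_T$; it is *regular* if $H_T\le Mh_T$ for all triangles $T\ni z$. **Error terms.** Assuming $|||u_h-u|||_{\varepsilon;\Omega}>0$, let $G=(u_h-u)/|||u_h-u|||_{\varepsilon;\Omega}$, let $G_h\in S_h$ be arbitrary, $g=G-G_h$, and for real numbers $\{\bar g_z\}_{z\in\mathcal N}$ put $$I=\sum_{z\in\mathcal N}\varepsilon^2\int_{\gamma_z}(g-\bar g_z)\phi_z[\![\nabla u_h]\!]\cdot\nu,\qquad II=\sum_{z\in\mathcal N}\int_{\omega_z}f_h^I(g-\bar g_z)\phi_z,\qquad \mathcal E_{\rm quad}=|\langle f_h-f_h^I,G\rangle|,$$ $$\Theta=\varepsilon^2\|\nabla g\|^2_{2;\Omega}+\sum_{z\in\mathcal N}(1+\varepsilon^2H_z^{-2})\|g\|^2_{2;\omega_z}.$$ **Choice of $\bar g_z$.** Call $\{\bar g_z\}$ an *averaging family* if $\bar g_z=0$ whenever $z\in\partial\Omega$ or $z$ is regular, while for every other $z$ the following holds in some local Cartesian coordinates $(\xi,\eta)$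 with origin $z$ and $\xi$-axis along a longest edge in $\mathcal S_z$. Let $\mathcal S_z^{\pm}$ be the set of edges $S\in\mathcal S_z$ with $|S|>\kappa h_z$ whose endpoint other than $z$ has $\pm\xi>0$; let $\xi_z^+$ be the minimum of $\xi$ over these endpoints for $\mathcal S_z^+$, and $\xi_z^-$ the maximum of $\xi$ over those for $\mathcal S_z^-$ ($0$ if the set is empty); let $\varphi_z$ be the piecewise-linear hat function on $(\xi_z^-,\xi_z^+)$ with $\varphi_z(0)=1$. Then for some continuous $\bar\eta_z$, linear for $\xi\le0$ and for $\xi\ge0$, with $\bar\eta_z(0)=0$ and $(\xi,\bar\eta_z(\xi))\in\omega_z$ for $\xi\in(\xi_z^-,\xi_z^+)$, $$\int_{\xi_z^-}^{\xi_z^+}\bigl[g(\xi,\bar\eta_z(\xi))-\bar g_z\bigr]\varphi_z(\xi)\,d\xi=0 .$$ **Theorem.** Let $\alpha_0<\pi$ and $K$ be given. For all sufficiently large $\kappa$ (depending on $\alpha_0,K$) and all sufficiently small $c_0>0$ (depending on $\alpha_0,K,\kappa$), and for all $M$, $\Omega$, $f$, $C_f$ as above, there is a constant $C>0$, independent of $\varepsilon$,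 of the triangulation (in particular of the diameters and aspect ratios of its elements), of $u$, $u_h$ and of $G_h$, such that the following holds whenever (a)–(c) are satisfied, every node is anisotropic or regular, and every corner of $\Omega$ is a regular node. 1. For every $\{\bar g_z\}$ with $\bar g_z=0$ for $z\in\mathcal N\cap\partial\Omega$, one has $|||u_h-u|||_{\varepsilon;\Omega}\le C\,(I+II+\mathcal E_{\rm quad})$. 2. Averaging families exist, and for each of them $$|I|\le C\Bigl\{\Theta\sum_{z\in\mathcal N}\min\{|\omega_z|,\varepsilon H_z\}\,\bigl\|\varepsilon[\![\nabla u_h]\!]\bigr\|^2_{\infty;\gamma_z}\Bigr\}^{1/2}.$$ -/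

import Mathlib

open MeasureTheory Filter Topology
open scoped ENNReal ContDiff RealInnerProductSpace

noncomputable section

namespace AnisoFEM

abbrev Plane := EuclideanSpace ℝ (Fin 2)

/-- Rotation by a right angle. -/
def rot (v : Plane) : Plane := !₂[-v 1, v 0]

/-! ### The domain -/

/-- A bounded polygonal domain, not necessarily Lipschitz (slits and touching boundary vertices
are allowed): a bounded connected open set whose boundary is a finite union of nondegenerate
segments. -/
structure IsPolygonalDomain (Ω : Set Plane) : Prop where
  isOpen : IsOpen Ω
  isConnected : IsConnected Ω
  isBounded : Bornology.IsBounded Ω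
  frontier_eq : ∃ B : Finset (Plane × Plane), (∀ p ∈ B, p.1 ≠ p.2) ∧
    frontier Ω = ⋃ p ∈ B, segment ℝ p.1 p.2

/-- A corner is a boundary point near which the boundary is not a straight line. -/
def IsCorner (Ω : Set Plane) (z : Plane) : Prop :=
  z ∈ frontier Ω ∧ ¬ ∃ v : Plane, v ≠ 0 ∧ ∃ r : ℝ, 0 < r ∧
    ∀ x ∈ Metric.ball z r, x ∈ frontier Ω ↔ ∃ t : ℝ, x = z + t • v

/-! ### The continuous problem -/

/-- `f` is continuous on `Ω × ℝ`, essentially bounded in `Ω` for each value of the last argument,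
and satisfies the one-sided Lipschitz condition with the constant `Cf ≥ 0`. -/
structure IsReaction (Ω : Set Plane) (f : Plane → ℝ → ℝ) (Cf : ℝ) : Prop where
  continuousOn : ContinuousOn (fun p : Plane × ℝ => f p.1 p.2) (Ω ×ˢ Set.univ)
  memLp_top : ∀ s : ℝ, MemLp (fun x => f x s) ∞ (volume.restrict Ω)
  const_nonneg : 0 ≤ Cf
  oneSided : ∀ x ∈ Ω, ∀ v w : ℝ, w ≤ v → Cf * (v - w) ≤ f x v - f x w

/-- Smooth functions with compact support in `Ω`. -/
structure IsTest (Ω : Set Plane) (φ : Plane → ℝ) : Prop where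
  contDiff : ContDiff ℝ ∞ φ
  hasCompactSupport : HasCompactSupport φ
  tsupport_subset : tsupport φ ⊆ Ω

/-- `v ∈ H¹₀(Ω)` with (weak) gradient `Dv`: the closure of the test functions in the `H¹` norm. -/
structure MemH10 (Ω : Set Plane) (v : Plane → ℝ) (Dv : Plane → Plane) : Prop where
  memLp : MemLp v 2 (volume.restrict Ω)
  memLp_grad : MemLp Dv 2 (volume.restrict Ω)
  approx : ∃ φ : ℕ → Plane → ℝ, (∀ n, IsTest Ω (φ n)) ∧
    Tendsto (fun n => eLpNorm (fun x => φ n x - v x) 2 (volume.restrict Ω)) atTop (𝓝 0) ∧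
    Tendsto (fun n => eLpNorm (fun x => gradient (φ n) x - Dv x) 2 (volume.restrict Ω))
      atTop (𝓝 0)

/-- `u` (with weak gradient `Du`) is the weak solution of `-ε² Δu + f(x; u) = 0` in `Ω`, `u = 0` on
`∂Ω`; it is continuous on the closure of `Ω`. -/
structure IsSolution (Ω : Set Plane) (f : Plane → ℝ → ℝ) (ε : ℝ) (u : Plane → ℝ)
    (Du : Plane → Plane) : Prop where
  continuousOn : ContinuousOn u (closure Ω)
  boundary : ∀ x ∈ frontier Ω, u x = 0
  memH10 : MemH10 Ω u Du
  weak : ∀ φ : Plane → ℝ, IsTest Ω φ →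
    ε ^ 2 * (∫ x in Ω, ⟪Du x, gradient φ x⟫) + ∫ x in Ω, f x (u x) * φ x = 0

/-- The energy norm over `D` of a function `v` with gradient `Dv`. -/
def energyNorm (ε : ℝ) (D : Set Plane) (v : Plane → ℝ) (Dv : Plane → Plane) : ℝ :=
  Real.sqrt (ε ^ 2 * (∫ x in D, ‖Dv x‖ ^ 2) + ∫ x in D, v x ^ 2)

/-! ### Triangulations -/

/-- A (conforming) triangulation of `Ω`: a finite simplicial complex all of whose faces belong to
triangles, which fills the closure of `Ω`, and such that the boundary of `Ω` is a union of edges. -/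
structure Triangulation (Ω : Set Plane) extends Geometry.SimplicialComplex ℝ Plane where
  finite_faces : faces.Finite
  pure : ∀ s ∈ faces, ∃ T ∈ faces, T.card = 3 ∧ s ⊆ T
  space_eq : toSimplicialComplex.space = closure Ω
  frontier_edges : ∀ x ∈ frontier Ω, ∃ s ∈ faces, s.card = 2 ∧
    x ∈ convexHull ℝ (s : Set Plane) ∧ convexHull ℝ (s : Set Plane) ⊆ frontier Ω

/-- The closed triangle (or edge) with the given vertices. -/
def cell (T : Finset Plane) : Set Plane := convexHull ℝ (T : Set Plane)

/-- The area `|T|`. -/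
def area (T : Finset Plane) : ℝ := volume.real (cell T)

/-- `H_T`, the maximum edge length. -/
def maxEdge (T : Finset Plane) : ℝ := Metric.diam (T : Set Plane)

/-- `h_T = 2 |T| / H_T`, the minimum height. -/
def minHeight (T : Finset Plane) : ℝ := 2 * area T / maxEdge T

theorem affineSpan_triangle {T : Finset Plane} (hT : AffineIndependent ℝ ((↑) : T → Plane))
    (hc : T.card = 3) : affineSpan ℝ (Set.range ((↑) : T → Plane)) = ⊤ := by
  rw [hT.affineSpan_eq_top_iff_card_eq_finrank_add_one]
  simp [hc]

/-- The vertices of a triangle as an affine basis of the plane; its coordinates are the barycentric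
coordinates. -/
def triangleBasis {T : Finset Plane} (hT : AffineIndependent ℝ ((↑) : T → Plane))
    (hc : T.card = 3) : AffineBasis T ℝ Plane :=
  ⟨(↑), hT, affineSpan_triangle hT hc⟩

/-- The outward unit normal of the triangle with the vertices `z, z', c` on its edge `zz'`. -/
def outerNormal (z z' c : Plane) : Plane :=
  let w : Plane := (c - z) - (⟪z' - z, c - z⟫ / ‖z' - z‖ ^ 2) • (z' - z);
  (-‖w‖⁻¹) • w

/-- The gradient on the triangle `T` of a function that is affine on `T`: its gradient at the
centroid. -/
def elemGrad (v : Plane → ℝ) (T : Finset Plane) : Plane :=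
  gradient v ((3 : ℝ)⁻¹ • ∑ x ∈ T, x)

/-- The integral over the edge `zz'` with respect to arc length. -/
def edgeIntegral (z z' : Plane) (F : Plane → ℝ) : ℝ :=
  dist z z' * ∫ t in (0 : ℝ)..1, F (AffineMap.lineMap z z' t)

/-- The closed rectangle with vertex `p` and the sides `a • e` and `b • rot e`. -/
def rectangle (p e : Plane) (a b : ℝ) : Set Plane :=
  {x | ∃ s ∈ Set.Icc 0 a, ∃ t ∈ Set.Icc 0 b, x = p + s • e + t • rot e}

/-- The piecewise-linear function with the slope `sm` for `ξ ≤ 0` and `sp` for `ξ ≥ 0`, which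
vanishes at `0`. -/
def bent (sm sp ξ : ℝ) : ℝ := if ξ ≤ 0 then sm * ξ else sp * ξ

/-- The piecewise-linear hat function on `[ξm, ξp] ∋ 0` that is equal to `1` at `0` and vanishes at
nonzero end points. -/
def hatOne (ξm ξp ξ : ℝ) : ℝ := if ξ ≤ 0 then 1 - ξ / ξm else 1 - ξ / ξp

namespace Triangulation

variable {Ω : Set Plane} (𝒯 : Triangulation Ω)

open scoped Classical in
/-- The triangles, each given by its set of vertices. -/
def triangles : Finset (Finset Plane) := 𝒯.finite_faces.toFinset.filter (fun T => T.card = 3)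

open scoped Classical in
/-- The set of nodes. -/
def nodes : Finset Plane := 𝒯.triangles.biUnion id

open scoped Classical in
/-- The triangles that contain the node `z`. -/
def star (z : Plane) : Finset (Finset Plane) := 𝒯.triangles.filter (fun T => z ∈ T)

/-- The patch `ω_z`. -/
def patch (z : Plane) : Set Plane := ⋃ T ∈ 𝒯.star z, cell T

/-- `|ω_z|`. -/
def patchArea (z : Plane) : ℝ := volume.real (𝒯.patch z)

/-- `H_z = diam ω_z`. -/
def bigH (z : Plane) : ℝ := Metric.diam (𝒯.patch z)

/-- `h_z = |ω_z| / H_z`. -/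
def smallH (z : Plane) : ℝ := 𝒯.patchArea z / 𝒯.bigH z

open scoped Classical in
/-- The other endpoints of the edges originating at `z`; these represent the set of edges `𝒮_z`. -/
def nbrs (z : Plane) : Finset Plane :=
  𝒯.nodes.filter (fun z' => z' ≠ z ∧ {z, z'} ∈ 𝒯.faces)

open scoped Classical in
/-- The endpoints that represent the edges of `γ_z`, i.e. those in `𝒮_z` and not on `∂Ω`. -/
def innerNbrs (z : Plane) : Finset Plane :=
  (𝒯.nbrs z).filter (fun z' => ¬ segment ℝ z z' ⊆ frontier Ω)

open scoped Classical in
/-- The standard hat function `φ_z`: on a triangle with the vertex `z` it is the barycentric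
coordinate with respect to `z`, elsewhere it vanishes. -/
def hat (z x : Plane) : ℝ :=
  if h : ∃ T : Finset Plane, ∃ _ : T ∈ 𝒯.faces ∧ T.card = 3, z ∈ T ∧ x ∈ cell T then
    (triangleBasis (𝒯.indep h.choose_spec.choose.1) h.choose_spec.choose.2).coord
      ⟨z, h.choose_spec.choose_spec.1⟩ x
  else 0

/-- The piecewise-linear Lagrange interpolant. -/
def interp (w : Plane → ℝ) (x : Plane) : ℝ := ∑ z ∈ 𝒯.nodes, w z * 𝒯.hat z x

/-- The finite element space `S_h`: continuous functions on the closure of `Ω` that are affine on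
each triangle and vanish on `∂Ω`. -/
structure IsFE (v : Plane → ℝ) : Prop where
  continuousOn : ContinuousOn v (closure Ω)
  affine : ∀ T ∈ 𝒯.triangles, ∃ A : Plane →ᵃ[ℝ] ℝ, Set.EqOn v A (cell T)
  boundary : ∀ x ∈ frontier Ω, v x = 0

/-- The computed solution `u_h`. -/
structure IsDiscreteSolution (f : Plane → ℝ → ℝ) (ε : ℝ) (uh : Plane → ℝ) : Prop where
  isFE : 𝒯.IsFE uh
  galerkin : ∀ vh : Plane → ℝ, 𝒯.IsFE vh →
    ε ^ 2 * (∫ x in Ω, ⟪gradient uh x, gradient vh x⟫) +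
      ∫ x in Ω, 𝒯.interp (fun y => f y (uh y)) x * vh x = 0

open scoped Classical in
/-- The jump `⟦∇v⟧ · ν` of the normal derivative of a piecewise-linear `v` across the interior edge
`zz'`: the sum over the two adjacent triangles of the outward normal derivatives. -/
def jump (v : Plane → ℝ) (z z' : Plane) : ℝ :=
  ∑ T ∈ (𝒯.star z).filter (fun T => z' ∈ T), ∑ c ∈ T \ {z, z'},
    ⟪elemGrad v T, outerNormal z z' c⟫

/-- `‖⟦∇v⟧‖_{∞; γ_z}` (zero if there are no edges in `γ_z`). -/
def maxJump (v : Plane → ℝ) (z : Plane) : ℝ :=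
  ⨆ z' : {z' // z' ∈ 𝒯.innerNbrs z}, |𝒯.jump v z z'|

/-! ### Mesh conditions -/

/-- The basic triangulation assumptions: the maximum angle condition with `α₀`, the local element
orientation condition with the constant `K`, and at most `K` triangles containing any node. -/
structure IsAdmissible (α₀ K : ℝ) : Prop where
  maxAngle : ∀ T ∈ 𝒯.triangles, ∀ a ∈ T, ∀ b ∈ T, ∀ c ∈ T, a ≠ b → b ≠ c → a ≠ c →
    EuclideanGeometry.angle a b c ≤ α₀
  orientation : ∀ z ∈ 𝒯.nodes, ∃ (p e : Plane) (a b : ℝ), ‖e‖ = 1 ∧ 0 < a ∧ 0 < b ∧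
    𝒯.patch z ⊆ rectangle p e a b ∧ a * b ≤ K * 𝒯.patchArea z ∧
    (z ∈ frontier Ω → ¬ IsCorner Ω z →
      ∀ z' ∈ 𝒯.nbrs z, segment ℝ z z' ⊆ frontier Ω → ⟪z' - z, e⟫ = 0 ∨ ⟪z' - z, rot e⟫ = 0)
  card_star : ∀ z ∈ 𝒯.nodes, ((𝒯.star z).card : ℝ) ≤ K

/-- Anisotropic nodes: `h_z < c₀ H_z`, and `h_T ∼ h_z`, `H_T ∼ H_z` (with the constant `K`) for all
triangles of the patch. -/
def IsAnisotropic (c₀ K : ℝ) (z : Plane) : Prop :=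
  𝒯.smallH z < c₀ * 𝒯.bigH z ∧ ∀ T ∈ 𝒯.star z,
    (minHeight T ≤ K * 𝒯.smallH z ∧ 𝒯.smallH z ≤ K * minHeight T) ∧
    (maxEdge T ≤ K * 𝒯.bigH z ∧ 𝒯.bigH z ≤ K * maxEdge T)

/-- Regular nodes: all triangles of the patch are shape-regular with the constant `M`. -/
def IsRegular (M : ℝ) (z : Plane) : Prop := ∀ T ∈ 𝒯.star z, maxEdge T ≤ M * minHeight T

/-! ### The averages `ḡ_z` -/

/-- The endpoints of the long edges originating at `z`: those with `|S| > κ h_z`. -/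
def longNbrs (κ : ℝ) (z : Plane) : Set Plane :=
  {z' | z' ∈ 𝒯.nbrs z ∧ κ * 𝒯.smallH z < dist z z'}

/-- `ξ_z⁺`: the length of the shortest projection onto the axis `e` of the long edges pointing in
the positive direction; `0` if there are none (`sInf ∅ = 0`). -/
def xiPlus (κ : ℝ) (z e : Plane) : ℝ :=
  sInf {s | ∃ z' ∈ 𝒯.longNbrs κ z, s = ⟪z' - z, e⟫ ∧ 0 < s}

/-- `ξ_z⁻`, similarly in the negative direction; `0` if there are no such edges (`sSup ∅ = 0`). -/
def xiMinus (κ : ℝ) (z e : Plane) : ℝ :=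
  sSup {s | ∃ z' ∈ 𝒯.longNbrs κ z, s = ⟪z' - z, e⟫ ∧ s < 0}

/-- `c` is the average of `g` along a bent line through `z`: the local coordinates `(ξ, η)` have the
origin `z` and the `ξ`-axis along a longest edge at `z`, the line `η = η̄(ξ)`, `ξ_z⁻ < ξ < ξ_z⁺`,
stays in the patch, `η̄` is linear on either side of `0` with `η̄(0) = 0`, and the hat function on
`(ξ_z⁻, ξ_z⁺)` serves as weight. -/
def IsNodeAverage (κ : ℝ) (g : Plane → ℝ) (z : Plane) (c : ℝ) : Prop :=
  ∃ y ∈ 𝒯.nbrs z, (∀ z' ∈ 𝒯.nbrs z, dist z z' ≤ dist z y) ∧ ∃ sm sp : ℝ,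
    let e : Plane := ‖y - z‖⁻¹ • (y - z)
    let ξm : ℝ := 𝒯.xiMinus κ z e
    let ξp : ℝ := 𝒯.xiPlus κ z e
    let line : ℝ → Plane := fun ξ => z + ξ • e + bent sm sp ξ • rot e;
    (∀ ξ ∈ Set.Ioo ξm ξp, line ξ ∈ 𝒯.patch z) ∧
      ∫ ξ in ξm..ξp, (g (line ξ) - c) * hatOne ξm ξp ξ = 0

/-- The choice of `ḡ`: zero at boundary nodes and at regular nodes, and the above average at all
other nodes. -/
def IsAverageFamily (κ M : ℝ) (g : Plane → ℝ) (gbar : Plane → ℝ) : Prop :=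
  ∀ z ∈ 𝒯.nodes, ((z ∈ frontier Ω ∨ 𝒯.IsRegular M z) → gbar z = 0) ∧
    (¬ (z ∈ frontier Ω ∨ 𝒯.IsRegular M z) → 𝒯.IsNodeAverage κ g z (gbar z))

/-! ### The terms of the error representation -/

/-- The jump residual `I`. -/
def jumpResidual (ε : ℝ) (uh g : Plane → ℝ) (gbar : Plane → ℝ) : ℝ :=
  ∑ z ∈ 𝒯.nodes, ε ^ 2 * ∑ z' ∈ 𝒯.innerNbrs z,
    edgeIntegral z z' (fun x => (g x - gbar z) * 𝒯.hat z x * 𝒯.jump uh z z')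

/-- The interior residual `II`. -/
def interiorResidual (f : Plane → ℝ → ℝ) (uh g : Plane → ℝ) (gbar : Plane → ℝ) : ℝ :=
  ∑ z ∈ 𝒯.nodes, ∫ x in 𝒯.patch z,
    𝒯.interp (fun y => f y (uh y)) x * (g x - gbar z) * 𝒯.hat z x

/-- The quadrature error `E_quad`, with the normalized error `G`. -/
def quadError (f : Plane → ℝ → ℝ) (uh G : Plane → ℝ) : ℝ :=
  |∫ x in Ω, (f x (uh x) - 𝒯.interp (fun y => f y (uh y)) x) * G x|

/-- `Θ`, for a function `g` with gradient `Dg`. -/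
def theta (ε : ℝ) (g : Plane → ℝ) (Dg : Plane → Plane) : ℝ :=
  ε ^ 2 * (∫ x in Ω, ‖Dg x‖ ^ 2) +
    ∑ z ∈ 𝒯.nodes, (1 + ε ^ 2 * (𝒯.bigH z ^ 2)⁻¹) * ∫ x in 𝒯.patch z, g x ^ 2

end Triangulation

end AnisoFEM

end

/-!
**The first estimate.** Put `w = g - gbar^I`. Since `G - w` is a finite element function, the
discrete equation, elementwise integration by parts and `∑ z, φ_z = 1` turn the sum of the residuals
`I + II` into `ε² ⟨∇u_h, ∇w⟩ + ⟨f_h^I, w⟩ = ε² ⟨∇u_h, ∇G⟩ + ⟨f_h^I, G⟩`. Subtracting the weak equation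
of `u`, tested with `G`, leaves `ε² ⟨∇(u_h - u), ∇G⟩ + ⟨f_h - f(·; u), G⟩` up to the quadrature error,
and the one-sided Lipschitz condition makes this coercive in the energy norm; if `C_f < 1/2`, so that
`ε² ≥ 1/2`, the Poincaré inequality provides the `L²` norm. See `Triangulation.exists_error_le`. What this
needs to know about `H¹₀` is that it contains the finite element functions (`IsFE.memH10`, by truncation
and mollification) and that its continuous elements are limits of `C¹` functions up to the boundary
(`Sob`), which is enough for traces on edges and Green's formula.

**The second estimate.** By `jumpResidual_eq_sum`, the jump residual is `ε²` times the sum over the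
nodes `z` and the inner edges `zs` of the jump across `zs`, which is constant, times the moment
`∫ (g - gbar z) φ_z` over the edge. It suffices to bound the contribution of every node by
`localError z * maxJump z`, where `localError² = localTheta * localMass / ε²`, and to apply the
Cauchy–Schwarz inequality (`JumpSetting.abs_jumpResidual_le`).

At a regular node, and at an anisotropic node with `ε ≲ h_z`, the trace inequality for `g²` bounds the
moments themselves. For thin patches, `h_z ≤ ε`, it is the `L¹` norm of `∇g` over the patch that is
bounded by `localError` (`integral_grad_le_localError`), but on a patch of width `h_z` the single moments
are not small in terms of `∇g`, as `g` may be large there. Two cancellations replace their smallness.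

* The patch is essentially one-dimensional. The moments on the long edges on one side of `z` agree up to
  the gradient term, and as `gbar z` is an average along a line through the patch, those of the two sides
  are opposite (`interior_bounds`). Thus they are, up to the gradient term, the inner products of one
  vector `V z` with the unit directions of the edges (`exists_vector`). As the tangential derivatives of
  `u_h` are continuous across edges, the sum over the edges at `z` of the jump times the unit direction
  vanishes (`sum_jump_inner`), so that the long edges contribute only the negative of what `V z` would
  contribute on the short edges.
* A short edge `zs` is seen from both of its ends, with opposite directions. The patches of `z` and `s`
  share a triangle with long edges, along which `V z` and `V s` are compared (`norm_vector_sub_le`), so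
  that the two contributions of the edge nearly cancel (`abs_pair_le`).

At a boundary node, where `gbar z = 0`, there are two cases (`boundary_cases`). If the boundary lies along
the patch, both sides have a long boundary edge, on which `g = 0`, and the moments are bounded from there.
If it lies across the patch, the short edges are boundary edges; the moments on the long edges of one side
agree up to the gradient term, and the components of jump times direction across the boundary sum to zero.

No vector is needed at a regular or boundary node or at one whose patch is not thin, so that `V z = 0`
there; `V` at the other end of a short edge is then small.
-/

open AffineMap (lineMap lineMap_apply lineMap_apply_zero lineMap_apply_one)
open intervalIntegral (integral_of_le integral_mono_on integral_add_adjacent_intervals)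
open Set (Icc Ioo uIcc_of_le indicator_of_notMem indicator_of_mem)
open Real (sqrt sq_sqrt norm_eq_abs)
open Finset (mem_filter mem_insert mem_singleton sum_congr)

namespace AnisoFEM

variable {a b b' c c' c₁ d d' e e' p q r s x x' y z : Plane} {Ω : Set Plane} {T : Finset Plane}
  {g gbar uh v φ : Plane → ℝ} {Dg Dv : Plane → Plane} {B H L h k t δ ε : ℝ}
  {Δ : Triangulation Ω}

/-! ### Plane vectors and the affine parametrization of a triangle -/

/-- The cross product of two plane vectors. -/
def cr (v w : Plane) : ℝ := v 0 * w 1 - v 1 * w 0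

lemma inner_eq (v w : Plane) : ⟪v, w⟫ = v 0 * w 0 + v 1 * w 1 := by
  simp [PiLp.inner_apply, Fin.sum_univ_two, mul_comm]

lemma norm_sq_eq (v : Plane) : ‖v‖ ^ 2 = v 0 ^ 2 + v 1 ^ 2 := by
  rw [← real_inner_self_eq_norm_sq, inner_eq]; ring

lemma plane_ext {v w : Plane} (h0 : v 0 = w 0) (h1 : v 1 = w 1) : v = w := by
  ext i; fin_cases i <;> assumption

@[simp] theorem rot_zero_apply (v : Plane) : rot v 0 = -v 1 := rfl
@[simp] theorem rot_one_apply (v : Plane) : rot v 1 = v 0 := rfl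

lemma norm_rot (v : Plane) : ‖rot v‖ = ‖v‖ := by
  have h : ‖rot v‖ ^ 2 = ‖v‖ ^ 2 := by simp only [norm_sq_eq, rot_zero_apply, rot_one_apply]; ring
  exact (pow_left_inj₀ (norm_nonneg _) (norm_nonneg _) two_ne_zero).1 h

/-- The affine map of the reference triangle onto the triangle with the vertices `c`, `a`, `b`. The
segments on which the first coordinate is constant are parallel to the edge `cb`. -/
def tri (c a b : Plane) (p : ℝ × ℝ) : Plane := c + p.1 • (a - c) + p.2 • (b - c)

/-- The closed reference triangle. -/
def refTri : Set (ℝ × ℝ) := {p | 0 ≤ p.1 ∧ 0 ≤ p.2 ∧ p.1 + p.2 ≤ 1}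

lemma isClosed_refTri : IsClosed refTri := (isClosed_le continuous_const continuous_fst).inter
    ((isClosed_le continuous_const continuous_snd).inter
      (isClosed_le (continuous_fst.add continuous_snd) continuous_const))

lemma continuous_tri (c a b : Plane) : Continuous (tri c a b) := by unfold tri; fun_prop

lemma tri_injective (h : cr (a - c) (b - c) ≠ 0) : Function.Injective (tri c a b) := by
  rintro ⟨x, y⟩ ⟨x', y'⟩ hxy
  have h0 := congrArg (fun v : Plane => v 0) hxy
  have h1 := congrArg (fun v : Plane => v 1) hxy
  simp only [tri, PiLp.add_apply, PiLp.smul_apply, PiLp.sub_apply, smul_eq_mul] at h0 h1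
  simp only [cr, PiLp.sub_apply] at h
  have e1 : (x - x') * ((a 0 - c 0) * (b 1 - c 1) - (a 1 - c 1) * (b 0 - c 0)) = 0 := by
    linear_combination (b 1 - c 1) * h0 - (b 0 - c 0) * h1
  have e2 : (y - y') * ((a 0 - c 0) * (b 1 - c 1) - (a 1 - c 1) * (b 0 - c 0)) = 0 := by
    linear_combination -(a 1 - c 1) * h0 + (a 0 - c 0) * h1
  have f1 := (mul_eq_zero.1 e1).resolve_right h
  have f2 := (mul_eq_zero.1 e2).resolve_right h
  ext <;> simp <;> linarith

lemma measurableEmbedding_tri (h : cr (a - c) (b - c) ≠ 0) : MeasurableEmbedding (tri c a b) :=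
  (continuous_tri c a b).measurableEmbedding (tri_injective h)

lemma map_tri (h : cr (a - c) (b - c) ≠ 0) :
    Measure.map (tri c a b) volume = ENNReal.ofReal |(cr (a - c) (b - c))⁻¹| • volume := by
  set M : Matrix (Fin 2) (Fin 2) ℝ := !![a 0 - c 0, b 0 - c 0; a 1 - c 1, b 1 - c 1] with hM
  have hdet : M.det = cr (a - c) (b - c) := by simp [hM, Matrix.det_fin_two, cr]; ring
  have hcomp : tri c a b = (fun v : Plane => c + v) ∘ (WithLp.toLp 2) ∘ (Matrix.toLin' M) ∘
      (MeasurableEquiv.finTwoArrow (α := ℝ)).symm := by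
    funext p
    apply plane_ext <;>
    · simp [tri, hM, MeasurableEquiv.finTwoArrow]
      ring
  have hL : Measurable (Matrix.toLin' M) := (LinearMap.continuous_of_finiteDimensional _).measurable
  have hT : Measurable (WithLp.toLp 2 : (Fin 2 → ℝ) → Plane) :=
    (PiLp.volume_preserving_toLp (Fin 2)).measurable
  rw [hcomp, ← Measure.map_map (measurable_const_add c) (hT.comp (hL.comp (MeasurableEquiv.measurable _))),
    ← Measure.map_map hT (hL.comp (MeasurableEquiv.measurable _)),
    ← Measure.map_map hL (MeasurableEquiv.measurable _),
    ((volume_preserving_finTwoArrow ℝ).symm).map_eq,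
    Real.map_matrix_volume_pi_eq_smul_volume_pi (by rw [hdet]; exact h), Measure.map_smul,
    (PiLp.volume_preserving_toLp (Fin 2)).map_eq, Measure.map_smul, hdet]
  congr 1
  exact map_add_left_eq_self _ c

lemma tri_image (c a b : Plane) : tri c a b '' refTri = convexHull ℝ {c, a, b} := by
  ext x
  rw [convexHull_insert (by simp), convexHull_pair]
  simp only [convexJoin_singleton_left, Set.mem_iUnion, Set.mem_image, exists_prop]
  constructor
  · rintro ⟨⟨p, q⟩, ⟨h1, h2, h3⟩, rfl⟩
    simp only at h1 h2 h3
    rcases eq_or_lt_of_le (add_nonneg h1 h2) with h0 | h0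
    · have hp : p = 0 := by linarith
      have hq : q = 0 := by linarith
      exact ⟨a, left_mem_segment _ _ _, by simpa [tri, hp, hq] using left_mem_segment ℝ c a⟩
    · refine ⟨(p / (p + q)) • a + (q / (p + q)) • b,
        ⟨p / (p + q), q / (p + q), by positivity, by positivity, by field_simp, rfl⟩,
        1 - (p + q), p + q, by linarith, by linarith, by ring, ?_⟩
      have e1 : (p + q) * (p / (p + q)) = p := by field_simp
      have e2 : (p + q) * (q / (p + q)) = q := by field_simp
      rw [smul_add, smul_smul, smul_smul, e1, e2]
      simp only [tri]; module
  · rintro ⟨y, ⟨s, t, hs, ht, hst, rfl⟩, ⟨s', t', hs', ht', hst', rfl⟩⟩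
    refine ⟨(t' * s, t' * t), ⟨by positivity, by positivity, ?_⟩, ?_⟩
    · simp only [← mul_add, hst]; linarith
    · simp only [tri]
      have : s' = 1 - t' := by linarith
      have h2 : s = 1 - t := by linarith
      subst this h2; module

lemma tri_preimage (h : cr (a - c) (b - c) ≠ 0) :
    tri c a b ⁻¹' convexHull ℝ {c, a, b} = refTri := by
  rw [← tri_image, Set.preimage_image_eq _ (tri_injective h)]

lemma lintegral_tri (h : cr (a - c) (b - c) ≠ 0) (F : Plane → ℝ≥0∞) :
    ∫⁻ p in refTri, F (tri c a b p) =
      ENNReal.ofReal |(cr (a - c) (b - c))⁻¹| * ∫⁻ x in convexHull ℝ {c, a, b}, F x := by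
  have h1 := (measurableEmbedding_tri h).restrict_map volume (convexHull ℝ {c, a, b})
  rw [tri_preimage h, map_tri h, Measure.restrict_smul] at h1
  rw [← (measurableEmbedding_tri h).lintegral_map, ← h1, lintegral_smul_measure, smul_eq_mul]

lemma integrableOn_tri (h : cr (a - c) (b - c) ≠ 0) {E : Type*}
    [NormedAddCommGroup E] {F : Plane → E} (hF : IntegrableOn F (convexHull ℝ {c, a, b})) :
    IntegrableOn (fun p => F (tri c a b p)) refTri := by
  have := (measurableEmbedding_tri h).integrableOn_map_iff (μ := volume) (f := F)
    (s := convexHull ℝ {c, a, b})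
  rw [tri_preimage h, map_tri h] at this
  refine this.1 ?_
  rw [IntegrableOn, Measure.restrict_smul]
  exact Integrable.smul_measure hF ENNReal.ofReal_ne_top

lemma integral_refTri (h : cr (a - c) (b - c) ≠ 0) {E : Type*}
    [NormedAddCommGroup E] [NormedSpace ℝ E] (F : Plane → E) :
    ∫ p in refTri, F (tri c a b p) =
      |cr (a - c) (b - c)|⁻¹ • ∫ x in convexHull ℝ {c, a, b}, F x := by
  have := (measurableEmbedding_tri h).setIntegral_map (μ := volume) F (convexHull ℝ {c, a, b})
  rw [tri_preimage h, map_tri h, Measure.restrict_smul, integral_smul_measure] at this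
  rw [← this, ENNReal.toReal_ofReal (abs_nonneg _), abs_inv]

lemma aestronglyMeasurable_tri (h : cr (a - c) (b - c) ≠ 0) {E : Type*}
    [TopologicalSpace E] {F : Plane → E}
    (hF : AEStronglyMeasurable F (volume.restrict (convexHull ℝ {c, a, b}))) :
    AEStronglyMeasurable (fun p => F (tri c a b p)) (volume.restrict refTri) := by
  have h1 := (measurableEmbedding_tri h).restrict_map volume (convexHull ℝ {c, a, b})
  rw [tri_preimage h, map_tri h, Measure.restrict_smul] at h1
  have h2 : AEStronglyMeasurable F (Measure.map (tri c a b) (volume.restrict refTri)) := by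
    rw [← h1]; exact hF.mono_ac (Measure.AbsolutelyContinuous.rfl.smul_left _)
  exact h2.comp_measurable (continuous_tri c a b).measurable

lemma refTri_indicator {E : Type*} [Zero E] (F : ℝ × ℝ → E) (x : ℝ) :
    (fun y => refTri.indicator F (x, y)) =
      if x ∈ Icc 0 1 then (Icc 0 (1 - x)).indicator (fun y => F (x, y)) else 0 := by
  split_ifs with hx
  · funext y
    by_cases hy : y ∈ Icc 0 (1 - x)
    · rw [indicator_of_mem hy, indicator_of_mem]
      exact ⟨hx.1, hy.1, by linarith [hy.2]⟩
    · rw [indicator_of_notMem hy, indicator_of_notMem]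
      exact fun h => hy ⟨h.2.1, by linarith [h.2.2]⟩
  · funext y
    rw [indicator_of_notMem]
    · rfl
    · exact fun h => hx ⟨h.1, by linarith [h.2.1, h.2.2]⟩

/-- Fubini's theorem on the reference triangle. -/
lemma fubini_refTri {F : ℝ × ℝ → ℝ} (hF : IntegrableOn F refTri) :
    (∀ᵐ x ∂volume.restrict (Icc 0 1), IntegrableOn (fun y => F (x, y)) (Icc 0 (1 - x))) ∧
    IntervalIntegrable (fun x => ∫ y in 0..(1 - x), F (x, y)) volume 0 1 ∧
    ∫ x in 0..1, ∫ y in 0..(1 - x), F (x, y) = ∫ p in refTri, F p := by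
  have hI : Integrable (refTri.indicator F) ((volume : Measure ℝ).prod volume) := by
    rw [← Measure.volume_eq_prod]
    exact (integrable_indicator_iff isClosed_refTri.measurableSet).2 hF
  have key : ∀ x, ∫ y, refTri.indicator F (x, y) =
      (Icc 0 1).indicator (fun x => ∫ y in 0..(1 - x), F (x, y)) x := by
    intro x
    rw [refTri_indicator]
    by_cases hx : x ∈ Icc 0 1
    · rw [if_pos hx, indicator_of_mem hx, integral_indicator measurableSet_Icc,
        integral_of_le (by linarith [hx.2]), integral_Icc_eq_integral_Ioc]
    · rw [if_neg hx, indicator_of_notMem hx]; simp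
  refine ⟨?_, ?_, ?_⟩
  · have := hI.prod_right_ae
    rw [ae_restrict_iff' measurableSet_Icc]
    filter_upwards [this] with x hx hx1
    rw [refTri_indicator, if_pos hx1] at hx
    exact (integrable_indicator_iff measurableSet_Icc).1 hx
  · have := hI.integral_prod_left
    simp_rw [key] at this
    have h2 := (integrable_indicator_iff measurableSet_Icc).1 this
    rw [intervalIntegrable_iff_integrableOn_Icc_of_le zero_le_one]
    exact h2
  · rw [← integral_indicator isClosed_refTri.measurableSet, Measure.volume_eq_prod,
      integral_prod _ hI]
    simp_rw [key]
    rw [integral_indicator measurableSet_Icc, integral_of_le zero_le_one,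
      integral_Icc_eq_integral_Ioc]

lemma volume_refTri : volume.real refTri = 1 / 2 := by
  have hfin : IntegrableOn (fun _ : ℝ × ℝ => (1 : ℝ)) refTri := by
    refine integrableOn_const (ne_of_lt ?_)
    refine lt_of_le_of_lt (measure_mono (t := Icc (0 : ℝ) 1 ×ˢ Icc (0 : ℝ) 1) ?_) ?_
    · rintro ⟨x, y⟩ ⟨h1, h2, h3⟩
      simp only at h1 h2 h3
      exact ⟨⟨h1, by simp only; linarith⟩, ⟨h2, by simp only; linarith⟩⟩
    · exact (isCompact_Icc.prod isCompact_Icc).measure_lt_top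
  have h := (fubini_refTri hfin).2.2
  simp only [intervalIntegral.integral_const, smul_eq_mul, mul_one, sub_zero, integral_const,
    MeasurableSet.univ, measureReal_restrict_apply, Set.univ_inter] at h
  rw [← h, intervalIntegral.integral_sub (by simp) (by simp)]
  norm_num

/-- The area of a triangle. -/
lemma volume_triangle (h : cr (a - c) (b - c) ≠ 0) :
    volume.real (convexHull ℝ {c, a, b}) = |cr (a - c) (b - c)| / 2 := by
  have := integral_refTri h (fun _ => (1 : ℝ))
  simp only [integral_const, smul_eq_mul, mul_one, MeasurableSet.univ, measureReal_restrict_apply,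
    Set.univ_inter, volume_refTri] at this
  field_simp at this
  linarith

/-! ### Absolute continuity along segments -/

lemma ae_lintegral_refTri {F : ℝ × ℝ → ℝ≥0∞} (hF : AEMeasurable F (volume.restrict refTri))
    (h : ∫⁻ p in refTri, F p ≠ ⊤) :
    ∀ᵐ x ∂volume.restrict (Icc 0 1), ∫⁻ y in Icc 0 (1 - x), F (x, y) ≠ ⊤ := by
  have hI := (aemeasurable_indicator_iff (f := F) isClosed_refTri.measurableSet).2 hF
  rw [← lintegral_indicator isClosed_refTri.measurableSet] at h
  rw [Measure.volume_eq_prod] at hI h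
  rw [lintegral_prod _ hI] at h
  have h3 := ae_lt_top' hI.lintegral_prod_right' h
  rw [ae_restrict_iff' measurableSet_Icc]
  filter_upwards [h3] with x hx hx1
  rw [refTri_indicator, if_pos hx1, lintegral_indicator measurableSet_Icc] at hx
  exact hx.ne

/-- A continuous function that is the `L¹` limit of `C¹` functions, the derivatives of which
converge in `L¹` to `f`, is a primitive of `f`. -/
lemma sub_eq_integral_of_approx {l : ℝ} {u f : ℝ → ℝ}
    (hu : ContinuousOn u (Icc 0 l)) (hf : IntegrableOn f (Icc 0 l)) {U U' : ℕ → ℝ → ℝ}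
    (hU : ∀ n x, HasDerivAt (U n) (U' n x) x) (hU' : ∀ n, Continuous (U' n))
    (h1 : ∑' n, ∫⁻ y in Icc 0 l, ‖U n y - u y‖ₑ ≠ ⊤)
    (h2 : ∑' n, ∫⁻ y in Icc 0 l, ‖U' n y - f y‖ₑ ≠ ⊤) :
    ∀ y ∈ Icc 0 l, u y - u 0 = ∫ s in 0..y, f s := by
  intro y hy
  rcases eq_or_lt_of_le (hy.1.trans hy.2) with hl | hl
  · have : y = 0 := le_antisymm (hl ▸ hy.2) hy.1
    simp [this]
  have hUc : ∀ n, Continuous (U n) := fun n =>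
    continuous_iff_continuousAt.2 fun x => (hU n x).continuousAt
  have hlim : ∀ y ∈ Icc 0 l, Tendsto (fun n => U n y - U n 0) atTop (𝓝 (∫ s in 0..y, f s)) := by
    intro y hy
    rw [tendsto_iff_dist_tendsto_zero]
    have h0 := (ENNReal.tendsto_toReal ENNReal.zero_ne_top).comp
      (ENNReal.tendsto_atTop_zero_of_tsum_ne_top h2)
    refine squeeze_zero (fun _ => dist_nonneg) (fun n => ?_) h0
    have hd : IntegrableOn (fun s => U' n s - f s) (Icc 0 l) :=
      ((hU' n).continuousOn.integrableOn_compact isCompact_Icc).sub hf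
    have hfy : IntervalIntegrable f volume 0 y := by
      rw [intervalIntegrable_iff_integrableOn_Icc_of_le hy.1]
      exact hf.mono_set (Set.Icc_subset_Icc_right hy.2)
    rw [← intervalIntegral.integral_eq_sub_of_hasDerivAt (fun x _ => hU n x)
      ((hU' n).intervalIntegrable _ _), Real.dist_eq,
      ← intervalIntegral.integral_sub ((hU' n).intervalIntegrable _ _) hfy]
    rw [← norm_eq_abs]
    refine (intervalIntegral.norm_integral_le_integral_norm hy.1).trans ?_
    rw [Function.comp_apply, ← integral_norm_eq_lintegral_enorm hd.aestronglyMeasurable,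
      integral_of_le hy.1, ← integral_Icc_eq_integral_Ioc]
    exact setIntegral_mono_set hd.norm (ae_of_all _ fun _ => norm_nonneg _)
      (Set.Icc_subset_Icc_right hy.2).eventuallyLE
  have hae : ∀ᵐ y ∂volume.restrict (Icc 0 l), Tendsto (fun n => U n y) atTop (𝓝 (u y)) := by
    have hm : ∀ n, AEMeasurable (fun y => ‖U n y - u y‖ₑ) (volume.restrict (Icc 0 l)) :=
      fun n => (((hUc n).continuousOn.sub hu).aestronglyMeasurable measurableSet_Icc).enorm
    rw [← lintegral_tsum hm] at h1
    filter_upwards [ae_lt_top' (AEMeasurable.tsum hm) h1] with y hy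
    have := ENNReal.tendsto_atTop_zero_of_tsum_ne_top hy.ne
    rw [tendsto_iff_edist_tendsto_0]
    simpa [edist_eq_enorm_sub] using this
  have hne : volume.restrict (Icc 0 l) ≠ 0 := by
    rw [Ne, Measure.restrict_eq_zero, Real.volume_Icc]
    simpa using hl
  obtain ⟨y₀, hy₀, hy₀m⟩ : ∃ y₀, Tendsto (fun n => U n y₀) atTop (𝓝 (u y₀)) ∧ y₀ ∈ Icc 0 l := by
    have : (ae (volume.restrict (Icc 0 l))).NeBot := ae_neBot.2 hne
    exact (hae.and (ae_restrict_mem measurableSet_Icc)).exists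
  have heq : u =ᵐ[volume.restrict (Icc 0 l)]
      fun y => (∫ s in 0..y, f s) + (u y₀ - ∫ s in 0..y₀, f s) := by
    filter_upwards [hae, ae_restrict_mem measurableSet_Icc] with y hy hym
    have ha := tendsto_nhds_unique ((hy.sub hy₀)) (((hlim y hym).sub (hlim y₀ hy₀m)).congr
      (fun n => by ring))
    linarith
  have hcont : ContinuousOn (fun y => ∫ s in 0..y, f s) (Icc 0 l) := by
    have := intervalIntegral.continuousOn_primitive_interval (μ := volume) (f := f) (a := 0) (b := l)
      (by rwa [uIcc_of_le hl.le])
    rwa [uIcc_of_le hl.le] at this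
  have hE := Measure.eqOn_Icc_of_ae_eq volume hl.ne heq hu (hcont.add continuousOn_const)
  rw [hE hy, hE ⟨le_rfl, hl.le⟩]
  simp

/-- `v` is continuous on `E`, and it is the limit in `W^{1,1}(E)` of functions of class `C¹`, with
the limit `Dv` of the gradients. -/
structure Sob (E : Set Plane) (v : Plane → ℝ) (Dv : Plane → Plane) : Prop where
  continuousOn : ContinuousOn v E
  integrableOn : IntegrableOn Dv E
  approx : ∀ δ : ℝ≥0∞, δ ≠ 0 → ∃ φ : Plane → ℝ, ContDiff ℝ 1 φ ∧
    ∫⁻ x in E, ‖φ x - v x‖ₑ ≤ δ ∧ ∫⁻ x in E, ‖gradient φ x - Dv x‖ₑ ≤ δ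

lemma Sob.mono {E E' : Set Plane} (h : Sob E v Dv) (hE : E' ⊆ E) : Sob E' v Dv where
  continuousOn := h.continuousOn.mono hE
  integrableOn := h.integrableOn.mono_set hE
  approx δ hδ := by
    obtain ⟨φ, h1, h2, h3⟩ := h.approx δ hδ
    exact ⟨φ, h1, (lintegral_mono_set hE).trans h2, (lintegral_mono_set hE).trans h3⟩

lemma continuous_gradient (h : ContDiff ℝ 1 φ) : Continuous (gradient φ) := by
  unfold gradient
  exact (LinearIsometryEquiv.continuous _).comp (h.continuous_fderiv one_ne_zero)

lemma isCompact_triangle (a b c : Plane) : IsCompact (convexHull ℝ {c, a, b}) :=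
  (Set.toFinite {c, a, b}).isCompact_convexHull ℝ

/-- On almost all lines parallel to a side of a triangle, `v` is a primitive of its directional
derivative. -/
lemma Sob.acl (h : Sob (convexHull ℝ {c, a, b}) v Dv) (hcr : cr (a - c) (b - c) ≠ 0) :
    ∀ᵐ x ∂volume.restrict (Icc 0 1), ∀ y ∈ Icc 0 (1 - x),
      v (tri c a b (x, y)) - v (tri c a b (x, 0)) =
        ∫ s in 0..y, ⟪Dv (tri c a b (x, s)), b - c⟫ := by
  set S := convexHull ℝ {c, a, b} with hS
  have hSm : MeasurableSet S := (isCompact_triangle a b c).measurableSet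
  obtain ⟨δ, hδ, hsum⟩ := ENNReal.exists_pos_sum_of_countable (ι := ℕ) one_ne_zero
  choose φ hφ h1 h2 using fun n => h.approx (δ n) (by simpa using (hδ n).ne')
  have hgc := fun n => continuous_gradient (hφ n)
  have hm1 : ∀ n, AEStronglyMeasurable (fun x => φ n x - v x) (volume.restrict S) := fun n =>
    ((hφ n).continuous.continuousOn.sub h.continuousOn).aestronglyMeasurable hSm
  have hm2 : ∀ n, AEStronglyMeasurable (fun x => gradient (φ n) x - Dv x) (volume.restrict S) :=
    fun n => (hgc n).aestronglyMeasurable.sub h.integrableOn.aestronglyMeasurable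
  set K : ℝ × ℝ → ℝ≥0∞ := fun p => ∑' n, (‖φ n (tri c a b p) - v (tri c a b p)‖ₑ +
    ‖gradient (φ n) (tri c a b p) - Dv (tri c a b p)‖ₑ * ‖b - c‖ₑ) with hK
  have hKm : ∀ n, AEMeasurable (fun p => ‖φ n (tri c a b p) - v (tri c a b p)‖ₑ +
      ‖gradient (φ n) (tri c a b p) - Dv (tri c a b p)‖ₑ * ‖b - c‖ₑ) (volume.restrict refTri) :=
    fun n => (aestronglyMeasurable_tri hcr (hm1 n)).enorm.add
      ((aestronglyMeasurable_tri hcr (hm2 n)).enorm.mul_const _)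
  have hKfin : ∫⁻ p in refTri, K p ≠ ⊤ := by
    rw [hK, lintegral_tsum hKm]
    refine ne_of_lt (lt_of_le_of_lt (b := ∑' n, (ENNReal.ofReal |(cr (a - c) (b - c))⁻¹| * (1 +
      ‖b - c‖ₑ)) * (δ n : ℝ≥0∞)) (ENNReal.tsum_le_tsum fun n => ?_) ?_)
    · rw [lintegral_add_left' (aestronglyMeasurable_tri hcr (hm1 n)).enorm,
        lintegral_mul_const' _ _ enorm_ne_top,
        lintegral_tri hcr (fun x => ‖φ n x - v x‖ₑ),
        lintegral_tri hcr (fun x => ‖gradient (φ n) x - Dv x‖ₑ)]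
      calc _ ≤ ENNReal.ofReal |(cr (a - c) (b - c))⁻¹| * δ n +
            ENNReal.ofReal |(cr (a - c) (b - c))⁻¹| * δ n * ‖b - c‖ₑ := by
            gcongr
            · exact h1 n
            · exact h2 n
        _ = _ := by ring
    · rw [ENNReal.tsum_mul_left]
      exact ENNReal.mul_lt_top (ENNReal.mul_lt_top ENNReal.ofReal_lt_top
        (ENNReal.add_lt_top.2 ⟨ENNReal.one_lt_top, enorm_lt_top⟩)) (hsum.trans ENNReal.one_lt_top)
  have hDi : IntegrableOn (fun x => ⟪Dv x, b - c⟫) S := h.integrableOn.inner_const (b - c)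
  filter_upwards [ae_lintegral_refTri (AEMeasurable.tsum hKm) hKfin,
    (fubini_refTri (integrableOn_tri hcr hDi)).1, ae_restrict_mem measurableSet_Icc] with x hx hxi hx1
  have hmem : ∀ y ∈ Icc 0 (1 - x), tri c a b (x, y) ∈ S := fun y hy => by
    rw [hS, ← tri_image]
    exact ⟨(x, y), ⟨hx1.1, hy.1, by simp only; linarith [hy.2]⟩, rfl⟩
  have hcx : Continuous (fun y => tri c a b (x, y)) := (continuous_tri c a b).comp (by fun_prop)
  have hvx : ContinuousOn (fun y => v (tri c a b (x, y))) (Icc 0 (1 - x)) :=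
    h.continuousOn.comp hcx.continuousOn hmem
  have hder : ∀ n y, HasDerivAt (fun y => φ n (tri c a b (x, y)))
      ⟪gradient (φ n) (tri c a b (x, y)), b - c⟫ y := by
    intro n y
    have hd : HasDerivAt (fun y : ℝ => tri c a b (x, y)) (b - c) y := by
      unfold tri
      simpa using ((hasDerivAt_id y).smul_const (b - c)).const_add (c + x • (a - c))
    have := (((hφ n).differentiable one_ne_zero _).hasFDerivAt).comp_hasDerivAt y hd
    rw [inner_gradient_left]
    exact this
  have hdc : ∀ n, Continuous (fun y => ⟪gradient (φ n) (tri c a b (x, y)), b - c⟫) := fun n =>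
    ((hgc n).comp hcx).inner continuous_const
  have hlt : ∀ {G : ℕ → ℝ → ℝ≥0∞}, (∀ n, AEMeasurable (G n) (volume.restrict (Icc 0 (1 - x)))) →
      (∀ n y, G n y ≤ ‖φ n (tri c a b (x, y)) - v (tri c a b (x, y))‖ₑ +
        ‖gradient (φ n) (tri c a b (x, y)) - Dv (tri c a b (x, y))‖ₑ * ‖b - c‖ₑ) →
      ∑' n, ∫⁻ y in Icc 0 (1 - x), G n y ≠ ⊤ := by
    intro G hG hle
    rw [← lintegral_tsum hG]
    refine ne_top_of_le_ne_top hx (lintegral_mono fun y => ENNReal.tsum_le_tsum fun n => hle n y)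
  refine sub_eq_integral_of_approx hvx hxi hder hdc (hlt (fun n => ?_) (fun n y => le_self_add))
    (hlt (fun n => ?_) (fun n y => ?_))
  · exact ((((hφ n).continuous.comp hcx).continuousOn.sub hvx).aestronglyMeasurable
      measurableSet_Icc).enorm
  · exact ((hdc n).aestronglyMeasurable.sub hxi.aestronglyMeasurable).enorm
  · refine le_trans ?_ le_add_self
    rw [← inner_sub_left, ← ofReal_norm, ← ofReal_norm, ← ofReal_norm,
      ← ENNReal.ofReal_mul (norm_nonneg _)]
    exact ENNReal.ofReal_le_ofReal (norm_inner_le_norm _ _)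

/-! ### Trace and Poincaré inequalities on a triangle -/

lemma continuousOn_edge {E : Set Plane} (h : ContinuousOn v E) (hpq : segment ℝ p q ⊆ E) :
    ContinuousOn (fun t : ℝ => v (lineMap p q t)) (Icc 0 1) :=
  h.comp AffineMap.lineMap_continuous.continuousOn fun t ht => hpq (by
    rw [segment_eq_image_lineMap]; exact ⟨t, ht, rfl⟩)

lemma intervalIntegrable_of_Icc {f : ℝ → ℝ} (h : ContinuousOn f (Icc 0 1)) :
    IntervalIntegrable f volume 0 1 :=
  ContinuousOn.intervalIntegrable_of_Icc zero_le_one h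

lemma segment_subset_triangle (a b c : Plane) :
    segment ℝ a b ⊆ convexHull ℝ {a, b, c} ∧ segment ℝ a c ⊆ convexHull ℝ {a, b, c} ∧
      segment ℝ b c ⊆ convexHull ℝ {a, b, c} := by
  have h := fun x (hx : x ∈ {a, b, c}) => subset_convexHull ℝ {a, b, c} hx
  refine ⟨(convex_convexHull ℝ _).segment_subset (h _ ?_) (h _ ?_),
    (convex_convexHull ℝ _).segment_subset (h _ ?_) (h _ ?_),
    (convex_convexHull ℝ _).segment_subset (h _ ?_) (h _ ?_)⟩ <;> simp

lemma triple_rotate (a b c : Plane) : ({c, a, b} : Set Plane) = {a, b, c} := by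
  ext x; simp only [Set.mem_insert_iff, Set.mem_singleton_iff]; tauto

lemma triple_swap' (a b c : Plane) : ({b, a, c} : Set Plane) = {a, b, c} := by
  ext x; simp only [Set.mem_insert_iff, Set.mem_singleton_iff]; tauto

lemma cr_rotate (a b c : Plane) : cr (a - c) (b - c) = cr (b - a) (c - a) := by
  simp only [cr, PiLp.sub_apply]; ring

lemma cr_comm (v w : Plane) : cr v w = -cr w v := by simp only [cr]; ring

lemma tri_zero (c a b : Plane) (x : ℝ) : tri c a b (x, 0) = lineMap c a x := by
  simp only [tri, lineMap_apply, vsub_eq_sub, vadd_eq_add]; module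

lemma tri_top (c a b : Plane) (x : ℝ) : tri c a b (x, 1 - x) = lineMap b a x := by
  simp only [tri, lineMap_apply, vsub_eq_sub, vadd_eq_add]; module

lemma integral_reflect (f : ℝ → ℝ) : ∫ t in 0..1, f (1 - t) = ∫ t in 0..1, f t := by
  rw [intervalIntegral.integral_comp_sub_left (fun t => f t)]; simp

lemma lineMap_reflect (p q : Plane) (t : ℝ) : lineMap p q (1 - t) = lineMap q p t := by
  rw [AffineMap.lineMap_apply_one_sub]

section

/-- The fundamental theorem of calculus along almost every segment parallel to the side `cb`. -/
lemma Sob.ae_abs_sub_le (h : Sob (convexHull ℝ {c, a, b}) v Dv) (hcr : cr (a - c) (b - c) ≠ 0) :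
    ∀ᵐ x ∂volume.restrict (Icc 0 1), ∀ y ∈ Icc 0 (1 - x),
      |v (tri c a b (x, y)) - v (tri c a b (x, 0))| ≤
        ‖b - c‖ * ∫ s in 0..(1 - x), ‖Dv (tri c a b (x, s))‖ := by
  filter_upwards [h.acl hcr, (fubini_refTri (integrableOn_tri hcr h.integrableOn.norm)).1]
    with x hx hi y hy
  rw [hx y hy, ← norm_eq_abs]
  refine (intervalIntegral.norm_integral_le_integral_norm hy.1).trans ?_
  have hi' := hi.mono_set (Set.Icc_subset_Icc_right hy.2)
  rw [integral_of_le hy.1, integral_of_le (hy.1.trans hy.2),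
    ← integral_Icc_eq_integral_Ioc, ← integral_Icc_eq_integral_Ioc, ← integral_const_mul]
  refine (integral_mono_of_nonneg (ae_of_all _ fun _ => norm_nonneg _) (hi'.const_mul ‖b - c‖)
    (ae_of_all _ fun s => ?_)).trans
    (setIntegral_mono_set (hi.const_mul _) (ae_of_all _ fun _ => by positivity)
      (Set.Icc_subset_Icc_right hy.2).eventuallyLE)
  simp only
  rw [mul_comm]
  exact norm_inner_le_norm _ _

/-- The traces on two sides of a triangle are compared along the segments parallel to the third side. -/
lemma Sob.edge_sub (h : Sob (convexHull ℝ {a, b, c}) v Dv) (hcr : cr (b - a) (c - a) ≠ 0) :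
    ∫ t in 0..1, |v (lineMap a b t) - v (lineMap a c t)| ≤
      ‖b - c‖ / |cr (b - a) (c - a)| * ∫ x in convexHull ℝ {a, b, c}, ‖Dv x‖ := by
  obtain ⟨s1, s2, s3⟩ := segment_subset_triangle a b c
  have hb := continuousOn_edge h.continuousOn (by rw [segment_symm]; exact s1 : segment ℝ b a ⊆ _)
  have hc := continuousOn_edge h.continuousOn (by rw [segment_symm]; exact s2 : segment ℝ c a ⊆ _)
  rw [← integral_reflect]
  simp_rw [lineMap_reflect]
  rw [← triple_rotate a b c] at h ⊢
  rw [← cr_rotate a b c] at hcr ⊢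
  have hF := fubini_refTri (integrableOn_tri hcr h.integrableOn.norm)
  calc _ ≤ ∫ x in 0..1, ‖b - c‖ * ∫ s in 0..(1 - x), ‖Dv (tri c a b (x, s))‖ := by
        refine intervalIntegral.integral_mono_ae_restrict zero_le_one
          (intervalIntegrable_of_Icc (hb.sub hc).abs) (hF.2.1.const_mul _) ?_
        filter_upwards [h.ae_abs_sub_le hcr, ae_restrict_mem measurableSet_Icc] with x hx hx1
        have := hx (1 - x) ⟨by linarith [hx1.2], le_rfl⟩
        rwa [tri_top, tri_zero] at this
    _ = _ := by
        rw [intervalIntegral.integral_const_mul, hF.2.2, integral_refTri hcr (fun x => ‖Dv x‖),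
          smul_eq_mul]
        ring

lemma Sob.edge_integral_sub (h : Sob (convexHull ℝ {a, b, c}) v Dv) (hcr : cr (b - a) (c - a) ≠ 0) :
    (∫ t in 0..1, v (lineMap a b t)) - ∫ t in 0..1, v (lineMap a c t) =
      |cr (b - a) (c - a)|⁻¹ * ∫ x in convexHull ℝ {a, b, c}, ⟪Dv x, b - c⟫ := by
  obtain ⟨s1, s2, s3⟩ := segment_subset_triangle a b c
  have hb := continuousOn_edge h.continuousOn s1
  have hc := continuousOn_edge h.continuousOn s2
  rw [← intervalIntegral.integral_sub (intervalIntegrable_of_Icc hb) (intervalIntegrable_of_Icc hc),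
    ← integral_reflect]
  simp_rw [lineMap_reflect]
  rw [← triple_rotate a b c] at h ⊢
  rw [← cr_rotate a b c] at hcr ⊢
  have hDi : IntegrableOn (fun x => ⟪Dv x, b - c⟫) (convexHull ℝ {c, a, b}) :=
    h.integrableOn.inner_const (b - c)
  have hF := fubini_refTri (integrableOn_tri hcr hDi)
  rw [← smul_eq_mul, ← integral_refTri hcr (fun x => ⟪Dv x, b - c⟫), ← hF.2.2,
    integral_of_le zero_le_one, integral_of_le zero_le_one,
    ← integral_Icc_eq_integral_Ioc, ← integral_Icc_eq_integral_Ioc]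
  refine integral_congr_ae ?_
  filter_upwards [h.acl hcr, ae_restrict_mem measurableSet_Icc] with x hx hx1
  have := hx (1 - x) ⟨by linarith [hx1.2], le_rfl⟩
  rwa [tri_top, tri_zero] at this

/-- A trace inequality with a weight that vanishes at one end of the edge. Only the length of the
edge `cb`, in the direction of which `v` is integrated, enters. -/
lemma Sob.trace (h : Sob (convexHull ℝ {c, a, b}) v Dv) (hcr : cr (a - c) (b - c) ≠ 0) :
    ∫ t in 0..1, (1 - t) * |v (lineMap c a t)| ≤
      |cr (a - c) (b - c)|⁻¹ * ((∫ x in convexHull ℝ {c, a, b}, |v x|) +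
        ‖b - c‖ * ∫ x in convexHull ℝ {c, a, b}, ‖Dv x‖) := by
  have hv : IntegrableOn (fun x => |v x|) (convexHull ℝ {c, a, b}) :=
    (h.continuousOn.integrableOn_compact (isCompact_triangle a b c)).abs
  have hF := fubini_refTri (integrableOn_tri hcr h.integrableOn.norm)
  have hG := fubini_refTri (integrableOn_tri hcr hv)
  have hc := continuousOn_edge h.continuousOn (segment_subset_triangle c a b).1
  rw [mul_add, mul_left_comm, ← smul_eq_mul, ← smul_eq_mul (|cr (a - c) (b - c)|⁻¹),
    ← integral_refTri hcr (fun x => ‖Dv x‖), ← integral_refTri hcr (fun x => |v x|),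
    ← hF.2.2, ← hG.2.2, ← intervalIntegral.integral_const_mul,
    ← intervalIntegral.integral_add hG.2.1 (hF.2.1.const_mul _)]
  refine intervalIntegral.integral_mono_ae_restrict zero_le_one
    (intervalIntegrable_of_Icc ((continuousOn_const.sub continuousOn_id).mul hc.abs)) (hG.2.1.add (hF.2.1.const_mul _)) ?_
  filter_upwards [h.ae_abs_sub_le hcr, hG.1, ae_restrict_mem measurableSet_Icc] with x hx hi hx1
  have hx0 : 0 ≤ 1 - x := by linarith [hx1.2]
  set N := ∫ s in 0..(1 - x), ‖Dv (tri c a b (x, s))‖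
  have hN0 : 0 ≤ N := intervalIntegral.integral_nonneg hx0 fun _ _ => norm_nonneg _
  have hint : IntervalIntegrable (fun y => |v (tri c a b (x, y))|) volume 0 (1 - x) := by
    rw [intervalIntegrable_iff_integrableOn_Icc_of_le hx0]; exact hi
  have h1 : ∫ y in 0..(1 - x), |v (lineMap c a x)| ≤
      ∫ y in 0..(1 - x), (|v (tri c a b (x, y))| + ‖b - c‖ * N) := by
    refine integral_mono_on hx0 (by simp) (hint.add (by simp)) fun y hy => ?_
    have := hx y hy
    rw [tri_zero] at this
    have h2 := abs_sub_abs_le_abs_sub (v (lineMap c a x)) (v (tri c a b (x, y)))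
    rw [abs_sub_comm] at h2
    linarith
  rw [intervalIntegral.integral_const, intervalIntegral.integral_add hint (by simp),
    intervalIntegral.integral_const] at h1
  simp only [sub_zero, smul_eq_mul] at h1
  refine h1.trans ?_
  have : (1 - x) * (‖b - c‖ * N) ≤ ‖b - c‖ * N :=
    mul_le_of_le_one_left (by positivity) (by linarith [hx1.1])
  linarith

/-- The first coordinate of `tri`, as a function on the plane. -/
noncomputable def triCoord (c a b q : Plane) : ℝ := cr (q - c) (b - c) / cr (a - c) (b - c)

lemma triCoord_tri (hcr : cr (a - c) (b - c) ≠ 0) (p : ℝ × ℝ) :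
    triCoord c a b (tri c a b p) = p.1 := by
  unfold triCoord
  rw [div_eq_iff hcr]
  simp only [cr, tri, PiLp.sub_apply, PiLp.add_apply, PiLp.smul_apply, smul_eq_mul]
  ring

lemma continuous_triCoord (c a b : Plane) : Continuous (triCoord c a b) := by
  unfold triCoord cr; fun_prop

lemma triCoord_mem (hcr : cr (a - c) (b - c) ≠ 0) (hq : q ∈ convexHull ℝ {c, a, b}) :
    triCoord c a b q ∈ Icc 0 1 := by
  rw [← tri_image] at hq
  obtain ⟨p, ⟨h1, h2, h3⟩, rfl⟩ := hq
  rw [triCoord_tri hcr]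
  exact ⟨h1, by linarith⟩

lemma Sob.integral_abs_sub_edge (h : Sob (convexHull ℝ {c, a, b}) v Dv)
    (hcr : cr (a - c) (b - c) ≠ 0) :
    ∫ q in convexHull ℝ {c, a, b}, |v q - v (lineMap c a (triCoord c a b q))| ≤
      ‖b - c‖ * ∫ x in convexHull ℝ {c, a, b}, ‖Dv x‖ := by
  have hc := continuousOn_edge h.continuousOn (segment_subset_triangle c a b).1
  have hcont : ContinuousOn (fun q => |v q - v (lineMap c a (triCoord c a b q))|)
      (convexHull ℝ {c, a, b}) :=
    (h.continuousOn.sub (hc.comp (continuous_triCoord c a b).continuousOn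
      fun q hq => triCoord_mem hcr hq)).abs
  have hint := hcont.integrableOn_compact (μ := volume) (isCompact_triangle a b c)
  have hF := fubini_refTri (integrableOn_tri hcr h.integrableOn.norm)
  have hG := fubini_refTri (integrableOn_tri hcr hint)
  have key : ∫ p in refTri, |v (tri c a b p) - v (lineMap c a (triCoord c a b (tri c a b p)))| ≤
      ‖b - c‖ * ∫ p in refTri, ‖Dv (tri c a b p)‖ := by
    rw [← hF.2.2, ← hG.2.2, ← intervalIntegral.integral_const_mul]
    refine intervalIntegral.integral_mono_ae_restrict zero_le_one hG.2.1 (hF.2.1.const_mul _) ?_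
    filter_upwards [h.ae_abs_sub_le hcr, hG.1, ae_restrict_mem measurableSet_Icc] with x hx hi hx1
    have hx0 : 0 ≤ 1 - x := by linarith [hx1.2]
    set N := ∫ s in 0..(1 - x), ‖Dv (tri c a b (x, s))‖
    have hN0 : 0 ≤ N := intervalIntegral.integral_nonneg hx0 fun _ _ => norm_nonneg _
    calc _ ≤ ∫ y in 0..(1 - x), ‖b - c‖ * N := by
          refine integral_mono_on hx0 ?_ (by simp) fun y hy => ?_
          · rw [intervalIntegrable_iff_integrableOn_Icc_of_le hx0]; exact hi
          · have := hx y hy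
            rw [triCoord_tri hcr]
            rwa [tri_zero] at this
      _ = (1 - x) * (‖b - c‖ * N) := by simp; ring
      _ ≤ _ := mul_le_of_le_one_left (by positivity) (by linarith [hx1.1])
  rw [integral_refTri hcr (fun q => |v q - v (lineMap c a (triCoord c a b q))|),
    integral_refTri hcr (fun q => ‖Dv q‖), smul_eq_mul, smul_eq_mul, mul_left_comm] at key
  exact le_of_mul_le_mul_left key (by positivity)

/-- A Poincaré inequality for the values on an edge of a triangle. -/
lemma Sob.edge_oscillation (h : Sob (convexHull ℝ {c, a, b}) v Dv) (hcr : cr (a - c) (b - c) ≠ 0) :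
    ∫ t in 0..1, |v (lineMap c a t) - ∫ s in 0..1, v (lineMap c a s)| ≤
      2 * (‖b - c‖ + ‖b - a‖) / |cr (a - c) (b - c)| * ∫ x in convexHull ℝ {c, a, b}, ‖Dv x‖ := by
  set f : ℝ → ℝ := fun t => v (lineMap c a t) with hf
  set S := convexHull ℝ {c, a, b} with hS
  have hS' : convexHull ℝ {a, c, b} = S := by rw [hS, triple_swap']
  have hcr' : cr (c - a) (b - a) ≠ 0 := by
    intro h0; apply hcr; rw [cr_rotate, cr_comm, h0, neg_zero]
  have hcrabs : |cr (c - a) (b - a)| = |cr (a - c) (b - c)| := by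
    rw [cr_rotate a b c, cr_comm, abs_neg]
  have hfc : ContinuousOn f (Icc 0 1) :=
    continuousOn_edge h.continuousOn (segment_subset_triangle c a b).1
  have e1 := h.integral_abs_sub_edge hcr
  have e2 := Sob.integral_abs_sub_edge (c := a) (a := c) (b := b) (by rw [hS']; exact h) hcr'
  rw [hS'] at e2
  have m1 : ∀ q ∈ S, triCoord c a b q ∈ Icc (0 : ℝ) 1 := fun q hq => triCoord_mem hcr hq
  have m2 : ∀ q ∈ S, 1 - triCoord a c b q ∈ Icc (0 : ℝ) 1 := fun q hq => by
    have := triCoord_mem (c := a) (a := c) (b := b) hcr' (by rw [hS']; exact hq)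
    exact ⟨by linarith [this.2], by linarith [this.1]⟩
  have c1 : ContinuousOn (fun q => f (triCoord c a b q)) S :=
    hfc.comp (continuous_triCoord c a b).continuousOn m1
  have c2 : ContinuousOn (fun q => f (1 - triCoord a c b q)) S :=
    hfc.comp (continuous_const.sub (continuous_triCoord a c b)).continuousOn m2
  have hSc : IsCompact S := isCompact_triangle a b c
  -- the values on the edge that are seen in the two directions parallel to the other edges
  have hT : ∫ q in S, |f (triCoord c a b q) - f (1 - triCoord a c b q)| ≤
      (‖b - c‖ + ‖b - a‖) * ∫ x in S, ‖Dv x‖ := by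
    have i1 := ((h.continuousOn.sub c1).abs).integrableOn_compact (μ := volume) hSc
    have i2 := ((h.continuousOn.sub c2).abs).integrableOn_compact (μ := volume) hSc
    have i3 := ((c1.sub c2).abs).integrableOn_compact (μ := volume) hSc
    calc _ ≤ ∫ q in S, (|v q - f (triCoord c a b q)| + |v q - f (1 - triCoord a c b q)|) := by
          refine setIntegral_mono_on i3 (i1.add i2) hSc.measurableSet fun q _ => ?_
          have := abs_sub_le (f (triCoord c a b q)) (v q) (f (1 - triCoord a c b q))
          rwa [abs_sub_comm (f (triCoord c a b q)) (v q)] at this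
      _ = (∫ q in S, |v q - f (triCoord c a b q)|) + ∫ q in S, |v q - f (1 - triCoord a c b q)| :=
          integral_add i1 i2
      _ ≤ _ := by
          have e2' : ∫ q in S, |v q - f (1 - triCoord a c b q)| ≤ ‖b - a‖ * ∫ x in S, ‖Dv x‖ := by
            simp only [hf, lineMap_reflect]; exact e2
          rw [add_mul]; exact add_le_add e1 e2'
  have i3 : IntegrableOn (fun q => |f (triCoord c a b q) - f (1 - triCoord a c b q)|) S :=
    ((c1.sub c2).abs).integrableOn_compact (μ := volume) hSc
  have p1 := (fubini_refTri (integrableOn_tri hcr i3)).2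
  have p2 := (fubini_refTri (integrableOn_tri (c := a) (a := c) (b := b) hcr'
    (by rw [hS']; exact i3))).2
  rw [integral_refTri hcr (fun q => |f (triCoord c a b q) - f (1 - triCoord a c b q)|)] at p1
  rw [integral_refTri hcr' (fun q => |f (triCoord c a b q) - f (1 - triCoord a c b q)|), hS',
    hcrabs] at p2
  have t12 : ∀ x y, tri c a b (x, y) = tri a c b (1 - x - y, y) := fun x y => by
    simp only [tri]; module
  have t21 : ∀ x y, tri a c b (x, y) = tri c a b (1 - x - y, y) := fun x y => by
    simp only [tri]; module
  have q1 : ∀ x, ∫ y in 0..(1 - x), |f (triCoord c a b (tri c a b (x, y))) -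
      f (1 - triCoord a c b (tri c a b (x, y)))| = ∫ r in x..1, |f x - f r| := by
    intro x
    have := intervalIntegral.integral_comp_add_left (a := 0) (b := 1 - x) (fun r => |f x - f r|) x
    rw [add_zero, add_sub_cancel] at this
    rw [← this]
    congr 1; funext y
    rw [triCoord_tri hcr, t12, triCoord_tri hcr']
    congr 3; simp only; ring
  have q2 : ∀ x, ∫ y in 0..(1 - x), |f (triCoord c a b (tri a c b (x, y))) -
      f (1 - triCoord a c b (tri a c b (x, y)))| = ∫ r in 0..(1 - x), |f (1 - x) - f r| := by
    intro x
    have := intervalIntegral.integral_comp_sub_left (a := 0) (b := 1 - x)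
      (fun r => |f (1 - x) - f r|) (1 - x)
    rw [sub_self, sub_zero] at this
    rw [← this]
    congr 1; funext y
    rw [triCoord_tri hcr', t21, triCoord_tri hcr, abs_sub_comm]
  simp_rw [q1] at p1
  simp_rw [q2] at p2
  rw [integral_reflect (fun x => ∫ r in 0..x, |f x - f r|)] at p2
  have p2i : IntervalIntegrable (fun x => ∫ r in 0..x, |f x - f r|) volume 0 1 := by
    have := (p2.1.comp_sub_left 1).symm
    simpa using this
  have hfi : ∀ x ∈ Icc (0 : ℝ) 1, IntervalIntegrable (fun r => |f x - f r|) volume 0 1 := fun x _ =>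
    intervalIntegrable_of_Icc ((continuousOn_const.sub hfc).abs)
  have hle : ∀ t ∈ Icc (0 : ℝ) 1, |f t - ∫ s in 0..1, f s| ≤
      (∫ r in 0..t, |f t - f r|) + ∫ r in t..1, |f t - f r| := by
    intro t ht
    have s1 : IntervalIntegrable (fun r => |f t - f r|) volume 0 t :=
      (hfi t ht).mono_set (by rw [uIcc_of_le ht.1, uIcc_of_le zero_le_one]; exact Set.Icc_subset_Icc_right ht.2)
    have s2 : IntervalIntegrable (fun r => |f t - f r|) volume t 1 :=
      (hfi t ht).mono_set (by rw [uIcc_of_le ht.2, uIcc_of_le zero_le_one]; exact Set.Icc_subset_Icc_left ht.1)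
    rw [integral_add_adjacent_intervals s1 s2]
    have : f t - ∫ s in 0..1, f s = ∫ s in 0..1, (f t - f s) := by
      rw [intervalIntegral.integral_sub (by simp) (intervalIntegrable_of_Icc hfc)]; simp
    rw [this]
    exact intervalIntegral.abs_integral_le_integral_abs zero_le_one
  calc _ ≤ ∫ t in 0..1, ((∫ r in 0..t, |f t - f r|) + ∫ r in t..1, |f t - f r|) :=
        integral_mono_on zero_le_one
          (intervalIntegrable_of_Icc ((hfc.sub continuousOn_const).abs)) (p2i.add p1.1) hle
    _ = 2 * (|cr (a - c) (b - c)|⁻¹ *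
          ∫ q in S, |f (triCoord c a b q) - f (1 - triCoord a c b q)|) := by
        rw [intervalIntegral.integral_add p2i p1.1, p1.2, p2.2, smul_eq_mul]; ring
    _ ≤ 2 * (|cr (a - c) (b - c)|⁻¹ * ((‖b - c‖ + ‖b - a‖) * ∫ x in S, ‖Dv x‖)) := by gcongr
    _ = _ := by ring

end

/-! ### The outward normal and Green's formula on a triangle -/

lemma outerNormal_eq (hab : a ≠ b) (hcr : cr (b - a) (c - a) ≠ 0) : outerNormal a b c =
      (-(cr (b - a) (c - a) / |cr (b - a) (c - a)|) / ‖b - a‖) • rot (b - a) := by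
  have hn : ‖b - a‖ ≠ 0 := norm_ne_zero_iff.2 (sub_ne_zero.2 hab.symm)
  have hn2 : ‖b - a‖ ^ 2 = (b 0 - a 0) ^ 2 + (b 1 - a 1) ^ 2 := norm_sq_eq _
  have hw : (c - a) - (⟪b - a, c - a⟫ / ‖b - a‖ ^ 2) • (b - a) =
      (cr (b - a) (c - a) / ‖b - a‖ ^ 2) • rot (b - a) := by
    have hd : (b 0 - a 0) ^ 2 + (b 1 - a 1) ^ 2 ≠ 0 := by rw [← hn2]; positivity
    apply plane_ext <;> rw [hn2] <;>
    · simp only [inner_eq, cr, PiLp.sub_apply, PiLp.smul_apply, smul_eq_mul, rot_zero_apply,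
        rot_one_apply]
      field_simp
      ring
  unfold outerNormal
  simp only [hw]
  rw [norm_smul, norm_rot, smul_smul]
  congr 1
  rw [norm_eq_abs, abs_div, abs_of_nonneg (by positivity : 0 ≤ ‖b - a‖ ^ 2)]
  field_simp

lemma outerNormal_comm (hab : a ≠ b) (hcr : cr (b - a) (c - a) ≠ 0) :
    outerNormal b a c = outerNormal a b c := by
  have h : cr (a - b) (c - b) = -cr (b - a) (c - a) := by simp only [cr, PiLp.sub_apply]; ring
  have hr : rot (a - b) = -rot (b - a) := by apply plane_ext <;> simp
  rw [outerNormal_eq hab hcr, outerNormal_eq hab.symm (by rw [h]; simpa using hcr), h, hr,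
    norm_sub_rev a b, abs_neg, smul_neg, ← neg_smul]
  congr 1
  ring

/-- Green's formula on a triangle for a constant vector field. -/
lemma Sob.green (h : Sob (convexHull ℝ {a, b, c}) v Dv) (hcr : cr (b - a) (c - a) ≠ 0) (p : Plane) :
    ∫ x in convexHull ℝ {a, b, c}, ⟪p, Dv x⟫ =
      edgeIntegral a b v * ⟪p, outerNormal a b c⟫ + edgeIntegral b c v * ⟪p, outerNormal b c a⟫ +
        edgeIntegral c a v * ⟪p, outerNormal c a b⟫ := by
  have hab : a ≠ b := by rintro rfl; simp [cr] at hcr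
  have hac : a ≠ c := by rintro rfl; simp [cr] at hcr
  have hbc : b ≠ c := by rintro rfl; apply hcr; simp only [cr]; ring
  have r1 : cr (c - b) (a - b) = cr (b - a) (c - a) := by simp only [cr, PiLp.sub_apply]; ring
  have r2 : cr (a - c) (b - c) = cr (b - a) (c - a) := by simp only [cr, PiLp.sub_apply]; ring
  rw [outerNormal_eq hab hcr, outerNormal_eq hbc (by rwa [r1]), outerNormal_eq hac.symm (by rwa [r2]),
    r1, r2]
  have h2 : Sob (convexHull ℝ {c, a, b}) v Dv := by rw [triple_rotate]; exact h
  have e1 := h.edge_integral_sub hcr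
  have e2 := h2.edge_integral_sub (by rwa [r2])
  rw [r2, triple_rotate] at e2
  simp only [edgeIntegral]
  have sym : ∀ x y : Plane, ∫ t in 0..1, v (lineMap x y t) = ∫ t in 0..1, v (lineMap y x t) := by
    intro x y
    rw [← integral_reflect]; simp_rw [lineMap_reflect]
  rw [sym c b] at e2
  rw [sym a c] at e1
  set mab := ∫ t in 0..1, v (lineMap a b t)
  set mbc := ∫ t in 0..1, v (lineMap b c t)
  set mca := ∫ t in 0..1, v (lineMap c a t)
  have hX : ∀ w : Plane, ∫ x in convexHull ℝ {a, b, c}, ⟪Dv x, w⟫ =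
      ⟪∫ x in convexHull ℝ {a, b, c}, Dv x, w⟫ := by
    intro w
    rw [real_inner_comm, ← integral_inner h.integrableOn w]
    simp_rw [real_inner_comm]
  simp_rw [real_inner_comm _ p]
  simp_rw [real_inner_comm p]
  rw [hX] at e1 e2
  have hXp : ∫ x in convexHull ℝ {a, b, c}, ⟪p, Dv x⟫ =
      ⟪∫ x in convexHull ℝ {a, b, c}, Dv x, p⟫ := by
    rw [← hX]; simp_rw [real_inner_comm]
  rw [hXp]
  set X := ∫ x in convexHull ℝ {a, b, c}, Dv x
  have nab : ‖b - a‖ ≠ 0 := norm_ne_zero_iff.2 (sub_ne_zero.2 hab.symm)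
  have nbc : ‖c - b‖ ≠ 0 := norm_ne_zero_iff.2 (sub_ne_zero.2 hbc.symm)
  have nca : ‖a - c‖ ≠ 0 := norm_ne_zero_iff.2 (sub_ne_zero.2 hac)
  have f1 : ⟪X, b - c⟫ = |cr (b - a) (c - a)| * (mab - mca) := by rw [e1]; field_simp
  have f2 : ⟪X, a - b⟫ = |cr (b - a) (c - a)| * (mca - mbc) := by rw [e2]; field_simp
  simp only [inner_smul_right, dist_comm a b, dist_comm b c, dist_comm c a, dist_eq_norm]
  have g : ∀ (n m s t : ℝ), n ≠ 0 → n * m * (-s / n * t) = -s * (m * t) := by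
    intro n m s t hn; field_simp
  rw [g _ _ _ _ nab, g _ _ _ _ nbc, g _ _ _ _ nca]
  set s := cr (b - a) (c - a) / |cr (b - a) (c - a)| with hs
  have hcs : cr (b - a) (c - a) = s * |cr (b - a) (c - a)| := by rw [hs]; field_simp
  have hs2 : s * s = 1 := by
    rw [hs, div_mul_div_comm, abs_mul_abs_self]; exact div_self (mul_ne_zero hcr hcr)
  have hcs' : |cr (b - a) (c - a)| = s * cr (b - a) (c - a) := by
    rw [hcs, abs_mul, abs_abs, ← mul_assoc, hs2, one_mul]
    have : |s| = 1 := by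
      have h3 : |s| * |s| = 1 := by rw [abs_mul_abs_self, hs2]
      nlinarith [abs_nonneg s]
    rw [this, one_mul]
  rw [hcs'] at f1 f2
  apply mul_left_cancel₀ hcr
  simp only [inner_eq, cr, PiLp.sub_apply, rot_zero_apply, rot_one_apply] at f1 f2 ⊢
  linear_combination (p 0 * (b 1 - a 1) - p 1 * (b 0 - a 0)) * f1 +
    (p 0 * (b 1 - c 1) - p 1 * (b 0 - c 0)) * f2

/-! ### The space `H¹₀` -/

lemma IsTest.gradient_memLp (h : IsTest Ω φ) (p : ℝ≥0∞) :
    MemLp (gradient φ) p (volume.restrict Ω) := by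
  have hc := continuous_gradient (h.contDiff.of_le (by simp) : ContDiff ℝ 1 φ)
  have hs : HasCompactSupport (gradient φ) := by
    unfold gradient
    exact (h.hasCompactSupport.fderiv ℝ).comp_left (map_zero _)
  exact (hc.memLp_of_hasCompactSupport hs).restrict Ω

lemma IsTest.memLp (h : IsTest Ω φ) (p : ℝ≥0∞) : MemLp φ p (volume.restrict Ω) :=
  (h.contDiff.continuous.memLp_of_hasCompactSupport h.hasCompactSupport).restrict Ω

lemma gradient_sub' {ψ : Plane → ℝ} (hφ : Differentiable ℝ φ) (hψ : Differentiable ℝ ψ)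
    (x : Plane) : gradient (fun y => φ y - ψ y) x = gradient φ x - gradient ψ x := by
  unfold gradient
  rw [← map_sub, ← fderiv_fun_sub (hφ x) (hψ x)]

lemma gradient_const_mul (hφ : Differentiable ℝ φ) (k : ℝ) (x : Plane) :
    gradient (fun y => k * φ y) x = k • gradient φ x := by
  unfold gradient
  rw [fderiv_const_mul (hφ x), map_smulₛₗ]
  simp

lemma IsTest.differentiable (h : IsTest Ω φ) :
    Differentiable ℝ φ := h.contDiff.differentiable (by simp)

lemma IsTest.sub {ψ : Plane → ℝ} (h : IsTest Ω φ) (h' : IsTest Ω ψ) :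
    IsTest Ω (fun x => φ x - ψ x) where
  contDiff := h.contDiff.sub h'.contDiff
  hasCompactSupport := h.hasCompactSupport.sub h'.hasCompactSupport
  tsupport_subset := (tsupport_sub φ ψ).trans (Set.union_subset h.tsupport_subset h'.tsupport_subset)

lemma IsTest.const_mul (h : IsTest Ω φ) (k : ℝ) : IsTest Ω (fun x => k * φ x) where
  contDiff := contDiff_const.mul h.contDiff
  hasCompactSupport := h.hasCompactSupport.mul_left
  tsupport_subset := (tsupport_mul_subset_right (f := fun _ => k)).trans h.tsupport_subset

lemma MemH10.const_smul (h : MemH10 Ω v Dv) (k : ℝ) :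
    MemH10 Ω (fun x => k * v x) (fun x => k • Dv x) := by
  obtain ⟨φ, h1, h2, h3⟩ := h.approx
  refine ⟨h.memLp.const_mul k, h.memLp_grad.const_smul k, fun n x => k * φ n x,
    fun n => (h1 n).const_mul k, ?_, ?_⟩
  · have : ∀ n, eLpNorm (fun x => k * φ n x - k * v x) 2 (volume.restrict Ω) =
        ‖k‖ₑ * eLpNorm (fun x => φ n x - v x) 2 (volume.restrict Ω) := fun n => by
      rw [← eLpNorm_const_smul]; congr 1; funext x; simp; ring
    simp_rw [this]
    simpa using ENNReal.Tendsto.const_mul h2 (Or.inr enorm_ne_top)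
  · have : ∀ n, eLpNorm (fun x => gradient (fun x => k * φ n x) x - k • Dv x) 2 (volume.restrict Ω) =
        ‖k‖ₑ * eLpNorm (fun x => gradient (φ n) x - Dv x) 2 (volume.restrict Ω) := fun n => by
      rw [← eLpNorm_const_smul]; congr 1; funext x
      rw [gradient_const_mul (h1 n).differentiable, Pi.smul_apply, smul_sub]
    simp_rw [this]
    simpa using ENNReal.Tendsto.const_mul h3 (Or.inr enorm_ne_top)

lemma MemH10.sub {w : Plane → ℝ} {Dw : Plane → Plane} (h : MemH10 Ω v Dv)
    (h' : MemH10 Ω w Dw) : MemH10 Ω (fun x => v x - w x) (fun x => Dv x - Dw x) := by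
  obtain ⟨φ, h1, h2, h3⟩ := h.approx
  obtain ⟨ψ, k1, k2, k3⟩ := h'.approx
  refine ⟨h.memLp.sub h'.memLp, h.memLp_grad.sub h'.memLp_grad, fun n x => φ n x - ψ n x,
    fun n => (h1 n).sub (k1 n), ?_, ?_⟩
  · refine tendsto_of_tendsto_of_tendsto_of_le_of_le tendsto_const_nhds
      (by simpa using h2.add k2) (fun _ => zero_le) fun n => ?_
    have : (fun x => φ n x - ψ n x - (v x - w x)) =
      (fun x => φ n x - v x) - fun x => ψ n x - w x := by funext x; simp; ring
    rw [this]
    exact eLpNorm_sub_le (((h1 n).memLp 2).sub h.memLp).aestronglyMeasurable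
      (((k1 n).memLp 2).sub h'.memLp).aestronglyMeasurable one_le_two
  · refine tendsto_of_tendsto_of_tendsto_of_le_of_le tendsto_const_nhds
      (by simpa using h3.add k3) (fun _ => zero_le) fun n => ?_
    have : (fun x => gradient (fun x => φ n x - ψ n x) x - (Dv x - Dw x)) =
      (fun x => gradient (φ n) x - Dv x) - fun x => gradient (ψ n) x - Dw x := by
      funext x; rw [gradient_sub' (h1 n).differentiable (k1 n).differentiable]
      simp only [Pi.sub_apply]; abel
    rw [this]
    exact eLpNorm_sub_le (((h1 n).gradient_memLp 2).sub h.memLp_grad).aestronglyMeasurable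
      (((k1 n).gradient_memLp 2).sub h'.memLp_grad).aestronglyMeasurable one_le_two

lemma integrable_inner {α E : Type*} [MeasurableSpace α] {μ : Measure α}
    [NormedAddCommGroup E] [InnerProductSpace ℝ E] {F G : α → E}
    (hF : MemLp F 2 μ) (hG : MemLp G 2 μ) : Integrable (fun x => ⟪F x, G x⟫) μ :=
  (hF.norm.integrable_mul hG.norm).mono' (hF.1.inner hG.1)
    (ae_of_all _ fun _ => norm_inner_le_norm _ _)

lemma tendsto_integral_inner {α E : Type*} [MeasurableSpace α] {μ : Measure α}
    [NormedAddCommGroup E] [InnerProductSpace ℝ E] {F G : α → E} {Gn : ℕ → α → E}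
    (hF : MemLp F 2 μ) (hG : MemLp G 2 μ) (hGn : ∀ n, MemLp (Gn n) 2 μ)
    (h : Tendsto (fun n => eLpNorm (fun x => Gn n x - G x) 2 μ) atTop (𝓝 0)) :
    Tendsto (fun n => ∫ x, ⟪F x, Gn n x⟫ ∂μ) atTop (𝓝 (∫ x, ⟪F x, G x⟫ ∂μ)) := by
  refine tendsto_integral_of_L1' _ (integrable_inner hF hG).1
    (Eventually.of_forall fun n => integrable_inner hF (hGn n)) ?_
  refine tendsto_of_tendsto_of_tendsto_of_le_of_le tendsto_const_nhds
      (by simpa using ENNReal.Tendsto.const_mul h (Or.inr hF.2.ne)) (fun _ => zero_le) fun n => ?_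
  have := eLpNorm_le_eLpNorm_mul_eLpNorm'_of_norm (p := 2) (q := 2) (r := 1) hF.1
    ((hGn n).sub hG).1 (fun x y : E => (⟪x, y⟫ : ℝ)) 1
    (ae_of_all _ fun x => by simpa using norm_inner_le_norm (𝕜 := ℝ) (F x) ((Gn n - G) x))
  have e : ((fun x => (⟪F x, Gn n x⟫ : ℝ)) - fun x => (⟪F x, G x⟫ : ℝ)) =
      fun x => (⟪F x, (Gn n - G) x⟫ : ℝ) := by
    funext x; simp [inner_sub_right]
  rw [ENNReal.coe_one, one_mul] at this
  rw [e]
  exact this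

lemma integral_norm_sq {α E : Type*} [MeasurableSpace α] {μ : Measure α}
    [NormedAddCommGroup E] {F : α → E} (hF : MemLp F 2 μ) :
    ∫ x, ‖F x‖ ^ 2 ∂μ = (eLpNorm F 2 μ).toReal ^ 2 := by
  have h0 : 0 ≤ ∫ x, ‖F x‖ ^ 2 ∂μ := integral_nonneg fun _ => by positivity
  rw [hF.eLpNorm_eq_integral_rpow_norm two_ne_zero ENNReal.ofNat_ne_top,
    ENNReal.toReal_ofReal (by positivity)]
  simp only [ENNReal.toReal_ofNat, Real.rpow_ofNat]
  rw [← Real.rpow_natCast, ← Real.rpow_mul h0]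
  norm_num

lemma restrict_closure_eq (hn : volume (frontier Ω) = 0) :
    volume.restrict (closure Ω) = volume.restrict Ω := by
  refine Measure.restrict_congr_set ?_
  rw [closure_eq_self_union_frontier]
  exact union_ae_eq_left_of_ae_eq_empty (ae_eq_empty.2 hn)

lemma tendsto_eLpNorm_one_of_two {α E : Type*} [MeasurableSpace α] {μ : Measure α}
    [IsFiniteMeasure μ] [NormedAddCommGroup E] {F : ℕ → α → E}
    (hm : ∀ n, AEStronglyMeasurable (F n) μ)
    (h : Tendsto (fun n => eLpNorm (F n) 2 μ) atTop (𝓝 0)) :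
    Tendsto (fun n => eLpNorm (F n) 1 μ) atTop (𝓝 0) := by
  refine tendsto_of_tendsto_of_tendsto_of_le_of_le tendsto_const_nhds
    (h := fun n => eLpNorm (F n) 2 μ * μ Set.univ ^ (1 / (1 : ℝ≥0∞).toReal - 1 / (2 : ℝ≥0∞).toReal))
    ?_ (fun _ => zero_le) fun n => eLpNorm_le_eLpNorm_mul_rpow_measure_univ one_le_two (hm n)
  have : μ Set.univ ^ (1 / (1 : ℝ≥0∞).toReal - 1 / (2 : ℝ≥0∞).toReal) ≠ ⊤ :=
    ENNReal.rpow_ne_top_of_nonneg (by norm_num) (measure_ne_top _ _)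
  simpa using ENNReal.Tendsto.mul_const h (Or.inr this)

lemma Sob.of_seq (hn : volume (frontier Ω) = 0)
    (hc : ContinuousOn v (closure Ω)) (hi : IntegrableOn Dv Ω) {φ : ℕ → Plane → ℝ}
    (hφ : ∀ n, ContDiff ℝ 1 (φ n))
    (h1 : Tendsto (fun n => eLpNorm (fun x => φ n x - v x) 1 (volume.restrict Ω)) atTop (𝓝 0))
    (h2 : Tendsto (fun n => eLpNorm (fun x => gradient (φ n) x - Dv x) 1 (volume.restrict Ω)) atTop
      (𝓝 0)) : Sob (closure Ω) v Dv := by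
  refine ⟨hc, by rw [IntegrableOn, restrict_closure_eq hn]; exact hi, fun δ hδ => ?_⟩
  obtain ⟨n, h3, h4⟩ := ((h1.eventually (ge_mem_nhds (pos_iff_ne_zero.2 hδ))).and
    (h2.eventually (ge_mem_nhds (pos_iff_ne_zero.2 hδ)))).exists
  rw [eLpNorm_one_eq_lintegral_enorm] at h3 h4
  refine ⟨φ n, hφ n, ?_, ?_⟩ <;> rw [restrict_closure_eq hn] <;> assumption

lemma Sob.of_memH10 (hb : Bornology.IsBounded Ω)
    (hn : volume (frontier Ω) = 0) (hc : ContinuousOn v (closure Ω)) (h : MemH10 Ω v Dv) :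
    Sob (closure Ω) v Dv := by
  have : IsFiniteMeasure (volume.restrict Ω) := ⟨by simpa using hb.measure_lt_top⟩
  obtain ⟨φ, h1, h2, h3⟩ := h.approx
  exact Sob.of_seq hn hc (h.memLp_grad.integrable one_le_two)
    (fun n => (h1 n).contDiff.of_le (by simp))
    (tendsto_eLpNorm_one_of_two (fun n => (((h1 n).memLp 2).sub h.memLp).1) h2)
    (tendsto_eLpNorm_one_of_two (fun n => (((h1 n).gradient_memLp 2).sub h.memLp_grad).1) h3)

/-- The squares of the approximating test functions converge to `v²` in `W^{1,1}`, as a product with a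
factor that tends to zero in `L²` tends to zero in `L¹`. -/
lemma Sob.sq_of_memH10 (hb : Bornology.IsBounded Ω)
    (hn : volume (frontier Ω) = 0) (hc : ContinuousOn v (closure Ω)) (h : MemH10 Ω v Dv) :
    Sob (closure Ω) (fun x => v x ^ 2) (fun x => (2 * v x) • Dv x) := by
  set μ := volume.restrict Ω with hμ
  have : IsFiniteMeasure μ := ⟨by simpa [hμ] using hb.measure_lt_top⟩
  obtain ⟨φ, h1, h2, h3⟩ := h.approx
  have hv := h.memLp
  have hD := h.memLp_grad
  have ma : ∀ n, MemLp (fun x => φ n x - v x) 2 μ :=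
    fun n => ((h1 n).memLp 2).sub hv
  have mb : ∀ n, MemLp (fun x => gradient (φ n) x - Dv x) 2 μ :=
    fun n => ((h1 n).gradient_memLp 2).sub hD
  have key : ∀ {E : Type} [NormedAddCommGroup E] [NormedSpace ℝ E] {f : Plane → ℝ} {g : Plane → E},
      MemLp f 2 μ → MemLp g 2 μ →
      eLpNorm (fun x => (2 * f x) • g x) 1 μ ≤
        2 * (eLpNorm f 2 μ * eLpNorm g 2 μ) := by
    intro E _ _ f g hf hg
    have := eLpNorm_le_eLpNorm_mul_eLpNorm'_of_norm (p := 2) (q := 2) (r := 1) hf.1 hg.1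
      (fun x y => (2 * x) • y) 2 (ae_of_all _ fun x => by simp [norm_smul])
    rwa [mul_assoc] at this
  refine Sob.of_seq hn (hc.pow 2) ?_ (φ := fun n x => φ n x ^ 2)
    (fun n => ((h1 n).contDiff.of_le (by simp)).pow 2) ?_ ?_
  · have hm : MemLp (fun x => (2 * v x) • Dv x) 1 μ :=
      ⟨(hv.1.const_mul 2).smul hD.1, lt_of_le_of_lt (key hv hD)
        (ENNReal.mul_lt_top (by simp) (ENNReal.mul_lt_top hv.2 hD.2))⟩
    exact memLp_one_iff_integrable.1 hm
  · have hlim := (ENNReal.Tendsto.const_mul (a := 2) (ENNReal.Tendsto.mul h2 (by simp) h2 (by simp))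
      (by simp)).add (ENNReal.Tendsto.const_mul (a := 2) (ENNReal.Tendsto.const_mul
        (a := eLpNorm v 2 μ) h2 (Or.inr hv.2.ne)) (by simp))
    simp only [mul_zero, add_zero] at hlim
    refine tendsto_of_tendsto_of_tendsto_of_le_of_le tendsto_const_nhds hlim
      (fun _ => zero_le) fun n => ?_
    have e : (fun x => φ n x ^ 2 - v x ^ 2) = (fun x => 1 * ((φ n x - v x) * (φ n x - v x))) +
          fun x => (2 * v x) • (φ n x - v x) := by
      funext x; simp; ring
    simp only
    rw [e]
    refine (eLpNorm_add_le ((((ma n).1.mul (ma n).1)).const_mul 1)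
      ((hv.1.const_mul 2).smul (ma n).1) le_rfl).trans ?_
    refine add_le_add ?_ (key hv (ma n))
    refine le_trans (eLpNorm_mono fun x => ?_) (key (ma n) (ma n))
    simp only [norm_mul, norm_smul, one_mul, Pi.mul_apply]
    rw [Real.norm_ofNat, mul_assoc]
    nlinarith [mul_nonneg (norm_nonneg (φ n x - v x)) (norm_nonneg (φ n x - v x))]
  · have hlim := (ENNReal.Tendsto.const_mul (a := 2) (ENNReal.Tendsto.mul h2 (by simp) h3 (by simp))
      (by simp)).add ((ENNReal.Tendsto.const_mul (a := 2) (ENNReal.Tendsto.const_mul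
        (a := eLpNorm v 2 μ) h3 (Or.inr hv.2.ne)) (by simp)).add (ENNReal.Tendsto.const_mul (a := 2)
        (ENNReal.Tendsto.mul_const (b := eLpNorm Dv 2 μ) h2 (Or.inr hD.2.ne)) (by simp)))
    simp only [mul_zero, zero_mul, add_zero] at hlim
    refine tendsto_of_tendsto_of_tendsto_of_le_of_le tendsto_const_nhds hlim
      (fun _ => zero_le) fun n => ?_
    have hg : ∀ x, gradient (fun x => φ n x ^ 2) x = (2 * φ n x) • gradient (φ n) x := by
      intro x
      unfold gradient
      have := ((h1 n).differentiable x).hasFDerivAt.pow 2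
      rw [this.fderiv, map_smulₛₗ]
      simp
    have e : (fun x => gradient (fun x => φ n x ^ 2) x - (2 * v x) • Dv x) =
        (fun x => (2 * (φ n x - v x)) • (gradient (φ n) x - Dv x)) +
          ((fun x => (2 * v x) • (gradient (φ n) x - Dv x)) +
            fun x => (2 * (φ n x - v x)) • Dv x) := by
      funext x
      simp only [Pi.add_apply]
      rw [hg]; module
    simp only
    rw [e]
    have t1 : AEStronglyMeasurable (fun x => (2 * (φ n x - v x)) • (gradient (φ n) x - Dv x))
      μ := ((ma n).1.const_mul 2).smul (mb n).1
    have t2 : AEStronglyMeasurable (fun x => (2 * v x) • (gradient (φ n) x - Dv x))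
      μ := (hv.1.const_mul 2).smul (mb n).1
    have t3 : AEStronglyMeasurable (fun x => (2 * (φ n x - v x)) • Dv x)
      μ := ((ma n).1.const_mul 2).smul hD.1
    exact (eLpNorm_add_le t1 (t2.add t3) le_rfl).trans (add_le_add (key (ma n) (mb n))
      ((eLpNorm_add_le t2 t3 le_rfl).trans (add_le_add (key hv (mb n)) (key (ma n) hD))))

/-- The Poincaré inequality on a bounded domain. -/
lemma exists_poincare (hb : Bornology.IsBounded Ω) : ∃ C : ℝ, 0 ≤ C ∧
    ∀ (v : Plane → ℝ) (Dv : Plane → Plane), MemH10 Ω v Dv →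
      ∫ x in Ω, v x ^ 2 ≤ C * ∫ x in Ω, ‖Dv x‖ ^ 2 := by
  have : IsFiniteMeasure (volume.restrict Ω) := ⟨by simpa using hb.measure_lt_top⟩
  set A : ℝ≥0∞ := eLpNormLESNormFDerivOfLeConst ℝ (volume : Measure Plane) Ω 1 2 *
    volume.restrict Ω Set.univ ^ (1 / (1 : ℝ≥0∞).toReal - 1 / (2 : ℝ≥0∞).toReal) with hA
  have hAt : A ≠ ⊤ := ENNReal.mul_ne_top ENNReal.coe_ne_top
    (ENNReal.rpow_ne_top_of_nonneg (by norm_num) (measure_ne_top _ _))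
  have htest : ∀ φ, IsTest Ω φ → eLpNorm φ 2 (volume.restrict Ω) ≤
      A * eLpNorm (gradient φ) 2 (volume.restrict Ω) := by
    intro φ hφ
    have hs : Function.support φ ⊆ Ω := (subset_tsupport φ).trans hφ.tsupport_subset
    have h1 := eLpNorm_le_eLpNorm_fderiv_of_le (volume : Measure Plane) (u := φ) (s := Ω)
      (hφ.contDiff.of_le (by simp)) hs (p := 1) (q := 2) le_rfl
      (by norm_num) (by norm_num) hb
    have h2 : eLpNorm (fderiv ℝ φ) 1 volume = eLpNorm (gradient φ) 1 (volume.restrict Ω) := by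
      rw [eLpNorm_restrict_eq_of_support_subset]
      · refine eLpNorm_congr_norm_ae (ae_of_all _ fun x => ?_)
        unfold gradient; simp
      · intro x hx
        refine hφ.tsupport_subset (support_fderiv_subset ℝ (f := φ) ?_)
        intro h0
        apply hx
        unfold gradient; rw [h0]; simp
    rw [eLpNorm_restrict_eq_of_support_subset hs, hA, mul_assoc]
    have h1' : eLpNorm φ 2 volume ≤ eLpNormLESNormFDerivOfLeConst ℝ (volume : Measure Plane) Ω 1 2 *
        eLpNorm (fderiv ℝ φ) 1 volume := by exact_mod_cast h1
    refine h1'.trans ?_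
    rw [h2]
    gcongr
    rw [mul_comm]
    exact eLpNorm_le_eLpNorm_mul_rpow_measure_univ one_le_two (hφ.gradient_memLp 2).1
  refine ⟨A.toReal ^ 2, by positivity, fun v Dv h => ?_⟩
  obtain ⟨φ, h1, h2, h3⟩ := h.approx
  have hle : eLpNorm v 2 (volume.restrict Ω) ≤ A * eLpNorm Dv 2 (volume.restrict Ω) := by
    have hlim : Tendsto (fun n => eLpNorm (fun x => φ n x - v x) 2 (volume.restrict Ω) +
        A * (eLpNorm (fun x => gradient (φ n) x - Dv x) 2 (volume.restrict Ω) +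
          eLpNorm Dv 2 (volume.restrict Ω))) atTop
        (𝓝 (0 + A * (0 + eLpNorm Dv 2 (volume.restrict Ω)))) :=
      h2.add (ENNReal.Tendsto.const_mul (h3.add tendsto_const_nhds) (Or.inr hAt))
    rw [zero_add, zero_add] at hlim
    refine ge_of_tendsto' hlim fun n => ?_
    have e1 : v = φ n - fun x => φ n x - v x := by funext x; simp
    have e2 : gradient (φ n) = (fun x => gradient (φ n) x - Dv x) + Dv := by funext x; simp
    calc eLpNorm v 2 (volume.restrict Ω) ≤ eLpNorm (φ n) 2 (volume.restrict Ω) +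
          eLpNorm (fun x => φ n x - v x) 2 (volume.restrict Ω) := by
          conv_lhs => rw [e1]
          exact eLpNorm_sub_le ((h1 n).memLp 2).1 (((h1 n).memLp 2).sub h.memLp).1 one_le_two
      _ ≤ A * eLpNorm (gradient (φ n)) 2 (volume.restrict Ω) +
          eLpNorm (fun x => φ n x - v x) 2 (volume.restrict Ω) := by gcongr; exact htest _ (h1 n)
      _ ≤ _ := by
          rw [add_comm]
          gcongr
          conv_lhs => rw [e2]
          exact eLpNorm_add_le (((h1 n).gradient_memLp 2).sub h.memLp_grad).1 h.memLp_grad.1 one_le_two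
  have i1 := integral_norm_sq h.memLp
  simp only [norm_eq_abs, sq_abs] at i1
  rw [i1, integral_norm_sq h.memLp_grad, ← mul_pow, ← ENNReal.toReal_mul]
  gcongr
  exact ENNReal.mul_ne_top hAt h.memLp_grad.2.ne

/-! ### The reaction term and the weak formulation -/

lemma IsReaction.comp_memLp {f : Plane → ℝ → ℝ} {Cf : ℝ} (hf : IsReaction Ω f Cf)
    (ho : IsOpen Ω) (hb : Bornology.IsBounded Ω) {w : Plane → ℝ}
    (hw : ContinuousOn w (closure Ω)) : MemLp (fun x => f x (w x)) 2 (volume.restrict Ω) := by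
  have : IsFiniteMeasure (volume.restrict Ω) := ⟨by simpa using hb.measure_lt_top⟩
  obtain ⟨R, hR⟩ := (hb.isCompact_closure).exists_bound_of_continuousOn hw
  have hm : AEStronglyMeasurable (fun x => f x (w x)) (volume.restrict Ω) := by
    have : ContinuousOn (fun x => f x (w x)) Ω :=
      hf.continuousOn.comp (continuousOn_id.prodMk (hw.mono subset_closure)) fun x hx => ⟨hx, trivial⟩
    exact this.aestronglyMeasurable ho.measurableSet
  refine MemLp.mono_exponent (q := ⊤) ?_ le_top
  have hB := ((hf.memLp_top R).norm.add (hf.memLp_top (-R)).norm)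
  refine hB.mono hm ((ae_restrict_iff' ho.measurableSet).2 (ae_of_all _ fun x hx => ?_))
  have hx1 := hR x (subset_closure hx)
  rw [norm_eq_abs, abs_le] at hx1
  have h1 := hf.oneSided x hx R (w x) hx1.2
  have h2 := hf.oneSided x hx (w x) (-R) hx1.1
  have h3 := mul_nonneg hf.const_nonneg (sub_nonneg.2 hx1.2)
  have h4 := mul_nonneg hf.const_nonneg (sub_nonneg.2 hx1.1)
  simp only [Pi.add_apply, norm_eq_abs]
  rw [abs_of_nonneg (by positivity : 0 ≤ |f x R| + |f x (-R)|), abs_le]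
  constructor
  · linarith [neg_abs_le (f x (-R)), abs_nonneg (f x R)]
  · linarith [le_abs_self (f x R), abs_nonneg (f x (-R))]

/-- The weak formulation holds for all test functions in `H¹₀`. -/
lemma IsSolution.weak_memH10 {f : Plane → ℝ → ℝ} {Cf : ℝ} (hf : IsReaction Ω f Cf)
    (ho : IsOpen Ω) (hb : Bornology.IsBounded Ω) {u : Plane → ℝ} {Du : Plane → Plane}
    (hu : IsSolution Ω f ε u Du) (hv : MemH10 Ω v Dv) :
    ε ^ 2 * (∫ x in Ω, ⟪Du x, Dv x⟫) + ∫ x in Ω, f x (u x) * v x = 0 := by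
  obtain ⟨φ, h1, h2, h3⟩ := hv.approx
  have t1 := tendsto_integral_inner hu.memH10.memLp_grad hv.memLp_grad
    (fun n => (h1 n).gradient_memLp 2) h3
  have t2 := tendsto_integral_inner (hf.comp_memLp ho hb hu.continuousOn) hv.memLp
    (fun n => (h1 n).memLp 2) h2
  have t3 := (t1.const_mul (ε ^ 2)).add t2
  have e : ∀ n, ε ^ 2 * (∫ x in Ω, ⟪Du x, gradient (φ n) x⟫) +
      ∫ x in Ω, ⟪f x (u x), φ n x⟫ = 0 := fun n => by
    rw [← hu.weak (φ n) (h1 n)]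
    simp [mul_comm]
  simp_rw [e] at t3
  have := tendsto_nhds_unique t3 tendsto_const_nhds
  rw [← this]
  simp [mul_comm]

/-! ### Conformity and the triangles on the two sides of an edge -/

lemma cr_smul_left (k : ℝ) (v w : Plane) : cr (k • v) w = k * cr v w := by simp [cr]; ring

lemma cr_smul_right (k : ℝ) (v w : Plane) : cr v (k • w) = k * cr v w := by simp [cr]; ring

lemma cr_add_left (u v w : Plane) : cr (u + v) w = cr u w + cr v w := by simp [cr]; ring

lemma cr_add_right (u v w : Plane) : cr u (v + w) = cr u v + cr u w := by simp [cr]; ring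

@[simp] theorem cr_self (v : Plane) : cr v v = 0 := by simp [cr]; ring

lemma cr_rot_self (v : Plane) : cr v (rot v) = ‖v‖ ^ 2 := by rw [norm_sq_eq]; simp [cr]; ring

/-- Cramer's rule. -/
lemma eq_combination (h : cr a b ≠ 0) (c : Plane) :
    c = (cr c b / cr a b) • a + (cr a c / cr a b) • b := by
  apply plane_ext <;>
  · simp only [PiLp.add_apply, PiLp.smul_apply, smul_eq_mul]
    field_simp
    simp only [cr]
    ring

namespace Triangulation

variable (Δ : Triangulation Ω)

lemma mem_triangles : T ∈ Δ.triangles ↔ T ∈ Δ.faces ∧ T.card = 3 := by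
  classical
  simp [triangles]

lemma mem_star : T ∈ Δ.star z ↔ (T ∈ Δ.faces ∧ T.card = 3) ∧ z ∈ T := by
  classical
  simp [star, mem_triangles]

lemma mem_nodes : z ∈ Δ.nodes ↔ ∃ T ∈ Δ.triangles, z ∈ T := by
  classical
  simp [nodes]

lemma star_subset (h : T ∈ Δ.star z) : T ∈ Δ.triangles := Δ.mem_triangles.2 (Δ.mem_star.1 h).1

lemma cr_ne_zero (hT : {z, a, b} ∈ Δ.faces) (hza : z ≠ a)
    (hzb : z ≠ b) (hab : a ≠ b) : cr (a - z) (b - z) ≠ 0 := by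
  intro h0
  have hind := Δ.indep hT
  have hc : ({z, a, b} : Finset Plane).card = 3 :=
    Finset.card_eq_three.2 ⟨z, a, b, hza, hzb, hab, rfl⟩
  have h1 := hind.finrank_vectorSpan (n := 2) (by simpa using hc)
  rw [Subtype.range_coe_subtype] at h1
  have h2 : {x | x ∈ ({z, a, b} : Finset Plane)} = ({z, a, b} : Set Plane) := by ext x; simp
  rw [h2] at h1
  have h3 : ¬ Collinear ℝ {z, a, b} := by
    intro h
    have := collinear_iff_finrank_le_one.1 h
    omega
  apply h3
  rw [collinear_iff_of_mem (p₀ := z) (by simp)]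
  refine ⟨a - z, ?_⟩
  have hn : (a 0 - z 0) ^ 2 + (a 1 - z 1) ^ 2 ≠ 0 := by
    have := norm_sq_eq (a - z)
    simp only [PiLp.sub_apply] at this
    rw [← this]
    have := norm_pos_iff.2 (sub_ne_zero.2 hza.symm)
    positivity
  simp only [cr, PiLp.sub_apply] at h0
  intro p hp
  simp only [Set.mem_insert_iff, Set.mem_singleton_iff] at hp
  rcases hp with rfl | rfl | rfl
  · exact ⟨0, by simp⟩
  · exact ⟨1, by simp⟩
  · refine ⟨⟪p - z, a - z⟫ / ((a 0 - z 0) ^ 2 + (a 1 - z 1) ^ 2), ?_⟩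
    apply plane_ext
    · simp only [inner_eq, vadd_eq_add, PiLp.add_apply, PiLp.smul_apply, PiLp.sub_apply, smul_eq_mul]
      field_simp
      linear_combination -(a 1 - z 1) * h0
    · simp only [inner_eq, vadd_eq_add, PiLp.add_apply, PiLp.smul_apply, PiLp.sub_apply, smul_eq_mul]
      field_simp
      linear_combination (a 0 - z 0) * h0

/-- A triangle of the star of `z` in terms of its vertices. -/
structure IsTri (z a b : Plane) : Prop where
  mem : {z, a, b} ∈ Δ.faces
  hza : z ≠ a
  hzb : z ≠ b
  hab : a ≠ b

variable {Δ}

namespace IsTri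

lemma cr_ne (h : Δ.IsTri z a b) : cr (a - z) (b - z) ≠ 0 := Δ.cr_ne_zero h.mem h.hza h.hzb h.hab

lemma card (h : Δ.IsTri z a b) : ({z, a, b} : Finset Plane).card = 3 :=
  Finset.card_eq_three.2 ⟨z, a, b, h.hza, h.hzb, h.hab, rfl⟩

lemma mem_triangles (h : Δ.IsTri z a b) : {z, a, b} ∈ Δ.triangles :=
  Δ.mem_triangles.2 ⟨h.mem, h.card⟩

lemma mem_star (h : Δ.IsTri z a b) : {z, a, b} ∈ Δ.star z :=
  Δ.mem_star.2 ⟨⟨h.mem, h.card⟩, by simp⟩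

lemma swap (h : Δ.IsTri z a b) : Δ.IsTri z b a :=
  ⟨by rw [Finset.pair_comm b a]; exact h.mem, h.hzb, h.hza, h.hab.symm⟩

lemma swap' (h : Δ.IsTri z a b) : Δ.IsTri a z b :=
  ⟨by rw [Finset.insert_comm]; exact h.mem, h.hza.symm, h.hab, h.hzb⟩

lemma edge (h : Δ.IsTri z a b) : {z, a} ∈ Δ.faces :=
  Δ.down_closed h.mem (by intro x; simp; tauto) (by simp)

lemma mem_nbrs (h : Δ.IsTri z a b) : a ∈ Δ.nbrs z := by
  classical
  simp only [nbrs, mem_filter]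
  exact ⟨Δ.mem_nodes.2 ⟨_, h.mem_triangles, by simp⟩, h.hza.symm, h.edge⟩

end IsTri

lemma cell_eq (z a b : Plane) : cell {z, a, b} = convexHull ℝ {z, a, b} := by simp [cell]

lemma exists_isTri (hT : T ∈ Δ.triangles) (hz : z ∈ T)
    (ha : a ∈ T) (hza : z ≠ a) : ∃ b, Δ.IsTri z a b ∧ T = {z, a, b} := by
  classical
  obtain ⟨hf, hc⟩ := Δ.mem_triangles.1 hT
  have hsub : {z, a} ⊆ T := by
    intro x hx; simp only [mem_insert, mem_singleton] at hx
    rcases hx with rfl | rfl <;> assumption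
  have h2 : (T \ {z, a}).card = 1 := by
    rw [Finset.card_sdiff_of_subset hsub, hc, Finset.card_pair hza]
  obtain ⟨b, hb⟩ := Finset.card_eq_one.1 h2
  have hTe : T = {z, a, b} := by
    rw [← Finset.sdiff_union_of_subset hsub, hb]
    ext x; simp only [Finset.mem_union, mem_singleton, mem_insert]; tauto
  have hbm : b ∈ T \ {z, a} := by rw [hb]; simp
  simp only [Finset.mem_sdiff, mem_insert, mem_singleton, not_or] at hbm
  exact ⟨b, ⟨hTe ▸ hf, hza, fun h => hbm.2.1 h.symm, fun h => hbm.2.2 h.symm⟩, hTe⟩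

lemma exists_isTri_of_mem_star (hT : T ∈ Δ.star z) : ∃ a b, Δ.IsTri z a b ∧ T = {z, a, b} := by
  obtain ⟨⟨hf, hc⟩, hz⟩ := Δ.mem_star.1 hT
  obtain ⟨a, ha, hne⟩ := Finset.exists_mem_ne (by omega : 1 < T.card) z
  obtain ⟨b, hb⟩ := exists_isTri (Δ.star_subset hT) hz ha hne.symm
  exact ⟨a, b, hb⟩

lemma mem_nbrs_edge (h : s ∈ Δ.nbrs z) :
    s ∈ Δ.nodes ∧ z ≠ s ∧ {z, s} ∈ Δ.faces := by
  classical
  simp only [nbrs, mem_filter] at h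
  exact ⟨h.1, h.2.1.symm, h.2.2⟩

lemma exists_isTri_of_mem_nbrs (h : s ∈ Δ.nbrs z) : ∃ b, Δ.IsTri z s b := by
  obtain ⟨_, hne, hf⟩ := mem_nbrs_edge h
  obtain ⟨T, hT, hc, hsub⟩ := Δ.pure _ hf
  obtain ⟨b, hb, _⟩ := exists_isTri (Δ.mem_triangles.2 ⟨hT, hc⟩) (hsub (by simp))
    (hsub (by simp : s ∈ {z, s})) hne
  exact ⟨b, hb⟩

lemma nbrs_symm (h : s ∈ Δ.nbrs z) : z ∈ Δ.nbrs s := by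
  obtain ⟨b, hb⟩ := exists_isTri_of_mem_nbrs h
  exact hb.swap'.mem_nbrs

lemma mem_innerNbrs : s ∈ Δ.innerNbrs z ↔ s ∈ Δ.nbrs z ∧ ¬ segment ℝ z s ⊆ frontier Ω := by
  classical
  simp [innerNbrs]

lemma innerNbrs_symm (h : s ∈ Δ.innerNbrs z) : z ∈ Δ.innerNbrs s := by
  rw [mem_innerNbrs] at h ⊢
  exact ⟨nbrs_symm h.1, by rw [segment_symm]; exact h.2⟩

/-- An edge at `z` cannot enter the closed angle of a triangle at `z`, unless it is a side of it. -/
lemma eq_or_eq_of_combination (hc : {z, c} ∈ Δ.faces)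
    (hT : Δ.IsTri z a b) {α β : ℝ} (hα : 0 ≤ α) (hβ : 0 ≤ β) (hzc : z ≠ c)
    (h : c - z = α • (a - z) + β • (b - z)) : c = a ∨ c = b := by
  classical
  by_contra hcon
  push Not at hcon
  set t := 1 / (1 + α + β) with ht
  have ht0 : 0 < t := by positivity
  have ht1 : t * (α + β) ≤ 1 := by rw [ht, div_mul_eq_mul_div, div_le_one (by positivity)]; linarith
  have ht2 : t ≤ 1 := by rw [ht, div_le_one (by positivity)]; linarith
  have hp1 : z + t • (c - z) ∈ convexHull ℝ (({z, c} : Finset Plane) : Set Plane) := by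
    rw [Finset.coe_pair, convexHull_pair, segment_eq_image']
    exact ⟨t, ⟨ht0.le, ht2⟩, rfl⟩
  have hp2 : z + t • (c - z) ∈ convexHull ℝ (({z, a, b} : Finset Plane) : Set Plane) := by
    rw [← cell, cell_eq, ← tri_image]
    refine ⟨(t * α, t * β), ⟨by positivity, by positivity, by simp only; linarith⟩, ?_⟩
    rw [h]; simp only [tri]; module
  have := Δ.inter_subset_convexHull hc hT.mem ⟨hp1, hp2⟩
  have he : ((({z, c} : Finset Plane) : Set Plane) ∩ (({z, a, b} : Finset Plane) : Set Plane)) = {z} := by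
    ext x
    simp only [Finset.coe_insert, Finset.coe_singleton, Set.mem_inter_iff, Set.mem_insert_iff,
      Set.mem_singleton_iff]
    constructor
    · rintro ⟨rfl | rfl, h2⟩
      · rfl
      · rcases h2 with h2 | h2 | h2
        · exact h2
        · exact absurd h2 hcon.1
        · exact absurd h2 hcon.2
    · rintro rfl; simp
  rw [he, convexHull_singleton, Set.mem_singleton_iff, add_eq_left, smul_eq_zero, sub_eq_zero] at this
  rcases this with h | h
  · exact ht0.ne' h
  · exact hzc h.symm

lemma eq_or_eq_of_cr (hc : c ∈ Δ.nbrs z) (hT : Δ.IsTri z a b)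
    (h1 : 0 ≤ cr (a - z) (c - z) * cr (a - z) (b - z))
    (h2 : 0 ≤ cr (c - z) (b - z) * cr (a - z) (b - z)) : c = a ∨ c = b := by
  obtain ⟨_, hne, hf⟩ := mem_nbrs_edge hc
  have hn := hT.cr_ne
  refine eq_or_eq_of_combination hf hT (α := cr (c - z) (b - z) / cr (a - z) (b - z))
    (β := cr (a - z) (c - z) / cr (a - z) (b - z)) ?_ ?_ hne (eq_combination hn _)
  · rw [← mul_div_mul_right _ _ hn]; exact div_nonneg h2 (mul_self_nonneg _)
  · rw [← mul_div_mul_right _ _ hn]; exact div_nonneg h1 (mul_self_nonneg _)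

/-- Two edges at `z` in the same direction coincide. -/
lemma eq_of_cr_eq_zero (hc : c ∈ Δ.nbrs z) (hd : d ∈ Δ.nbrs z)
    (h0 : cr (c - z) (d - z) = 0) (hin : 0 < ⟪c - z, d - z⟫) : c = d := by
  obtain ⟨b, hb⟩ := exists_isTri_of_mem_nbrs hd
  obtain ⟨_, hne, hf⟩ := mem_nbrs_edge hc
  have hcb := hb.cr_ne
  have hnd : 0 < ‖d - z‖ ^ 2 := by
    have := norm_pos_iff.2 (sub_ne_zero.2 hb.hza.symm); positivity
  have hcd : c - z = (⟪c - z, d - z⟫ / ‖d - z‖ ^ 2) • (d - z) := by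
    rw [norm_sq_eq] at hnd ⊢
    apply plane_ext
    · simp only [PiLp.smul_apply, smul_eq_mul, inner_eq]
      rw [div_mul_eq_mul_div, eq_div_iff hnd.ne']
      simp only [cr] at h0
      linear_combination (d - z) 1 * h0
    · simp only [PiLp.smul_apply, smul_eq_mul, inner_eq]
      rw [div_mul_eq_mul_div, eq_div_iff hnd.ne']
      simp only [cr] at h0
      linear_combination -(d - z) 0 * h0
  rcases eq_or_eq_of_combination hf hb (α := ⟪c - z, d - z⟫ / ‖d - z‖ ^ 2) (β := 0)
    (by positivity) le_rfl hne (by rw [zero_smul, add_zero]; exact hcd) with h | h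
  · exact h
  · subst h
    exact absurd (by rw [cr_comm, h0, neg_zero]) hcb

/-- By conformity, only the faces that contain the edge `zs` contain its midpoint. -/
lemma pair_subset_of_mem_cell {m : Plane} {E : Finset Plane} (hE : E ∈ Δ.faces)
    (hzs : z ≠ s) (hf : {z, s} ∈ Δ.faces) (hm : m = midpoint ℝ z s)
    (hmE : m ∈ convexHull ℝ (E : Set Plane)) : z ∈ E ∧ s ∈ E := by
  classical
  have hm1 : m ∈ convexHull ℝ (({z, s} : Finset Plane) : Set Plane) := by
    rw [Finset.coe_pair, convexHull_pair, hm]; exact midpoint_mem_segment z s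
  have h := Δ.inter_subset_convexHull hf hE ⟨hm1, hmE⟩
  have hms : m ≠ z ∧ m ≠ s := by
    rw [hm]
    refine ⟨fun h => hzs ?_, fun h => hzs ?_⟩
    · exact (midpoint_eq_left_iff ℝ).1 h
    · exact (midpoint_eq_right_iff ℝ).1 h
  constructor
  · by_contra hz
    have : ((({z, s} : Finset Plane) : Set Plane) ∩ (E : Set Plane)) ⊆ {s} := by
      rintro x ⟨hx, hxE⟩
      simp only [Finset.coe_insert, Finset.coe_singleton, Set.mem_insert_iff,
        Set.mem_singleton_iff] at hx
      rcases hx with rfl | rfl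
      · exact absurd hxE hz
      · rfl
    have := convexHull_mono this h
    rw [convexHull_singleton] at this
    exact hms.2 this
  · by_contra hz
    have : ((({z, s} : Finset Plane) : Set Plane) ∩ (E : Set Plane)) ⊆ {z} := by
      rintro x ⟨hx, hxE⟩
      simp only [Finset.coe_insert, Finset.coe_singleton, Set.mem_insert_iff,
        Set.mem_singleton_iff] at hx
      rcases hx with rfl | rfl
      · rfl
      · exact absurd hxE hz
    have := convexHull_mono this h
    rw [convexHull_singleton] at this
    exact hms.1 this

/-- The midpoint of an interior edge lies in `Ω`. -/
lemma midpoint_mem (h : s ∈ Δ.innerNbrs z) : midpoint ℝ z s ∈ Ω := by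
  classical
  obtain ⟨hn, hfr⟩ := mem_innerNbrs.1 h
  obtain ⟨_, hne, hf⟩ := mem_nbrs_edge hn
  have hcl : midpoint ℝ z s ∈ closure Ω := by
    rw [← Δ.space_eq]
    refine Δ.convexHull_subset_space hf ?_
    rw [Finset.coe_pair, convexHull_pair]; exact midpoint_mem_segment z s
  rw [closure_eq_self_union_frontier] at hcl
  refine hcl.resolve_right fun hmf => hfr ?_
  obtain ⟨E, hE, hEc, hmE, hsub⟩ := Δ.frontier_edges _ hmf
  obtain ⟨h1, h2⟩ := pair_subset_of_mem_cell hE hne hf rfl hmE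
  have : {z, s} = E := Finset.eq_of_subset_of_card_le
    (by intro x hx; simp only [mem_insert, mem_singleton] at hx
        rcases hx with rfl | rfl <;> assumption)
    (by rw [hEc, Finset.card_pair hne])
  rw [← this, Finset.coe_pair, convexHull_pair] at hsub
  exact hsub

lemma mem_cell_of_mem_closure (hx : x ∈ closure Ω) : ∃ T ∈ Δ.triangles, x ∈ cell T := by
  rw [← Δ.space_eq, Geometry.SimplicialComplex.mem_space_iff] at hx
  obtain ⟨s, hs, hxs⟩ := hx
  obtain ⟨T, hT, hc, hsub⟩ := Δ.pure s hs
  exact ⟨T, Δ.mem_triangles.2 ⟨hT, hc⟩, convexHull_mono (by exact_mod_cast hsub) hxs⟩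

lemma cell_subset_closure (hT : T ∈ Δ.faces) : cell T ⊆ closure Ω := by
  rw [← Δ.space_eq]; exact Δ.convexHull_subset_space hT

lemma isCompact_cell (T : Finset Plane) : IsCompact (cell T) :=
  T.finite_toSet.isCompact_convexHull ℝ

/-- An interior edge has a triangle on each side. -/
lemma exists_isTri_side (hΩ : IsOpen Ω) (h : s ∈ Δ.innerNbrs z) {σ : ℝ}
    (hσ : σ ≠ 0) : ∃ b, Δ.IsTri z s b ∧ 0 < σ * cr (s - z) (b - z) := by
  classical
  obtain ⟨hn, hfr⟩ := mem_innerNbrs.1 h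
  obtain ⟨_, hne, hf⟩ := mem_nbrs_edge hn
  have hm := midpoint_mem h
  set m := midpoint ℝ z s with hmdef
  set w := σ • rot (s - z) with hw
  have ht : Tendsto (fun δ : ℝ => m + δ • w) (𝓝[>] 0) (𝓝 m) := by
    have : Continuous (fun δ : ℝ => m + δ • w) := by fun_prop
    have h0 := this.tendsto 0
    simp only [zero_smul, add_zero] at h0
    exact h0.mono_left nhdsWithin_le_nhds
  have hev : ∀ᶠ δ in 𝓝[>] (0 : ℝ), m + δ • w ∈ Ω := ht.eventually (hΩ.mem_nhds hm)
  obtain ⟨T, hT, hfreq⟩ : ∃ T ∈ Δ.triangles, ∃ᶠ δ in 𝓝[>] (0 : ℝ), m + δ • w ∈ cell T := by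
    by_contra hcon
    push Not at hcon
    have h1 := (Filter.eventually_all_finset Δ.triangles).2 hcon
    obtain ⟨δ, h2, h3⟩ := (h1.and hev).exists
    obtain ⟨T, hT, hx⟩ := mem_cell_of_mem_closure (Δ := Δ) (subset_closure h3)
    exact h2 T hT hx
  have hmT : m ∈ cell T := (isCompact_cell T).isClosed.mem_of_frequently_of_tendsto hfreq ht
  obtain ⟨h1, h2⟩ := pair_subset_of_mem_cell (Δ.mem_triangles.1 hT).1 hne hf rfl hmT
  obtain ⟨b, hb, rfl⟩ := exists_isTri hT h1 h2 hne
  refine ⟨b, hb, ?_⟩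
  obtain ⟨δ, hδ, hδ0⟩ := (hfreq.and_eventually self_mem_nhdsWithin).exists
  rw [cell_eq, ← tri_image] at hδ
  obtain ⟨⟨p, q⟩, ⟨hp, hq, _⟩, he⟩ := hδ
  simp only at hp hq
  have hmz : m - z = (1 / 2 : ℝ) • (s - z) := by
    rw [hmdef, midpoint_eq_smul_add]; simp only [invOf_eq_inv]; module
  have e1 : cr (s - z) (tri z s b (p, q) - z) = q * cr (s - z) (b - z) := by
    simp only [tri, cr, PiLp.sub_apply, PiLp.add_apply, PiLp.smul_apply, smul_eq_mul]; ring
  have e2 : cr (s - z) (m + δ • w - z) = δ * σ * ‖s - z‖ ^ 2 := by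
    have : m + δ • w - z = (1 / 2 : ℝ) • (s - z) + (δ * σ) • rot (s - z) := by
      rw [add_sub_right_comm, hmz, hw, smul_smul]
    rw [this, cr_add_right, cr_smul_right, cr_smul_right, cr_self, cr_rot_self]; ring
  rw [he, e2] at e1
  have hnp : 0 < ‖s - z‖ := norm_pos_iff.2 (sub_ne_zero.2 hne.symm)
  have hpos : 0 < q * (σ * cr (s - z) (b - z)) := by
    have : q * (σ * cr (s - z) (b - z)) = δ * σ ^ 2 * ‖s - z‖ ^ 2 := by linear_combination -σ * e1
    rw [this]
    positivity
  exact (pos_iff_pos_of_mul_pos hpos).1 (lt_of_le_of_ne hq (by rintro rfl; simp at hpos))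

lemma isTri_unique (h : Δ.IsTri z s b) (h' : Δ.IsTri z s b')
    (hs : 0 < cr (s - z) (b - z) * cr (s - z) (b' - z)) : b = b' := by
  rcases le_total 0 (cr (b' - z) (b - z) * cr (s - z) (b - z)) with h0 | h0
  · rcases eq_or_eq_of_cr h'.swap.mem_nbrs h (by rw [mul_comm]; exact hs.le) h0 with h1 | h1
    · exact absurd h1.symm h'.hab
    · exact h1.symm
  · have h1 : 0 ≤ cr (b - z) (b' - z) * cr (s - z) (b' - z) := by
      rw [cr_comm]
      by_contra hneg
      push Not at hneg
      have := mul_pos_of_neg_of_neg (a := -cr (b' - z) (b - z) * cr (s - z) (b' - z))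
        (b := -(cr (s - z) (b - z) * cr (s - z) (b' - z))) hneg (by linarith)
      nlinarith [sq_nonneg (cr (s - z) (b' - z)), mul_nonneg (neg_nonneg.2 h0) (sq_nonneg (cr (s - z) (b' - z)))]
    rcases eq_or_eq_of_cr h.swap.mem_nbrs h' hs.le h1 with h2 | h2
    · exact absurd h2.symm h.hab
    · exact h2

/-- Exactly two triangles contain an interior edge, one on each side. -/
lemma exists_two_sides (hΩ : IsOpen Ω) (h : s ∈ Δ.innerNbrs z) :
    ∃ b b', Δ.IsTri z s b ∧ Δ.IsTri z s b' ∧ 0 < cr (s - z) (b - z) ∧ cr (s - z) (b' - z) < 0 ∧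
      ∀ T ∈ Δ.star z, s ∈ T → T = {z, s, b} ∨ T = {z, s, b'} := by
  obtain ⟨b, hb, hb0⟩ := exists_isTri_side hΩ h one_ne_zero
  obtain ⟨b', hb', hb0'⟩ := exists_isTri_side hΩ h (neg_ne_zero.2 one_ne_zero)
  refine ⟨b, b', hb, hb', by linarith, by linarith, fun T hT hs => ?_⟩
  obtain ⟨d, hd, rfl⟩ := exists_isTri (Δ.star_subset hT) (Δ.mem_star.1 hT).2 hs hb.hza
  rcases lt_or_gt_of_ne hd.cr_ne with h0 | h0
  · right; rw [isTri_unique hd hb' (mul_pos_of_neg_of_neg h0 (by linarith))]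
  · left; rw [isTri_unique hd hb (mul_pos h0 (by linarith))]

end Triangulation

/-! ### Null sets and the decomposition of integrals -/

lemma volume_segment (a b : Plane) : volume (segment ℝ a b) = 0 := by
  have h : affineSpan ℝ {a, b} ≠ ⊤ := by
    intro h
    have h1 := AffineSubspace.direction_top ℝ Plane Plane
    rw [← h, direction_affineSpan] at h1
    have h2 := collinear_iff_finrank_le_one.1 (collinear_pair ℝ a b)
    rw [h1, finrank_top, finrank_euclideanSpace, Fintype.card_fin] at h2
    omega
  refine measure_mono_null ?_ (Measure.addHaar_affineSubspace volume _ h)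
  rw [← convexHull_pair]
  exact convexHull_subset_affineSpan _

lemma IsPolygonalDomain.volume_frontier (h : IsPolygonalDomain Ω) : volume (frontier Ω) = 0 := by
  obtain ⟨B, _, hB⟩ := h.frontier_eq
  rw [hB]
  exact (measure_biUnion_null_iff B.countable_toSet).2 fun p _ => volume_segment _ _

lemma volume_cell_of_card_le {S : Finset Plane} (h : S.card ≤ 2) : volume (cell S) = 0 := by
  classical
  have : S.card = 0 ∨ S.card = 1 ∨ S.card = 2 := by omega
  rcases this with h | h | h
  · rw [Finset.card_eq_zero] at h; simp [cell, h]
  · obtain ⟨a, rfl⟩ := Finset.card_eq_one.1 h; simp [cell]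
  · obtain ⟨a, b, _, rfl⟩ := Finset.card_eq_two.1 h
    rw [cell, Finset.coe_pair, convexHull_pair]; exact volume_segment a b

lemma gradient_eq_of_affine {A : Plane →ᵃ[ℝ] ℝ} {x₀ : Plane}
    (h : v =ᶠ[𝓝 x₀] A) (x y : Plane) : A x - A y = ⟪gradient v x₀, x - y⟫ := by
  have hA : HasFDerivAt v (LinearMap.toContinuousLinearMap A.linear) x₀ := by
    have h1 := ((LinearMap.toContinuousLinearMap A.linear).hasFDerivAt (x := x₀)).add_const (A 0)
    refine HasFDerivAt.congr_of_eventuallyEq h1 (h.trans (Eventually.of_forall fun z => ?_))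
    have := A.decomp
    exact congrFun this z
  rw [gradient, InnerProductSpace.toDual_symm_apply, hA.fderiv]
  have := A.linearMap_vsub x y
  simpa using this.symm

namespace Triangulation

lemma interior_cell (hT : T ∈ Δ.triangles) : (3 : ℝ)⁻¹ • ∑ x ∈ T, x ∈ interior (cell T) := by
  classical
  obtain ⟨hf, hc⟩ := Δ.mem_triangles.1 hT
  have h := (triangleBasis (Δ.indep hf) hc).centroid_mem_interior_convexHull
  have h1 : Set.range (triangleBasis (Δ.indep hf) hc) = (T : Set Plane) := by
    exact Subtype.range_coe
  have h2 : Finset.univ.centroid ℝ (triangleBasis (Δ.indep hf) hc) = (3 : ℝ)⁻¹ • ∑ x ∈ T, x := by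
    rw [Finset.centroid_def, Finset.affineCombination_eq_linear_combination]
    · simp only [Finset.centroidWeights, Function.const_apply, ← Finset.smul_sum]
      have : (Finset.univ : Finset T).card = 3 := by simpa using hc
      rw [this]
      congr 1
      exact Finset.sum_coe_sort T (fun x => x)
    · apply Finset.sum_centroidWeights_eq_one_of_card_ne_zero
      simp [hc]
  rw [h1, h2] at h
  exact h

lemma measurableSet_cell (T : Finset Plane) : MeasurableSet (cell T) :=
  (isCompact_cell T).isClosed.measurableSet

lemma volume_inter_cell {T' : Finset Plane} (hT : T ∈ Δ.triangles) (hT' : T' ∈ Δ.triangles)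
    (hne : T ≠ T') : volume (cell T ∩ cell T') = 0 := by
  classical
  obtain ⟨hf, hc⟩ := Δ.mem_triangles.1 hT
  obtain ⟨hf', hc'⟩ := Δ.mem_triangles.1 hT'
  have hsub : cell T ∩ cell T' ⊆ cell (T ∩ T') := by
    have := Δ.inter_subset_convexHull hf hf'
    rw [← Finset.coe_inter] at this
    exact this
  refine measure_mono_null hsub (volume_cell_of_card_le ?_)
  by_contra hcon
  push Not at hcon
  have h1 := Finset.eq_of_subset_of_card_le (Finset.inter_subset_left : T ∩ T' ⊆ T) (by omega)
  have h2 := Finset.eq_of_subset_of_card_le (Finset.inter_subset_right : T ∩ T' ⊆ T') (by omega)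
  exact hne (h1.symm.trans h2)

lemma restrict_biUnion_cell {𝒢 : Finset (Finset Plane)} (h : 𝒢 ⊆ Δ.triangles) :
    volume.restrict (⋃ T ∈ 𝒢, cell T) = ∑ T ∈ 𝒢, volume.restrict (cell T) := by
  have h1 : (⋃ T ∈ 𝒢, cell T) = ⋃ T : 𝒢, cell (T : Finset Plane) := by rw [Set.iUnion_subtype]
  rw [h1, Measure.restrict_iUnion_ae, Measure.sum_fintype]
  · exact Finset.sum_coe_sort 𝒢 fun T => volume.restrict (cell T)
  · intro T T' hne
    exact volume_inter_cell (h T.2) (h T'.2) fun h => hne (Subtype.ext h)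
  · exact fun T => (measurableSet_cell _).nullMeasurableSet

lemma biUnion_cell : (⋃ T ∈ Δ.triangles, cell T) = closure Ω := by
  ext x
  simp only [Set.mem_iUnion, exists_prop]
  constructor
  · rintro ⟨T, hT, hx⟩; exact cell_subset_closure (Δ.mem_triangles.1 hT).1 hx
  · exact mem_cell_of_mem_closure

lemma patch_subset_closure (z : Plane) : Δ.patch z ⊆ closure Ω := by
  rw [← Δ.biUnion_cell]
  exact Set.biUnion_subset_biUnion_left fun T hT => Δ.star_subset hT

lemma isCompact_patch (z : Plane) : IsCompact (Δ.patch z) :=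
  (Δ.star z).isCompact_biUnion fun T _ => isCompact_cell T

lemma cell_subset_patch (h : T ∈ Δ.star z) : cell T ⊆ Δ.patch z :=
  Set.subset_biUnion_of_mem (u := fun T => cell T) h

section
variable {E : Type*} [NormedAddCommGroup E] [NormedSpace ℝ E]

lemma integral_biUnion_cell {𝒢 : Finset (Finset Plane)} (h : 𝒢 ⊆ Δ.triangles) {g : Plane → E}
    (hg : IntegrableOn g (closure Ω)) :
    ∫ x in ⋃ T ∈ 𝒢, cell T, g x = ∑ T ∈ 𝒢, ∫ x in cell T, g x := by
  rw [restrict_biUnion_cell h, integral_finsetSum_measure]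
  exact fun T hT => hg.mono_set (cell_subset_closure (Δ.mem_triangles.1 (h hT)).1)

lemma integral_patch {g : Plane → E} (hg : IntegrableOn g (closure Ω)) (z : Plane) :
    ∫ x in Δ.patch z, g x = ∑ T ∈ Δ.star z, ∫ x in cell T, g x :=
  integral_biUnion_cell (fun _ hT => Δ.star_subset hT) hg

lemma integral_eq_sum (hn : volume (frontier Ω) = 0) {g : Plane → E}
    (hg : IntegrableOn g (closure Ω)) :
    ∫ x in Ω, g x = ∑ T ∈ Δ.triangles, ∫ x in cell T, g x := by
  rw [← restrict_closure_eq hn, ← Δ.biUnion_cell]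
  exact integral_biUnion_cell subset_rfl hg

end

lemma sum_nodes_star {M : Type*} [AddCommMonoid M] (F : Plane → Finset Plane → M) :
    ∑ z ∈ Δ.nodes, ∑ T ∈ Δ.star z, F z T = ∑ T ∈ Δ.triangles, ∑ z ∈ T, F z T := by
  refine Finset.sum_comm' fun z T => ?_
  simp only [mem_star, mem_nodes, mem_triangles]
  constructor
  · rintro ⟨_, h⟩; exact ⟨h.2, h.1⟩
  · rintro ⟨h, h'⟩; exact ⟨⟨T, h', h⟩, h', h⟩

/-- Every point lies in the patches of three nodes. -/
lemma sum_integral_patch (hn : volume (frontier Ω) = 0) (hg : IntegrableOn g (closure Ω)) :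
    ∑ z ∈ Δ.nodes, ∫ x in Δ.patch z, g x = 3 * ∫ x in Ω, g x := by
  simp_rw [integral_patch hg]
  rw [sum_nodes_star fun _ T => ∫ x in cell T, g x, integral_eq_sum hn hg, Finset.mul_sum]
  refine sum_congr rfl fun T hT => ?_
  rw [Finset.sum_const, (Δ.mem_triangles.1 hT).2]; simp

/-! ### Piecewise-affine functions -/

lemma affine_sub_eq (hT : T ∈ Δ.triangles)
    {A : Plane →ᵃ[ℝ] ℝ} (hA : Set.EqOn v A (cell T)) (x y : Plane) :
    A x - A y = ⟪elemGrad v T, x - y⟫ :=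
  gradient_eq_of_affine (hA.eventuallyEq_of_mem (mem_interior_iff_mem_nhds.1 (interior_cell hT))) x y

lemma gradient_eq_elemGrad (hT : T ∈ Δ.triangles)
    {A : Plane →ᵃ[ℝ] ℝ} (hA : Set.EqOn v A (cell T)) (hx : x ∈ interior (cell T)) :
    gradient v x = elemGrad v T := by
  refine ext_inner_right ℝ fun w => ?_
  have h1 := gradient_eq_of_affine (hA.eventuallyEq_of_mem (mem_interior_iff_mem_nhds.1 hx)) w 0
  have h2 := affine_sub_eq hT hA w 0
  rw [sub_zero] at h1 h2
  rw [← h1, ← h2]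

lemma ae_mem_interior_cell (T : Finset Plane) :
    ∀ᵐ x ∂volume.restrict (cell T), x ∈ interior (cell T) := by
  rw [ae_restrict_iff' (measurableSet_cell T)]
  have h : volume (frontier (cell T)) = 0 :=
    Convex.addHaar_frontier volume (convex_convexHull ℝ (T : Set Plane))
  filter_upwards [measure_eq_zero_iff_ae_notMem.1 h] with x hx hxT
  by_contra hcon
  exact hx ⟨subset_closure hxT, hcon⟩

namespace IsFE
variable {v w : Plane → ℝ}

lemma sub_eq (hv : Δ.IsFE v) (hT : T ∈ Δ.triangles)
    (hx : x ∈ cell T) (hy : y ∈ cell T) : v x - v y = ⟪elemGrad v T, x - y⟫ := by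
  obtain ⟨A, hA⟩ := hv.affine T hT
  rw [hA hx, hA hy, affine_sub_eq hT hA]

lemma ae_gradient (hv : Δ.IsFE v) (hT : T ∈ Δ.triangles) :
    ∀ᵐ x ∂volume.restrict (cell T), gradient v x = elemGrad v T := by
  obtain ⟨A, hA⟩ := hv.affine T hT
  filter_upwards [ae_mem_interior_cell T] with x hx
  exact gradient_eq_elemGrad hT hA hx

lemma sub (hv : Δ.IsFE v) (hw : Δ.IsFE w) : Δ.IsFE (fun x => v x - w x) where
  continuousOn := hv.continuousOn.sub hw.continuousOn
  affine T hT := by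
    obtain ⟨A, hA⟩ := hv.affine T hT
    obtain ⟨B, hB⟩ := hw.affine T hT
    exact ⟨A - B, fun x hx => by simp [hA hx, hB hx]⟩
  boundary x hx := by rw [hv.boundary x hx, hw.boundary x hx, sub_zero]

lemma add (hv : Δ.IsFE v) (hw : Δ.IsFE w) : Δ.IsFE (fun x => v x + w x) where
  continuousOn := hv.continuousOn.add hw.continuousOn
  affine T hT := by
    obtain ⟨A, hA⟩ := hv.affine T hT
    obtain ⟨B, hB⟩ := hw.affine T hT
    exact ⟨A + B, fun x hx => by simp [hA hx, hB hx]⟩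
  boundary x hx := by rw [hv.boundary x hx, hw.boundary x hx, add_zero]

lemma const_mul (hv : Δ.IsFE v) (k : ℝ) : Δ.IsFE (fun x => k * v x) where
  continuousOn := continuousOn_const.mul hv.continuousOn
  affine T hT := by
    obtain ⟨A, hA⟩ := hv.affine T hT
    exact ⟨k • A, fun x hx => by simp [hA hx]⟩
  boundary x hx := by rw [hv.boundary x hx, mul_zero]

lemma zero : Δ.IsFE (fun _ => 0) where
  continuousOn := continuousOn_const
  affine _ _ := ⟨0, fun x _ => by simp⟩
  boundary _ _ := rfl

lemma sum {ι : Type*} (s : Finset ι) {F : ι → Plane → ℝ} (h : ∀ i ∈ s, Δ.IsFE (F i)) :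
    Δ.IsFE (fun x => ∑ i ∈ s, F i x) := by
  classical
  induction s using Finset.induction_on with
  | empty => simpa using zero
  | insert i s hi ih =>
    simp_rw [Finset.sum_insert hi]
    exact (h i (by simp)).add (ih fun j hj => h j (by simp [hj]))

end IsFE

/-! ### The hat functions -/

/-- The barycentric coordinate of the triangle `T` with respect to its vertex `z`. -/
noncomputable def bary (hT : T ∈ Δ.triangles) (hz : z ∈ T) : Plane →ᵃ[ℝ] ℝ :=
  (triangleBasis (Δ.indep (Δ.mem_triangles.1 hT).1) (Δ.mem_triangles.1 hT).2).coord ⟨z, hz⟩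

lemma bary_self (hT : T ∈ Δ.triangles) (hz : z ∈ T) : bary hT hz z = 1 :=
  (triangleBasis (Δ.indep (Δ.mem_triangles.1 hT).1) (Δ.mem_triangles.1 hT).2).coord_apply_eq ⟨z, hz⟩

lemma bary_of_ne (hT : T ∈ Δ.triangles) (hz : z ∈ T) (hy : y ∈ T)
    (hne : z ≠ y) : bary hT hz y = 0 :=
  (triangleBasis (Δ.indep (Δ.mem_triangles.1 hT).1) (Δ.mem_triangles.1 hT).2).coord_apply_ne
    (i := ⟨z, hz⟩) (j := ⟨y, hy⟩) (fun h => hne (congrArg Subtype.val h))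

lemma eqOn_convexHull {A B : Plane →ᵃ[ℝ] ℝ} {S : Set Plane} (h : Set.EqOn A B S) :
    Set.EqOn A B (convexHull ℝ S) := by
  have hc : Convex ℝ {x | (A - B) x = 0} := (convex_singleton 0).affine_preimage (A - B)
  have := convexHull_min (s := S) (t := {x | (A - B) x = 0}) (fun x hx => by simp [h hx]) hc
  intro x hx
  have := this hx
  simpa [sub_eq_zero] using this

lemma hat_of_mem (hT : T ∈ Δ.triangles) (hz : z ∈ T)
    (hx : x ∈ cell T) : Δ.hat z x = bary hT hz x := by
  classical
  have h : ∃ T : Finset Plane, ∃ _ : T ∈ Δ.faces ∧ T.card = 3, z ∈ T ∧ x ∈ cell T :=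
    ⟨T, Δ.mem_triangles.1 hT, hz, hx⟩
  rw [hat, dif_pos h]
  set T' := h.choose
  have h1 : T' ∈ Δ.faces ∧ T'.card = 3 := h.choose_spec.choose
  have h2 : z ∈ T' ∧ x ∈ cell T' := h.choose_spec.choose_spec
  have hx2 : x ∈ convexHull ℝ ((T' : Set Plane) ∩ (T : Set Plane)) :=
    Δ.inter_subset_convexHull h1.1 (Δ.mem_triangles.1 hT).1 ⟨h2.2, hx⟩
  refine eqOn_convexHull (A := bary (Δ.mem_triangles.2 h1) h2.1) (B := bary hT hz) ?_ hx2
  rintro y ⟨hy', hy⟩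
  by_cases hzy : z = y
  · subst hzy; rw [bary_self, bary_self]
  · rw [bary_of_ne _ _ hy' hzy, bary_of_ne _ _ hy hzy]

lemma hat_of_notMem (hT : T ∈ Δ.triangles) (hz : z ∉ T) (hx : x ∈ cell T) : Δ.hat z x = 0 := by
  classical
  by_cases h : ∃ T' ∈ Δ.triangles, z ∈ T' ∧ x ∈ cell T'
  · obtain ⟨T', hT', hz', hx'⟩ := h
    rw [hat_of_mem hT' hz' hx']
    have hx2 : x ∈ convexHull ℝ ((T' : Set Plane) ∩ (T : Set Plane)) :=
      Δ.inter_subset_convexHull (Δ.mem_triangles.1 hT').1 (Δ.mem_triangles.1 hT).1 ⟨hx', hx⟩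
    refine eqOn_convexHull (A := bary hT' hz') (B := 0) ?_ hx2
    rintro y ⟨hy', hy⟩
    rw [bary_of_ne hT' hz' hy' (by rintro rfl; exact hz hy)]; rfl
  · rw [hat, dif_neg]
    rintro ⟨T', h1, h2⟩
    exact h ⟨T', Δ.mem_triangles.2 h1, h2⟩

lemma hat_of_notMem_patch (hx : x ∉ Δ.patch z) : Δ.hat z x = 0 := by
  rw [hat, dif_neg]
  rintro ⟨T', h1, h2⟩
  exact hx (cell_subset_patch (Δ.mem_star.2 ⟨h1, h2.1⟩) h2.2)

lemma exists_affine_hat (hT : T ∈ Δ.triangles) (z : Plane) :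
    ∃ A : Plane →ᵃ[ℝ] ℝ, Set.EqOn (Δ.hat z) A (cell T) := by
  by_cases hz : z ∈ T
  · exact ⟨bary hT hz, fun x hx => hat_of_mem hT hz hx⟩
  · exact ⟨0, fun x hx => hat_of_notMem hT hz hx⟩

/-- The hat functions form a partition of unity. -/
lemma sum_hat (hx : x ∈ closure Ω) : ∑ z ∈ Δ.nodes, Δ.hat z x = 1 := by
  classical
  obtain ⟨T, hT, hxT⟩ := mem_cell_of_mem_closure (Δ := Δ) hx
  have hsub : T ⊆ Δ.nodes := fun z hz => Δ.mem_nodes.2 ⟨T, hT, hz⟩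
  rw [← Finset.sum_subset hsub fun z _ hz => hat_of_notMem hT hz hxT, ← Finset.sum_coe_sort]
  have := (triangleBasis (Δ.indep (Δ.mem_triangles.1 hT).1)
    (Δ.mem_triangles.1 hT).2).sum_coord_apply_eq_one x
  rw [← this]
  exact sum_congr rfl fun z _ => hat_of_mem hT z.2 hxT

lemma segment_subset_cell (hz : z ∈ T) (hs : s ∈ T) : segment ℝ z s ⊆ cell T :=
  (convex_convexHull ℝ _).segment_subset (subset_convexHull ℝ _ hz) (subset_convexHull ℝ _ hs)

lemma lineMap_mem_segment (ht : t ∈ Icc 0 1) : lineMap p q t ∈ segment ℝ p q := by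
  rw [segment_eq_image_lineMap]; exact ⟨t, ht, rfl⟩

lemma hat_lineMap (h : s ∈ Δ.nbrs z) (ht : t ∈ Icc 0 1) :
    Δ.hat z (lineMap z s t) = 1 - t := by
  obtain ⟨b, hb⟩ := exists_isTri_of_mem_nbrs h
  have hz : z ∈ ({z, s, b} : Finset Plane) := by simp
  have hs : s ∈ ({z, s, b} : Finset Plane) := by simp
  rw [hat_of_mem hb.mem_triangles hz (segment_subset_cell hz hs (lineMap_mem_segment ht)),
    AffineMap.apply_lineMap, bary_self, bary_of_ne _ _ hs hb.hza, AffineMap.lineMap_apply_ring]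
  ring

lemma continuousOn_of_affine (h : ∀ T ∈ Δ.triangles, ∃ A : Plane →ᵃ[ℝ] ℝ, Set.EqOn v A (cell T)) :
    ContinuousOn v (closure Ω) := by
  rw [← Δ.biUnion_cell]
  have : (⋃ T ∈ Δ.triangles, cell T) = ⋃ T : Δ.triangles, cell (T : Finset Plane) := by
    rw [Set.iUnion_subtype]
  rw [this]
  refine LocallyFinite.continuousOn_iUnion (locallyFinite_of_finite _)
    (fun T => (isCompact_cell _).isClosed) fun T => ?_
  obtain ⟨A, hA⟩ := h T.1 T.2
  exact A.continuous_of_finiteDimensional.continuousOn.congr hA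

lemma continuousOn_hat (z : Plane) : ContinuousOn (Δ.hat z) (closure Ω) :=
  continuousOn_of_affine fun _ hT => exists_affine_hat hT z

lemma continuousOn_interp (w : Plane → ℝ) : ContinuousOn (Δ.interp w) (closure Ω) := by
  unfold interp
  exact continuousOn_finsetSum _ fun z _ => continuousOn_const.mul (continuousOn_hat z)

lemma isFE_hat (hz : z ∉ frontier Ω) : Δ.IsFE (Δ.hat z) where
  continuousOn := continuousOn_hat z
  affine _ hT := exists_affine_hat hT z
  boundary x hx := by
    obtain ⟨s, hs, hc, hxs, hsub⟩ := Δ.frontier_edges x hx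
    obtain ⟨T, hTf, hTc, hsT⟩ := Δ.pure s hs
    have hT := Δ.mem_triangles.2 ⟨hTf, hTc⟩
    have hzs : z ∉ s := fun h => hz (hsub (subset_convexHull ℝ _ h))
    have hxT : x ∈ cell T := convexHull_mono (by exact_mod_cast hsT) hxs
    by_cases hzT : z ∈ T
    · rw [hat_of_mem hT hzT hxT]
      refine eqOn_convexHull (A := bary hT hzT) (B := 0) (fun y hy => ?_) hxs
      rw [bary_of_ne hT hzT (hsT hy) (by rintro rfl; exact hzs hy)]; rfl
    · exact hat_of_notMem hT hzT hxT

lemma isFE_interp {w : Plane → ℝ} (hw : ∀ z ∈ Δ.nodes, z ∈ frontier Ω → w z = 0) :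
    Δ.IsFE (Δ.interp w) := by
  unfold interp
  refine IsFE.sum _ fun z hz => ?_
  by_cases hf : z ∈ frontier Ω
  · rw [hw z hz hf]; simpa using IsFE.zero
  · exact (isFE_hat hf).const_mul _

end Triangulation

/-! ### Mollification of Lipschitz functions -/

/-- A continuous function on an interval which is Lipschitz on each set of a finite closed cover is
Lipschitz. -/
lemma abs_sub_le_of_finite_cover {ι : Type*} [Finite ι] {f : ℝ → ℝ}
    (hf : ContinuousOn f (Icc 0 1)) {C : ι → Set ℝ} (hC : ∀ i, IsClosed (C i))
    (hcov : ∀ t ∈ Icc 0 1, ∃ i, t ∈ C i)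
    (hL : ∀ i, ∀ s ∈ C i, ∀ t ∈ C i, s ≤ t → f t - f s ≤ L * (t - s)) :
    f 1 - f 0 ≤ L := by
  have key := image_le_of_liminf_slope_right_le_deriv_boundary (f := f) (a := 0) (b := 1)
    (B := fun t => f 0 + L * t) (B' := fun _ => L) hf (by simp) (by fun_prop)
    (fun x _ => by
      have := ((hasDerivAt_id x).const_mul L).const_add (f 0)
      simpa using this.hasDerivWithinAt) (fun x hx r hr => ?_) (x := 1) (by simp)
  · linarith
  · obtain ⟨i, hi⟩ : ∃ i, ∃ᶠ t in 𝓝[>] x, t ∈ C i := by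
      by_contra hcon
      push Not at hcon
      have h1 : ∀ᶠ t in 𝓝[>] x, ∀ i, t ∉ C i := eventually_all.2 hcon
      have h2 : ∀ᶠ t in 𝓝[>] x, t ∈ Icc 0 1 := by
        filter_upwards [Ioo_mem_nhdsGT hx.2] with t ht
        exact ⟨hx.1.trans ht.1.le, ht.2.le⟩
      obtain ⟨t, h3, h4⟩ := (h1.and h2).exists
      obtain ⟨i, hi⟩ := hcov t h4
      exact h3 i hi
    have hxi : x ∈ C i := (hC i).mem_of_frequently_of_tendsto hi
      (tendsto_id.mono_left nhdsWithin_le_nhds)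
    refine (hi.and_eventually self_mem_nhdsWithin).mono ?_
    rintro t ⟨ht, hxt⟩
    have hxt' : x < t := hxt
    rw [slope_def_field]
    refine lt_of_le_of_lt ?_ hr
    rw [div_le_iff₀ (by linarith)]
    exact hL i x hxi t ht hxt'.le

/-- The mollification of `g` at the scale `r`. -/
noncomputable def mollify (r : ℝ) (g : Plane → ℝ) (x : Plane) : ℝ :=
  if hr : 0 < r then ∫ t, (ContDiffBump.normed (⟨r / 2, r, by linarith, by linarith⟩ :
    ContDiffBump (0 : Plane)) volume) t * g (x - t) else 0

section
variable {r : ℝ}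

lemma exists_mollifier (hr : 0 < r) : ∃ ρ : Plane → ℝ, ContDiff ℝ ∞ ρ ∧ HasCompactSupport ρ ∧
    (∀ t, 0 ≤ ρ t) ∧ (∀ t, ρ t ≠ 0 → ‖t‖ < r) ∧ ∫ t, ρ t = 1 ∧
    ∀ g x, mollify r g x = ∫ t, ρ t * g (x - t) := by
  let φ : ContDiffBump (0 : Plane) := ⟨r / 2, r, by linarith, by linarith⟩
  refine ⟨φ.normed volume, φ.contDiff_normed, φ.hasCompactSupport_normed, φ.nonneg_normed,
    fun t ht => ?_, φ.integral_normed, fun g x => ?_⟩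
  · have : t ∈ Function.support (φ.normed volume) := ht
    rw [φ.support_normed_eq] at this
    simpa using this
  · rw [mollify, dif_pos hr]

lemma contDiff_mollify (hr : 0 < r) (hg : Continuous g) : ContDiff ℝ ∞ (mollify r g) := by
  obtain ⟨ρ, h1, h2, -, -, -, h⟩ := exists_mollifier hr
  have h3 := h2.contDiff_convolution_left (μ := volume) (ContinuousLinearMap.lsmul ℝ ℝ) h1
    hg.locallyIntegrable
  convert h3 using 1
  funext x
  rw [h, convolution_def]
  simp

lemma integrable_mollify {ρ : Plane → ℝ} (h1 : ContDiff ℝ ∞ ρ) (h2 : HasCompactSupport ρ)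
    (hg : Continuous g) (x : Plane) : Integrable (fun t => ρ t * g (x - t)) :=
  (h1.continuous.mul (hg.comp (by fun_prop))).integrable_of_hasCompactSupport h2.mul_right

lemma abs_mollify_sub_le (hr : 0 < r) (hg : Continuous g) {c : ℝ}
    (h : ∀ t, ‖t‖ < r → |g (x - t) - c| ≤ k) : |mollify r g x - c| ≤ k := by
  obtain ⟨ρ, h1, h2, h3, h4, h5, h6⟩ := exists_mollifier hr
  have hi := integrable_mollify h1 h2 hg x
  have hρ : Integrable ρ := h1.continuous.integrable_of_hasCompactSupport h2
  have e : mollify r g x - c = ∫ t, ρ t * (g (x - t) - c) := by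
    simp_rw [mul_sub]
    rw [integral_sub hi (hρ.mul_const c), integral_mul_const, h5, one_mul, h6]
  rw [e]
  calc |∫ t, ρ t * (g (x - t) - c)| ≤ ∫ t, ρ t * k := by
        rw [← norm_eq_abs]
        refine norm_integral_le_of_norm_le (hρ.mul_const k) (ae_of_all _ fun t => ?_)
        rw [norm_eq_abs, abs_mul, abs_of_nonneg (h3 t)]
        by_cases ht : ρ t = 0
        · simp [ht]
        · exact mul_le_mul_of_nonneg_left (h t (h4 t ht)) (h3 t)
    _ = k := by rw [integral_mul_const, h5, one_mul]

lemma mollify_sub_mollify (hr : 0 < r) (hg : Continuous g) {c : ℝ}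
    (h : ∀ t, ‖t‖ < r → |g (x - t) - g (y - t) - c| ≤ k) :
    |mollify r g x - mollify r g y - c| ≤ k := by
  obtain ⟨ρ, h1, h2, -, -, -, h6⟩ := exists_mollifier hr
  have e : mollify r (fun t => g t - g (t + (y - x))) x = mollify r g x - mollify r g y := by
    rw [h6, h6, h6, ← integral_sub (integrable_mollify h1 h2 hg x) (integrable_mollify h1 h2 hg y)]
    exact integral_congr_ae (ae_of_all _ fun t => by simp only; rw [mul_sub]; congr 4; abel)
  rw [← e]
  refine abs_mollify_sub_le hr (by fun_prop) fun t ht => ?_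
  rw [show x - t + (y - x) = y - t by abel]; exact h t ht

/-- Near a point in whose neighbourhood `g` has the constant gradient `p`, so has its mollification
at a small scale. -/
lemma gradient_mollify (hr : 0 < r) (hg : Continuous g) (hδ : r < δ)
    (h : ∀ y ∈ Metric.ball x δ, ∀ y' ∈ Metric.ball x δ, g y - g y' = ⟪p, y - y'⟫) :
    gradient (mollify r g) x = p := by
  refine HasGradientAt.gradient ?_
  rw [hasGradientAt_iff_hasFDerivAt]
  have h1 : HasFDerivAt (fun y : Plane => mollify r g x + ⟪p, y - x⟫)
      (InnerProductSpace.toDual ℝ Plane p) x := by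
    have h0 : HasFDerivAt (fun y : Plane => ⟪p, y - x⟫) (InnerProductSpace.toDual ℝ Plane p) x := by
      have := ((InnerProductSpace.toDual ℝ Plane p).hasFDerivAt (x := x)).sub_const ⟪p, x⟫
      simpa [inner_sub_right] using this
    exact h0.const_add _
  refine h1.congr_of_eventuallyEq ?_
  filter_upwards [Metric.ball_mem_nhds x (show 0 < δ - r by linarith)] with y hy
  have := mollify_sub_mollify hr hg (x := y) (y := x) (k := 0) (c := ⟪p, y - x⟫) (fun t ht => by
    rw [h, sub_sub_sub_cancel_right, sub_self, abs_zero]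
    · rw [mem_ball_iff_norm] at hy ⊢
      calc ‖y - t - x‖ = ‖(y - x) - t‖ := by congr 1; abel
        _ ≤ ‖y - x‖ + ‖t‖ := norm_sub_le _ _
        _ < δ := by linarith
    · rw [mem_ball_iff_norm]; simp; linarith)
  have := abs_nonpos_iff.1 this
  linarith

end

/-- Bounded convergence in `L²`. -/
lemma tendsto_eLpNorm_two_of_bounded {α E : Type*} [MeasurableSpace α] {μ : Measure α}
    [IsFiniteMeasure μ] [NormedAddCommGroup E] {F : ℕ → α → E}
    (hm : ∀ n, AEStronglyMeasurable (F n) μ) (hb : ∀ n, ∀ᵐ x ∂μ, ‖F n x‖ ≤ k)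
    (hl : ∀ᵐ x ∂μ, Tendsto (fun n => F n x) atTop (𝓝 0)) :
    Tendsto (fun n => eLpNorm (F n) 2 μ) atTop (𝓝 0) := by
  have h1 : Tendsto (fun n => ∫⁻ x, ‖F n x‖ₑ ^ (2 : ℝ) ∂μ) atTop (𝓝 (∫⁻ _, 0 ∂μ)) := by
    refine tendsto_lintegral_of_dominated_convergence' (fun _ => ENNReal.ofReal k ^ (2 : ℝ))
      (fun n => (hm n).enorm.pow_const _) (fun n => ?_) ?_ ?_
    · filter_upwards [hb n] with x hx
      refine ENNReal.rpow_le_rpow ?_ (by norm_num)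
      rw [← ofReal_norm]
      exact ENNReal.ofReal_le_ofReal hx
    · rw [lintegral_const]
      exact ENNReal.mul_ne_top (ENNReal.rpow_ne_top_of_nonneg (by norm_num) ENNReal.ofReal_ne_top)
        (measure_ne_top _ _)
    · filter_upwards [hl] with x hx
      have h2 : Tendsto (fun n => ‖F n x‖ₑ) atTop (𝓝 0) := by
        have := (continuous_enorm.tendsto (0 : E)).comp hx
        simpa [Function.comp_def] using this
      have h3 := (ENNReal.continuous_rpow_const (y := 2)).tendsto (0 : ℝ≥0∞)
      have h4 := h3.comp h2
      simpa [Function.comp_def] using h4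
  have h2 := ((ENNReal.continuous_rpow_const (y := 1 / 2)).tendsto _).comp h1
  simp only [lintegral_zero, one_div, Function.comp_def] at h2
  rw [ENNReal.zero_rpow_of_pos (by norm_num)] at h2
  refine h2.congr fun n => ?_
  rw [eLpNorm_eq_lintegral_rpow_enorm_toReal two_ne_zero ENNReal.ofNat_ne_top]
  simp

/-! ### Finite element functions belong to `H¹₀` -/

/-- Truncation of the values in `[-δ, δ]`. -/
noncomputable def shrink (δ s : ℝ) : ℝ := max (s - δ) 0 + min (s + δ) 0

lemma abs_shrink_sub_le (hδ : 0 ≤ δ) (s t : ℝ) : |shrink δ s - shrink δ t| ≤ |s - t| := by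
  unfold shrink
  rcases abs_cases (s - t) with ⟨h, _⟩ | ⟨h, _⟩ <;> rw [h, abs_le] <;>
  rcases max_cases (s - δ) 0 with ⟨h1, _⟩ | ⟨h1, _⟩ <;>
  rcases max_cases (t - δ) 0 with ⟨h2, _⟩ | ⟨h2, _⟩ <;>
  rcases min_cases (s + δ) 0 with ⟨h3, _⟩ | ⟨h3, _⟩ <;>
  rcases min_cases (t + δ) 0 with ⟨h4, _⟩ | ⟨h4, _⟩ <;> constructor <;> linarith

lemma abs_shrink_sub_self (hδ : 0 ≤ δ) (s : ℝ) : |shrink δ s - s| ≤ δ := by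
  unfold shrink
  rw [abs_le]
  rcases max_cases (s - δ) 0 with ⟨h1, _⟩ | ⟨h1, _⟩ <;>
  rcases min_cases (s + δ) 0 with ⟨h3, _⟩ | ⟨h3, _⟩ <;> constructor <;> linarith

lemma shrink_eq_zero {s : ℝ} (h : |s| ≤ δ) : shrink δ s = 0 := by
  have := abs_le.1 h
  unfold shrink
  rw [max_eq_right (by linarith), min_eq_right (by linarith), add_zero]

lemma shrink_sub_of_pos {s : ℝ} (hδ : 0 ≤ δ) (hs : δ ≤ s) (ht : δ ≤ t) :
    shrink δ s - shrink δ t = s - t := by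
  unfold shrink
  rw [max_eq_left (by linarith), max_eq_left (by linarith), min_eq_right (by linarith),
    min_eq_right (by linarith)]; ring

lemma shrink_sub_of_neg {s : ℝ} (hδ : 0 ≤ δ) (hs : s ≤ -δ) (ht : t ≤ -δ) :
    shrink δ s - shrink δ t = s - t := by
  unfold shrink
  rw [max_eq_right (by linarith), max_eq_right (by linarith), min_eq_left (by linarith),
    min_eq_left (by linarith)]; ring

lemma continuous_shrink (δ : ℝ) : Continuous (shrink δ) := by unfold shrink; fun_prop

lemma norm_gradient_le (hL : 0 ≤ L)
    (h : ∀ x y, |φ x - φ y| ≤ L * ‖x - y‖) (x : Plane) : ‖gradient φ x‖ ≤ L := by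
  rw [gradient, LinearIsometryEquiv.norm_map]
  have : LipschitzWith ⟨L, hL⟩ φ := LipschitzWith.of_dist_le_mul fun a b => by
    rw [Real.dist_eq, dist_eq_norm]; exact h a b
  exact norm_fderiv_le_of_lipschitz ℝ this

lemma volume_zero_affine {A : Plane →ᵃ[ℝ] ℝ} (hp : p ≠ 0)
    (hA : ∀ x y, A x - A y = ⟪p, x - y⟫) : volume {x | A x = 0} = 0 := by
  by_cases h : ∃ x₀, A x₀ = 0
  · obtain ⟨x₀, hx₀⟩ := h
    have hne : AffineSubspace.mk' x₀ (ℝ ∙ p)ᗮ ≠ ⊤ := by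
      intro htop
      have : x₀ + p ∈ AffineSubspace.mk' x₀ (ℝ ∙ p)ᗮ := by rw [htop]; trivial
      rw [AffineSubspace.mem_mk', vsub_eq_sub, add_sub_cancel_left,
        Submodule.mem_orthogonal_singleton_iff_inner_right] at this
      exact hp (inner_self_eq_zero.1 this)
    refine measure_mono_null (fun x hx => ?_) (Measure.addHaar_affineSubspace volume _ hne)
    have := hA x x₀
    rw [hx, hx₀, sub_zero] at this
    rw [SetLike.mem_coe, AffineSubspace.mem_mk', vsub_eq_sub,
      Submodule.mem_orthogonal_singleton_iff_inner_right]
    exact this.symm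
  · push Not at h
    have : {x | A x = 0} = ∅ := Set.eq_empty_iff_forall_notMem.2 h
    rw [this, measure_empty]

namespace Triangulation

/-- A segment is covered by the triangles and the complement of `Ω`, and on each of these closed sets the
function is Lipschitz. -/
lemma IsFE.exists_lipschitz (ho : IsOpen Ω) (hv : Δ.IsFE v) : ∃ L : ℝ, 0 ≤ L ∧
    ∀ x y, |Ω.indicator v x - Ω.indicator v y| ≤ L * ‖x - y‖ := by
  set w := Ω.indicator v with hw
  have hwc : Continuous w := continuous_indicator hv.boundary hv.continuousOn
  have hwv : ∀ x ∈ closure Ω, w x = v x := by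
    intro x hx
    by_cases hxΩ : x ∈ Ω
    · exact indicator_of_mem hxΩ v
    · rw [hw, indicator_of_notMem hxΩ, hv.boundary x ⟨hx, by rwa [ho.interior_eq]⟩]
  set L := ∑ T ∈ Δ.triangles, ‖elemGrad v T‖
  have hLT : ∀ T ∈ Δ.triangles, ‖elemGrad v T‖ ≤ L := fun T hT =>
    Finset.single_le_sum (f := fun T => ‖elemGrad v T‖) (fun _ _ => norm_nonneg _) hT
  have hL0 : 0 ≤ L := Finset.sum_nonneg fun _ _ => norm_nonneg _
  have key : ∀ x y, w x - w y ≤ L * ‖x - y‖ := by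
    intro x y
    have hc : Continuous (fun t : ℝ => (lineMap y x t : Plane)) := AffineMap.lineMap_continuous
    have := abs_sub_le_of_finite_cover (ι := Option Δ.triangles) (L := L * ‖x - y‖)
      (f := fun t : ℝ => w (lineMap y x t)) (hwc.comp hc).continuousOn
      (C := fun i => (fun t : ℝ => (lineMap y x t : Plane)) ⁻¹'
        (i.elim Ωᶜ fun T => cell T.1)) (fun i => ?_) (fun t _ => ?_) ?_
    · simpa using this
    · refine IsClosed.preimage hc ?_
      cases i with
      | none => exact ho.isClosed_compl
      | some T => exact (isCompact_cell _).isClosed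
    · by_cases h : (lineMap y x t : Plane) ∈ Ω
      · obtain ⟨T, hT, hx⟩ := mem_cell_of_mem_closure (Δ := Δ) (subset_closure h)
        exact ⟨some ⟨T, hT⟩, hx⟩
      · exact ⟨none, h⟩
    · intro i s hs t ht hst
      cases i with
      | none =>
        simp only [Option.elim_none, Set.mem_preimage, Set.mem_compl_iff] at hs ht
        simp only [hw]
        rw [indicator_of_notMem hs, indicator_of_notMem ht, sub_self]
        exact mul_nonneg (by positivity) (by linarith)
      | some T =>
        simp only [Option.elim_some, Set.mem_preimage] at hs ht
        have hcl := cell_subset_closure (Δ.mem_triangles.1 T.2).1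
        have e : (lineMap y x t : Plane) - lineMap y x s = (t - s) • (x - y) := by
          simp only [lineMap_apply, vsub_eq_sub, vadd_eq_add]; module
        rw [hwv _ (hcl hs), hwv _ (hcl ht), hv.sub_eq T.2 ht hs, e]
        refine (real_inner_le_norm _ _).trans ?_
        rw [norm_smul, Real.norm_of_nonneg (by linarith)]
        calc ‖elemGrad v T.1‖ * ((t - s) * ‖x - y‖) ≤ L * ((t - s) * ‖x - y‖) :=
              mul_le_mul_of_nonneg_right (hLT _ T.2) (mul_nonneg (by linarith) (norm_nonneg _))
          _ = _ := by ring
  refine ⟨L, hL0, fun x y => abs_le.2 ⟨?_, key x y⟩⟩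
  have := key y x
  rw [norm_sub_rev] at this
  linarith

lemma ae_exists_cell (hn : volume (frontier Ω) = 0) {P : Plane → Prop}
    (h : ∀ T ∈ Δ.triangles, ∀ᵐ x ∂volume.restrict (cell T), P x) :
    ∀ᵐ x ∂volume.restrict Ω, P x := by
  rw [← restrict_closure_eq hn, ← Δ.biUnion_cell, ae_restrict_biUnion_finset_iff]
  exact h

/-- Truncations of the zero extension of a finite element function have compact support in `Ω`, and
their mollifications have eventually the right gradient at almost every point. -/
lemma IsFE.memH10 (hP : IsPolygonalDomain Ω) (hv : Δ.IsFE v) : MemH10 Ω v (gradient v) := by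
  have hn := hP.volume_frontier
  have hfin : IsFiniteMeasure (volume.restrict Ω) := ⟨by simpa using hP.isBounded.measure_lt_top⟩
  obtain ⟨L, hL0, hL⟩ := hv.exists_lipschitz hP.isOpen
  set w := Ω.indicator v with hw
  have hwc : Continuous w := continuous_indicator hv.boundary hv.continuousOn
  have hwΩ : ∀ x ∈ Ω, w x = v x := fun x hx => indicator_of_mem hx v
  obtain ⟨d, hδ, hd1, hlim⟩ : ∃ d : ℕ → ℝ, (∀ n, 0 < d n) ∧ (∀ n, d n ≤ 1) ∧
      Tendsto d atTop (𝓝 0) :=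
    ⟨fun n => 1 / ((n : ℝ) + 1), fun n => by positivity, fun n => by
      rw [div_le_one (by positivity)]; linarith [(Nat.cast_nonneg n : (0 : ℝ) ≤ n)],
      tendsto_one_div_add_atTop_nhds_zero_nat⟩
  -- values in `[-d n, d n]` are cut off, so that the mollification has its support in `Ω`
  have hr : ∀ n : ℕ, ∃ r : ℝ, 0 < r ∧ r ≤ d n ∧
      Metric.cthickening r {x | d n ≤ |w x|} ⊆ Ω := by
    intro n
    have hsub : {x | d n ≤ |w x|} ⊆ Ω := by
      intro x hx
      by_contra hxΩ
      have hx' : d n ≤ |w x| := hx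
      rw [hw, indicator_of_notMem hxΩ, abs_zero] at hx'
      exact absurd (hδ n) (not_lt.2 hx')
    have hK : IsCompact {x | d n ≤ |w x|} :=
      Metric.isCompact_of_isClosed_isBounded (isClosed_le continuous_const hwc.abs)
        (hP.isBounded.subset hsub)
    obtain ⟨r, hr0, hr1⟩ := hK.exists_cthickening_subset_open hP.isOpen hsub
    exact ⟨min r (d n), lt_min hr0 (hδ n), min_le_right _ _,
      (Metric.cthickening_mono (min_le_left _ _) _).trans hr1⟩
  choose r hr0 hr1 hr2 using hr
  set g : ℕ → Plane → ℝ := fun n x => shrink (d n) (w x) with hg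
  have hgc : ∀ n, Continuous (g n) := fun n => (continuous_shrink _).comp hwc
  have hgL : ∀ n x y, |g n x - g n y| ≤ L * ‖x - y‖ := fun n x y =>
    (abs_shrink_sub_le (hδ n).le _ _).trans (hL x y)
  set φ : ℕ → Plane → ℝ := fun n => mollify (r n) (g n)
  have hφL : ∀ n x y, |φ n x - φ n y| ≤ L * ‖x - y‖ := by
    intro n x y
    have := mollify_sub_mollify (hr0 n) (hgc n) (x := x) (y := y) (k := L * ‖x - y‖) (c := 0)
      (fun t _ => by rw [sub_zero]; refine (hgL n _ _).trans ?_; rw [sub_sub_sub_cancel_right])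
    rwa [sub_zero] at this
  have htest : ∀ n, IsTest Ω (φ n) := by
    intro n
    have hsupp : tsupport (φ n) ⊆ Metric.cthickening (r n) {x | d n ≤ |w x|} := by
      refine closure_minimal (fun x hx => ?_) Metric.isClosed_cthickening
      by_contra hcon
      refine hx ?_
      have := abs_mollify_sub_le (hr0 n) (hgc n) (x := x) (k := 0) (c := 0) (fun t ht => ?_)
      · rw [sub_zero] at this; exact abs_nonpos_iff.1 this
      · rw [sub_zero, abs_nonpos_iff]
        refine shrink_eq_zero ?_
        by_contra hlt
        push Not at hlt
        refine hcon (Metric.mem_cthickening_of_dist_le x (x - t) _ _ hlt.le ?_)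
        rw [dist_eq_norm, sub_sub_cancel]; exact ht.le
    refine ⟨contDiff_mollify (hr0 n) (hgc n), ?_, hsupp.trans (hr2 n)⟩
    exact Metric.isCompact_of_isClosed_isBounded (isClosed_tsupport _)
      (hP.isBounded.subset (hsupp.trans (hr2 n)))
  -- where `v = 0`, the gradient vanishes almost everywhere, and elsewhere the cut-off is a shift
  have hgrad : ∀ᵐ x ∂volume.restrict Ω, ∀ᶠ n in atTop, gradient (φ n) x = gradient v x := by
    refine ae_exists_cell (Δ := Δ) hn fun T hT => ?_
    obtain ⟨A, hA⟩ := hv.affine T hT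
    have hae : ∀ᵐ x ∂volume.restrict (cell T), elemGrad v T = 0 ∨ v x ≠ 0 := by
      by_cases hp : elemGrad v T = 0
      · exact ae_of_all _ fun _ => Or.inl hp
      · rw [ae_restrict_iff' (measurableSet_cell T)]
        have := measure_eq_zero_iff_ae_notMem.1
          (volume_zero_affine hp fun x y => affine_sub_eq hT hA x y)
        filter_upwards [this] with x hx hxT
        rw [hA hxT]; exact Or.inr hx
    have hcl : closure Ω =ᵐ[volume] Ω := by
      rw [closure_eq_self_union_frontier]
      exact union_ae_eq_left_of_ae_eq_empty (ae_eq_empty.2 hn)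
    filter_upwards [hae, ae_mem_interior_cell T, ae_restrict_of_ae hcl.mem_iff] with x hx hxT hxc
    have hxΩ : x ∈ Ω := hxc.1 (cell_subset_closure (Δ.mem_triangles.1 hT).1 (interior_subset hxT))
    rw [gradient_eq_elemGrad hT hA hxT]
    have hopen : interior (cell T) ∩ Ω ∈ 𝓝 x :=
      (isOpen_interior.inter hP.isOpen).mem_nhds ⟨hxT, hxΩ⟩
    have hsign : ∀ᶠ y in 𝓝 x, v x ≠ 0 → 0 < w y * w x ∧ |w x| / 2 < |w y| := by
      by_cases h0 : v x = 0
      · exact Eventually.of_forall fun y h => absurd h0 h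
      · have h0' : w x ≠ 0 := by rwa [hwΩ x hxΩ]
        have h1 : ∀ᶠ y in 𝓝 x, 0 < w y * w x :=
          (hwc.mul continuous_const).continuousAt.eventually (lt_mem_nhds (mul_self_pos.2 h0'))
        have h2 : ∀ᶠ y in 𝓝 x, |w x| / 2 < |w y| := hwc.abs.continuousAt.eventually (lt_mem_nhds (by
            have := abs_pos.2 h0'; linarith))
        filter_upwards [h1, h2] with y h3 h4 _ using ⟨h3, h4⟩
    obtain ⟨δ, hδ0, hball⟩ := Metric.mem_nhds_iff.1 (Filter.inter_mem hopen hsign)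
    have hev : ∀ᶠ n : ℕ in atTop, d n < δ ∧ (v x ≠ 0 → d n < |w x| / 2) := by
      refine (hlim.eventually (gt_mem_nhds hδ0)).and ?_
      by_cases h0 : v x = 0
      · exact Eventually.of_forall fun y h => absurd h0 h
      · have h0' : w x ≠ 0 := by rwa [hwΩ x hxΩ]
        filter_upwards [hlim.eventually (gt_mem_nhds (show 0 < |w x| / 2 by positivity))] with n h _
        exact h
    filter_upwards [hev] with n hn'
    refine gradient_mollify (hr0 n) (hgc n) (lt_of_le_of_lt (hr1 n) hn'.1) fun y hy y' hy' => ?_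
    obtain ⟨⟨hyT, hyΩ⟩, hys⟩ := hball hy
    obtain ⟨⟨hyT', hyΩ'⟩, hys'⟩ := hball hy'
    have e : w y - w y' = ⟪elemGrad v T, y - y'⟫ := by
      rw [hwΩ y hyΩ, hwΩ y' hyΩ', hv.sub_eq hT (interior_subset hyT) (interior_subset hyT')]
    rw [← e]
    simp only [hg]
    rcases hx with hx | hx
    · rw [hx, inner_zero_left, sub_eq_zero] at e
      rw [e, sub_self, sub_self]
    · obtain ⟨s1, s2⟩ := hys hx
      obtain ⟨s3, s4⟩ := hys' hx
      have h5 := hn'.2 hx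
      rcases lt_or_gt_of_ne (show w x ≠ 0 by rwa [hwΩ x hxΩ]) with h6 | h6
      · have h7 : w y < 0 := by by_contra h; push Not at h; nlinarith
        have h8 : w y' < 0 := by by_contra h; push Not at h; nlinarith
        rw [abs_of_neg h7] at s2
        rw [abs_of_neg h8] at s4
        exact shrink_sub_of_neg (hδ n).le (by linarith) (by linarith)
      · have h7 : 0 < w y := pos_of_mul_pos_left s1 h6.le
        have h8 : 0 < w y' := pos_of_mul_pos_left s3 h6.le
        rw [abs_of_pos h7] at s2
        rw [abs_of_pos h8] at s4
        exact shrink_sub_of_pos (hδ n).le (by linarith) (by linarith)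
  have hgc' : ∀ n, Continuous (gradient (φ n)) := fun n =>
    continuous_gradient ((htest n).contDiff.of_le (by simp))
  have hgm : AEStronglyMeasurable (gradient v) (volume.restrict Ω) :=
    aestronglyMeasurable_of_tendsto_ae atTop (f := fun n => gradient (φ n))
      (fun n => (hgc' n).aestronglyMeasurable)
      (hgrad.mono fun x hx => tendsto_const_nhds.congr' (hx.mono fun n h => h.symm))
  have hgb : ∀ᵐ x ∂volume.restrict Ω, ‖gradient v x‖ ≤ L := by
    filter_upwards [hgrad] with x hx
    obtain ⟨n, h⟩ := hx.exists
    rw [← h]; exact norm_gradient_le hL0 (hφL n) x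
  have hvm : AEStronglyMeasurable v (volume.restrict Ω) :=
    (hv.continuousOn.mono subset_closure).aestronglyMeasurable hP.isOpen.measurableSet
  obtain ⟨R, hR⟩ := hP.isBounded.isCompact_closure.exists_bound_of_continuousOn hv.continuousOn
  have hdist : ∀ n, ∀ x ∈ Ω, |φ n x - v x| ≤ (L + 1) * d n := by
    intro n x hx
    have h1 := abs_mollify_sub_le (hr0 n) (hgc n) (x := x) (k := L * d n)
      (c := g n x) (fun t ht => by
        refine (hgL n _ _).trans (mul_le_mul_of_nonneg_left ?_ hL0)
        rw [sub_sub_cancel_left, norm_neg]; exact ht.le.trans (hr1 n))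
    have h2 := abs_shrink_sub_self (hδ n).le (w x)
    rw [hwΩ x hx] at h2
    have h3 : g n x = shrink (d n) (v x) := by simp only [hg]; rw [hwΩ x hx]
    rw [← h3] at h2
    calc |φ n x - v x| = |(φ n x - g n x) + (g n x - v x)| := by ring_nf
      _ ≤ _ := (abs_add_le _ _).trans (by linarith)
  refine ⟨MemLp.of_bound hvm R ?_, MemLp.of_bound hgm L hgb, φ, htest, ?_, ?_⟩
  · exact (ae_restrict_iff' hP.isOpen.measurableSet).2
      (ae_of_all _ fun x hx => hR x (subset_closure hx))
  · refine tendsto_eLpNorm_two_of_bounded (k := (L + 1) * 1) (fun n =>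
      (htest n).contDiff.continuous.aestronglyMeasurable.sub hvm) (fun n => ?_) ?_
    · refine (ae_restrict_iff' hP.isOpen.measurableSet).2 (ae_of_all _ fun x hx => ?_)
      exact (hdist n x hx).trans (mul_le_mul_of_nonneg_left (hd1 n) (by linarith))
    · refine (ae_restrict_iff' hP.isOpen.measurableSet).2 (ae_of_all _ fun x hx => ?_)
      have := hlim.const_mul (L + 1)
      rw [mul_zero] at this
      exact squeeze_zero_norm (fun n => hdist n x hx) this
  · refine tendsto_eLpNorm_two_of_bounded (k := 2 * L) (fun n =>
      (hgc' n).aestronglyMeasurable.sub hgm) (fun n => ?_) ?_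
    · filter_upwards [hgb] with x hx
      refine (norm_sub_le _ _).trans ?_
      have := norm_gradient_le hL0 (hφL n) x
      linarith
    · filter_upwards [hgrad] with x hx
      exact tendsto_const_nhds.congr' (hx.mono fun n h => by simp only [h, sub_self])

end Triangulation

/-! ### The error representation -/

/-- The integral over the edge `zs` of `g - k` with the hat function of `z` as weight. -/
noncomputable def edgeMoment (g : Plane → ℝ) (k : ℝ) (z s : Plane) : ℝ :=
  dist z s * ∫ t in 0..1, (1 - t) * (g (lineMap z s t) - k)

namespace Triangulation

lemma segment_subset_closure (hs : s ∈ Δ.nbrs z) : segment ℝ z s ⊆ closure Ω := by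
  obtain ⟨b, hb⟩ := exists_isTri_of_mem_nbrs hs
  exact (segment_subset_cell (by simp) (by simp)).trans (cell_subset_closure hb.mem)

lemma edgeIntegral_hat (hs : s ∈ Δ.nbrs z) (g : Plane → ℝ) (k j : ℝ) :
    edgeIntegral z s (fun x => (g x - k) * Δ.hat z x * j) = edgeMoment g k z s * j := by
  rw [edgeIntegral, edgeMoment, mul_assoc, ← intervalIntegral.integral_mul_const]
  congr 1
  refine intervalIntegral.integral_congr fun t ht => ?_
  rw [uIcc_of_le zero_le_one] at ht
  rw [hat_lineMap hs ht]; ring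

lemma jumpResidual_eq_sum (ε : ℝ) (uh g gbar : Plane → ℝ) :
    Δ.jumpResidual ε uh g gbar = ε ^ 2 * ∑ z ∈ Δ.nodes, ∑ s ∈ Δ.innerNbrs z,
      edgeMoment g (gbar z) z s * Δ.jump uh z s := by
  rw [jumpResidual, Finset.mul_sum]
  refine sum_congr rfl fun z _ => ?_
  congr 1
  exact sum_congr rfl fun s hs => edgeIntegral_hat (mem_innerNbrs.1 hs).1 _ _ _

lemma hat_lineMap_right (h : s ∈ Δ.nbrs z) (ht : t ∈ Icc 0 1) :
    Δ.hat s (lineMap z s t) = t := by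
  rw [← lineMap_reflect, hat_lineMap (nbrs_symm h) ⟨by linarith [ht.2], by linarith [ht.1]⟩]; ring

lemma interp_lineMap (w : Plane → ℝ) (h : s ∈ Δ.nbrs z) (ht : t ∈ Icc 0 1) :
    Δ.interp w (lineMap z s t) = (1 - t) * w z + t * w s := by
  classical
  obtain ⟨b, hb⟩ := exists_isTri_of_mem_nbrs h
  have hT := hb.mem_triangles
  have hz : z ∈ ({z, s, b} : Finset Plane) := by simp
  have hs : s ∈ ({z, s, b} : Finset Plane) := by simp
  have hsub : {z, s} ⊆ Δ.nodes := by
    intro y hy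
    refine Δ.mem_nodes.2 ⟨_, hT, ?_⟩
    simp only [mem_insert, mem_singleton] at hy ⊢; tauto
  have hx := segment_subset_cell hz hs (lineMap_mem_segment (p := z) (q := s) ht)
  rw [interp, ← Finset.sum_subset hsub fun y _ hy => ?_, Finset.sum_pair hb.hza, hat_lineMap h ht,
    hat_lineMap_right h ht]
  · ring
  · simp only [mem_insert, mem_singleton, not_or] at hy
    by_cases hyT : y ∈ ({z, s, b} : Finset Plane)
    · rw [hat_of_mem hT hyT hx, AffineMap.apply_lineMap, bary_of_ne hT hyT hz hy.1,
        bary_of_ne hT hyT hs hy.2]; simp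
    · rw [hat_of_notMem hT hyT hx, mul_zero]

lemma continuousOn_nbr_edge (hg : ContinuousOn g (closure Ω)) (h : s ∈ Δ.nbrs z) :
    ContinuousOn (fun t : ℝ => g (lineMap z s t)) (Icc 0 1) :=
  continuousOn_edge hg (segment_subset_closure h)

lemma edgeMoment_add (hg : ContinuousOn g (closure Ω)) (gbar : Plane → ℝ) (h : s ∈ Δ.nbrs z) :
    edgeMoment g (gbar z) z s + edgeMoment g (gbar s) s z =
      edgeIntegral z s (fun x => g x - Δ.interp gbar x) := by
  have hc := continuousOn_nbr_edge hg h
  rw [edgeIntegral, edgeMoment, edgeMoment, dist_comm s z, ← mul_add]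
  congr 1
  rw [← integral_reflect fun t => (1 - t) * (g (lineMap s z t) - gbar s)]
  simp_rw [lineMap_reflect]
  rw [← intervalIntegral.integral_add]
  · refine intervalIntegral.integral_congr fun t ht => ?_
    rw [uIcc_of_le zero_le_one] at ht
    rw [interp_lineMap gbar h ht]; ring
  · exact intervalIntegrable_of_Icc (ContinuousOn.mul (by fun_prop) (hc.sub continuousOn_const))
  · exact intervalIntegrable_of_Icc (ContinuousOn.mul (by fun_prop) (hc.sub continuousOn_const))

lemma edgeMoment_of_frontier (hg : ∀ x ∈ frontier Ω, g x = 0)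
    (h : segment ℝ z s ⊆ frontier Ω) : edgeMoment g 0 z s = 0 := by
  rw [edgeMoment, intervalIntegral.integral_congr (g := fun _ => 0)]
  · simp
  · intro t ht
    rw [uIcc_of_le zero_le_one] at ht
    simp only
    rw [hg _ (h (lineMap_mem_segment ht))]; simp

open scoped Classical in
lemma sum_nodes_nbrs {M : Type*} [AddCommMonoid M] (F : Plane → Plane → Finset Plane → M) :
    ∑ z ∈ Δ.nodes, ∑ s ∈ Δ.nbrs z, ∑ T ∈ (Δ.star z).filter (fun T => s ∈ T), F z s T =
      ∑ T ∈ Δ.triangles, ∑ z ∈ T, ∑ s ∈ T.erase z, F z s T := by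
  rw [← sum_nodes_star]
  refine sum_congr rfl fun z _ => ?_
  refine Finset.sum_comm' fun s T => ?_
  simp only [mem_filter, Finset.mem_erase]
  constructor
  · rintro ⟨h1, h2, h3⟩
    exact ⟨⟨(mem_nbrs_edge h1).2.1.symm, h3⟩, h2⟩
  · rintro ⟨⟨h1, h2⟩, h3⟩
    obtain ⟨b, hb, _⟩ := exists_isTri (Δ.star_subset h3) (Δ.mem_star.1 h3).2 h2 (Ne.symm h1)
    exact ⟨hb.mem_nbrs, h3, h2⟩

lemma sum_triple {M : Type*} [AddCommMonoid M] (hab : a ≠ b) (hac : a ≠ c)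
    (hbc : b ≠ c) (F : Plane → M) : ∑ x ∈ {a, b, c}, F x = F a + (F b + F c) := by
  classical
  rw [Finset.sum_insert (by simp [hab, hac]), Finset.sum_pair hbc]

open scoped Classical in
lemma sum_opposite {M : Type*} [AddCommMonoid M] (h : Δ.IsTri z a b)
    (F : Plane → M) : ∑ c ∈ {z, a, b} \ {z, a}, F c = F b := by
  have : ({z, a, b} : Finset Plane) \ {z, a} = {b} := by
    ext x
    simp only [Finset.mem_sdiff, mem_insert, mem_singleton]
    have h1 := h.hzb
    have h2 := h.hab
    constructor
    · tauto
    · rintro rfl; exact ⟨by tauto, by rintro (h | h) <;> simp_all⟩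
  rw [this, Finset.sum_singleton]

open scoped Classical in
/-- Green's formula on a triangle, in terms of the edge moments. -/
lemma sum_edgeMoment_triangle {w : Plane → ℝ} {Dw : Plane → Plane} (hg : ContinuousOn g (closure Ω))
    (hw : ∀ x ∈ closure Ω, w x = g x - Δ.interp gbar x)
    (hS : Sob (closure Ω) w Dw) (hT : T ∈ Δ.triangles) (p : Plane) :
    ∑ z ∈ T, ∑ s ∈ T.erase z, edgeMoment g (gbar z) z s * ∑ c ∈ T \ {z, s}, ⟪p, outerNormal z s c⟫ =
      ∫ x in cell T, ⟪p, Dw x⟫ := by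
  obtain ⟨z, hz⟩ : T.Nonempty := Finset.card_pos.1 (by rw [(Δ.mem_triangles.1 hT).2]; norm_num)
  obtain ⟨a, b, h, rfl⟩ := exists_isTri_of_mem_star (Δ.mem_star.2 ⟨Δ.mem_triangles.1 hT, hz⟩)
  have hcl : convexHull ℝ {z, a, b} ⊆ closure Ω := by
    rw [← cell_eq]; exact cell_subset_closure h.mem
  have hG := (hS.mono hcl).green h.cr_ne p
  have e1 : ∀ {x y : Plane}, y ∈ Δ.nbrs x → edgeIntegral x y w =
      edgeMoment g (gbar x) x y + edgeMoment g (gbar y) y x := by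
    intro x y hxy
    rw [edgeMoment_add hg gbar hxy, edgeIntegral, edgeIntegral]
    congr 1
    refine intervalIntegral.integral_congr fun t ht => ?_
    rw [uIcc_of_le zero_le_one] at ht
    exact hw _ (segment_subset_closure hxy (lineMap_mem_segment ht))
  have h2 : Δ.IsTri a b z := h.swap'.swap
  have h3 : Δ.IsTri b z a := h2.swap'.swap
  rw [cell_eq, hG, e1 h.mem_nbrs, e1 h2.mem_nbrs, e1 h3.mem_nbrs, sum_triple h.hza h.hzb h.hab]
  have E1 : ({z, a, b} : Finset Plane).erase z = {a, b} := by
    rw [Finset.erase_insert (by simp [h.hza, h.hzb])]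
  have E2 : ({z, a, b} : Finset Plane).erase a = {z, b} := by
    rw [Finset.insert_comm, Finset.erase_insert (by simp [h.hza.symm, h.hab])]
  have E3 : ({z, a, b} : Finset Plane).erase b = {z, a} := by
    rw [Finset.pair_comm, Finset.insert_comm, Finset.erase_insert (by simp [h.hzb.symm, h.hab.symm])]
  have P1 : ({z, a, b} : Finset Plane) = {a, b, z} := by
    ext x; simp only [mem_insert, mem_singleton]; tauto
  have P2 : ({z, a, b} : Finset Plane) = {b, z, a} := by
    ext x; simp only [mem_insert, mem_singleton]; tauto
  have P3 : ({z, a, b} : Finset Plane) = {z, b, a} := by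
    ext x; simp only [mem_insert, mem_singleton]; tauto
  have P4 : ({z, a, b} : Finset Plane) = {a, z, b} := by
    ext x; simp only [mem_insert, mem_singleton]; tauto
  have P5 : ({z, a, b} : Finset Plane) = {b, a, z} := by
    ext x; simp only [mem_insert, mem_singleton]; tauto
  have S := fun {x y v : Plane} (k : Δ.IsTri x y v) => sum_opposite k
    (fun c => ⟪p, outerNormal x y c⟫)
  rw [E1, E2, E3, Finset.sum_pair h.hab, Finset.sum_pair h.hzb, Finset.sum_pair h.hza]
  have s1 := S h
  have s2 := S h.swap
  rw [← P3] at s2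
  have s3 := S h.swap'
  rw [← P4] at s3
  have s4 := S h2
  rw [← P1] at s4
  have s5 := S h3
  rw [← P2] at s5
  have s6 := S h2.swap'
  rw [← P5] at s6
  rw [s1, s2, s3, s4, s5, s6, outerNormal_comm h.hza h.cr_ne, outerNormal_comm h2.hza h2.cr_ne,
    outerNormal_comm h3.hza h3.cr_ne]
  ring

/-- Green's formula on the triangles; the hat functions add up to one, so that the averages enter only
through `w`. -/
lemma jumpResidual_eq_integral (hn : volume (frontier Ω) = 0) {w : Plane → ℝ}
    {Dw : Plane → Plane} (huh : Δ.IsFE uh) (hg : ContinuousOn g (closure Ω))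
    (hg0 : ∀ x ∈ frontier Ω, g x = 0) (hgbar : ∀ z ∈ Δ.nodes, z ∈ frontier Ω → gbar z = 0)
    (hw : ∀ x ∈ closure Ω, w x = g x - Δ.interp gbar x) (hS : Sob (closure Ω) w Dw)
    (hi : IntegrableOn (fun x => ⟪gradient uh x, Dw x⟫) (closure Ω)) :
    Δ.jumpResidual ε uh g gbar = ε ^ 2 * ∫ x in Ω, ⟪gradient uh x, Dw x⟫ := by
  classical
  rw [jumpResidual_eq_sum, integral_eq_sum hn hi]
  congr 1
  have h1 : ∀ z ∈ Δ.nodes, ∑ s ∈ Δ.innerNbrs z, edgeMoment g (gbar z) z s * Δ.jump uh z s =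
      ∑ s ∈ Δ.nbrs z, ∑ T ∈ (Δ.star z).filter (fun T => s ∈ T), edgeMoment g (gbar z) z s *
        ∑ c ∈ T \ {z, s}, ⟪elemGrad uh T, outerNormal z s c⟫ := by
    intro z hz
    simp_rw [← Finset.mul_sum]
    refine (Finset.sum_subset (fun s hs => (mem_innerNbrs.1 hs).1) fun s hs hs' => ?_).trans
      (sum_congr rfl fun s _ => ?_)
    · rw [mem_innerNbrs, not_and, not_not] at hs'
      have hf := hs' hs
      rw [hgbar z hz (hf (left_mem_segment ℝ z s)), edgeMoment_of_frontier hg0 hf, zero_mul]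
    · rw [jump]
  rw [sum_congr rfl h1, sum_nodes_nbrs]
  refine sum_congr rfl fun T hT => ?_
  rw [sum_edgeMoment_triangle hg hw hS hT]
  refine integral_congr_ae ?_
  filter_upwards [huh.ae_gradient hT] with x hx
  rw [hx]

lemma interiorResidual_eq_integral (hn : volume (frontier Ω) = 0) (hb : Bornology.IsBounded Ω)
    {f : Plane → ℝ → ℝ} (hg : ContinuousOn g (closure Ω)) :
    Δ.interiorResidual f uh g gbar =
      ∫ x in Ω, Δ.interp (fun y => f y (uh y)) x * (g x - Δ.interp gbar x) := by
  have hK := hb.isCompact_closure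
  have hc := continuousOn_interp (Δ := Δ) (fun y => f y (uh y))
  have h1 : ∀ z ∈ Δ.nodes, ∫ x in Δ.patch z,
      Δ.interp (fun y => f y (uh y)) x * (g x - gbar z) * Δ.hat z x =
      ∫ x in closure Ω, Δ.interp (fun y => f y (uh y)) x * (g x - gbar z) * Δ.hat z x := by
    intro z _
    symm
    refine setIntegral_eq_of_subset_of_forall_sdiff_eq_zero isClosed_closure.measurableSet
      (patch_subset_closure z) fun x hx => ?_
    rw [hat_of_notMem_patch hx.2, mul_zero]
  rw [interiorResidual, sum_congr rfl h1, ← integral_finsetSum, ← restrict_closure_eq hn]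
  · refine setIntegral_congr_fun isClosed_closure.measurableSet fun x hx => ?_
    have h2 := sum_hat (Δ := Δ) hx
    have e : ∑ z ∈ Δ.nodes, Δ.interp (fun y => f y (uh y)) x * (g x - gbar z) * Δ.hat z x =
        Δ.interp (fun y => f y (uh y)) x * (g x * ∑ z ∈ Δ.nodes, Δ.hat z x -
          ∑ z ∈ Δ.nodes, gbar z * Δ.hat z x) := by
      rw [Finset.mul_sum, ← Finset.sum_sub_distrib, Finset.mul_sum]
      exact sum_congr rfl fun _ _ => by ring
    rw [e, h2, mul_one, interp.eq_def Δ gbar]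
  · intro z _
    exact ((hc.mul (hg.sub continuousOn_const)).mul (continuousOn_hat z)).integrableOn_compact hK

end Triangulation

/-! ### The error is bounded by the residuals -/

/-- The energy norm is controlled by the bilinear form, either through the monotonicity of the
reaction term or through the Poincaré inequality. -/
lemma exists_coercive (hb : Bornology.IsBounded Ω) {Cf : ℝ} (hCf : 0 ≤ Cf) :
    ∃ C : ℝ, 0 < C ∧ ∀ ε : ℝ, 1 ≤ Cf + ε ^ 2 → ∀ (v : Plane → ℝ) (Dv : Plane → Plane),
      MemH10 Ω v Dv → ε ^ 2 * (∫ x in Ω, ‖Dv x‖ ^ 2) + ∫ x in Ω, v x ^ 2 ≤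
        C * (ε ^ 2 * (∫ x in Ω, ‖Dv x‖ ^ 2) + Cf * ∫ x in Ω, v x ^ 2) := by
  obtain ⟨P, hP0, hP⟩ := exists_poincare hb
  refine ⟨2 + 2 * P, by linarith, fun ε hε v Dv hv => ?_⟩
  have h := hP v Dv hv
  have hA : 0 ≤ ∫ x in Ω, ‖Dv x‖ ^ 2 := integral_nonneg fun _ => by positivity
  have hB : 0 ≤ ∫ x in Ω, v x ^ 2 := integral_nonneg fun _ => by positivity
  set A := ∫ x in Ω, ‖Dv x‖ ^ 2
  set B := ∫ x in Ω, v x ^ 2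
  have hεA : 0 ≤ ε ^ 2 * A := by positivity
  have hCB : 0 ≤ Cf * B := by positivity
  rcases le_total (1 / 2) Cf with h1 | h1
  · have : 1 / 2 * B ≤ Cf * B := by gcongr
    nlinarith [mul_nonneg hP0 hεA, mul_nonneg hP0 hCB]
  · have h2 : 1 / 2 * A ≤ ε ^ 2 * A := by gcongr; linarith
    nlinarith [mul_nonneg hP0 hεA, mul_nonneg hP0 hCB, mul_le_mul_of_nonneg_left h2 hP0]

lemma energyNorm_sq (ε : ℝ) (D : Set Plane) (v : Plane → ℝ) (Dv : Plane → Plane) :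
    energyNorm ε D v Dv ^ 2 = ε ^ 2 * (∫ x in D, ‖Dv x‖ ^ 2) + ∫ x in D, v x ^ 2 := by
  rw [energyNorm, sq_sqrt]
  exact add_nonneg (mul_nonneg (sq_nonneg _) (integral_nonneg fun _ => by positivity))
    (integral_nonneg fun _ => by positivity)

lemma memLp_of_continuousOn (hP : IsPolygonalDomain Ω)
    (hv : ContinuousOn v (closure Ω)) : MemLp v 2 (volume.restrict Ω) := by
  have hfin : IsFiniteMeasure (volume.restrict Ω) := ⟨by simpa using hP.isBounded.measure_lt_top⟩
  obtain ⟨R, hR⟩ := hP.isBounded.isCompact_closure.exists_bound_of_continuousOn hv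
  refine MemLp.of_bound ((hv.mono subset_closure).aestronglyMeasurable hP.isOpen.measurableSet) R ?_
  exact (ae_restrict_iff' hP.isOpen.measurableSet).2
    (ae_of_all _ fun x hx => hR x (subset_closure hx))

lemma integrable_mul_of_memLp {μ : Measure Plane} {w : Plane → ℝ} (hv : MemLp v 2 μ)
    (hw : MemLp w 2 μ) : Integrable (fun x => v x * w x) μ := hv.integrable_mul hw

namespace Triangulation

/-- The bound of the error by the jump residual, the interior residual and the quadrature error. -/
lemma exists_error_le (hP : IsPolygonalDomain Ω) {f : Plane → ℝ → ℝ} {Cf : ℝ}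
    (hf : IsReaction Ω f Cf) : ∃ C : ℝ, 0 < C ∧ ∀ ε : ℝ, 1 ≤ Cf + ε ^ 2 →
    ∀ (Δ : Triangulation Ω) (u : Plane → ℝ) (Du : Plane → Plane), IsSolution Ω f ε u Du →
    ∀ uh : Plane → ℝ, Δ.IsDiscreteSolution f ε uh → ∀ err : ℝ,
    err = energyNorm ε Ω (fun x => uh x - u x) (fun x => gradient uh x - Du x) → 0 < err →
    ∀ (Gh gbar : Plane → ℝ), Δ.IsFE Gh → (∀ z ∈ Δ.nodes, z ∈ frontier Ω → gbar z = 0) →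
    err ≤ C * (Δ.jumpResidual ε uh (fun x => (uh x - u x) / err - Gh x) gbar +
      Δ.interiorResidual f uh (fun x => (uh x - u x) / err - Gh x) gbar +
      Δ.quadError f uh (fun x => (uh x - u x) / err)) := by
  obtain ⟨C, hC0, hC⟩ := exists_coercive hP.isBounded hf.const_nonneg
  refine ⟨C, hC0, fun ε hε Δ u Du hu uh hd err herr herr0 Gh gbar hGh hgbar => ?_⟩
  have hn := hP.volume_frontier
  have huh := hd.isFE
  have he : MemH10 Ω (fun x => uh x - u x) (fun x => gradient uh x - Du x) :=
    (huh.memH10 hP).sub hu.memH10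
  have hec : ContinuousOn (fun x => uh x - u x) (closure Ω) := huh.continuousOn.sub hu.continuousOn
  set G : Plane → ℝ := fun x => (uh x - u x) / err with hG
  set DG : Plane → Plane := fun x => err⁻¹ • (gradient uh x - Du x) with hDG
  have hGm : MemH10 Ω G DG := by
    have := he.const_smul err⁻¹
    simpa only [hG, hDG, div_eq_inv_mul] using this
  have hGc : ContinuousOn G (closure Ω) := hec.div_const err
  have hgs := isFE_interp hgbar
  set gs := Δ.interp gbar with hgsdef
  set fI := Δ.interp (fun y => f y (uh y)) with hfI
  have hfIc : ContinuousOn fI (closure Ω) := continuousOn_interp _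
  have hfIm := memLp_of_continuousOn hP hfIc
  have hfh := hf.comp_memLp hP.isOpen hP.isBounded huh.continuousOn
  have hfu := hf.comp_memLp hP.isOpen hP.isBounded hu.continuousOn
  have hgm : MemH10 Ω (fun x => G x - Gh x) (fun x => DG x - gradient Gh x) :=
    hGm.sub (hGh.memH10 hP)
  have hgc : ContinuousOn (fun x => G x - Gh x) (closure Ω) := hGc.sub hGh.continuousOn
  have hwm := hgm.sub (hgs.memH10 hP)
  have hwc : ContinuousOn (fun x => G x - Gh x - gs x) (closure Ω) := hgc.sub hgs.continuousOn
  have hum := (huh.memH10 hP).memLp_grad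
  -- the jump residual is `ε² ⟨∇u_h, ∇(g - gbar^I)⟩`
  have hJ : Δ.jumpResidual ε uh (fun x => G x - Gh x) gbar = ε ^ 2 *
      ((∫ x in Ω, ⟪gradient uh x, DG x⟫) - (∫ x in Ω, ⟪gradient uh x, gradient Gh x⟫) -
        ∫ x in Ω, ⟪gradient uh x, gradient gs x⟫) := by
    have hi : Integrable (fun x => ⟪gradient uh x, DG x - gradient Gh x - gradient gs x⟫)
        (volume.restrict (closure Ω)) := by
      rw [restrict_closure_eq hn]
      exact integrable_inner hum hwm.memLp_grad
    have hg0 : ∀ x ∈ frontier Ω, (uh x - u x) / err - Gh x = 0 := fun x hx => by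
      rw [huh.boundary x hx, hu.boundary x hx, hGh.boundary x hx]; simp
    rw [jumpResidual_eq_integral hn huh hgc hg0 hgbar (fun x _ => rfl)
      (Sob.of_memH10 hP.isBounded hn hwc hwm) hi]
    rw [← integral_sub (integrable_inner hum hGm.memLp_grad)
      (integrable_inner hum (hGh.memH10 hP).memLp_grad), ← integral_sub]
    · simp_rw [inner_sub_right]
    · exact (integrable_inner hum hGm.memLp_grad).sub
        (integrable_inner hum (hGh.memH10 hP).memLp_grad)
    · exact integrable_inner hum (hgs.memH10 hP).memLp_grad
  have hII : Δ.interiorResidual f uh (fun x => G x - Gh x) gbar =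
      (∫ x in Ω, fI x * G x) - (∫ x in Ω, fI x * Gh x) - ∫ x in Ω, fI x * gs x := by
    rw [interiorResidual_eq_integral hn hP.isBounded hgc, ← integral_sub
      (integrable_mul_of_memLp hfIm hGm.memLp)
      (integrable_mul_of_memLp hfIm (hGh.memH10 hP).memLp), ← integral_sub]
    · exact integral_congr_ae (ae_of_all _ fun x => by simp only [← hfI, ← hgsdef]; ring)
    · exact (integrable_mul_of_memLp hfIm hGm.memLp).sub
        (integrable_mul_of_memLp hfIm (hGh.memH10 hP).memLp)
    · exact integrable_mul_of_memLp hfIm (hgs.memH10 hP).memLp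
  have hQ : (∫ x in Ω, f x (uh x) * G x) - (∫ x in Ω, fI x * G x) ≤ Δ.quadError f uh G := by
    rw [quadError, ← integral_sub (integrable_mul_of_memLp hfh hGm.memLp)
      (integrable_mul_of_memLp hfIm hGm.memLp)]
    refine (le_abs_self _).trans (le_of_eq ?_)
    simp_rw [sub_mul, hfI]
  have hweak := hu.weak_memH10 hf hP.isOpen hP.isBounded hGm
  -- the finite element parts `Gh` and `gbar^I` drop out
  have hgal1 := hd.galerkin Gh hGh
  have hgal2 := hd.galerkin gs hgs
  have hDe : ∫ x in Ω, ⟪gradient uh x, DG x⟫ = (∫ x in Ω, ⟪Du x, DG x⟫) +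
      err⁻¹ * ∫ x in Ω, ‖gradient uh x - Du x‖ ^ 2 := by
    rw [← sub_eq_iff_eq_add', ← integral_sub (integrable_inner hum hGm.memLp_grad)
      (integrable_inner hu.memH10.memLp_grad hGm.memLp_grad), ← integral_const_mul]
    refine integral_congr_ae (ae_of_all _ fun x => ?_)
    simp only [hDG]
    rw [← inner_sub_left, inner_smul_right, real_inner_self_eq_norm_sq]
  have hfe : err⁻¹ * (Cf * ∫ x in Ω, (uh x - u x) ^ 2) ≤
      (∫ x in Ω, f x (uh x) * G x) - ∫ x in Ω, f x (u x) * G x := by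
    rw [← integral_sub (integrable_mul_of_memLp hfh hGm.memLp)
      (integrable_mul_of_memLp hfu hGm.memLp), ← integral_const_mul, ← integral_const_mul]
    refine setIntegral_mono_on ?_ ?_ hP.isOpen.measurableSet fun x hx => ?_
    · exact ((he.memLp.integrable_sq).const_mul _).const_mul _
    · exact (integrable_mul_of_memLp hfh hGm.memLp).sub (integrable_mul_of_memLp hfu hGm.memLp)
    · have key : Cf * (uh x - u x) ^ 2 ≤ (f x (uh x) - f x (u x)) * (uh x - u x) := by
        rcases le_total (u x) (uh x) with h | h
        · have := mul_le_mul_of_nonneg_right (hf.oneSided x hx _ _ h) (sub_nonneg.2 h)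
          linarith
        · have := mul_le_mul_of_nonneg_right (hf.oneSided x hx _ _ h) (sub_nonneg.2 h)
          linarith
      have := mul_le_mul_of_nonneg_left key (inv_nonneg.2 herr0.le)
      refine this.trans (le_of_eq ?_)
      simp only [hG]
      ring
  have hcoer := hC ε hε _ _ he
  rw [← energyNorm_sq, ← herr] at hcoer
  set A := ∫ x in Ω, ‖gradient uh x - Du x‖ ^ 2
  set B := ∫ x in Ω, (uh x - u x) ^ 2
  rw [hJ, hII]
  have hS : err⁻¹ * (ε ^ 2 * A + Cf * B) ≤
      ε ^ 2 * ((∫ x in Ω, ⟪gradient uh x, DG x⟫) - (∫ x in Ω, ⟪gradient uh x, gradient Gh x⟫) -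
        ∫ x in Ω, ⟪gradient uh x, gradient gs x⟫) + ((∫ x in Ω, fI x * G x) -
        (∫ x in Ω, fI x * Gh x) - ∫ x in Ω, fI x * gs x) + Δ.quadError f uh G := by
    rw [hDe]
    linarith
  calc err = err⁻¹ * err ^ 2 := by field_simp
    _ ≤ err⁻¹ * (C * (ε ^ 2 * A + Cf * B)) :=
        mul_le_mul_of_nonneg_left hcoer (inv_nonneg.2 herr0.le)
    _ = C * (err⁻¹ * (ε ^ 2 * A + Cf * B)) := by ring
    _ ≤ _ := by gcongr

end Triangulation

/-! ### The geometry of an anisotropic patch -/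

lemma frame_norm_sq (he : ‖e‖ = 1) (v : Plane) : ‖v‖ ^ 2 = ⟪e, v⟫ ^ 2 + cr e v ^ 2 := by
  have h := norm_sq_eq e
  rw [he] at h
  rw [norm_sq_eq, inner_eq, cr]
  linear_combination (v 0 ^ 2 + v 1 ^ 2) * h

lemma frame_cr (he : ‖e‖ = 1) (v w : Plane) : cr v w = ⟪e, v⟫ * cr e w - cr e v * ⟪e, w⟫ := by
  have h := norm_sq_eq e
  rw [he] at h
  rw [inner_eq, inner_eq, cr, cr, cr]
  linear_combination (v 0 * w 1 - v 1 * w 0) * h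

lemma frame_inner (he : ‖e‖ = 1) (v w : Plane) : ⟪v, w⟫ = ⟪e, v⟫ * ⟪e, w⟫ + cr e v * cr e w := by
  have h := norm_sq_eq e
  rw [he] at h
  rw [inner_eq, inner_eq, inner_eq, cr, cr]
  linear_combination (v 0 * w 0 + v 1 * w 1) * h

lemma abs_frame_inner_le (he : ‖e‖ = 1) (v : Plane) : |⟪e, v⟫| ≤ ‖v‖ := by
  have := abs_real_inner_le_norm e v
  rwa [he, one_mul] at this

namespace Triangulation

/-- The shape of an anisotropic patch: it lies in a strip of width `≲ h` in the direction of the unit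
vector `e`, each of its triangles has an area `≳ h H`, one edge of length `≲ h` and two edges of
length `≳ H`. All constants, including the numbers of edges, are expressed by powers of `B`. -/
structure AnisoAt (Δ : Triangulation Ω) (B : ℝ) (z e : Plane) (h H : ℝ) : Prop where
  hB : 10 ≤ B
  norm_e : ‖e‖ = 1
  h_pos : 0 < h
  small : B ^ 12 * h ≤ H
  card_le : ((Δ.nbrs z).card : ℝ) ≤ B
  dist_le : ∀ x ∈ Δ.patch z, ∀ y ∈ Δ.patch z, ‖x - y‖ ≤ H
  eta_le : ∀ x ∈ Δ.patch z, |cr e (x - z)| ≤ B * h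
  cr_ge : ∀ a b, Δ.IsTri z a b → h * H ≤ B * |cr (a - z) (b - z)|
  cases : ∀ a b, Δ.IsTri z a b → (‖a - b‖ ≤ B * h ∧ H ≤ B * ‖a - z‖ ∧ H ≤ B * ‖b - z‖) ∨
    (‖a - z‖ ≤ B * h ∧ H ≤ B * ‖b - z‖ ∧ H ≤ B * ‖a - b‖) ∨
    (‖b - z‖ ≤ B * h ∧ H ≤ B * ‖a - z‖ ∧ H ≤ B * ‖a - b‖)

/-- The other endpoint of a long edge at `z` on the side of `e`. -/
structure IsRight (Δ : Triangulation Ω) (B : ℝ) (z e : Plane) (H : ℝ) (s : Plane) : Prop where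
  mem : s ∈ Δ.nbrs z
  long : H ≤ B * ‖s - z‖
  pos : 0 < ⟪e, s - z⟫

lemma mem_patch_of_mem_nbrs (hs : s ∈ Δ.nbrs z) : s ∈ Δ.patch z ∧ z ∈ Δ.patch z := by
  obtain ⟨b, hb⟩ := exists_isTri_of_mem_nbrs hs
  have := cell_subset_patch hb.mem_star
  exact ⟨this (subset_convexHull ℝ _ (by simp)), this (subset_convexHull ℝ _ (by simp))⟩

namespace AnisoAt
variable (A : Δ.AnisoAt B z e h H)
include A

lemma neg : Δ.AnisoAt B z (-e) h H where
  hB := A.hB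
  norm_e := by rw [norm_neg, A.norm_e]
  h_pos := A.h_pos
  small := A.small
  card_le := A.card_le
  dist_le := A.dist_le
  eta_le x hx := by
    have : cr (-e) (x - z) = -cr e (x - z) := by simp [cr]; ring
    rw [this, abs_neg]; exact A.eta_le x hx
  cr_ge := A.cr_ge
  cases := A.cases

lemma B_pos : 0 < B := by linarith [A.hB]

/-- Smallness of `h` in a weaker form. -/
lemma small_of_le {k : ℕ} (hk : k ≤ 12) : B ^ k * h ≤ H :=
  (mul_le_mul_of_nonneg_right (pow_le_pow_right₀ (by linarith [A.hB]) hk) A.h_pos.le).trans A.small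

lemma H_pos : 0 < H := lt_of_lt_of_le (by have := A.h_pos; have := A.B_pos; positivity) A.small

lemma pos : 0 < B ∧ 10 ≤ B ∧ 0 < h ∧ 0 < H := ⟨A.B_pos, A.hB, A.h_pos, A.H_pos⟩

lemma not_long (h1 : ‖s - z‖ ≤ B * h) (h2 : H ≤ B * ‖s - z‖) : False := by
  have h3 := A.small_of_le (k := 3) (by norm_num)
  have := mul_le_mul_of_nonneg_left h1 A.B_pos.le
  have hp := A.h_pos
  have := A.hB
  have h5 : 0 < B * (B * h) := by have := A.B_pos; positivity
  nlinarith

lemma short_or_long (hs : s ∈ Δ.nbrs z) : ‖s - z‖ ≤ B * h ∨ H ≤ B * ‖s - z‖ := by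
  obtain ⟨b, hb⟩ := exists_isTri_of_mem_nbrs hs
  rcases A.cases s b hb with h | h | h
  · exact Or.inr h.2.1
  · exact Or.inl h.1
  · exact Or.inr h.2.1

lemma norm_sub_le (hs : s ∈ Δ.nbrs z) : ‖s - z‖ ≤ H :=
  A.dist_le _ (mem_patch_of_mem_nbrs hs).1 _ (mem_patch_of_mem_nbrs hs).2

lemma abs_eta_le (hs : s ∈ Δ.nbrs z) : |cr e (s - z)| ≤ B * h :=
  A.eta_le _ (mem_patch_of_mem_nbrs hs).1

lemma xi_ge (hs : s ∈ Δ.nbrs z) (hl : H ≤ B * ‖s - z‖) : H ≤ 2 * B * |⟪e, s - z⟫| := by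
  by_contra hcon
  push Not at hcon
  have h1 := frame_norm_sq A.norm_e (s - z)
  have h2 := A.abs_eta_le hs
  obtain ⟨_, hb, hh, hH⟩ := A.pos
  have h3 := A.small_of_le (k := 3) (by norm_num)
  have h4 : B * |cr e (s - z)| ≤ H / 2 := by
    have : B * |cr e (s - z)| ≤ B * (B * h) := by gcongr
    have h6 : 0 < B * (B * h) := by have := A.B_pos; positivity
    nlinarith
  have h5 : (B * ‖s - z‖) ^ 2 = (B * |⟪e, s - z⟫|) ^ 2 + (B * |cr e (s - z)|) ^ 2 := by
    rw [mul_pow, mul_pow, mul_pow, sq_abs, sq_abs, h1]; ring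
  have h6 : H ^ 2 ≤ (B * ‖s - z‖) ^ 2 := by gcongr
  have h7 : (B * |⟪e, s - z⟫|) ^ 2 ≤ (H / 2) ^ 2 :=
    pow_le_pow_left₀ (mul_nonneg A.B_pos.le (abs_nonneg _)) (by linarith) 2
  have h8 : (B * |cr e (s - z)|) ^ 2 ≤ (H / 2) ^ 2 :=
    pow_le_pow_left₀ (mul_nonneg A.B_pos.le (abs_nonneg _)) h4 2
  nlinarith

lemma right_or_left (hs : s ∈ Δ.nbrs z) (hl : H ≤ B * ‖s - z‖) :
    Δ.IsRight B z e H s ∨ Δ.IsRight B z (-e) H s := by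
  have h1 := A.xi_ge hs hl
  have hH := A.H_pos
  rcases lt_trichotomy ⟪e, s - z⟫ 0 with h | h | h
  · exact Or.inr ⟨hs, hl, by rw [inner_neg_left]; linarith⟩
  · rw [h, abs_zero, mul_zero] at h1; linarith
  · exact Or.inl ⟨hs, hl, h⟩

lemma right_xi_ge (hs : Δ.IsRight B z e H s) : H ≤ 2 * B * ⟪e, s - z⟫ := by
  have := A.xi_ge hs.mem hs.long
  rwa [abs_of_pos hs.pos] at this

/-- The products of the `η`-coordinates with short lengths are negligible against areas. -/
lemma abs_xi_mul_eta_le (hs : ‖s - z‖ ≤ B * h) (hc : c ∈ Δ.nbrs z) :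
    |⟪e, s - z⟫ * cr e (c - z)| ≤ B ^ 2 * h ^ 2 := by
  rw [abs_mul]
  have h1 := (abs_frame_inner_le A.norm_e (s - z)).trans hs
  have h2 := A.abs_eta_le hc
  calc _ ≤ (B * h) * (B * h) := mul_le_mul h1 h2 (abs_nonneg _) (by
        have := A.h_pos; have := A.B_pos; positivity)
    _ = _ := by ring

lemma sq_small : 8 * B ^ 4 * h ^ 2 ≤ h * H := by
  have h1 := A.small_of_le (k := 5) (by norm_num)
  obtain ⟨_, hb, hh, _⟩ := A.pos
  have h2 : 0 < B ^ 4 * h := by have := A.B_pos; positivity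
  have h4 : 8 * (B ^ 4 * h) ≤ H := by nlinarith
  nlinarith

/-- A short edge which forms a triangle with a long edge has a height `≳ h` over the axis. -/
lemma short_eta (hT : Δ.IsTri z s c) (hs : ‖s - z‖ ≤ B * h) : h ≤ 2 * B * |cr e (s - z)| := by
  have h1 := A.cr_ge s c hT
  have h2 := A.abs_xi_mul_eta_le hs hT.swap.mem_nbrs
  have h3 := (abs_frame_inner_le A.norm_e (c - z)).trans (A.norm_sub_le hT.swap.mem_nbrs)
  have h4 := A.sq_small
  obtain ⟨_, hb, hh, hH⟩ := A.pos
  rw [frame_cr A.norm_e] at h1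
  have h5 := abs_sub (⟪e, s - z⟫ * cr e (c - z)) (cr e (s - z) * ⟪e, c - z⟫)
  have h6 : |cr e (s - z) * ⟪e, c - z⟫| ≤ |cr e (s - z)| * H := by
    rw [abs_mul]; exact mul_le_mul_of_nonneg_left h3 (abs_nonneg _)
  have h7 : h * H ≤ B * (B ^ 2 * h ^ 2) + B * (|cr e (s - z)| * H) := by nlinarith
  have h8 : B * (B ^ 2 * h ^ 2) ≤ B ^ 4 * h ^ 2 := by
    have : B ^ 4 * h ^ 2 = B * (B * (B ^ 2 * h ^ 2)) := by ring
    have h9 : 0 < B * (B ^ 2 * h ^ 2) := by positivity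
    nlinarith
  have h9 : h * H ≤ 2 * B * |cr e (s - z)| * H := by nlinarith
  exact le_of_mul_le_mul_right h9 hH

/-- The orientation of the angle between a short edge, which is not almost parallel to the axis, and
a long edge. -/
lemma sign_cr (hs : ‖s - z‖ ≤ B * h) (hη : h ≤ 2 * B * |cr e (s - z)|)
    (hc : Δ.IsRight B z e H c) : cr (s - z) (c - z) * cr e (s - z) < 0 := by
  have h1 := A.right_xi_ge hc
  have h2 := A.abs_xi_mul_eta_le hs hc.mem
  have h4 := A.sq_small
  obtain ⟨hB, _, hh, hH⟩ := A.pos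
  rw [frame_cr A.norm_e]
  set η := cr e (s - z)
  set x := ⟪e, s - z⟫ * cr e (c - z)
  set ξ := ⟪e, c - z⟫
  have hη0 : 0 < |η| := by
    by_contra h0
    have : |η| = 0 := le_antisymm (not_lt.1 h0) (abs_nonneg _)
    rw [this, mul_zero] at hη; linarith
  have h5 : h * H ≤ 4 * B ^ 2 * (|η| * ξ) := by
    have : h * H ≤ (2 * B * |η|) * (2 * B * ξ) := by gcongr
    linarith
  have h6 : |x| < |η| * ξ := by
    have h7 : B ^ 2 * (8 * B ^ 2 * h ^ 2) ≤ B ^ 2 * (4 * (|η| * ξ)) := by nlinarith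
    have h8 := le_of_mul_le_mul_left h7 (by positivity)
    have h9 : 0 < B ^ 2 * h ^ 2 := by positivity
    linarith
  have h7 : (x - η * ξ) * η ≤ |x| * |η| - |η| ^ 2 * ξ := by
    rw [sq_abs, ← abs_mul]; nlinarith [le_abs_self (x * η)]
  nlinarith [mul_lt_mul_of_pos_right h6 hη0]

lemma same_side (hT : Δ.IsTri z a b) (ha : Δ.IsRight B z e H a)
    (hb : H ≤ B * ‖b - z‖) : Δ.IsRight B z e H b ∧ ‖a - b‖ ≤ B * h := by
  have h0 : ‖a - b‖ ≤ B * h := by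
    rcases A.cases a b hT with h | h | h
    · exact h.1
    · exact (A.not_long h.1 ha.long).elim
    · exact (A.not_long h.1 hb).elim
  refine ⟨⟨hT.swap.mem_nbrs, hb, ?_⟩, h0⟩
  have h1 := A.right_xi_ge ha
  have h2 := abs_le.1 ((abs_frame_inner_le A.norm_e (a - b)).trans h0)
  have h3 : ⟪e, b - z⟫ = ⟪e, a - z⟫ - ⟪e, a - b⟫ := by rw [← inner_sub_right]; congr 1; abel
  have h4 := A.small_of_le (k := 3) (by norm_num)
  obtain ⟨_, hb, hh, _⟩ := A.pos
  have h6 : 0 < B * (B * h) := by positivity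
  have h7 : 2 * B * (B * h) < 2 * B * ⟪e, a - z⟫ := by nlinarith
  have h8 := lt_of_mul_lt_mul_left h7 (by positivity)
  rw [h3]; linarith [h2.2]

omit A in
lemma right_cr_pos (he : ‖e‖ = 1) (hc : Δ.IsRight B z e H c) (hd : Δ.IsRight B z e H d) :
    cr (c - z) (d - z) = ⟪e, c - z⟫ * ⟪e, d - z⟫ *
      (cr e (d - z) / ⟪e, d - z⟫ - cr e (c - z) / ⟪e, c - z⟫) := by
  have h1 := hc.pos
  have h2 := hd.pos
  rw [frame_cr he]; field_simp

lemma right_eq_of_cr (hc : Δ.IsRight B z e H c) (hd : Δ.IsRight B z e H d)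
    (h0 : cr (c - z) (d - z) = 0) : c = d := by
  refine eq_of_cr_eq_zero hc.mem hd.mem h0 ?_
  rw [frame_inner A.norm_e]
  rw [frame_cr A.norm_e] at h0
  have h1 := hc.pos
  have h2 := hd.pos
  set x := ⟪e, c - z⟫
  set x' := ⟪e, d - z⟫
  set y := cr e (c - z)
  set y' := cr e (d - z)
  have h3 : 0 ≤ y * y' := by
    by_contra hneg
    push Not at hneg
    have : x * y' * y' = y * y' * x' := by linear_combination y' * h0
    nlinarith [mul_nonneg h1.le (sq_nonneg y'), mul_pos_of_neg_of_neg hneg (neg_lt_zero.2 h2)]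
  have := mul_pos h1 h2
  linarith

/-- The next long edge in the direction of a given one. -/
lemma exists_next (hΩ : IsOpen Ω) (hc : Δ.IsRight B z e H c)
    (hd : Δ.IsRight B z e H d) (hne : c ≠ d) (hin : c ∈ Δ.innerNbrs z) :
    ∃ b, Δ.IsTri z c b ∧ Δ.IsRight B z e H b ∧ 0 < cr (c - z) (d - z) * cr (c - z) (b - z) ∧
      (b = d ∨ 0 < cr (c - z) (d - z) * cr (b - z) (d - z)) := by
  have h0 : cr (c - z) (d - z) ≠ 0 := fun h => hne (A.right_eq_of_cr hc hd h)
  obtain ⟨b, hb, hpos⟩ := exists_isTri_side hΩ hin h0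
  set σ := cr (c - z) (d - z)
  set τ := cr (c - z) (b - z) with hτ
  have hlong : H ≤ B * ‖b - z‖ := by
    refine (A.short_or_long hb.swap.mem_nbrs).resolve_left fun hs => ?_
    have hη := A.short_eta hb.swap hs
    have s1 := A.sign_cr hs hη hc
    have s2 := A.sign_cr hs hη hd
    have hx : 0 ≤ cr (d - z) (b - z) * cr (c - z) (b - z) := by
      rw [cr_comm (b - z) (c - z)] at s1
      rw [cr_comm (b - z) (d - z)] at s2
      rw [← hτ] at s1 ⊢
      have := mul_pos_of_neg_of_neg s1 s2
      have hη2 : 0 < cr e (b - z) ^ 2 := by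
        refine lt_of_le_of_ne (sq_nonneg _) fun h => ?_
        rw [eq_comm, sq_eq_zero_iff] at h
        rw [h, abs_zero, mul_zero] at hη; linarith [A.h_pos]
      by_contra hneg
      push Not at hneg
      nlinarith [mul_pos_of_neg_of_neg hneg (neg_lt_zero.2 hη2)]
    rcases eq_or_eq_of_cr hd.mem hb hpos.le hx with h | h
    · exact hne h.symm
    · rw [h] at hd; exact A.not_long hs hd.long
  have hbr := (A.same_side hb hc hlong).1
  refine ⟨b, hb, hbr, hpos, ?_⟩
  by_contra hcon
  push Not at hcon
  have hx : 0 ≤ cr (d - z) (b - z) * cr (c - z) (b - z) := by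
    rw [cr_comm (d - z), ← hτ]
    by_contra hneg
    push Not at hneg
    have h1 : 0 < cr (b - z) (d - z) * τ := by linarith
    have := mul_pos hpos h1
    nlinarith [mul_nonneg_of_nonpos_of_nonpos hcon.2 (neg_nonpos.2 (sq_nonneg τ))]
  rcases eq_or_eq_of_cr hd.mem hb hpos.le hx with h | h
  · exact hne h.symm
  · exact hcon.1 h.symm

/-- Going from one long edge to the next one. -/
lemma chain (hΩ : IsOpen Ω) (hd : Δ.IsRight B z e H d)
    (hin : ∀ c, Δ.IsRight B z e H c → c ≠ d → c ∈ Δ.innerNbrs z) {ρ : Plane → Plane → ℝ}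
    (hδ : 0 ≤ δ) (hself : ρ d d ≤ 0)
    (htri : ∀ c b, Δ.IsRight B z e H c → Δ.IsRight B z e H b → ρ c d ≤ ρ c b + ρ b d)
    (hadj : ∀ c b, Δ.IsRight B z e H c → Δ.IsRight B z e H b → Δ.IsTri z c b → ρ c b ≤ δ) (hc : Δ.IsRight B z e H c) : ρ c d ≤ B * δ := by
  classical
  let m : Plane → ℝ := fun x => cr e (x - z) / ⟪e, x - z⟫
  let S : Plane → Finset Plane := fun c => (Δ.nbrs z).filter
    (fun x => 0 < (m d - m c) * (m x - m c))
  have hmpos : ∀ x y, Δ.IsRight B z e H x → Δ.IsRight B z e H y → ∀ k : ℝ,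
      0 < k * cr (x - z) (y - z) → 0 < k * (m y - m x) := by
    intro x y hx hy k hk
    rw [right_cr_pos A.norm_e hx hy] at hk
    have := mul_pos hx.pos hy.pos
    by_contra hneg
    push Not at hneg
    have h1 := mul_nonpos_of_nonneg_of_nonpos this.le hneg
    have h2 : k * (⟪e, x - z⟫ * ⟪e, y - z⟫ * (m y - m x)) =
      ⟪e, x - z⟫ * ⟪e, y - z⟫ * (k * (m y - m x)) := by ring
    have h3 : 0 < k * (⟪e, x - z⟫ * ⟪e, y - z⟫ * (m y - m x)) := hk
    linarith
  have key : ∀ n : ℕ, ∀ c, Δ.IsRight B z e H c → (S c).card ≤ n → ρ c d ≤ n * δ := by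
    intro n
    induction n with
    | zero =>
      intro c hc hn
      by_cases hcd : c = d
      · subst hcd; simpa using hself
      · obtain ⟨b, hb, hbr, h1, h2⟩ := A.exists_next hΩ hc hd hcd (hin c hc hcd)
        exfalso
        have h3 := hmpos c b hc hbr _ h1
        rw [mul_comm] at h3
        have h4 : d ∈ S c := by
          simp only [S, mem_filter]
          refine ⟨hd.mem, mul_self_pos.2 fun h0 => hcd (A.right_eq_of_cr hc hd ?_)⟩
          rw [right_cr_pos A.norm_e hc hd]
          have h0' : cr e (d - z) / ⟪e, d - z⟫ - cr e (c - z) / ⟪e, c - z⟫ = 0 := h0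
          rw [h0', mul_zero]
        rw [Nat.le_zero, Finset.card_eq_zero] at hn
        rw [hn] at h4; simp at h4
    | succ n ih =>
      intro c hc hn
      by_cases hcd : c = d
      · subst hcd
        exact hself.trans (by positivity)
      · obtain ⟨b, hb, hbr, h1, h2⟩ := A.exists_next hΩ hc hd hcd (hin c hc hcd)
        have e1 : 0 < (m d - m c) * (m b - m c) := by
          have h3 := hmpos c b hc hbr _ h1
          rw [mul_comm] at h3
          have h4 := hmpos c d hc hd _ h3
          linarith
        have hbS : b ∈ S c := by simp only [S, mem_filter]; exact ⟨hbr.mem, e1⟩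
        have hsub : S b ⊆ (S c).erase b := by
          intro x hx
          simp only [S, mem_filter, Finset.mem_erase] at hx ⊢
          refine ⟨?_, hx.1, ?_⟩
          · rintro rfl; simp at hx
          · rcases h2 with rfl | h2
            · simp at hx
            · have h3 := hmpos b d hbr hd _ h2
              rw [mul_comm] at h3
              have h4 := hmpos c d hc hd _ h3
              have h5 := hx.2
              rcases lt_or_gt_of_ne (show m d - m c ≠ 0 by rintro h; rw [h] at e1; simp at e1)
                with h6 | h6
              · have h7 : m b - m c < 0 := by by_contra h; push Not at h; nlinarith
                have h8 : m d - m b < 0 := by by_contra h; push Not at h; nlinarith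
                have h9 : m x - m b < 0 := by by_contra h; push Not at h; nlinarith
                exact mul_pos_of_neg_of_neg h6 (by linarith)
              · have h7 : 0 < m b - m c := by by_contra h; push Not at h; nlinarith
                have h8 : 0 < m d - m b := by by_contra h; push Not at h; nlinarith
                have h9 : 0 < m x - m b := by by_contra h; push Not at h; nlinarith
                exact mul_pos h6 (by linarith)
        have hcard := Finset.card_le_card hsub
        rw [Finset.card_erase_of_mem hbS] at hcard
        have h3 := ih b hbr (by omega)
        have h4 := htri c b hc hbr
        have h5 := hadj c b hc hbr hb
        push_cast
        linarith
  have h1 := key _ c hc le_rfl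
  refine h1.trans (mul_le_mul_of_nonneg_right ?_ hδ)
  refine le_trans ?_ A.card_le
  exact_mod_cast Finset.card_le_card (Finset.filter_subset _ _)

/-- On the side of an interior long edge there is a triangle with a long and a short edge. -/
lemma exists_right_short (hΩ : IsOpen Ω) (hin : ∀ c, Δ.IsRight B z e H c → c ∈ Δ.innerNbrs z) (hc : Δ.IsRight B z e H c) :
    ∃ d s, Δ.IsRight B z e H d ∧ Δ.IsTri z s d ∧ ‖s - z‖ ≤ B * h := by
  classical
  obtain ⟨d, hd, hmax⟩ := Finset.exists_max_image
    ((Δ.nbrs z).filter fun x => Δ.IsRight B z e H x) (fun x => cr e (x - z) / ⟪e, x - z⟫)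
    ⟨c, by simp only [mem_filter]; exact ⟨hc.mem, hc⟩⟩
  simp only [mem_filter] at hd hmax
  obtain ⟨s, hs, hs0⟩ := exists_isTri_side hΩ (hin d hd.2) one_ne_zero
  refine ⟨d, s, hd.2, hs.swap, (A.short_or_long hs.swap.mem_nbrs).resolve_right fun hl => ?_⟩
  have hsr := (A.same_side hs hd.2 hl).1
  have h1 := hmax s ⟨hsr.mem, hsr⟩
  rw [one_mul, right_cr_pos A.norm_e hd.2 hsr] at hs0
  have h2 := mul_pos hd.2.pos hsr.pos
  nlinarith [mul_nonneg h2.le (sub_nonneg.2 h1)]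

lemma partner_long (hT : Δ.IsTri z s c) (hs : ‖s - z‖ ≤ B * h) :
    H ≤ B * ‖c - z‖ ∧ H ≤ B * ‖s - c‖ := by
  rcases A.cases s c hT with h | h | h
  · exact (A.not_long hs h.2.1).elim
  · exact h.2
  · exact (A.not_long hs h.2.1).elim

/-- The two triangles at an interior short edge lie on different sides. -/
lemma short_two_sides (hΩ : IsOpen Ω) (hin : s ∈ Δ.innerNbrs z)
    (hs : ‖s - z‖ ≤ B * h) : ∃ c b, Δ.IsTri z s c ∧ Δ.IsTri z s b ∧ Δ.IsRight B z e H c ∧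
      Δ.IsRight B z (-e) H b := by
  have hn := (mem_innerNbrs.1 hin).1
  obtain ⟨c₀, hc₀⟩ := exists_isTri_of_mem_nbrs hn
  have hη := A.short_eta hc₀ hs
  have hη0 : cr e (s - z) ≠ 0 := by intro h; rw [h, abs_zero, mul_zero] at hη; linarith [A.h_pos]
  have hη' : h ≤ 2 * B * |cr (-e) (s - z)| := by
    have : cr (-e) (s - z) = -cr e (s - z) := by simp [cr]; ring
    rwa [this, abs_neg]
  obtain ⟨c, hc, hcσ⟩ := exists_isTri_side hΩ hin (neg_ne_zero.2 hη0)
  obtain ⟨b, hb, hbσ⟩ := exists_isTri_side hΩ hin hη0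
  have hcl := (A.partner_long hc hs).1
  have hbl := (A.partner_long hb hs).1
  refine ⟨c, b, hc, hb, ?_, ?_⟩
  · refine (A.right_or_left hc.swap.mem_nbrs hcl).resolve_right fun h => ?_
    have h1 := A.neg.sign_cr hs hη' h
    have : cr (-e) (s - z) = -cr e (s - z) := by simp [cr]; ring
    rw [this] at h1; linarith
  · refine (A.right_or_left hb.swap.mem_nbrs hbl).resolve_left fun h => ?_
    have h1 := A.sign_cr hs hη h
    linarith

end AnisoAt
end Triangulation

/-! ### Weighted means along rays -/

section
variable {F : ℝ → ℝ} {τ : ℝ}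

lemma integral_hat_comp_mul (hτ : 0 < τ) (F : ℝ → ℝ) :
    τ ^ 2 * ∫ t in 0..1, (1 - t) * F (τ * t) = ∫ r in 0..τ, (τ - r) * F r := by
  have h := intervalIntegral.integral_comp_mul_left (a := 0) (b := 1) (fun r => (τ - r) * F r) hτ.ne'
  rw [mul_zero, mul_one, smul_eq_mul, inv_mul_eq_div, eq_div_iff hτ.ne'] at h
  have h' : ∫ t in 0..1, (τ - τ * t) * F (τ * t) = τ * ∫ t in 0..1, (1 - t) * F (τ * t) := by
    rw [← intervalIntegral.integral_const_mul]
    exact intervalIntegral.integral_congr fun t _ => by ring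
  rw [← h, h']; ring

lemma integrable_sub (hF : ContinuousOn F (Icc 0 1)) {a b : ℝ} (ha : a ∈ Icc 0 1)
    (hb : b ∈ Icc 0 1) : IntervalIntegrable F volume a b :=
  (hF.mono (Set.uIcc_subset_Icc ha hb)).intervalIntegrable

lemma integral_hat_sub (hF : ContinuousOn F (Icc 0 1)) (hτ : 0 < τ) (hτ1 : τ ≤ 1) :
    (∫ t in 0..1, (1 - t) * F t) - τ ^ 2 * ∫ t in 0..1, (1 - t) * F (τ * t) =
      (∫ t in 0..τ, (1 - τ) * F t) + ∫ t in τ..1, (1 - t) * F t := by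
  have m0 : 0 ∈ Icc (0 : ℝ) 1 := by simp
  have mt : τ ∈ Icc (0 : ℝ) 1 := ⟨hτ.le, hτ1⟩
  have c1 : ContinuousOn (fun t => (1 - t) * F t) (Icc 0 1) := ContinuousOn.mul (by fun_prop) hF
  have c2 : ContinuousOn (fun t => (τ - t) * F t) (Icc 0 1) := ContinuousOn.mul (by fun_prop) hF
  rw [integral_hat_comp_mul hτ, ← integral_add_adjacent_intervals
    (integrable_sub c1 m0 mt) (integrable_sub c1 mt (by simp)), add_sub_right_comm,
    ← intervalIntegral.integral_sub (integrable_sub c1 m0 mt) (integrable_sub c2 m0 mt)]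
  simp only [← sub_mul, sub_sub_sub_cancel_right]

lemma abs_integral_hat_sub_le (hF : ContinuousOn F (Icc 0 1)) (hτ : 0 < τ) (hτ1 : τ ≤ 1) :
    |(∫ t in 0..1, (1 - t) * F t) - τ ^ 2 * ∫ t in 0..1, (1 - t) * F (τ * t)| ≤
      (1 - τ) * ∫ t in 0..1, |F t| := by
  have i1 := integrable_sub hF.abs (a := 0) (b := τ) (by simp) ⟨hτ.le, hτ1⟩
  have i2 := integrable_sub hF.abs (a := τ) (b := 1) ⟨hτ.le, hτ1⟩ (by simp)
  rw [integral_hat_sub hF hτ hτ1, ← integral_add_adjacent_intervals i1 i2, mul_add,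
    ← norm_eq_abs, ← intervalIntegral.integral_const_mul, ← intervalIntegral.integral_const_mul]
  refine (norm_add_le _ _).trans (add_le_add ?_ ?_)
  · refine intervalIntegral.norm_integral_le_of_norm_le hτ.le (ae_of_all _ fun t _ => ?_)
      (i1.const_mul _)
    rw [norm_eq_abs, abs_mul, abs_of_nonneg (sub_nonneg.2 hτ1)]
  · refine intervalIntegral.norm_integral_le_of_norm_le hτ1 (ae_of_all _ fun t ht => ?_)
      (i2.const_mul _)
    rw [norm_eq_abs, abs_mul, abs_of_nonneg (sub_nonneg.2 ht.2)]
    gcongr; exact ht.1.le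

lemma integral_abs_comp_mul_le (hF : ContinuousOn F (Icc 0 1)) (hτ : 0 < τ) (hτ1 : τ ≤ 1) :
    τ * ∫ t in 0..1, |F (τ * t)| ≤ ∫ t in 0..1, |F t| := by
  have h := intervalIntegral.integral_comp_mul_left (a := 0) (b := 1) (fun r => |F r|) hτ.ne'
  rw [mul_zero, mul_one, smul_eq_mul, inv_mul_eq_div, eq_div_iff hτ.ne', mul_comm] at h
  rw [h]
  exact intervalIntegral.integral_mono_interval le_rfl hτ.le hτ1 (ae_of_all _ fun _ => abs_nonneg _)
    (intervalIntegrable_of_Icc hF.abs)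

lemma integral_hat_comp_mul_le (hF : ContinuousOn F (Icc 0 1)) (h0 : ∀ t ∈ Icc 0 1, 0 ≤ F t)
    (hτ : 0 < τ) (hτ1 : τ ≤ 1) :
    τ ^ 2 * ∫ t in 0..1, (1 - t) * F (τ * t) ≤ ∫ t in 0..1, (1 - t) * F t := by
  rw [← sub_nonneg, integral_hat_sub hF hτ hτ1]
  exact add_nonneg (intervalIntegral.integral_nonneg hτ.le fun t ht => mul_nonneg (by linarith)
    (h0 t ⟨ht.1, ht.2.trans hτ1⟩)) (intervalIntegral.integral_nonneg hτ1 fun t ht =>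
      mul_nonneg (by linarith [ht.2]) (h0 t ⟨hτ.le.trans ht.1, ht.2⟩))

lemma abs_integral_hat_le (hF : ContinuousOn F (Icc 0 1)) :
    |∫ t in 0..1, (1 - t) * F t| ≤ ∫ t in 0..1, |F t| := by
  rw [← norm_eq_abs]
  refine intervalIntegral.norm_integral_le_of_norm_le zero_le_one (ae_of_all _ fun t ht => ?_)
    (intervalIntegrable_of_Icc hF.abs)
  rw [norm_eq_abs, abs_mul, abs_of_nonneg (by linarith [ht.2] : 0 ≤ 1 - t)]
  nlinarith [abs_nonneg (F t), ht.1]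

/-- The Cauchy–Schwarz inequality for the hat weight. -/
lemma sq_integral_hat_le (hF : ContinuousOn F (Icc 0 1)) :
    (∫ t in 0..1, (1 - t) * F t) ^ 2 ≤ ∫ t in 0..1, (1 - t) * F t ^ 2 := by
  set m := ∫ t in 0..1, (1 - t) * F t
  have hm2 : 2 * m * m = ∫ t in 0..1, 2 * m * ((1 - t) * F t) := by
    rw [intervalIntegral.integral_const_mul]
  clear_value m
  have c1 : ContinuousOn (fun t => (1 - t) * F t) (Icc 0 1) := ContinuousOn.mul (by fun_prop) hF
  have c2 : ContinuousOn (fun t => (1 - t) * F t ^ 2) (Icc 0 1) :=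
    ContinuousOn.mul (by fun_prop) (hF.pow 2)
  have h0 : 0 ≤ ∫ t in 0..1, (1 - t) * (F t - m) ^ 2 :=
    intervalIntegral.integral_nonneg zero_le_one fun t ht =>
      mul_nonneg (by linarith [ht.2]) (sq_nonneg _)
  have h1 : ∫ t in 0..1, (1 - t) * (F t - m) ^ 2 =
      (∫ t in 0..1, (1 - t) * F t ^ 2) - 2 * m * m + m ^ 2 * ∫ t in 0..1, (1 - t) := by
    rw [hm2, ← intervalIntegral.integral_const_mul,
      ← intervalIntegral.integral_sub (intervalIntegrable_of_Icc c2)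
        ((intervalIntegrable_of_Icc c1).const_mul _), ← intervalIntegral.integral_add]
    · exact intervalIntegral.integral_congr fun t _ => by ring
    · exact (intervalIntegrable_of_Icc c2).sub ((intervalIntegrable_of_Icc c1).const_mul _)
    · exact (Continuous.intervalIntegrable (by fun_prop) _ _)
  have h2 : ∫ t in 0..1, (1 - t) = (1 / 2 : ℝ) := by
    rw [intervalIntegral.integral_sub (by simp) (by simp)]; simp; norm_num
  rw [h1, h2] at h0
  nlinarith [sq_nonneg m]

end

/-- The mean of `g - k` along the segment from `z` to `x`, with the hat function of `z` as weight. -/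
noncomputable def rayMean (g : Plane → ℝ) (k : ℝ) (z x : Plane) : ℝ :=
  ∫ t in 0..1, (1 - t) * (g (lineMap z x t) - k)

lemma edgeMoment_eq (g : Plane → ℝ) (k : ℝ) (z s : Plane) :
    edgeMoment g k z s = ‖s - z‖ * rayMean g k z s := by
  rw [edgeMoment, rayMean, dist_comm, dist_eq_norm]

lemma lineMap_lineMap_ray (z c : Plane) (τ t : ℝ) :
    lineMap z (lineMap z c τ : Plane) t = (lineMap z c (τ * t) : Plane) := by
  simp only [lineMap_apply, vsub_eq_sub, vadd_eq_add, add_sub_cancel_right, smul_smul]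
  rw [mul_comm]

namespace Triangulation

/-- The `L¹` norm of `Dw` over the patch of `z`. -/
noncomputable abbrev gradL1 (Δ : Triangulation Ω) (Dw : Plane → Plane) (z : Plane) : ℝ := ∫ x in Δ.patch z, ‖Dw x‖

lemma gradL1_nonneg (Δ : Triangulation Ω) (Dw : Plane → Plane) (z : Plane) : 0 ≤ Δ.gradL1 Dw z :=
  integral_nonneg fun _ => norm_nonneg _

lemma setIntegral_patch_mono (hT : T ∈ Δ.star z) {F : Plane → ℝ}
    (hF : IntegrableOn F (closure Ω)) (h0 : ∀ x, 0 ≤ F x) {S : Set Plane} (hS : S ⊆ cell T) :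
    ∫ x in S, F x ≤ ∫ x in Δ.patch z, F x :=
  setIntegral_mono_set (hF.mono_set (patch_subset_closure z)) (ae_of_all _ h0)
    (hS.trans (cell_subset_patch hT)).eventuallyLE

/-- The ray from `z` to `x` is close to the long edge `zc`; the point `z + τ (c - z)` of the edge
corresponds to `x`. -/
structure RayCompare (Δ : Triangulation Ω) (B : ℝ) (z e : Plane) (h H : ℝ) (x c : Plane) (τ : ℝ) :
    Prop where
  right : Δ.IsRight B z e H c
  xi_le : |⟪e, c - z⟫ - ⟪e, x - z⟫| ≤ B ^ 2 * h
  pos : 0 < τ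
  le_one : τ ≤ 1
  one_le : 1 ≤ 2 * τ
  near : (1 - τ) * H ≤ B ^ 4 * h
  dist_le : ∀ w Dw, Sob (closure Ω) w Dw →
    ∫ t in 0..1, |w (lineMap z x t) - w (lineMap z c (τ * t))| ≤
      B ^ 3 / H * Δ.gradL1 Dw z

namespace AnisoAt
variable (A : Δ.AnisoAt B z e h H)
include A

lemma inv_cr_le (hT : Δ.IsTri z a b) : |cr (a - z) (b - z)|⁻¹ ≤ B / (h * H) := by
  have h1 := A.cr_ge a b hT
  have := abs_pos.2 hT.cr_ne
  obtain ⟨_, _, hh, hH⟩ := A.pos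
  rw [inv_le_comm₀ this (by have := A.B_pos; positivity), inv_div, div_le_iff₀ A.B_pos]
  linarith

variable {w : Plane → ℝ} {Dw : Plane → Plane}

lemma edge_sub_le (hw : Sob (closure Ω) w Dw) (hT : Δ.IsTri z a b) :
    ∫ t in 0..1, |w (lineMap z a t) - w (lineMap z b t)| ≤
      ‖a - b‖ * (B / (h * H)) * Δ.gradL1 Dw z := by
  have hcl : convexHull ℝ {z, a, b} ⊆ closure Ω := by
    rw [← cell_eq]; exact cell_subset_closure hT.mem
  refine ((hw.mono hcl).edge_sub hT.cr_ne).trans ?_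
  have hm := setIntegral_patch_mono hT.mem_star hw.integrableOn.norm (fun _ => norm_nonneg _)
    (S := convexHull ℝ {z, a, b}) (by rw [cell_eq])
  rw [div_eq_mul_inv]
  obtain ⟨hBp, _, hh, hH⟩ := A.pos
  exact mul_le_mul (mul_le_mul_of_nonneg_left (A.inv_cr_le hT) (norm_nonneg _)) hm
    (integral_nonneg fun _ => norm_nonneg _) (by positivity)

lemma edge_sub_le_of_long (hw : Sob (closure Ω) w Dw) (hT : Δ.IsTri z a b) (hab : ‖a - b‖ ≤ B * h) :
    ∫ t in 0..1, |w (lineMap z a t) - w (lineMap z b t)| ≤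
      B ^ 2 / H * Δ.gradL1 Dw z := by
  obtain ⟨hBp, _, hh, hH⟩ := A.pos
  refine (A.edge_sub_le hw hT).trans
    (mul_le_mul_of_nonneg_right ?_ (integral_nonneg fun _ => norm_nonneg _))
  calc _ ≤ (B * h) * (B / (h * H)) := by gcongr
    _ = B ^ 2 / H := by field_simp

lemma edge_sub_le_of_short (hw : Sob (closure Ω) w Dw) (hT : Δ.IsTri z a b) :
    ∫ t in 0..1, |w (lineMap z a t) - w (lineMap z b t)| ≤ B / h * Δ.gradL1 Dw z := by
  obtain ⟨hBp, _, hh, hH⟩ := A.pos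
  refine (A.edge_sub_le hw hT).trans
    (mul_le_mul_of_nonneg_right ?_ (integral_nonneg fun _ => norm_nonneg _))
  have hab : ‖a - b‖ ≤ H := A.dist_le _ (mem_patch_of_mem_nbrs hT.mem_nbrs).1 _
    (mem_patch_of_mem_nbrs hT.swap.mem_nbrs).1
  calc _ ≤ H * (B / (h * H)) := by gcongr
    _ = B / h := by field_simp

omit A in
lemma edge_dist_triangle (hw : ContinuousOn w (closure Ω)) (ha : a ∈ Δ.nbrs z)
    (hb : b ∈ Δ.nbrs z) (hc : c ∈ Δ.nbrs z) :
    ∫ t in 0..1, |w (lineMap z a t) - w (lineMap z c t)| ≤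
      (∫ t in 0..1, |w (lineMap z a t) - w (lineMap z b t)|) +
        ∫ t in 0..1, |w (lineMap z b t) - w (lineMap z c t)| := by
  have h1 := continuousOn_nbr_edge hw ha
  have h2 := continuousOn_nbr_edge hw hb
  have h3 := continuousOn_nbr_edge hw hc
  rw [← intervalIntegral.integral_add (f := fun t : ℝ => |w (lineMap z a t) - w (lineMap z b t)|)
    (g := fun t : ℝ => |w (lineMap z b t) - w (lineMap z c t)|)
    (intervalIntegrable_of_Icc (h1.sub h2).abs) (intervalIntegrable_of_Icc (h2.sub h3).abs)]
  exact integral_mono_on zero_le_one (intervalIntegrable_of_Icc (h1.sub h3).abs)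
    (intervalIntegrable_of_Icc ((h1.sub h2).abs.add (h2.sub h3).abs)) fun t _ => abs_sub_le _ _ _

/-- The traces on the long edges of one side are close to each other. -/
lemma right_edge_dist (hΩ : IsOpen Ω) (hw : Sob (closure Ω) w Dw) (hd : Δ.IsRight B z e H d)
    (hin : ∀ c, Δ.IsRight B z e H c → c ≠ d → c ∈ Δ.innerNbrs z)
    (hc : Δ.IsRight B z e H c) :
    ∫ t in 0..1, |w (lineMap z c t) - w (lineMap z d t)| ≤
      B ^ 3 / H * Δ.gradL1 Dw z := by
  obtain ⟨hBp, _, _, hH⟩ := A.pos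
  have := A.chain hΩ hd hin (ρ := fun c d =>
    ∫ t in 0..1, |w (lineMap z c t) - w (lineMap z d t)|)
    (δ := B ^ 2 / H * Δ.gradL1 Dw z) (by positivity) (by simp)
    (fun c b hc hb => edge_dist_triangle hw.continuousOn hc.mem hb.mem hd.mem)
    (fun c b hc hb hT => A.edge_sub_le_of_long hw hT (A.same_side hT hc hb.long).2) hc
  refine this.trans (le_of_eq ?_)
  ring

lemma right_norm_sub_le (hΩ : IsOpen Ω) (hd : Δ.IsRight B z e H d)
    (hin : ∀ c, Δ.IsRight B z e H c → c ≠ d → c ∈ Δ.innerNbrs z)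
    (hc : Δ.IsRight B z e H c) : ‖c - d‖ ≤ B ^ 2 * h := by
  obtain ⟨hBp, _, hh, _⟩ := A.pos
  have := A.chain hΩ hd hin (ρ := fun c d => ‖c - d‖) (δ := B * h) (by positivity) (by simp)
    (fun c b _ _ => norm_sub_le_norm_sub_add_norm_sub _ _ _)
    (fun c b hc hb hT => (A.same_side hT hc hb.long).2) hc
  refine this.trans (le_of_eq ?_)
  ring

/-- The comparison of a ray in the patch with a nearby long edge: the ray ends at `x`, and the
comparison point on the edge is `z + τ (c - z)`. -/
lemma ray_compare_aux {v : Plane} (hT : T ∈ Δ.star z)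
    (hc : Δ.IsRight B z e H c) (hcT : c ∈ T) (hx : x ∈ cell T) {τ β : ℝ} (hβ : 0 ≤ β) (hβ1 : β ≤ 1)
    (hτ1 : τ ≤ 1) (hxe : x - z = τ • (c - z) + β • v) (hv : ‖v‖ ≤ B * h)
    (hcr : h * H ≤ B * |cr (c - z) v|) (hξ : |⟪e, c - z⟫ - ⟪e, x - z⟫| ≤ B ^ 2 * h) :
    Δ.RayCompare B z e h H x c τ := by
  obtain ⟨hBp, hb, hh, hH⟩ := A.pos
  have h1 := A.right_xi_ge hc
  have hev := abs_le.1 ((abs_frame_inner_le A.norm_e v).trans hv)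
  have e1 : ⟪e, x - z⟫ = τ * ⟪e, c - z⟫ + β * ⟪e, v⟫ := by
    rw [hxe, inner_add_right, inner_smul_right, inner_smul_right]
  have h2 : β * ⟪e, v⟫ ≤ B * h := by nlinarith
  have h3 : (1 - τ) * ⟪e, c - z⟫ ≤ B ^ 2 * h + B * h := by linarith [(abs_le.1 hξ).2]
  have h4 : (1 - τ) * H ≤ B ^ 4 * h := by
    have : (1 - τ) * H ≤ (1 - τ) * (2 * B * ⟪e, c - z⟫) :=
      mul_le_mul_of_nonneg_left h1 (by linarith)
    have h5 : 2 * B * ((1 - τ) * ⟪e, c - z⟫) ≤ 2 * B * (B ^ 2 * h + B * h) :=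
      mul_le_mul_of_nonneg_left h3 (by linarith)
    have h6 : 2 * B * (B ^ 2 * h + B * h) ≤ B ^ 4 * h := by
      have : 2 * B * (B ^ 2 + B) ≤ B ^ 4 := by nlinarith [mul_pos hBp hBp, pow_pos hBp 3]
      nlinarith
    linarith
  have h5 : 1 ≤ 2 * τ := by
    have h6 := A.small_of_le (k := 5) (by norm_num)
    by_contra hcon
    push Not at hcon
    have h9 : 1 / 2 * H < (1 - τ) * H := mul_lt_mul_of_pos_right (by linarith) hH
    nlinarith
  have hτ : 0 < τ := by linarith
  refine ⟨hc, hξ, hτ, hτ1, h5, h4, fun w Dw hw => ?_⟩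
  have hD := Δ.gradL1_nonneg Dw z
  set y : Plane := lineMap z c τ with hy
  have hye : y - z = τ • (c - z) := by
    rw [hy, lineMap_apply, vsub_eq_sub, vadd_eq_add, add_sub_cancel_right]
  simp_rw [← lineMap_lineMap_ray z c τ, ← hy]
  rcases eq_or_lt_of_le hβ with h0 | h0
  · have : x = y := by
      have : x - z = y - z := by rw [hxe, hye, ← h0]; simp
      exact sub_left_injective this
    rw [this]; simp; positivity
  · have hzT : z ∈ T := (Δ.mem_star.1 hT).2
    have hyT : y ∈ cell T := segment_subset_cell hzT hcT (lineMap_mem_segment ⟨hτ.le, hτ1⟩)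
    have hsub : convexHull ℝ {z, x, y} ⊆ cell T := by
      refine convexHull_min ?_ (convex_convexHull ℝ _)
      rintro q (rfl | rfl | rfl)
      · exact subset_convexHull ℝ _ hzT
      · exact hx
      · exact hyT
    have hcl := hsub.trans (cell_subset_closure (Δ.mem_star.1 hT).1.1)
    have ecr : cr (x - z) (y - z) = -(β * τ * cr (c - z) v) := by
      rw [hxe, hye, cr_smul_right, cr_add_left, cr_smul_left, cr_smul_left, cr_self,
        cr_comm v]; ring
    have hcr0 : 0 < |cr (c - z) v| := by
      by_contra hneg
      have : |cr (c - z) v| = 0 := le_antisymm (not_lt.1 hneg) (abs_nonneg _)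
      rw [this, mul_zero] at hcr
      have := mul_pos hh hH
      linarith
    have hne : cr (x - z) (y - z) ≠ 0 := by
      rw [ecr]
      exact neg_ne_zero.2 (mul_ne_zero (mul_pos h0 hτ).ne' (abs_pos.1 hcr0))
    refine ((hw.mono hcl).edge_sub hne).trans (mul_le_mul ?_ (setIntegral_patch_mono hT
      hw.integrableOn.norm (fun _ => norm_nonneg _) hsub) (by positivity) (by positivity))
    have hxy : x - y = β • v := by
      have : x - y = (x - z) - (y - z) := by abel
      rw [this, hxe, hye]; abel
    rw [hxy, ecr, abs_neg, abs_mul, abs_of_pos (mul_pos h0 hτ), norm_smul, Real.norm_of_nonneg hβ,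
      div_le_div_iff₀ (by positivity) hH]
    have h6 : ‖v‖ * H ≤ B * (h * H) := by nlinarith
    have h7 : B * (h * H) ≤ B * (B * |cr (c - z) v|) := by gcongr
    have h8 : B * (B * |cr (c - z) v|) ≤ B ^ 3 * τ * |cr (c - z) v| := by
      have : B * B ≤ B ^ 3 * τ := by nlinarith [mul_pos hBp hBp, pow_pos hBp 3]
      nlinarith
    calc β * ‖v‖ * H = β * (‖v‖ * H) := by ring
      _ ≤ β * (B ^ 3 * τ * |cr (c - z) v|) := mul_le_mul_of_nonneg_left (by linarith) hβ
      _ = _ := by ring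

/-- A ray in the patch, the end point of which has the smallest `ξ`-coordinate among the end points
of the long edges of one side, is close to one of these edges. -/
lemma ray_compare (hΩ : IsOpen Ω) (hin : ∀ c, Δ.IsRight B z e H c → c ∈ Δ.innerNbrs z)
    (hx : x ∈ Δ.patch z) (hd : Δ.IsRight B z e H d) (hxd : ⟪e, x - z⟫ = ⟪e, d - z⟫) :
    ∃ c τ, Δ.RayCompare B z e h H x c τ := by
  obtain ⟨hBp, hb, hh, hH⟩ := A.pos
  have hξ : ∀ c, Δ.IsRight B z e H c → |⟪e, c - z⟫ - ⟪e, x - z⟫| ≤ B ^ 2 * h := by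
    intro c hc
    rw [hxd, ← inner_sub_right, sub_sub_sub_cancel_right]
    exact (abs_frame_inner_le A.norm_e _).trans
      (A.right_norm_sub_le hΩ hd (fun c hc _ => hin c hc) hc)
  have hx0 : H ≤ 2 * B * ⟪e, x - z⟫ := by rw [hxd]; exact A.right_xi_ge hd
  -- the case of a triangle with a short edge `zs` and a long edge `zc`
  have hshort : ∀ s c, Δ.IsTri z s c → ‖s - z‖ ≤ B * h → ∀ α β : ℝ, 0 ≤ α → 0 ≤ β → α + β ≤ 1 →
      x - z = α • (s - z) + β • (c - z) →
      ∃ c τ, Δ.RayCompare B z e h H x c τ := by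
    intro s c hT hs α β hα hβ hαβ hxe
    have hl := (A.partner_long hT hs).1
    have e1 : ⟪e, x - z⟫ = α * ⟪e, s - z⟫ + β * ⟪e, c - z⟫ := by
      rw [hxe, inner_add_right, inner_smul_right, inner_smul_right]
    have hsξ := abs_le.1 ((abs_frame_inner_le A.norm_e (s - z)).trans hs)
    have hc : Δ.IsRight B z e H c := by
      refine (A.right_or_left hT.swap.mem_nbrs hl).resolve_right fun hc => ?_
      have h1 := hc.pos
      rw [inner_neg_left] at h1
      have h2 : ⟪e, x - z⟫ ≤ B * h := by
        have : β * ⟪e, c - z⟫ ≤ 0 := mul_nonpos_of_nonneg_of_nonpos hβ (by linarith)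
        have : α * ⟪e, s - z⟫ ≤ B * h := by nlinarith [mul_pos hBp hh]
        linarith
      have h3 := A.small_of_le (k := 3) (by norm_num)
      have h5 : 0 < B * (B * h) := by positivity
      nlinarith
    have hxT : x ∈ cell {z, s, c} := by
      rw [cell_eq, ← tri_image]
      refine ⟨(α, β), ⟨hα, hβ, hαβ⟩, ?_⟩
      rw [tri, add_assoc, ← hxe, add_sub_cancel]
    exact ⟨c, β, A.ray_compare_aux hT.mem_star hc (by simp) hxT hα (by linarith)
      (by linarith : β ≤ 1) (v := s - z) (by rw [hxe, add_comm]) hs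
      (by rw [cr_comm, abs_neg]; exact A.cr_ge s c hT) (hξ c hc)⟩
  obtain ⟨T, hT, hxT⟩ : ∃ T ∈ Δ.star z, x ∈ cell T := by simpa [patch] using hx
  obtain ⟨a, b, hab, rfl⟩ := exists_isTri_of_mem_star hT
  have hxT' := hxT
  rw [cell_eq, ← tri_image] at hxT'
  obtain ⟨⟨α, β⟩, ⟨hα, hβ, hαβ⟩, hxe⟩ := hxT'
  simp only at hα hβ hαβ
  have hxe' : x - z = α • (a - z) + β • (b - z) := by rw [← hxe]; simp only [tri]; abel
  rcases A.cases a b hab with hc | hc | hc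
  · have ha : Δ.IsRight B z e H a := by
      refine (A.right_or_left hab.mem_nbrs hc.2.1).resolve_right fun ha => ?_
      have h1 := (A.neg.same_side hab ha hc.2.2).1.pos
      have h2 := ha.pos
      rw [inner_neg_left] at h1 h2
      have e1 : ⟪e, x - z⟫ = α * ⟪e, a - z⟫ + β * ⟪e, b - z⟫ := by
        rw [hxe', inner_add_right, inner_smul_right, inner_smul_right]
      nlinarith [mul_nonneg hα h2.le, mul_nonneg hβ h1.le]
    exact ⟨a, α + β, A.ray_compare_aux hT ha (by simp) hxT hβ (by linarith)
      hαβ (v := b - a) (by rw [hxe']; module) (by rw [norm_sub_rev]; exact hc.1)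
      (by
        have : cr (a - z) (b - a) = cr (a - z) (b - z) := by simp only [cr, PiLp.sub_apply]; ring
        rw [this]; exact A.cr_ge a b hab) (hξ a ha)⟩
  · exact hshort a b hab hc.1 α β hα hβ hαβ hxe'
  · exact hshort b a hab.swap hc.1 β α hβ hα (by linarith) (by rw [hxe', add_comm])

end AnisoAt
end Triangulation

/-! ### The moments at interior nodes -/

lemma rayMean_sub (hg : ContinuousOn (fun t : ℝ => g (lineMap z x t)) (Icc 0 1)) (k m : ℝ) :
    rayMean g k z x = rayMean g m z x - (k - m) / 2 := by
  have h2 : ∫ t in 0..1, (1 - t) * (k - m) = (k - m) / 2 := by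
    rw [intervalIntegral.integral_mul_const, intervalIntegral.integral_sub (by simp) (by simp)]
    simp; ring
  rw [rayMean, rayMean, ← h2, ← intervalIntegral.integral_sub]
  · exact intervalIntegral.integral_congr fun t _ => by ring
  · exact intervalIntegrable_of_Icc (ContinuousOn.mul (by fun_prop) (hg.sub continuousOn_const))
  · exact Continuous.intervalIntegrable (by fun_prop) _ _

/-- If `k` is the average of `g` over two opposite rays, it is close to any `m` to which the means
over both rays are close. -/
lemma abs_sub_le_of_average {m r : ℝ} (hg : ContinuousOn (fun t : ℝ => g (lineMap z x t)) (Icc 0 1))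
    (hg' : ContinuousOn (fun t : ℝ => g (lineMap z x' t)) (Icc 0 1)) (p1 : 0 < ⟪e, x - z⟫)
    (p2 : 0 < -⟪e, x' - z⟫) (hk : ⟪e, x - z⟫ * rayMean g k z x = ⟪e, x' - z⟫ * rayMean g k z x')
    (h1 : |rayMean g m z x| ≤ r) (h2 : |rayMean g m z x'| ≤ r) : |k - m| ≤ 2 * r := by
  rw [rayMean_sub hg k m, rayMean_sub hg' k m] at hk
  have a1 := mul_le_mul_of_nonneg_left h1 p1.le
  have a2 := mul_le_mul_of_nonneg_left h2 p2.le
  refine le_of_mul_le_mul_left ?_ (add_pos p1 p2)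
  rw [← abs_of_pos (add_pos p1 p2), ← abs_mul, abs_of_pos (add_pos p1 p2),
    show (⟪e, x - z⟫ + -⟪e, x' - z⟫) * (k - m) =
      2 * (⟪e, x - z⟫ * rayMean g m z x + -⟪e, x' - z⟫ * rayMean g m z x') by
        linear_combination (-2) * hk, abs_mul, abs_two]
  have := abs_add_le (⟪e, x - z⟫ * rayMean g m z x) (-⟪e, x' - z⟫ * rayMean g m z x')
  rw [abs_mul, abs_mul, abs_of_pos p1, abs_of_pos p2] at this
  linarith

lemma integral_abs_sub_le_add {f g k : ℝ → ℝ} (hf : ContinuousOn f (Icc 0 1))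
    (hg : ContinuousOn g (Icc 0 1)) (hk : ContinuousOn k (Icc 0 1)) :
    ∫ t in 0..1, |f t - k t| ≤ (∫ t in 0..1, |f t - g t|) + ∫ t in 0..1, |g t - k t| := by
  rw [← intervalIntegral.integral_add (f := fun t : ℝ => |f t - g t|) (g := fun t : ℝ => |g t - k t|)
    (intervalIntegrable_of_Icc (hf.sub hg).abs) (intervalIntegrable_of_Icc (hg.sub hk).abs)]
  exact integral_mono_on zero_le_one (intervalIntegrable_of_Icc (hf.sub hk).abs)
    (intervalIntegrable_of_Icc ((hf.sub hg).abs.add (hg.sub hk).abs)) fun t _ => abs_sub_le _ _ _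

namespace Triangulation

lemma segment_subset_patch (hx : x ∈ Δ.patch z) : segment ℝ z x ⊆ Δ.patch z := by
  obtain ⟨T, hT, hxT⟩ : ∃ T ∈ Δ.star z, x ∈ cell T := by simpa [patch] using hx
  exact ((convex_convexHull ℝ _).segment_subset (subset_convexHull ℝ _ (Δ.mem_star.1 hT).2)
    hxT).trans (cell_subset_patch hT)

lemma continuousOn_ray (hg : ContinuousOn g (closure Ω))
    (hx : x ∈ Δ.patch z) : ContinuousOn (fun t : ℝ => g (lineMap z x t)) (Icc 0 1) :=
  continuousOn_edge hg ((segment_subset_patch hx).trans (patch_subset_closure z))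

/-- The weighted mean along the bent line in terms of the means along its two rays. -/
lemma bent_integral (hg : ContinuousOn g (closure Ω)) {sm sp ξm ξp : ℝ} (hm : ξm < 0) (hp : 0 < ξp)
    (hx : x = z + ξp • e + (sp * ξp) • rot e) (hx' : x' = z + ξm • e + (sm * ξm) • rot e)
    (hxp : x ∈ Δ.patch z) (hxp' : x' ∈ Δ.patch z) (k : ℝ) :
    ∫ ξ in ξm..ξp, (g (z + ξ • e + bent sm sp ξ • rot e) - k) * hatOne ξm ξp ξ =
      ξp * rayMean g k z x - ξm * rayMean g k z x' := by
  have hφ : ∀ {y : Plane}, y ∈ Δ.patch z → ContinuousOn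
      (fun t : ℝ => (1 - t) * (g (lineMap z y t) - k)) (Icc 0 1) := fun hy =>
    ContinuousOn.mul (by fun_prop) ((continuousOn_ray hg hy).sub continuousOn_const)
  have e1 : ∀ ξ ∈ Set.uIcc 0 ξp, (g (z + ξ • e + bent sm sp ξ • rot e) - k) * hatOne ξm ξp ξ =
      (1 - ξ / ξp) * (g (lineMap z x (ξ / ξp)) - k) := by
    intro ξ hξ
    rw [uIcc_of_le hp.le] at hξ
    have h1 : bent sm sp ξ = sp * ξ := by
      rcases eq_or_lt_of_le hξ.1 with h | h
      · rw [← h]; simp [bent]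
      · rw [bent, if_neg (not_le.2 h)]
    have h2 : hatOne ξm ξp ξ = 1 - ξ / ξp := by
      rcases eq_or_lt_of_le hξ.1 with h | h
      · rw [← h]; simp [hatOne]
      · rw [hatOne, if_neg (not_le.2 h)]
    have h3 : z + ξ • e + (sp * ξ) • rot e = lineMap z x (ξ / ξp) := by
      rw [lineMap_apply, vsub_eq_sub, vadd_eq_add, hx,
        show z + ξp • e + (sp * ξp) • rot e - z = ξp • (e + sp • rot e) by module, smul_smul,
        div_mul_cancel₀ _ hp.ne']
      module
    rw [h1, h2, h3, mul_comm]
  have e2 : ∀ ξ ∈ Set.uIcc ξm 0, (g (z + ξ • e + bent sm sp ξ • rot e) - k) * hatOne ξm ξp ξ =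
      (1 - ξ / ξm) * (g (lineMap z x' (ξ / ξm)) - k) := by
    intro ξ hξ
    rw [uIcc_of_le hm.le] at hξ
    have h3 : z + ξ • e + (sm * ξ) • rot e = lineMap z x' (ξ / ξm) := by
      rw [lineMap_apply, vsub_eq_sub, vadd_eq_add, hx',
        show z + ξm • e + (sm * ξm) • rot e - z = ξm • (e + sm • rot e) by module, smul_smul,
        div_mul_cancel₀ _ hm.ne]
      module
    rw [bent, if_pos hξ.2, hatOne, if_pos hξ.2, h3, mul_comm]
  have i1 : IntervalIntegrable
      (fun ξ => (1 - ξ / ξp) * (g (lineMap z x (ξ / ξp)) - k)) volume 0 ξp := by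
    refine ContinuousOn.intervalIntegrable ?_
    rw [uIcc_of_le hp.le]
    refine (hφ hxp).comp (by fun_prop : ContinuousOn (fun ξ => ξ / ξp) _) fun ξ hξ => ?_
    exact ⟨div_nonneg hξ.1 hp.le, (div_le_one hp).2 hξ.2⟩
  have i2 : IntervalIntegrable
      (fun ξ => (1 - ξ / ξm) * (g (lineMap z x' (ξ / ξm)) - k)) volume ξm 0 := by
    refine ContinuousOn.intervalIntegrable ?_
    rw [uIcc_of_le hm.le]
    refine (hφ hxp').comp (by fun_prop : ContinuousOn (fun ξ => ξ / ξm) _) fun ξ hξ => ?_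
    exact ⟨div_nonneg_of_nonpos hξ.2 hm.le, (div_le_one_of_neg hm).2 hξ.1⟩
  have hs : Set.uIoc 0 ξp ⊆ Set.uIcc 0 ξp := Set.uIoc_subset_uIcc
  have hs' : Set.uIoc ξm 0 ⊆ Set.uIcc ξm 0 := Set.uIoc_subset_uIcc
  rw [← integral_add_adjacent_intervals (b := 0)
    (i2.congr fun ξ hξ => (e2 ξ (hs' hξ)).symm) (i1.congr fun ξ hξ => (e1 ξ (hs hξ)).symm),
    intervalIntegral.integral_congr e1, intervalIntegral.integral_congr e2,
    intervalIntegral.integral_comp_div (fun t => (1 - t) * (g (lineMap z x t) - k)) hp.ne',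
    intervalIntegral.integral_comp_div (fun t => (1 - t) * (g (lineMap z x' t) - k)) hm.ne,
    zero_div, div_self hp.ne', zero_div, div_self hm.ne, intervalIntegral.integral_symm 0 1, rayMean,
    rayMean, smul_eq_mul, smul_eq_mul]
  ring

/-- Bounds of the moments `a s` on the edges `zs` of an anisotropic patch. -/
structure MomentBounds (Δ : Triangulation Ω) (B : ℝ) (z e : Plane) (h H : ℝ) (a : Plane → ℝ) (δ : ℝ) :
    Prop where
  le : ∀ s ∈ Δ.nbrs z, |a s| * h ≤ ‖s - z‖ * δ
  opposite : ∀ c b, Δ.IsRight B z e H c → Δ.IsRight B z (-e) H b → |a c + a b| ≤ δ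
  right : ∀ c c', Δ.IsRight B z e H c → Δ.IsRight B z e H c' → |a c - a c'| ≤ δ
  left : ∀ c c', Δ.IsRight B z (-e) H c → Δ.IsRight B z (-e) H c' → |a c - a c'| ≤ δ

namespace AnisoAt
variable (A : Δ.AnisoAt B z e h H)
include A

lemma B_pow_le (k l : ℕ) (hkl : k ≤ l) : B ^ k ≤ B ^ l := pow_le_pow_right₀ (by linarith [A.hB]) hkl

lemma div_H_le {k : ℕ} (hk : k ≤ 12) : B ^ k / H ≤ 1 / h := by
  rw [div_le_div_iff₀ A.H_pos A.h_pos, one_mul]; exact A.small_of_le hk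

/-- The traces on all edges of an interior patch are close to a common constant. -/
lemma exists_common_mean (hΩ : IsOpen Ω) (hin : ∀ s ∈ Δ.nbrs z, s ∈ Δ.innerNbrs z)
    (hg : Sob (closure Ω) g Dg) (hd : Δ.IsRight B z e H d) :
    ∃ m : ℝ, ∀ s ∈ Δ.nbrs z, ∫ t in 0..1, |g (lineMap z s t) - m| ≤
      B ^ 3 / h * Δ.gradL1 Dg z := by
  obtain ⟨hBp, hb, hh, hH⟩ := A.pos
  set D := Δ.gradL1 Dg z
  have hD := Δ.gradL1_nonneg Dg z
  obtain ⟨d₁, s₀, hd₁, hT₁, hs₀⟩ := A.exists_right_short hΩ (fun c hc => hin c hc.mem) hd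
  have hs₀n : s₀ ∈ Δ.nbrs z := hT₁.mem_nbrs
  obtain ⟨c₀, b₀, hc₀T, hb₀T, hc₀, hb₀⟩ := A.short_two_sides hΩ (hin s₀ hs₀n) hs₀
  have hcont := fun {s : Plane} (hs : s ∈ Δ.nbrs z) => continuousOn_nbr_edge hg.continuousOn hs
  set m := ∫ t in 0..1, g (lineMap z s₀ t)
  have h0 : ∫ t in 0..1, |g (lineMap z s₀ t) - m| ≤ 4 * B / h * D := by
    have hcl : convexHull ℝ {z, s₀, c₀} ⊆ closure Ω := by
      rw [← cell_eq]; exact cell_subset_closure hc₀T.mem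
    refine ((hg.mono hcl).edge_oscillation hc₀T.cr_ne).trans ?_
    have hmono := setIntegral_patch_mono hc₀T.mem_star hg.integrableOn.norm (fun _ => norm_nonneg _)
      (S := convexHull ℝ {z, s₀, c₀}) (by rw [cell_eq])
    refine mul_le_mul ?_ hmono (integral_nonneg fun _ => norm_nonneg _) (by positivity)
    have h1 : ‖c₀ - z‖ ≤ H := A.norm_sub_le hc₀.mem
    have h2 : ‖c₀ - s₀‖ ≤ H := A.dist_le _ (mem_patch_of_mem_nbrs hc₀.mem).1 _
      (mem_patch_of_mem_nbrs hs₀n).1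
    rw [div_eq_mul_inv]
    calc _ ≤ (4 * H) * (B / (h * H)) := mul_le_mul (by linarith) (A.inv_cr_le hc₀T)
          (by positivity) (by positivity)
      _ = _ := by field_simp
  have hshort : ∀ {s c : Plane}, Δ.IsTri z s c → ∫ t in 0..1,
      |g (lineMap z c t) - g (lineMap z s t)| ≤ B / h * D := fun hT =>
    A.edge_sub_le_of_short hg hT.swap
  have hlong : ∀ {f : Plane} (_ : Δ.AnisoAt B z f h H) {c₁ c : Plane}, Δ.IsTri z s₀ c₁ →
      Δ.IsRight B z f H c₁ → Δ.IsRight B z f H c →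
      ∫ t in 0..1, |g (lineMap z c t) - m| ≤ B ^ 2 / h * D := by
    intro f A' c₁ c hT hc₁ hc
    have h1 := A'.right_edge_dist hΩ hg hc₁ (fun c hc _ => hin c hc.mem) hc
    have h2 := hshort hT
    have h3 := integral_abs_sub_le_add (hcont hc.mem) (hcont hs₀n) (continuousOn_const (c := m))
    have h4 := integral_abs_sub_le_add (hcont hc.mem) (hcont hc₁.mem) (hcont hs₀n)
    have h5 : B ^ 3 / H * D ≤ 1 / h * D := mul_le_mul_of_nonneg_right (A.div_H_le (by norm_num)) hD
    have h6 : 1 / h * D + B / h * D + 4 * B / h * D ≤ B ^ 2 / h * D := by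
      have : 1 / h * D + B / h * D + 4 * B / h * D = (1 + 5 * B) * (D / h) := by ring
      rw [this, show B ^ 2 / h * D = B ^ 2 * (D / h) by ring]
      gcongr; nlinarith
    linarith
  have hB23 : B ^ 2 / h * D + B / h * D ≤ B ^ 3 / h * D := by
    have : B ^ 2 / h * D + B / h * D = (B ^ 2 + B) * (D / h) := by ring
    rw [this, show B ^ 3 / h * D = B ^ 3 * (D / h) by ring]
    gcongr; nlinarith [mul_pos hBp hBp]
  have hBD : 0 ≤ B / h * D := by positivity
  refine ⟨m, fun s hs => ?_⟩
  rcases A.short_or_long hs with h1 | h1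
  · obtain ⟨c, _, hcT, _, hc, _⟩ := A.short_two_sides hΩ (hin s hs) h1
    have h2 := hlong A hc₀T hc₀ hc
    have h3 := A.edge_sub_le_of_short hg hcT
    have h4 := integral_abs_sub_le_add (hcont hs) (hcont hc.mem) (continuousOn_const (c := m))
    linarith
  · rcases A.right_or_left hs h1 with h2 | h2
    · linarith [hlong A hc₀T hc₀ h2]
    · linarith [hlong A.neg hb₀T hb₀ h2]

omit A in
lemma continuousOn_ray_mul (hg : ContinuousOn g (closure Ω)) {τ : ℝ}
    (hc : c ∈ Δ.nbrs z) (hτ : 0 < τ) (hτ1 : τ ≤ 1) :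
    ContinuousOn (fun t : ℝ => g (lineMap z c (τ * t))) (Icc 0 1) :=
  (continuousOn_nbr_edge hg hc).comp (by fun_prop : ContinuousOn (fun t : ℝ => τ * t) _)
    fun t ht => ⟨mul_nonneg hτ.le ht.1, by nlinarith [ht.1, ht.2]⟩

lemma ray_dist_le (hg : Sob (closure Ω) g Dg) {τ m : ℝ} (hx : x ∈ Δ.patch z)
    (hr : Δ.RayCompare B z e h H x c τ)
    (hm : ∫ t in 0..1, |g (lineMap z c t) - m| ≤ B ^ 3 / h * Δ.gradL1 Dg z) :
    |rayMean g m z x| ≤ B ^ 4 / h * Δ.gradL1 Dg z := by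
  obtain ⟨hBp, hb, hh, _⟩ := A.pos
  set D := Δ.gradL1 Dg z
  have hD := Δ.gradL1_nonneg Dg z
  have h1 := hr.dist_le g Dg hg
  have hcx := continuousOn_ray hg.continuousOn hx
  have hcc := continuousOn_nbr_edge hg.continuousOn hr.right.mem
  have hct := continuousOn_ray_mul hg.continuousOn hr.right.mem hr.pos hr.le_one
  have h2 : τ * ∫ t in 0..1, |g (lineMap z c (τ * t)) - m| ≤ ∫ t in 0..1, |g (lineMap z c t) - m| :=
    integral_abs_comp_mul_le (F := fun t => g (lineMap z c t) - m)
      (hcc.sub continuousOn_const) hr.pos hr.le_one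
  have h3 := integral_abs_sub_le_add hcx hct (continuousOn_const (c := m))
  have h4 : |∫ t in 0..1, (1 - t) * (g (lineMap z x t) - m)| ≤
      ∫ t in 0..1, |g (lineMap z x t) - m| :=
    abs_integral_hat_le (hcx.sub continuousOn_const)
  have h5 : B ^ 3 / H * D ≤ 1 / h * D := mul_le_mul_of_nonneg_right (A.div_H_le (by norm_num)) hD
  have h6 : 0 ≤ ∫ t in 0..1, |g (lineMap z c (τ * t)) - m| :=
    intervalIntegral.integral_nonneg zero_le_one fun _ _ => abs_nonneg _
  have h7 : ∫ t in 0..1, |g (lineMap z c (τ * t)) - m| ≤ 2 * (B ^ 3 / h * D) := by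
    have : 1 * ∫ t in 0..1, |g (lineMap z c (τ * t)) - m| ≤
        2 * (τ * ∫ t in 0..1, |g (lineMap z c (τ * t)) - m|) := by
      rw [← mul_assoc]; gcongr; exact hr.one_le
    linarith
  have h8 : 1 / h * D + 2 * (B ^ 3 / h * D) ≤ B ^ 4 / h * D := by
    have : 1 / h * D + 2 * (B ^ 3 / h * D) = (1 + 2 * B ^ 3) * (D / h) := by ring
    rw [this, show B ^ 4 / h * D = B ^ 4 * (D / h) by ring]
    gcongr ?_ * _
    have : 1 ≤ B ^ 3 := one_le_pow₀ (by linarith)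
    nlinarith
  rw [rayMean]
  linarith

lemma abs_norm_sub_inner_le (hc : Δ.IsRight B z e H c)
    (hξ : |⟪e, c - z⟫ - ⟪e, x - z⟫| ≤ B ^ 2 * h) : |‖c - z‖ - ⟪e, x - z⟫| ≤ B ^ 3 * h := by
  obtain ⟨hBp, hb, hh, _⟩ := A.pos
  have hξ := abs_le.1 hξ
  have hcξ := abs_frame_inner_le A.norm_e (c - z)
  have h8 := frame_norm_sq A.norm_e (c - z)
  have h9 := A.abs_eta_le hc.mem
  have h10 := hc.pos
  have h11 : ‖c - z‖ ≤ ⟪e, c - z⟫ + |cr e (c - z)| := by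
    refine (sq_le_sq₀ (norm_nonneg _) (by positivity)).1 ?_
    rw [h8, add_sq, sq_abs]
    have : 0 ≤ 2 * ⟪e, c - z⟫ * |cr e (c - z)| := by positivity
    linarith
  have h12 : B ^ 2 * h + B * h ≤ B ^ 3 * h := by
    rw [← add_mul]
    gcongr ?_ * _
    have : 0 < B * B := by positivity
    nlinarith
  rw [abs_le]
  rw [abs_of_pos h10] at hcξ
  have : 0 < B * h := by positivity
  constructor <;> linarith

/-- Points with the same projection are compared. The bound contains `1 / H` instead of `1 / h`, since ray
and edge differ in length only by a fraction `h / H`. -/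
lemma ray_mean_sub_le (hg : Sob (closure Ω) g Dg) {τ : ℝ} (hx : x ∈ Δ.patch z)
    (hr : Δ.RayCompare B z e h H x c τ)
    (hk : ∫ t in 0..1, |g (lineMap z c t) - k| ≤ B ^ 5 / h * Δ.gradL1 Dg z) :
    |rayMean g k z c - rayMean g k z x| ≤ 6 * (B ^ 9 / H * Δ.gradL1 Dg z) := by
  obtain ⟨hBp, _, hh, hH⟩ := A.pos
  set D := Δ.gradL1 Dg z
  have hD := Δ.gradL1_nonneg Dg z
  have h1 := hr.dist_le g Dg hg
  have hcx := continuousOn_ray hg.continuousOn hx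
  have hcc := continuousOn_nbr_edge hg.continuousOn hr.right.mem
  have hct := continuousOn_ray_mul hg.continuousOn hr.right.mem hr.pos hr.le_one
  set F : ℝ → ℝ := fun t => g (lineMap z c t) - k with hF
  have hFc : ContinuousOn F (Icc 0 1) := hcc.sub continuousOn_const
  have hFτ : ContinuousOn (fun t => F (τ * t)) (Icc 0 1) := hct.sub continuousOn_const
  set R := rayMean g k z x with hR
  set I := rayMean g k z c
  set Q := ∫ t in 0..1, (1 - t) * F (τ * t) with hQ
  have h2 : |R - Q| ≤ B ^ 3 / H * D := by
    have e1 : R - Q = ∫ t in 0..1, (1 - t) * (g (lineMap z x t) - g (lineMap z c (τ * t))) := by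
      rw [hR, rayMean, hQ, ← intervalIntegral.integral_sub]
      · exact intervalIntegral.integral_congr fun t _ => by simp only [hF]; ring
      · exact intervalIntegrable_of_Icc (ContinuousOn.mul (by fun_prop) (hcx.sub continuousOn_const))
      · exact intervalIntegrable_of_Icc (ContinuousOn.mul (by fun_prop) hFτ)
    rw [e1]
    exact (abs_integral_hat_le (hcx.sub hct)).trans h1
  have h3 : |I - τ ^ 2 * Q| ≤ (1 - τ) * (B ^ 5 / h * D) :=
    (abs_integral_hat_sub_le hFc hr.pos hr.le_one).trans
      (mul_le_mul_of_nonneg_left hk (by linarith [hr.le_one]))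
  have h4 : |Q| ≤ 2 * (B ^ 5 / h * D) := by
    have h5 := abs_integral_hat_le hFτ
    have h6 := integral_abs_comp_mul_le hFc hr.pos hr.le_one
    have h7 : 0 ≤ ∫ t in 0..1, |F (τ * t)| :=
      intervalIntegral.integral_nonneg zero_le_one fun _ _ => abs_nonneg _
    nlinarith [hr.one_le]
  have h5 : (1 - τ) * (B ^ 5 / h * D) ≤ B ^ 9 / H * D := by
    have h6 : (1 - τ) * H * (B ^ 5 * D) ≤ B ^ 4 * h * (B ^ 5 * D) :=
      mul_le_mul_of_nonneg_right hr.near (by positivity)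
    rw [show (1 - τ) * (B ^ 5 / h * D) = (1 - τ) * (B ^ 5 * D) / h by ring,
      show B ^ 9 / H * D = B ^ 9 * D / H by ring, div_le_div_iff₀ hh hH]
    linarith
  have e1 : I - R = (I - τ ^ 2 * Q) - (1 - τ ^ 2) * Q - (R - Q) := by ring
  have h7 : |(1 - τ ^ 2) * Q| ≤ 4 * (B ^ 9 / H * D) := by
    rw [abs_mul, abs_of_nonneg (by nlinarith [hr.le_one, hr.pos])]
    have h8 : (1 - τ ^ 2) ≤ 2 * (1 - τ) := by nlinarith [sq_nonneg (1 - τ)]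
    calc _ ≤ (2 * (1 - τ)) * (2 * (B ^ 5 / h * D)) :=
          mul_le_mul h8 h4 (abs_nonneg _) (by linarith [hr.le_one])
      _ ≤ _ := by linarith
  have h8 : B ^ 3 / H * D ≤ B ^ 9 / H * D :=
    mul_le_mul_of_nonneg_right (div_le_div_of_nonneg_right (A.B_pow_le 3 9 (by norm_num)) hH.le) hD
  rw [e1]
  refine (abs_sub _ _).trans ?_
  have := abs_sub (I - τ ^ 2 * Q) ((1 - τ ^ 2) * Q)
  linarith

/-- The moment on a long edge and the mean along a nearby ray. -/
lemma ray_moment_le (hg : Sob (closure Ω) g Dg) {τ : ℝ} (hx : x ∈ Δ.patch z)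
    (hr : Δ.RayCompare B z e h H x c τ)
    (hk : ∫ t in 0..1, |g (lineMap z c t) - k| ≤ B ^ 5 / h * Δ.gradL1 Dg z) :
    |edgeMoment g k z c - ⟪e, x - z⟫ * rayMean g k z x| ≤ B ^ 10 * Δ.gradL1 Dg z := by
  obtain ⟨hBp, hb, hh, hH⟩ := A.pos
  have h6 := A.ray_mean_sub_le hg hx hr hk
  have hIle : |rayMean g k z c| ≤ B ^ 5 / h * Δ.gradL1 Dg z :=
    (abs_integral_hat_le ((continuousOn_nbr_edge hg.continuousOn hr.right.mem).sub
      continuousOn_const)).trans hk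
  set D := Δ.gradL1 Dg z
  have hD := Δ.gradL1_nonneg Dg z
  set R := rayMean g k z x
  set I := rayMean g k z c with hI
  have h7 := A.abs_norm_sub_inner_le hr.right hr.xi_le
  have h8 : |⟪e, x - z⟫| ≤ H := by
    refine (abs_frame_inner_le A.norm_e _).trans (A.dist_le _ hx _ ?_)
    exact (mem_patch_of_mem_nbrs hr.right.mem).2
  rw [edgeMoment_eq, ← hI]
  have e1 : ‖c - z‖ * I - ⟪e, x - z⟫ * R = (‖c - z‖ - ⟪e, x - z⟫) * I + ⟪e, x - z⟫ * (I - R) := by ring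
  rw [e1]
  have h9 : |(‖c - z‖ - ⟪e, x - z⟫) * I| ≤ (B ^ 3 * h) * (B ^ 5 / h * D) := by
    rw [abs_mul]; exact mul_le_mul h7 hIle (abs_nonneg _) (by positivity)
  have h10 : |⟪e, x - z⟫ * (I - R)| ≤ H * (6 * (B ^ 9 / H * D)) := by
    rw [abs_mul]; exact mul_le_mul h8 h6 (abs_nonneg _) hH.le
  have e2 : (B ^ 3 * h) * (B ^ 5 / h * D) = B ^ 8 * D := by field_simp
  have e3 : H * (6 * (B ^ 9 / H * D)) = 6 * (B ^ 9 * D) := by field_simp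
  rw [e2] at h9
  rw [e3] at h10
  have h11 : B ^ 8 * D ≤ B ^ 9 * D := mul_le_mul_of_nonneg_right (A.B_pow_le 8 9 (by norm_num)) hD
  have h12 : 7 * (B ^ 9 * D) ≤ B ^ 10 * D := by
    have : 0 ≤ B ^ 9 * D := by positivity
    rw [show B ^ 10 * D = B * (B ^ 9 * D) by ring]
    nlinarith
  refine (abs_add_le _ _).trans ?_
  linarith

/-- The moments on two long edges of the same side. -/
lemma right_moment_sub_le (hΩ : IsOpen Ω) (hg : Sob (closure Ω) g Dg)
    (hc : Δ.IsRight B z e H c) (hc' : Δ.IsRight B z e H c')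
    (hin : ∀ s, Δ.IsRight B z e H s → s ≠ c' → s ∈ Δ.innerNbrs z)
    (hk : ∫ t in 0..1, |g (lineMap z c t) - k| ≤ B ^ 5 / h * Δ.gradL1 Dg z) :
    |edgeMoment g k z c - edgeMoment g k z c'| ≤ B ^ 8 * Δ.gradL1 Dg z := by
  obtain ⟨hBp, hb, hh, hH⟩ := A.pos
  set D := Δ.gradL1 Dg z
  have hD := Δ.gradL1_nonneg Dg z
  have hcc := continuousOn_nbr_edge hg.continuousOn hc.mem
  have hcc' := continuousOn_nbr_edge hg.continuousOn hc'.mem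
  have h1 : |rayMean g k z c - rayMean g k z c'| ≤ B ^ 3 / H * D := by
    have e1 : rayMean g k z c - rayMean g k z c' = ∫ t in 0..1, (1 - t) *
        (g (lineMap z c t) - g (lineMap z c' t)) := by
      rw [rayMean, rayMean, ← intervalIntegral.integral_sub]
      · exact intervalIntegral.integral_congr fun t _ => by ring
      · exact intervalIntegrable_of_Icc (ContinuousOn.mul (by fun_prop) (hcc.sub continuousOn_const))
      · exact intervalIntegrable_of_Icc (ContinuousOn.mul (by fun_prop) (hcc'.sub continuousOn_const))
    rw [e1]
    exact (abs_integral_hat_le (hcc.sub hcc')).trans (A.right_edge_dist hΩ hg hc' hin hc)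
  have h2 : |rayMean g k z c| ≤ B ^ 5 / h * D :=
    (abs_integral_hat_le (hcc.sub continuousOn_const)).trans hk
  have h3 : |‖c - z‖ - ‖c' - z‖| ≤ B ^ 2 * h := by
    refine (abs_norm_sub_norm_le _ _).trans ?_
    rw [sub_sub_sub_cancel_right]
    exact A.right_norm_sub_le hΩ hc' hin hc
  rw [edgeMoment_eq, edgeMoment_eq]
  have e1 : ‖c - z‖ * rayMean g k z c - ‖c' - z‖ * rayMean g k z c' =
      (‖c - z‖ - ‖c' - z‖) * rayMean g k z c +
        ‖c' - z‖ * (rayMean g k z c - rayMean g k z c') := by ring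
  have h4 : |(‖c - z‖ - ‖c' - z‖) * rayMean g k z c| ≤ (B ^ 2 * h) * (B ^ 5 / h * D) := by
    rw [abs_mul]; exact mul_le_mul h3 h2 (abs_nonneg _) (by positivity)
  have h5 : |‖c' - z‖ * (rayMean g k z c - rayMean g k z c')| ≤ H * (B ^ 3 / H * D) := by
    rw [abs_mul, abs_norm]
    exact mul_le_mul (A.norm_sub_le hc'.mem) h1 (abs_nonneg _) hH.le
  have e2 : (B ^ 2 * h) * (B ^ 5 / h * D) = B ^ 7 * D := by field_simp
  have e3 : H * (B ^ 3 / H * D) = B ^ 3 * D := by field_simp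
  rw [e2] at h4
  rw [e3] at h5
  have h6 : B ^ 3 * D ≤ B ^ 7 * D := mul_le_mul_of_nonneg_right (A.B_pow_le 3 7 (by norm_num)) hD
  have h7 : 2 * (B ^ 7 * D) ≤ B ^ 8 * D := by
    have : 0 ≤ B ^ 7 * D := by positivity
    rw [show B ^ 8 * D = B * (B ^ 7 * D) by ring]
    nlinarith
  rw [e1]
  refine (abs_add_le _ _).trans ?_
  linarith

/-- The moments at an interior node, where `k` is the average along a bent line. -/
lemma interior_bounds (hΩ : IsOpen Ω) (hin : ∀ s ∈ Δ.nbrs z, s ∈ Δ.innerNbrs z)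
    (hg : Sob (closure Ω) g Dg) (hd : Δ.IsRight B z e H d)
    (hd' : Δ.IsRight B z (-e) H d') (hx : x ∈ Δ.patch z) (hx' : x' ∈ Δ.patch z)
    (hxd : ⟪e, x - z⟫ = ⟪e, d - z⟫) (hxd' : ⟪e, x' - z⟫ = ⟪e, d' - z⟫)
    (hk : ⟪e, x - z⟫ * rayMean g k z x = ⟪e, x' - z⟫ * rayMean g k z x') :
    Δ.MomentBounds B z e h H (edgeMoment g k z) (B ^ 11 * Δ.gradL1 Dg z) := by
  obtain ⟨hBp, hb, hh, _⟩ := A.pos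
  set D := Δ.gradL1 Dg z
  have hD := Δ.gradL1_nonneg Dg z
  have hinr : ∀ {f : Plane}, ∀ c, Δ.IsRight B z f H c → c ∈ Δ.innerNbrs z := fun c hc => hin c hc.mem
  obtain ⟨m, hm⟩ := A.exists_common_mean hΩ hin hg hd
  obtain ⟨c, τ, hr⟩ := A.ray_compare hΩ hinr hx hd hxd
  have hxd'' : ⟪-e, x' - z⟫ = ⟪-e, d' - z⟫ := by rw [inner_neg_left, inner_neg_left, hxd']
  obtain ⟨c', τ', hr'⟩ := A.neg.ray_compare hΩ hinr hx' hd' hxd''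
  have h1 := A.ray_dist_le hg hx hr (hm c hr.right.mem)
  have h2 := A.neg.ray_dist_le hg hx' hr' (hm c' hr'.right.mem)
  have hkm := abs_sub_le_of_average (continuousOn_ray hg.continuousOn hx)
    (continuousOn_ray hg.continuousOn hx') (by rw [hxd]; exact hd.pos)
    (by rw [hxd', ← inner_neg_left]; exact hd'.pos) hk h1 h2
  have hall : ∀ s ∈ Δ.nbrs z, ∫ t in 0..1, |g (lineMap z s t) - k| ≤ B ^ 5 / h * D := by
    intro s hs
    have h3 := integral_abs_sub_le_add (continuousOn_nbr_edge hg.continuousOn hs)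
      (continuousOn_const (c := m)) (continuousOn_const (c := k))
    have h4 : ∫ _ in 0..1, |m - k| = |k - m| := by simp [abs_sub_comm]
    rw [h4] at h3
    have h5 := hm s hs
    have h6 : B ^ 3 / h * D + 2 * (B ^ 4 / h * D) ≤ B ^ 5 / h * D := by
      have : B ^ 3 / h * D + 2 * (B ^ 4 / h * D) = (1 + 2 * B) * (B ^ 3 * (D / h)) := by ring
      rw [this, show B ^ 5 / h * D = B ^ 2 * (B ^ 3 * (D / h)) by ring]
      gcongr; nlinarith
    linarith
  have hB10 : 2 * (B ^ 10 * D) + 2 * (B ^ 8 * D) ≤ B ^ 11 * D := by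
    have h3 : B ^ 8 * D ≤ B ^ 10 * D :=
      mul_le_mul_of_nonneg_right (A.B_pow_le 8 10 (by norm_num)) hD
    have : 0 ≤ B ^ 10 * D := by positivity
    rw [show B ^ 11 * D = B * (B ^ 10 * D) by ring]
    nlinarith
  have hB10' : 0 ≤ B ^ 10 * D := by positivity
  have hsame := fun {a b : Plane} (ha : Δ.IsRight B z e H a) (hb : Δ.IsRight B z e H b) =>
    A.right_moment_sub_le hΩ hg (k := k) ha hb (fun s hs _ => hinr s hs) (hall a ha.mem)
  have hsame' := fun {a b : Plane} (ha : Δ.IsRight B z (-e) H a) (hb : Δ.IsRight B z (-e) H b) =>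
    A.neg.right_moment_sub_le hΩ hg (k := k) ha hb (fun s hs _ => hinr s hs) (hall a ha.mem)
  have hB8 : 0 ≤ B ^ 8 * D := by positivity
  refine ⟨fun s hs => ?_, fun a b ha hb => ?_, fun a b ha hb => ?_, fun a b ha hb => ?_⟩
  · rw [edgeMoment_eq, abs_mul, abs_norm, mul_assoc]
    gcongr _ * ?_
    have h3 := (abs_integral_hat_le ((continuousOn_nbr_edge hg.continuousOn hs).sub
      (continuousOn_const (c := k)))).trans (hall s hs)
    calc _ ≤ (B ^ 5 / h * D) * h := mul_le_mul_of_nonneg_right h3 hh.le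
      _ = B ^ 5 * D := by field_simp
      _ ≤ _ := mul_le_mul_of_nonneg_right (A.B_pow_le 5 11 (by norm_num)) hD
  · have h3 := A.ray_moment_le hg hx hr (hall c hr.right.mem)
    have h4 := A.neg.ray_moment_le hg hx' hr' (hall c' hr'.right.mem)
    rw [inner_neg_left] at h4
    have h5 := hsame ha hr.right
    have h6 := hsame' hb hr'.right
    have e1 : edgeMoment g k z a + edgeMoment g k z b =
        (edgeMoment g k z c - ⟪e, x - z⟫ * rayMean g k z x) +
        (edgeMoment g k z c' - -⟪e, x' - z⟫ * rayMean g k z x') +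
        (edgeMoment g k z a - edgeMoment g k z c) + (edgeMoment g k z b - edgeMoment g k z c') := by
      linear_combination hk
    rw [e1]
    refine (abs_add_le _ _).trans ?_
    have h7 := abs_add_le (edgeMoment g k z c - ⟪e, x - z⟫ * rayMean g k z x)
      (edgeMoment g k z c' - -⟪e, x' - z⟫ * rayMean g k z x')
    have h8 := abs_add_le ((edgeMoment g k z c - ⟪e, x - z⟫ * rayMean g k z x) +
      (edgeMoment g k z c' - -⟪e, x' - z⟫ * rayMean g k z x'))
      (edgeMoment g k z a - edgeMoment g k z c)
    linarith
  · have := hsame ha hb; linarith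
  · have := hsame' ha hb; linarith

end AnisoAt
end Triangulation

/-! ### Averages along bent lines -/

namespace Triangulation

/-- An average `k` of `g` at the node `z` in terms of two rays `zx`, `zx'`, which end above the
endpoints `d`, `d'` of long edges of either side. -/
structure AverageRays (Δ : Triangulation Ω) (B : ℝ) (z e : Plane) (H : ℝ) (g : Plane → ℝ) (k : ℝ)
    (x x' d d' : Plane) : Prop where
  right : Δ.IsRight B z e H d
  left : Δ.IsRight B z (-e) H d'
  mem : x ∈ Δ.patch z
  mem' : x' ∈ Δ.patch z
  inner_eq : ⟪e, x - z⟫ = ⟪e, d - z⟫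
  inner_eq' : ⟪e, x' - z⟫ = ⟪e, d' - z⟫
  average : ⟪e, x - z⟫ * rayMean g k z x = ⟪e, x' - z⟫ * rayMean g k z x'

lemma mem_patch_of_openSegment (h : openSegment ℝ z x ⊆ Δ.patch z) : x ∈ Δ.patch z := by
  have h1 := closure_mono h
  rw [closure_openSegment, (isCompact_patch z).isClosed.closure_eq] at h1
  exact h1 (right_mem_segment ℝ z x)

lemma frame_decomp (he : ‖e‖ = 1) (v : Plane) : v = ⟪e, v⟫ • e + cr e v • rot e := by
  have h := norm_sq_eq e
  rw [he] at h
  ext i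
  fin_cases i
  · simp [inner_eq, cr, rot]; linear_combination v 0 * h
  · simp [inner_eq, cr, rot]; linear_combination v 1 * h

lemma inner_frame (he : ‖e‖ = 1) (ξ η : ℝ) : ⟪e, ξ • e + η • rot e⟫ = ξ := by
  have h := norm_sq_eq e
  rw [he] at h
  simp [inner_eq, rot]; linear_combination -ξ * h

namespace AnisoAt
variable (A : Δ.AnisoAt B z e h H)
include A
variable {κ : ℝ}

omit A in
lemma exists_xiPlus (hlong : ∀ s ∈ Δ.nbrs z, κ * Δ.smallH z < dist z s ↔ H ≤ B * ‖s - z‖) (hy : Δ.IsRight B z e H y) :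
    ∃ d, Δ.IsRight B z e H d ∧ Δ.xiPlus κ z e = ⟪e, d - z⟫ := by
  set S : Set ℝ := {s | ∃ z' ∈ Δ.longNbrs κ z, s = ⟪z' - z, e⟫ ∧ 0 < s} with hS
  have hfin : S.Finite := by
    refine ((Δ.nbrs z).finite_toSet.image fun z' => ⟪z' - z, e⟫).subset ?_
    rintro s ⟨z', hz', rfl, -⟩
    exact ⟨z', hz'.1, rfl⟩
  have hne : S.Nonempty :=
    ⟨⟪y - z, e⟫, y, ⟨hy.mem, (hlong y hy.mem).2 hy.long⟩, rfl, by rw [real_inner_comm]; exact hy.pos⟩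
  obtain ⟨d, hd, hd1, hd2⟩ := hne.csInf_mem hfin
  rw [hd1, real_inner_comm] at hd2
  exact ⟨d, ⟨hd.1, (hlong d hd.1).1 hd.2, hd2⟩, by rw [xiPlus, ← hS, hd1, real_inner_comm]⟩

omit A in
lemma exists_xiMinus (hlong : ∀ s ∈ Δ.nbrs z, κ * Δ.smallH z < dist z s ↔ H ≤ B * ‖s - z‖) (hy : Δ.IsRight B z (-e) H y) :
    ∃ d, Δ.IsRight B z (-e) H d ∧ Δ.xiMinus κ z e = ⟪e, d - z⟫ := by
  set S : Set ℝ := {s | ∃ z' ∈ Δ.longNbrs κ z, s = ⟪z' - z, e⟫ ∧ s < 0} with hS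
  have hfin : S.Finite := by
    refine ((Δ.nbrs z).finite_toSet.image fun z' => ⟪z' - z, e⟫).subset ?_
    rintro s ⟨z', hz', rfl, -⟩
    exact ⟨z', hz'.1, rfl⟩
  have hne : S.Nonempty := by
    refine ⟨⟪y - z, e⟫, y, ⟨hy.mem, (hlong y hy.mem).2 hy.long⟩, rfl, ?_⟩
    have := hy.pos
    rw [inner_neg_left] at this
    rw [real_inner_comm]; linarith
  obtain ⟨d, hd, hd1, hd2⟩ := hne.csSup_mem hfin
  rw [hd1, real_inner_comm] at hd2
  exact ⟨d, ⟨hd.1, (hlong d hd.1).1 hd.2, by rw [inner_neg_left]; linarith⟩,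
    by rw [xiMinus, ← hS, hd1, real_inner_comm]⟩

lemma exists_left (hΩ : IsOpen Ω) (hin : ∀ s ∈ Δ.nbrs z, s ∈ Δ.innerNbrs z)
    (hy : Δ.IsRight B z e H y) : ∃ b, Δ.IsRight B z (-e) H b := by
  obtain ⟨d, s, -, hT, hs⟩ := A.exists_right_short hΩ (fun c hc => hin c hc.mem) hy
  obtain ⟨-, b, -, -, -, hb⟩ := A.short_two_sides hΩ (hin s hT.mem_nbrs) hs
  exact ⟨b, hb⟩

omit A in
lemma isRight_longest (he : e ≠ 0) (hy : y ∈ Δ.nbrs z) (hl : H ≤ B * ‖y - z‖)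
    (hey : e = ‖y - z‖⁻¹ • (y - z)) : Δ.IsRight B z e H y := by
  refine ⟨hy, hl, ?_⟩
  have h0 : y - z ≠ 0 := by rintro h; rw [hey, h] at he; simp at he
  rw [hey, real_inner_smul_left, real_inner_self_eq_norm_sq]
  have := norm_pos_iff.2 h0
  positivity

lemma averageRays (hΩ : IsOpen Ω) (hin : ∀ s ∈ Δ.nbrs z, s ∈ Δ.innerNbrs z)
    (hlong : ∀ s ∈ Δ.nbrs z, κ * Δ.smallH z < dist z s ↔ H ≤ B * ‖s - z‖)
    (hg : ContinuousOn g (closure Ω)) (hy : Δ.IsRight B z e H y) {sm sp : ℝ}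
    (hline : ∀ ξ ∈ Ioo (Δ.xiMinus κ z e) (Δ.xiPlus κ z e),
      z + ξ • e + bent sm sp ξ • rot e ∈ Δ.patch z)
    (hk : ∫ ξ in (Δ.xiMinus κ z e)..(Δ.xiPlus κ z e),
      (g (z + ξ • e + bent sm sp ξ • rot e) - k) * hatOne (Δ.xiMinus κ z e) (Δ.xiPlus κ z e) ξ = 0) :
    ∃ x x' d d', Δ.AverageRays B z e H g k x x' d d' := by
  obtain ⟨y', hy'⟩ := A.exists_left hΩ hin hy
  obtain ⟨d, hd, hdp⟩ := exists_xiPlus hlong hy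
  obtain ⟨d', hd', hdm⟩ := exists_xiMinus hlong hy'
  rw [hdp, hdm] at hline hk
  have hp := hd.pos
  have hm : ⟪e, d' - z⟫ < 0 := by have := hd'.pos; rw [inner_neg_left] at this; linarith
  set ξp := ⟪e, d - z⟫
  set ξm := ⟪e, d' - z⟫
  have e1 : ∀ ξ σ : ℝ, ⟪e, z + ξ • e + (σ * ξ) • rot e - z⟫ = ξ := fun ξ σ => by
    rw [show z + ξ • e + (σ * ξ) • rot e - z = ξ • e + (σ * ξ) • rot e by abel, inner_frame A.norm_e]
  have hx : z + ξp • e + (sp * ξp) • rot e ∈ Δ.patch z := by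
    refine mem_patch_of_openSegment ?_
    rw [openSegment_eq_image_lineMap]
    rintro _ ⟨t, ht, rfl⟩
    have h1 : 0 < t * ξp := mul_pos ht.1 hp
    have := hline (t * ξp) ⟨by linarith, by nlinarith [ht.2]⟩
    rw [bent, if_neg (not_le.2 h1)] at this
    convert this using 1
    rw [lineMap_apply, vsub_eq_sub, vadd_eq_add]
    module
  have hx' : z + ξm • e + (sm * ξm) • rot e ∈ Δ.patch z := by
    refine mem_patch_of_openSegment ?_
    rw [openSegment_eq_image_lineMap]
    rintro _ ⟨t, ht, rfl⟩
    have h1 : t * ξm < 0 := mul_neg_of_pos_of_neg ht.1 hm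
    have := hline (t * ξm) ⟨by nlinarith [ht.2], by linarith⟩
    rw [bent, if_pos h1.le] at this
    convert this using 1
    rw [lineMap_apply, vsub_eq_sub, vadd_eq_add]
    module
  rw [bent_integral hg hm hp rfl rfl hx hx'] at hk
  exact ⟨_, _, d, d', hd, hd', hx, hx', e1 _ _, e1 _ _, by rw [e1, e1]; linarith⟩

/-- The segments to the nearest endpoints of long edges on the two sides form an admissible bent line. -/
lemma exists_average (hΩ : IsOpen Ω) (hin : ∀ s ∈ Δ.nbrs z, s ∈ Δ.innerNbrs z)
    (hlong : ∀ s ∈ Δ.nbrs z, κ * Δ.smallH z < dist z s ↔ H ≤ B * ‖s - z‖)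
    (hg : ContinuousOn g (closure Ω)) (hy : Δ.IsRight B z e H y) :
    ∃ k sm sp : ℝ, (∀ ξ ∈ Ioo (Δ.xiMinus κ z e) (Δ.xiPlus κ z e),
      z + ξ • e + bent sm sp ξ • rot e ∈ Δ.patch z) ∧
    ∫ ξ in (Δ.xiMinus κ z e)..(Δ.xiPlus κ z e),
      (g (z + ξ • e + bent sm sp ξ • rot e) - k) * hatOne (Δ.xiMinus κ z e) (Δ.xiPlus κ z e) ξ = 0 := by
  obtain ⟨y', hy'⟩ := A.exists_left hΩ hin hy
  obtain ⟨d, hd, hdp⟩ := exists_xiPlus hlong hy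
  obtain ⟨d', hd', hdm⟩ := exists_xiMinus hlong hy'
  rw [hdp, hdm]
  have hp := hd.pos
  have hm : ⟪e, d' - z⟫ < 0 := by have := hd'.pos; rw [inner_neg_left] at this; linarith
  have e1 := frame_decomp A.norm_e (d - z)
  have e2 := frame_decomp A.norm_e (d' - z)
  have hdmem := (mem_patch_of_mem_nbrs hd.mem).1
  have hdmem' := (mem_patch_of_mem_nbrs hd'.mem).1
  set ξp := ⟪e, d - z⟫
  set ξm := ⟪e, d' - z⟫
  set sp := cr e (d - z) / ξp with hsp
  set sm := cr e (d' - z) / ξm with hsm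
  have hx : d = z + ξp • e + (sp * ξp) • rot e := by
    rw [hsp, div_mul_cancel₀ _ hp.ne', add_assoc, ← e1]; abel
  have hx' : d' = z + ξm • e + (sm * ξm) • rot e := by
    rw [hsm, div_mul_cancel₀ _ hm.ne, add_assoc, ← e2]; abel
  obtain ⟨k, hk⟩ : ∃ k : ℝ, k * (ξp - ξm) = 2 * (ξp * rayMean g 0 z d - ξm * rayMean g 0 z d') :=
    ⟨_, div_mul_cancel₀ _ (by linarith)⟩
  refine ⟨k, sm, sp, fun ξ hξ => ?_, ?_⟩
  · rcases le_or_gt ξ 0 with h1 | h1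
    · rw [bent, if_pos h1]
      refine segment_subset_patch hdmem' ?_
      have h2 : z + ξ • e + (sm * ξ) • rot e = lineMap z d' (ξ / ξm) := by
        rw [lineMap_apply, vsub_eq_sub, vadd_eq_add, hx',
          show z + ξm • e + (sm * ξm) • rot e - z = ξm • (e + sm • rot e) by module, smul_smul,
          div_mul_cancel₀ _ hm.ne]
        module
      rw [h2]
      exact lineMap_mem_segment ⟨div_nonneg_of_nonpos h1 hm.le, (div_le_one_of_neg hm).2 hξ.1.le⟩
    · rw [bent, if_neg (not_le.2 h1)]
      refine segment_subset_patch hdmem ?_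
      have h2 : z + ξ • e + (sp * ξ) • rot e = lineMap z d (ξ / ξp) := by
        rw [lineMap_apply, vsub_eq_sub, vadd_eq_add, hx,
          show z + ξp • e + (sp * ξp) • rot e - z = ξp • (e + sp • rot e) by module, smul_smul,
          div_mul_cancel₀ _ hp.ne']
        module
      rw [h2]
      exact lineMap_mem_segment ⟨div_nonneg h1.le hp.le, (div_le_one hp).2 hξ.2.le⟩
  · rw [bent_integral hg hm hp hx hx' hdmem hdmem', rayMean_sub (continuousOn_ray hg hdmem) k 0,
      rayMean_sub (continuousOn_ray hg hdmem') k 0]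
    linear_combination (-1 / 2) * hk

end AnisoAt
end Triangulation

/-! ### The jumps around a node -/

/-- The unit vector along the edge from `z` to `s`. -/
noncomputable def edgeDir (z s : Plane) : Plane := ‖s - z‖⁻¹ • (s - z)

lemma norm_edgeDir (h : z ≠ s) : ‖edgeDir z s‖ = 1 := by
  have h1 : 0 < ‖s - z‖ := norm_pos_iff.2 (sub_ne_zero.2 h.symm)
  rw [edgeDir, norm_smul, norm_inv, norm_norm, inv_mul_cancel₀ h1.ne']

lemma edgeDir_comm (z s : Plane) : edgeDir s z = -edgeDir z s := by
  rw [edgeDir, edgeDir, norm_sub_rev, ← smul_neg, neg_sub]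

lemma inner_outerNormal_mul (hzs : z ≠ s) (hcr : cr (s - z) (b - z) ≠ 0) (p q : Plane) :
    ⟪p, outerNormal z s b⟫ * ⟪edgeDir z s, q⟫ = cr (s - z) (b - z) / |cr (s - z) (b - z)| *
      (⟪rot p, q⟫ - ⟪p, s - z⟫ * (cr (s - z) q / ‖s - z‖ ^ 2)) := by
  have h1 : 0 < ‖s - z‖ := norm_pos_iff.2 (sub_ne_zero.2 hzs.symm)
  rw [outerNormal_eq hzs hcr, edgeDir, real_inner_smul_left, real_inner_smul_right]
  have e1 : -⟪p, rot (s - z)⟫ * ⟪s - z, q⟫ = ‖s - z‖ ^ 2 * ⟪rot p, q⟫ - ⟪p, s - z⟫ * cr (s - z) q := by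
    rw [norm_sq_eq, inner_eq, inner_eq, inner_eq, inner_eq, cr]
    simp [rot]; ring
  have e2 : (⟪rot p, q⟫ - ⟪p, s - z⟫ * (cr (s - z) q / ‖s - z‖ ^ 2)) =
      (-⟪p, rot (s - z)⟫ * ⟪s - z, q⟫) / ‖s - z‖ ^ 2 := by
    rw [e1]; field_simp
  rw [e2]
  field_simp

namespace Triangulation

/-- The jump across an edge in terms of the rotated gradients on the two adjacent triangles; the
tangential parts cancel, since `v` is continuous. -/
lemma jump_mul_inner (hΩ : IsOpen Ω) (hv : Δ.IsFE v) (hs : s ∈ Δ.innerNbrs z)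
    (q : Plane) : Δ.jump v z s * ⟪edgeDir z s, q⟫ =
      ∑ T ∈ (Δ.star z).filter (fun T => s ∈ T), ∑ c ∈ T \ {z, s},
        cr (s - z) (c - z) / |cr (s - z) (c - z)| * ⟪rot (elemGrad v T), q⟫ := by
  classical
  obtain ⟨b, b', hT, hT', hpos, hneg, huniq⟩ := exists_two_sides hΩ hs
  have hne : ({z, s, b} : Finset Plane) ≠ {z, s, b'} := by
    intro h
    have : b ∈ ({z, s, b'} : Finset Plane) := by rw [← h]; simp
    simp only [mem_insert, mem_singleton] at this
    rcases this with h | h | h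
    · exact hT.hzb h.symm
    · exact hT.hab h.symm
    · rw [h] at hpos; linarith
  have hfil : (Δ.star z).filter (fun T => s ∈ T) = {{z, s, b}, {z, s, b'}} := by
    ext T
    simp only [mem_filter, mem_insert, mem_singleton]
    constructor
    · rintro ⟨h1, h2⟩; exact huniq T h1 h2
    · rintro (rfl | rfl)
      · exact ⟨hT.mem_star, by simp⟩
      · exact ⟨hT'.mem_star, by simp⟩
  have hd : ∀ {c}, Δ.IsTri z s c → ⟪elemGrad v {z, s, c}, s - z⟫ = v s - v z := fun {c} h =>
    (hv.sub_eq h.mem_triangles (subset_convexHull ℝ _ (by simp))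
      (subset_convexHull ℝ _ (by simp))).symm
  rw [jump, hfil, Finset.sum_pair hne, Finset.sum_pair hne, sum_opposite hT, sum_opposite hT',
    sum_opposite hT, sum_opposite hT', add_mul, inner_outerNormal_mul hT.hza hT.cr_ne,
    inner_outerNormal_mul hT'.hza hT'.cr_ne, hd hT, hd hT', abs_of_pos hpos, abs_of_neg hneg,
    div_neg, div_self hpos.ne', div_self hneg.ne]
  ring

/-- The jumps on the edges `zs`, `s ∈ X`, weighted by the unit vectors along these edges, are in
equilibrium in the direction `q`, provided that the triangles that contain only one of the edges
contribute nothing. -/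
lemma sum_jump_inner (hΩ : IsOpen Ω) (hv : Δ.IsFE v) {X : Finset Plane}
    (hX : ∀ s ∈ X, s ∈ Δ.innerNbrs z)
    (h : ∀ a b, Δ.IsTri z a b → a ∈ X → b ∉ X → ⟪rot (elemGrad v {z, a, b}), q⟫ = 0) :
    ∑ s ∈ X, Δ.jump v z s * ⟪edgeDir z s, q⟫ = 0 := by
  classical
  rw [sum_congr rfl fun s hs => jump_mul_inner hΩ hv (hX s hs) q]
  rw [Finset.sum_comm' (t' := Δ.star z) (s' := fun T => X.filter (fun s => s ∈ T))
    (by intro s T; simp only [mem_filter]; tauto)]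
  refine Finset.sum_eq_zero fun T hT => ?_
  obtain ⟨a, b, hab, rfl⟩ := exists_isTri_of_mem_star hT
  have hzX : z ∉ X := fun hz => (mem_nbrs_edge (mem_innerNbrs.1 (hX z hz)).1).2.1 rfl
  have h1 : X.filter (fun s => s ∈ ({z, a, b} : Finset Plane)) =
      ({z, a, b} : Finset Plane).filter (fun s => s ∈ X) := by
    ext s; simp only [mem_filter]; tauto
  have hba : ({z, a, b} : Finset Plane) = {z, b, a} := by
    ext s; simp only [mem_insert, mem_singleton]; tauto
  have hb : ∑ c ∈ ({z, a, b} : Finset Plane) \ {z, b}, cr (b - z) (c - z) / |cr (b - z) (c - z)| *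
      ⟪rot (elemGrad v {z, a, b}), q⟫ =
      cr (b - z) (a - z) / |cr (b - z) (a - z)| * ⟪rot (elemGrad v {z, a, b}), q⟫ := by
    conv_lhs => rw [show ({z, a, b} : Finset Plane) \ {z, b} = {z, b, a} \ {z, b} by rw [hba]]
    rw [sum_opposite hab.swap]
  rw [h1, Finset.sum_filter, sum_triple hab.hza hab.hzb hab.hab, if_neg hzX, zero_add, hb,
    sum_opposite hab]
  have hsw : ⟪rot (elemGrad v {z, b, a}), q⟫ = ⟪rot (elemGrad v {z, a, b}), q⟫ := by rw [hba]
  by_cases ha' : a ∈ X <;> by_cases hb' : b ∈ X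
  · rw [if_pos ha', if_pos hb', cr_comm (b - z), abs_neg]; ring
  · rw [h a b hab ha' hb']; simp
  · rw [← hsw, h b a hab.swap hb' ha']; simp
  · rw [if_neg ha', if_neg hb', add_zero]

lemma jump_comm (hs : s ∈ Δ.nbrs z) : Δ.jump v s z = Δ.jump v z s := by
  classical
  have h1 : (Δ.star s).filter (fun T => z ∈ T) = (Δ.star z).filter (fun T => s ∈ T) := by
    ext T; simp only [mem_filter, mem_star]; tauto
  rw [jump, jump, h1]
  refine sum_congr rfl fun T hT => ?_
  obtain ⟨hT, hsT⟩ := Finset.mem_filter.1 hT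
  obtain ⟨b, hb, rfl⟩ := exists_isTri (Δ.star_subset hT) (Δ.mem_star.1 hT).2 hsT (mem_nbrs_edge hs).2.1
  rw [show ({z, s, b} : Finset Plane) \ {s, z} = {z, s, b} \ {z, s} by rw [Finset.pair_comm s z],
    sum_opposite hb, sum_opposite hb, outerNormal_comm hb.hza hb.cr_ne]

lemma abs_jump_le (hs : s ∈ Δ.innerNbrs z) : |Δ.jump v z s| ≤ Δ.maxJump v z :=
  le_ciSup (f := fun z' : {z' // z' ∈ Δ.innerNbrs z} => |Δ.jump v z z'|)
    (Set.finite_range _).bddAbove ⟨s, hs⟩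

lemma maxJump_nonneg (z : Plane) : 0 ≤ Δ.maxJump v z := Real.iSup_nonneg fun _ => abs_nonneg _

end Triangulation

/-! ### Trace estimates of the moments -/

/-- The regularity of `g²` on the closure of `Ω`, in terms of `g` and its gradient `Dg`. -/
abbrev SobSq (Ω : Set Plane) (g : Plane → ℝ) (Dg : Plane → Plane) : Prop :=
  Sob (closure Ω) (fun x => g x ^ 2) (fun x => (2 * g x) • Dg x)

/-- The weighted mean of `g²` along the segment `zs`. -/
noncomputable def edgeSq (g : Plane → ℝ) (z s : Plane) : ℝ :=
  ∫ t in 0..1, (1 - t) * g (lineMap z s t) ^ 2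

namespace Triangulation

/-- The right-hand side of the multiplicative trace inequality on the patch of `z`. -/
noncomputable def traceTerm (Δ : Triangulation Ω) (h : ℝ) (z : Plane) (g : Plane → ℝ) (Dg : Plane → Plane) : ℝ :=
  (∫ x in Δ.patch z, g x ^ 2) / h + ∫ x in Δ.patch z, ‖(2 * g x) • Dg x‖

lemma edgeSq_nonneg (g : Plane → ℝ) (z s : Plane) : 0 ≤ edgeSq g z s :=
  intervalIntegral.integral_nonneg zero_le_one fun _ ht =>
    mul_nonneg (by linarith [ht.2]) (sq_nonneg _)

lemma edgeSq_le_add {F G : ℝ → ℝ} (hF : ContinuousOn F (Icc 0 1)) (hG : ContinuousOn G (Icc 0 1)) :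
    ∫ t in 0..1, (1 - t) * F t ≤ (∫ t in 0..1, (1 - t) * G t) + ∫ t in 0..1, |F t - G t| := by
  rw [← intervalIntegral.integral_add (f := fun t : ℝ => (1 - t) * G t) (g := fun t : ℝ => |F t - G t|)
    (intervalIntegrable_of_Icc (ContinuousOn.mul (by fun_prop) hG))
    (intervalIntegrable_of_Icc (hF.sub hG).abs)]
  refine integral_mono_on zero_le_one
    (intervalIntegrable_of_Icc (ContinuousOn.mul (by fun_prop) hF))
    (intervalIntegrable_of_Icc (ContinuousOn.add (ContinuousOn.mul (by fun_prop) hG) (hF.sub hG).abs))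
    fun t ht => ?_
  have h1 := le_abs_self (F t - G t)
  have h2 := abs_nonneg (F t - G t)
  nlinarith [ht.1, ht.2]

lemma rayMean_sq_le (hg : ContinuousOn (fun t : ℝ => g (lineMap z x t)) (Icc 0 1)) :
    rayMean g 0 z x ^ 2 ≤ edgeSq g z x := by
  have := sq_integral_hat_le (F := fun t => g (lineMap z x t)) hg
  simpa only [rayMean, sub_zero, edgeSq] using this

lemma isCompact_closure_of (Δ : Triangulation Ω) : IsCompact (closure Ω) := by
  rw [← biUnion_cell (Δ := Δ)]
  exact Finset.isCompact_biUnion _ fun T _ => isCompact_cell T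

namespace AnisoAt
variable (A : Δ.AnisoAt B z e h H)
include A

omit A in
lemma traceTerm_nonneg (hh : 0 < h) : 0 ≤ Δ.traceTerm h z g Dg :=
  add_nonneg (div_nonneg (integral_nonneg fun _ => sq_nonneg _) hh.le)
    (integral_nonneg fun _ => norm_nonneg _)

lemma edgeSq_le (hg : SobSq Ω g Dg)
    (hT : Δ.IsTri z s b) :
    edgeSq g z s ≤ B / (h * H) * ((∫ x in Δ.patch z, g x ^ 2) +
      ‖b - z‖ * ∫ x in Δ.patch z, ‖(2 * g x) • Dg x‖) := by
  obtain ⟨hB, _, hh, hH⟩ := A.pos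
  have hcl : convexHull ℝ {z, s, b} ⊆ closure Ω := by
    rw [← cell_eq]; exact cell_subset_closure hT.mem
  have h1 := (hg.mono hcl).trace hT.cr_ne
  simp only [abs_of_nonneg (sq_nonneg (g _))] at h1
  refine h1.trans (mul_le_mul (A.inv_cr_le hT) ?_ ?_ (by positivity))
  · refine add_le_add ?_ (mul_le_mul_of_nonneg_left ?_ (norm_nonneg _))
    · exact setIntegral_patch_mono hT.mem_star (hg.continuousOn.integrableOn_compact Δ.isCompact_closure_of) (fun _ => sq_nonneg _) (by rw [cell_eq])
    · exact setIntegral_patch_mono hT.mem_star hg.integrableOn.norm (fun _ => norm_nonneg _)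
        (by rw [cell_eq])
  · exact add_nonneg (integral_nonneg fun _ => sq_nonneg _)
      (mul_nonneg (norm_nonneg _) (integral_nonneg fun _ => norm_nonneg _))

/-- The trace on a long edge that forms a triangle with a short edge. -/
lemma edgeSq_le_of_partner_short
    (hg : SobSq Ω g Dg)
    (hT : Δ.IsTri z s b) (hb : ‖b - z‖ ≤ B * h) :
    edgeSq g z s ≤ B ^ 2 / H * Δ.traceTerm h z g Dg := by
  obtain ⟨hB, hB1, hh, hH⟩ := A.pos
  refine (A.edgeSq_le hg hT).trans ?_
  rw [traceTerm]
  have hN : 0 ≤ ∫ x in Δ.patch z, g x ^ 2 := integral_nonneg fun _ => sq_nonneg _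
  have hS : 0 ≤ ∫ x in Δ.patch z, ‖(2 * g x) • Dg x‖ := integral_nonneg fun _ => norm_nonneg _
  set N := ∫ x in Δ.patch z, g x ^ 2
  set S := ∫ x in Δ.patch z, ‖(2 * g x) • Dg x‖
  have h1 : ‖b - z‖ * S ≤ B * h * S := by gcongr
  calc B / (h * H) * (N + ‖b - z‖ * S) ≤ B / (h * H) * (B * N + B * h * S) :=
        mul_le_mul_of_nonneg_left (by nlinarith) (by positivity)
    _ = B ^ 2 / H * (N / h + S) := by field_simp

lemma norm_sq_mul_edgeSq_le_of_short
    (hg : SobSq Ω g Dg)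
    (hs : s ∈ Δ.nbrs z) (hsh : ‖s - z‖ ≤ B * h) :
    ‖s - z‖ ^ 2 * edgeSq g z s ≤ H * Δ.traceTerm h z g Dg := by
  obtain ⟨hB, _, hh, hH⟩ := A.pos
  obtain ⟨b, hT⟩ := exists_isTri_of_mem_nbrs hs
  have h1 := A.edgeSq_le hg hT
  have hbH := A.norm_sub_le hT.swap.mem_nbrs
  rw [traceTerm]
  have hN : 0 ≤ ∫ x in Δ.patch z, g x ^ 2 := integral_nonneg fun _ => sq_nonneg _
  have hS : 0 ≤ ∫ x in Δ.patch z, ‖(2 * g x) • Dg x‖ := integral_nonneg fun _ => norm_nonneg _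
  set N := ∫ x in Δ.patch z, g x ^ 2
  set S := ∫ x in Δ.patch z, ‖(2 * g x) • Dg x‖
  have hhH : h ≤ H := by have := A.small_of_le (k := 0) (by norm_num); linarith
  have h2 : B / (h * H) * (N + ‖b - z‖ * S) ≤ B / h * (N / h + S) := by
    have h3 : N + ‖b - z‖ * S ≤ H * (N / h + S) := by
      have h4 : N ≤ H * (N / h) := by rw [← mul_div_assoc, le_div_iff₀ hh]; nlinarith
      have := mul_le_mul_of_nonneg_right hbH hS
      linarith
    calc _ ≤ B / (h * H) * (H * (N / h + S)) := by gcongr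
      _ = _ := by field_simp
  have h3 : ‖s - z‖ ^ 2 ≤ (B * h) ^ 2 := pow_le_pow_left₀ (norm_nonneg _) hsh 2
  have hW : 0 ≤ N / h + S := by positivity
  calc _ ≤ (B * h) ^ 2 * (B / h * (N / h + S)) :=
        mul_le_mul h3 (h1.trans h2) (edgeSq_nonneg _ _ _) (by positivity)
    _ = (B ^ 3 * h) * (N / h + S) := by field_simp
    _ ≤ _ := by gcongr; exact A.small_of_le (by norm_num)

/-- The traces on the long edges of one side, at most one of which may lie on the boundary. -/
lemma edgeSq_le_of_right (hΩ : IsOpen Ω) (hc : ContinuousOn g (closure Ω))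
    (hg : SobSq Ω g Dg)
    (hg0 : ∀ x ∈ frontier Ω, g x = 0) (hd : Δ.IsRight B z e H d)
    (hin : ∀ s, Δ.IsRight B z e H s → s ≠ d → s ∈ Δ.innerNbrs z)
    (hcr : Δ.IsRight B z e H c) : edgeSq g z c ≤ 2 * B ^ 3 / H * Δ.traceTerm h z g Dg := by
  obtain ⟨hB, _, hh, hH⟩ := A.pos
  have hW : 0 ≤ Δ.traceTerm h z g Dg := traceTerm_nonneg hh
  have hSW : ∫ x in Δ.patch z, ‖(2 * g x) • Dg x‖ ≤ Δ.traceTerm h z g Dg :=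
    le_add_of_nonneg_left (div_nonneg (integral_nonneg fun _ => sq_nonneg _) hh.le)
  have key : ∀ d', Δ.IsRight B z e H d' → (∀ s, Δ.IsRight B z e H s → s ≠ d' → s ∈ Δ.innerNbrs z) →
      edgeSq g z c ≤ edgeSq g z d' + B ^ 3 / H * Δ.traceTerm h z g Dg := by
    intro d' hd' hin'
    have h1 := A.right_edge_dist hΩ hg hd' hin' hcr
    have h2 := edgeSq_le_add (F := fun t => g (lineMap z c t) ^ 2)
      (G := fun t => g (lineMap z d' t) ^ 2)
      ((continuousOn_nbr_edge hc hcr.mem).pow 2) ((continuousOn_nbr_edge hc hd'.mem).pow 2)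
    have h3 := mul_le_mul_of_nonneg_left hSW (by positivity : 0 ≤ B ^ 3 / H)
    rw [edgeSq, edgeSq]
    linarith
  by_cases hdi : d ∈ Δ.innerNbrs z
  · have hall : ∀ s, Δ.IsRight B z e H s → s ∈ Δ.innerNbrs z := fun s hs => by
      by_cases h : s = d
      · rw [h]; exact hdi
      · exact hin s hs h
    obtain ⟨d', s, hd', hT, hs⟩ := A.exists_right_short hΩ hall hd
    have h1 := key d' hd' fun s hs _ => hall s hs
    have h2 := A.edgeSq_le_of_partner_short hg hT.swap hs
    have h3 : B ^ 2 / H * Δ.traceTerm h z g Dg ≤ B ^ 3 / H * Δ.traceTerm h z g Dg :=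
      mul_le_mul_of_nonneg_right (div_le_div_of_nonneg_right (A.B_pow_le 2 3 (by norm_num)) hH.le) hW
    rw [show 2 * B ^ 3 / H * Δ.traceTerm h z g Dg = B ^ 3 / H * Δ.traceTerm h z g Dg +
      B ^ 3 / H * Δ.traceTerm h z g Dg by ring]
    linarith
  · have hf : segment ℝ z d ⊆ frontier Ω := by
      by_contra hcon; exact hdi (mem_innerNbrs.2 ⟨hd.mem, hcon⟩)
    have h0 : edgeSq g z d = 0 := by
      rw [edgeSq, intervalIntegral.integral_congr (g := fun _ => (0 : ℝ))]
      · simp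
      · intro t ht
        rw [uIcc_of_le zero_le_one] at ht
        simp [hg0 _ (hf (lineMap_mem_segment ht))]
    have h1 := key d hd hin
    have h2 : 0 ≤ B ^ 3 / H * Δ.traceTerm h z g Dg := by positivity
    rw [show 2 * B ^ 3 / H * Δ.traceTerm h z g Dg = B ^ 3 / H * Δ.traceTerm h z g Dg +
      B ^ 3 / H * Δ.traceTerm h z g Dg by ring]
    linarith

/-- A mean along a ray in terms of the traces on the long edges. -/
lemma rayMean_sq_le_of_compare (hc : ContinuousOn g (closure Ω))
    (hg : SobSq Ω g Dg) {τ : ℝ}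
    (hx : x ∈ Δ.patch z) (hr : Δ.RayCompare B z e h H x c τ)
    (hle : edgeSq g z c ≤ 2 * B ^ 3 / H * Δ.traceTerm h z g Dg) :
    rayMean g 0 z x ^ 2 ≤ B ^ 4 / H * Δ.traceTerm h z g Dg := by
  obtain ⟨hB, hB1, hh, hH⟩ := A.pos
  have hW : 0 ≤ Δ.traceTerm h z g Dg := traceTerm_nonneg hh
  have hSW : ∫ x in Δ.patch z, ‖(2 * g x) • Dg x‖ ≤ Δ.traceTerm h z g Dg :=
    le_add_of_nonneg_left (div_nonneg (integral_nonneg fun _ => sq_nonneg _) hh.le)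
  have h0 := rayMean_sq_le (continuousOn_ray hc hx)
  have h1 := hr.dist_le _ _ hg
  have h2 := edgeSq_le_add (F := fun t => g (lineMap z x t) ^ 2)
    (G := fun t => g (lineMap z c (τ * t)) ^ 2)
    ((continuousOn_ray hc hx).pow 2) ((continuousOn_ray_mul hc hr.right.mem hr.pos hr.le_one).pow 2)
  have h3 : τ ^ 2 * ∫ t in 0..1, (1 - t) * g (lineMap z c (τ * t)) ^ 2 ≤ edgeSq g z c :=
    integral_hat_comp_mul_le (F := fun t => g (lineMap z c t) ^ 2)
      ((continuousOn_nbr_edge hc hr.right.mem).pow 2) (fun _ _ => sq_nonneg _) hr.pos hr.le_one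
  have h4 : 0 ≤ ∫ t in 0..1, (1 - t) * g (lineMap z c (τ * t)) ^ 2 :=
    intervalIntegral.integral_nonneg zero_le_one fun _ ht =>
      mul_nonneg (by linarith [ht.2]) (sq_nonneg _)
  have h5 : (1 : ℝ) ≤ 4 * τ ^ 2 := by nlinarith [hr.one_le]
  have h6 : ∫ t in 0..1, (1 - t) * g (lineMap z c (τ * t)) ^ 2 ≤
      4 * (2 * B ^ 3 / H * Δ.traceTerm h z g Dg) := by
    have := mul_le_mul_of_nonneg_right h5 h4
    linarith
  have h7 := mul_le_mul_of_nonneg_left hSW (by positivity : 0 ≤ B ^ 3 / H)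
  have h8 : 9 * (B ^ 3 / H * Δ.traceTerm h z g Dg) ≤ B ^ 4 / H * Δ.traceTerm h z g Dg := by
    rw [show B ^ 4 / H * Δ.traceTerm h z g Dg = B * (B ^ 3 / H * Δ.traceTerm h z g Dg) by ring]
    gcongr; linarith
  rw [edgeSq] at h0
  have h9 : 4 * (2 * B ^ 3 / H * Δ.traceTerm h z g Dg) = 8 * (B ^ 3 / H * Δ.traceTerm h z g Dg) := by
    ring
  linarith

/-- Bounds of `k` and of the means on the long edges suffice, as short edges are covered by the trace
inequality. -/
lemma sq_edgeMoment_le (hc : ContinuousOn g (closure Ω))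
    (hg : SobSq Ω g Dg)
    (hk : k ^ 2 ≤ 4 * (B ^ 4 / H * Δ.traceTerm h z g Dg)) (hs : s ∈ Δ.nbrs z)
    (hlong : H ≤ B * ‖s - z‖ → edgeSq g z s ≤ 2 * B ^ 3 / H * Δ.traceTerm h z g Dg) :
    edgeMoment g k z s ^ 2 ≤ B ^ 5 * (H * Δ.traceTerm h z g Dg) := by
  obtain ⟨hB, hB1, hh, hH⟩ := A.pos
  have hW : 0 ≤ Δ.traceTerm h z g Dg := traceTerm_nonneg hh
  set W := Δ.traceTerm h z g Dg
  have hsH : ‖s - z‖ ^ 2 ≤ H ^ 2 := pow_le_pow_left₀ (norm_nonneg _) (A.norm_sub_le hs) 2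
  have hB3 : 1 ≤ B ^ 3 := one_le_pow₀ (by linarith)
  have h1 : ‖s - z‖ ^ 2 * edgeSq g z s ≤ 2 * B ^ 3 * (H * W) := by
    rcases A.short_or_long hs with h | h
    · refine (A.norm_sq_mul_edgeSq_le_of_short hg hs h).trans ?_
      have : 0 ≤ H * W := by positivity
      nlinarith
    · calc _ ≤ H ^ 2 * (2 * B ^ 3 / H * W) := mul_le_mul hsH (hlong h) (edgeSq_nonneg _ _ _) (by positivity)
        _ = _ := by field_simp
  have h2 : ‖s - z‖ ^ 2 * k ^ 2 ≤ 4 * B ^ 4 * (H * W) := by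
    calc _ ≤ H ^ 2 * (4 * (B ^ 4 / H * W)) := mul_le_mul hsH hk (sq_nonneg _) (by positivity)
      _ = _ := by field_simp
  have hcs := continuousOn_nbr_edge hc hs
  rw [edgeMoment_eq, rayMean_sub hcs k 0, mul_pow]
  have h3 := mul_le_mul_of_nonneg_left (rayMean_sq_le hcs) (sq_nonneg ‖s - z‖)
  have h4 : ‖s - z‖ ^ 2 * (rayMean g 0 z s - (k - 0) / 2) ^ 2 ≤
      2 * (‖s - z‖ ^ 2 * rayMean g 0 z s ^ 2) + (‖s - z‖ ^ 2 * k ^ 2) / 2 := by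
    have : (rayMean g 0 z s - (k - 0) / 2) ^ 2 ≤ 2 * rayMean g 0 z s ^ 2 + k ^ 2 / 2 := by
      nlinarith [sq_nonneg (rayMean g 0 z s + k / 2)]
    nlinarith [mul_le_mul_of_nonneg_left this (sq_nonneg ‖s - z‖)]
  have h5 : 4 * B ^ 3 * (H * W) + 2 * B ^ 4 * (H * W) ≤ B ^ 5 * (H * W) := by
    rw [← add_mul]
    gcongr ?_ * _
    have : 0 ≤ B ^ 3 * (B ^ 2 - 2 * B - 4) := mul_nonneg (by positivity) (by nlinarith)
    linarith [show B ^ 3 * (B ^ 2 - 2 * B - 4) = B ^ 5 - 2 * B ^ 4 - 4 * B ^ 3 by ring]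
  linarith

/-- At an interior node, where `k` is the average along a bent line. -/
lemma sq_edgeMoment_le_of_average (hΩ : IsOpen Ω) (hin : ∀ s ∈ Δ.nbrs z, s ∈ Δ.innerNbrs z)
    (hc : ContinuousOn g (closure Ω))
    (hg : SobSq Ω g Dg)
    (hg0 : ∀ x ∈ frontier Ω, g x = 0)
    (hr : Δ.AverageRays B z e H g k x x' d d') (hs : s ∈ Δ.nbrs z) :
    edgeMoment g k z s ^ 2 ≤ B ^ 5 * (H * Δ.traceTerm h z g Dg) := by
  obtain ⟨hB, _, hh, hH⟩ := A.pos
  have hW : 0 ≤ Δ.traceTerm h z g Dg := traceTerm_nonneg hh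
  have hinr : ∀ {f : Plane}, ∀ c, Δ.IsRight B z f H c → c ∈ Δ.innerNbrs z := fun c hc => hin c hc.mem
  have hR := fun {c : Plane} (hcr : Δ.IsRight B z e H c) =>
    A.edgeSq_le_of_right hΩ hc hg hg0 hr.right (fun s hs _ => hinr s hs) hcr
  have hL := fun {c : Plane} (hcr : Δ.IsRight B z (-e) H c) =>
    A.neg.edgeSq_le_of_right hΩ hc hg hg0 hr.left (fun s hs _ => hinr s hs) hcr
  obtain ⟨c, τ, hcmp⟩ := A.ray_compare hΩ hinr hr.mem hr.right hr.inner_eq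
  obtain ⟨c', τ', hcmp'⟩ := A.neg.ray_compare hΩ hinr hr.mem' hr.left
    (by rw [inner_neg_left, inner_neg_left, hr.inner_eq'])
  have h1 := A.rayMean_sq_le_of_compare hc hg hr.mem hcmp (hR hcmp.right)
  have h2 := A.neg.rayMean_sq_le_of_compare hc hg hr.mem' hcmp' (hL hcmp'.right)
  refine A.sq_edgeMoment_le hc hg ?_ hs fun hl => ?_
  · set E := B ^ 4 / H * Δ.traceTerm h z g Dg
    have hE : 0 ≤ E := by positivity
    have h3 := abs_sub_le_of_average (m := 0) (continuousOn_ray hc hr.mem) (continuousOn_ray hc hr.mem')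
      (by rw [hr.inner_eq]; exact hr.right.pos)
      (by rw [hr.inner_eq', ← inner_neg_left]; exact hr.left.pos) hr.average (Real.abs_le_sqrt h1)
      (Real.abs_le_sqrt h2)
    rw [sub_zero] at h3
    have h4 := pow_le_pow_left₀ (abs_nonneg k) h3 2
    rwa [sq_abs, mul_pow, sq_sqrt hE, show (2 : ℝ) ^ 2 = 4 by norm_num] at h4
  · rcases A.right_or_left hs hl with h | h
    · exact hR h
    · exact hL h

/-- At a boundary node, where each side contains at most one long edge on the boundary. -/
lemma sq_edgeMoment_le_of_boundary (hΩ : IsOpen Ω) (hc : ContinuousOn g (closure Ω))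
    (hg : SobSq Ω g Dg)
    (hg0 : ∀ x ∈ frontier Ω, g x = 0)
    (hone : ∀ f ∈ ({e, -e} : Set Plane), ∀ c c', Δ.IsRight B z f H c → Δ.IsRight B z f H c' →
      c ∉ Δ.innerNbrs z → c' ∉ Δ.innerNbrs z → c = c') (hs : s ∈ Δ.nbrs z) :
    edgeMoment g 0 z s ^ 2 ≤ B ^ 5 * (H * Δ.traceTerm h z g Dg) := by
  obtain ⟨hB, _, hh, hH⟩ := A.pos
  have hW : 0 ≤ Δ.traceTerm h z g Dg := traceTerm_nonneg hh
  refine A.sq_edgeMoment_le hc hg (by rw [zero_pow two_ne_zero]; positivity) hs fun hl => ?_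
  have key : ∀ f ∈ ({e, -e} : Set Plane), Δ.AnisoAt B z f h H → Δ.IsRight B z f H s →
      edgeSq g z s ≤ 2 * B ^ 3 / H * Δ.traceTerm h z g Dg := by
    intro f hf A' hsf
    by_cases hex : ∃ d, Δ.IsRight B z f H d ∧ d ∉ Δ.innerNbrs z
    · obtain ⟨d, hd, hdn⟩ := hex
      refine A'.edgeSq_le_of_right hΩ hc hg hg0 hd (fun c hc hne => ?_) hsf
      by_contra hcn
      exact hne (hone f hf c d hc hd hcn hdn)
    · push Not at hex
      exact A'.edgeSq_le_of_right hΩ hc hg hg0 hsf (fun c hc _ => hex c hc) hsf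
  rcases A.right_or_left hs hl with h | h
  · exact key e (by simp) A h
  · exact key (-e) (by simp) A.neg h

end AnisoAt
end Triangulation

/-! ### Boundary nodes -/

namespace Triangulation

lemma eq_smul_of_segment_subset_frontier {v : Plane} {r : ℝ} (hr : 0 < r)
    (hv : ∀ x ∈ Metric.ball z r, x ∈ frontier Ω ↔ ∃ t : ℝ, x = z + t • v)
    (hs : segment ℝ z s ⊆ frontier Ω) : ∃ t : ℝ, s - z = t • v := by
  obtain ⟨τ, hτ0, hτ1, hτ⟩ : ∃ τ : ℝ, 0 < τ ∧ τ ≤ 1 ∧ τ * ‖s - z‖ < r := by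
    refine ⟨min 1 (r / (‖s - z‖ + 1)), by positivity, min_le_left _ _, ?_⟩
    have h1 : min 1 (r / (‖s - z‖ + 1)) * (‖s - z‖ + 1) ≤ r := by
      rw [← le_div_iff₀ (by positivity)]; exact min_le_right _ _
    have h2 : 0 < min 1 (r / (‖s - z‖ + 1)) := by positivity
    nlinarith
  have h1 : lineMap z s τ ∈ Metric.ball z r := by
    rw [Metric.mem_ball, dist_lineMap_left, Real.norm_of_nonneg hτ0.le, dist_comm, dist_eq_norm]
    exact hτ
  obtain ⟨t, ht⟩ := (hv _ h1).1 (hs (lineMap_mem_segment ⟨hτ0.le, hτ1⟩))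
  refine ⟨t / τ, ?_⟩
  rw [lineMap_apply, vsub_eq_sub, vadd_eq_add, add_comm z] at ht
  rw [div_eq_inv_mul, mul_smul, ← add_right_cancel ht, inv_smul_smul₀ hτ0.ne']

lemma mem_of_mem_cell (hz : z ∈ Δ.nodes) {E : Finset Plane} (hE : E ∈ Δ.faces)
    (h : z ∈ cell E) : z ∈ E := by
  obtain ⟨T, hT, hzT⟩ := Δ.mem_nodes.1 hz
  have hzf : ({z} : Finset Plane) ∈ Δ.faces :=
    Δ.down_closed (Δ.mem_triangles.1 hT).1 (by simpa using hzT) (by simp)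
  have h1 := Δ.inter_subset_convexHull hzf hE ⟨by simp, h⟩
  by_contra hcon
  have : ((({z} : Finset Plane) : Set Plane) ∩ (E : Set Plane)) = ∅ := by
    ext x
    simp only [Finset.coe_singleton, Set.mem_inter_iff, Set.mem_singleton_iff, Finset.mem_coe,
      Set.mem_empty_iff_false, iff_false, not_and]
    rintro rfl; exact hcon
  rw [this, convexHull_empty] at h1
  exact h1

/-- If the boundary is straight near the node `z`, it contains edges at `z` in both directions. -/
lemma exists_frontier_nbr {v : Plane} (hz : z ∈ Δ.nodes) (hv0 : v ≠ 0) {r : ℝ} (hr : 0 < r)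
    (hv : ∀ x ∈ Metric.ball z r, x ∈ frontier Ω ↔ ∃ t : ℝ, x = z + t • v) :
    ∃ s ∈ Δ.nbrs z, segment ℝ z s ⊆ frontier Ω ∧ ∃ l : ℝ, 0 < l ∧ s - z = l • v := by
  classical
  have hvp : 0 < ‖v‖ := norm_pos_iff.2 hv0
  set τ : ℕ → ℝ := fun n => r / (2 * ‖v‖) / (n + 1) with hτ
  have hτ0 : ∀ n, 0 < τ n := fun n => by positivity
  have hlim : Tendsto τ atTop (𝓝 0) := by
    have := (tendsto_one_div_add_atTop_nhds_zero_nat (𝕜 := ℝ)).const_mul (r / (2 * ‖v‖))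
    rw [mul_zero] at this
    refine this.congr fun n => ?_
    rw [hτ]; ring
  have hmem : ∀ n, z + τ n • v ∈ frontier Ω := by
    intro n
    refine (hv _ ?_).2 ⟨_, rfl⟩
    rw [Metric.mem_ball, dist_eq_norm, add_sub_cancel_left, norm_smul, Real.norm_of_nonneg (hτ0 n).le]
    have h1 : τ n ≤ r / (2 * ‖v‖) := div_le_self (by positivity) (by linarith [n.cast_nonneg (α := ℝ)])
    calc τ n * ‖v‖ ≤ r / (2 * ‖v‖) * ‖v‖ := mul_le_mul_of_nonneg_right h1 hvp.le
      _ = r / 2 := by field_simp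
      _ < r := by linarith
  choose E hE hcard hxE hEf using fun n => Δ.frontier_edges _ (hmem n)
  -- one of the finitely many edges contains infinitely many of these points
  obtain ⟨F, hF⟩ : ∃ F, ∃ᶠ n in atTop, E n = F := by
    have : Finite Δ.faces := Δ.finite_faces
    obtain ⟨F, hF⟩ := Finite.exists_infinite_fiber (fun n => (⟨E n, hE n⟩ : Δ.faces))
    refine ⟨F, Nat.frequently_atTop_iff_infinite.2 ?_⟩
    rw [Set.infinite_coe_iff] at hF
    refine hF.mono fun n hn => ?_
    have : (⟨E n, hE n⟩ : Δ.faces) = F := hn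
    exact congrArg Subtype.val this
  have hz2 : z ∈ cell F := by
    have h1 : Tendsto (fun n => z + τ n • v) atTop (𝓝 z) := by
      have := (hlim.smul_const v).const_add z
      simpa using this
    refine (isCompact_cell F).isClosed.mem_of_frequently_of_tendsto ?_ h1
    exact hF.mono fun n hn => by rw [← hn]; exact hxE n
  obtain ⟨n, rfl⟩ := hF.exists
  have hzE := mem_of_mem_cell hz (hE n) hz2
  obtain ⟨s, hs⟩ : ∃ s, E n = {z, s} := by
    obtain ⟨a, b, -, hab⟩ := Finset.card_eq_two.1 (hcard n)
    rw [hab] at hzE ⊢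
    simp only [mem_insert, mem_singleton] at hzE
    rcases hzE with rfl | rfl
    · exact ⟨b, rfl⟩
    · exact ⟨a, Finset.pair_comm _ _⟩
  have hzs : z ≠ s := by
    rintro rfl
    have := hcard n
    rw [hs] at this
    simp at this
  have hsf : ({z, s} : Finset Plane) ∈ Δ.faces := by rw [← hs]; exact hE n
  have hseg : convexHull ℝ ((E n : Finset Plane) : Set Plane) = segment ℝ z s := by
    rw [hs, Finset.coe_insert, Finset.coe_singleton, convexHull_pair]
  have hsn : s ∈ Δ.nbrs z := by
    obtain ⟨T, hT, hT3, hsub⟩ := Δ.pure _ hsf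
    have h1 : s ∈ Δ.nodes := Δ.mem_nodes.2 ⟨T, Δ.mem_triangles.2 ⟨hT, hT3⟩, hsub (by simp)⟩
    simp only [nbrs, mem_filter]
    exact ⟨h1, hzs.symm, hsf⟩
  have h1 := hxE n
  rw [hseg, segment_eq_image_lineMap] at h1
  obtain ⟨t, ht, hts⟩ := h1
  rw [lineMap_apply, vsub_eq_sub, vadd_eq_add, add_comm z] at hts
  have h2 := add_right_cancel hts
  have h2' : t • (s - z) = τ n • v := by rw [h2]
  have ht0 : 0 < t := by
    refine lt_of_le_of_ne ht.1 fun h0 => ?_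
    rw [← h0, zero_smul] at h2'
    exact smul_ne_zero (hτ0 n).ne' hv0 h2'.symm
  refine ⟨s, hsn, by rw [← hseg]; exact hEf n, τ n / t, div_pos (hτ0 n) ht0, ?_⟩
  rw [div_eq_inv_mul, mul_smul, ← h2', inv_smul_smul₀ ht0.ne']

namespace AnisoAt
variable (A : Δ.AnisoAt B z e h H)
include A

/-- A boundary node with boundary edges in the directions of `e` and `-e`. -/
lemma isRight_of_cr (hs : s ∈ Δ.nbrs z) (h0 : cr e (s - z) = 0)
    (hl : 0 < ⟪e, s - z⟫) : Δ.IsRight B z e H s := by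
  refine ⟨hs, ?_, hl⟩
  rcases A.short_or_long hs with h | h
  · obtain ⟨b, hT⟩ := exists_isTri_of_mem_nbrs hs
    have := A.short_eta hT h
    rw [h0, abs_zero, mul_zero] at this
    linarith [A.h_pos]
  · exact h

/-- At a boundary node that is not a corner, the boundary edges lie along the patch or across it. -/
lemma boundary_cases (hz : z ∈ Δ.nodes) (hzf : z ∈ frontier Ω) (hcor : ¬ IsCorner Ω z)
    (hor : ∀ s ∈ Δ.nbrs z, segment ℝ z s ⊆ frontier Ω → ⟪e, s - z⟫ = 0 ∨ cr e (s - z) = 0)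
    (hΩ : IsOpen Ω) :
    ((∀ f ∈ ({e, -e} : Set Plane), ∃ d, Δ.IsRight B z f H d ∧ segment ℝ z d ⊆ frontier Ω ∧
      ∀ s, Δ.IsRight B z f H s → s ≠ d → s ∈ Δ.innerNbrs z)) ∨
    ((∀ s ∈ Δ.nbrs z, segment ℝ z s ⊆ frontier Ω → ⟪e, s - z⟫ = 0) ∧
      ∀ s ∈ Δ.nbrs z, ‖s - z‖ ≤ B * h → segment ℝ z s ⊆ frontier Ω) := by
  obtain ⟨v, hv0, r, hr, hv⟩ : ∃ v : Plane, v ≠ 0 ∧ ∃ r : ℝ, 0 < r ∧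
      ∀ x ∈ Metric.ball z r, x ∈ frontier Ω ↔ ∃ t : ℝ, x = z + t • v := by
    by_contra hcon; exact hcor ⟨hzf, hcon⟩
  have hv' : ∀ x ∈ Metric.ball z r, x ∈ frontier Ω ↔ ∃ t : ℝ, x = z + t • (-v) := by
    intro x hx
    rw [hv x hx]
    exact ⟨fun ⟨t, ht⟩ => ⟨-t, by rw [ht, neg_smul_neg]⟩, fun ⟨t, ht⟩ => ⟨-t, by rw [ht]; simp⟩⟩
  obtain ⟨w, hw, hwf, l, hl, hwl⟩ := exists_frontier_nbr hz hv0 hr hv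
  obtain ⟨w', hw', hwf', l', hl', hwl'⟩ := exists_frontier_nbr hz (neg_ne_zero.2 hv0) hr hv'
  have hpar := fun {s : Plane} (hs : segment ℝ z s ⊆ frontier Ω) =>
    eq_smul_of_segment_subset_frontier hr hv hs
  have hcase : ⟪e, v⟫ = 0 ∨ cr e v = 0 := by
    rcases hor w hw hwf with h | h
    · rw [hwl, real_inner_smul_right] at h
      exact Or.inl ((mul_eq_zero.1 h).resolve_left hl.ne')
    · rw [hwl, cr_smul_right] at h
      exact Or.inr ((mul_eq_zero.1 h).resolve_left hl.ne')
  have hvf := frame_norm_sq A.norm_e v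
  rcases hcase with h0 | h0
  · right
    have hηv : cr e v ≠ 0 := by rintro h; rw [h0, h] at hvf; simp at hvf; exact hv0 hvf
    refine ⟨fun s _ hsf => ?_, fun s hs hsh => ?_⟩
    · obtain ⟨t, ht⟩ := hpar hsf
      rw [ht, real_inner_smul_right, h0, mul_zero]
    · by_contra hsn
      have hsi : s ∈ Δ.innerNbrs z := mem_innerNbrs.2 ⟨hs, hsn⟩
      obtain ⟨c, b, hc, hb, hcr, hbl⟩ := A.short_two_sides hΩ hsi hsh
      have hη := A.short_eta hc hsh
      have hη0 : cr e (s - z) ≠ 0 := by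
        rintro h; rw [h, abs_zero, mul_zero] at hη; linarith [A.h_pos]
      -- the boundary edge on the same side as `s` lies in one of the two triangles at `zs`
      obtain ⟨u, hu, huf, hu0, huη⟩ : ∃ u ∈ Δ.nbrs z, segment ℝ z u ⊆ frontier Ω ∧ ⟪e, u - z⟫ = 0 ∧
          0 < cr e (u - z) * cr e (s - z) := by
        rcases lt_or_gt_of_ne (mul_ne_zero hηv hη0) with hlt | hlt
        · refine ⟨w', hw', hwf', ?_, ?_⟩
          · rw [hwl', real_inner_smul_right, inner_neg_right, h0]; simp
          · rw [hwl', cr_smul_right, show cr e (-v) = -cr e v by simp [cr]; ring]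
            nlinarith
        · refine ⟨w, hw, hwf, ?_, ?_⟩
          · rw [hwl, real_inner_smul_right, h0, mul_zero]
          · rw [hwl, cr_smul_right]; nlinarith
      have hus : u ≠ s := by rintro rfl; exact hsn huf
      have s1 := A.sign_cr hsh hη hcr
      have s2 := A.neg.sign_cr (s := s) (c := b) hsh
        (by rwa [show cr (-e) (s - z) = -cr e (s - z) by simp [cr]; ring, abs_neg]) hbl
      rw [show cr (-e) (s - z) = -cr e (s - z) by simp [cr]; ring] at s2
      have e1 : cr (s - z) (u - z) = ⟪e, s - z⟫ * cr e (u - z) := by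
        rw [frame_cr A.norm_e, hu0]; ring
      have e2 : ∀ c, cr (u - z) (c - z) = -(cr e (u - z) * ⟪e, c - z⟫) := fun c => by
        rw [frame_cr A.norm_e, hu0]; ring
      have pc := hcr.pos
      have pb := hbl.pos
      rw [inner_neg_left] at pb
      have neg_of : ∀ {x y w : ℝ}, x * y < 0 → 0 < w * y → w * x < 0 := fun {x y w} h1 h2 => by
        have hy : y ≠ 0 := by rintro rfl; simp at h1
        have h3 : 0 < y ^ 2 := by positivity
        have h4 : (x * y) * (w * y) < 0 := mul_neg_of_neg_of_pos h1 h2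
        by_contra hcon
        push Not at hcon
        nlinarith [mul_nonneg hcon h3.le]
      have q1 := neg_of s1 huη
      have q2 : 0 < cr e (u - z) * cr (s - z) (b - z) := by
        have := neg_of (w := -cr e (u - z)) s2 (by linarith)
        linarith
      rcases le_total ⟪e, s - z⟫ 0 with hξ | hξ
      · rcases eq_or_eq_of_cr hu hc
          (by rw [e1, mul_assoc]; exact mul_nonneg_of_nonpos_of_nonpos hξ q1.le)
          (by rw [e2]; nlinarith) with h | h
        · exact hus h
        · rw [h] at hu0; linarith
      · rcases eq_or_eq_of_cr hu hb (by rw [e1, mul_assoc]; exact mul_nonneg hξ q2.le)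
          (by rw [e2]; nlinarith) with h | h
        · exact hus h
        · rw [h] at hu0; linarith
  · left
    have hξv : ⟪e, v⟫ ≠ 0 := by rintro h; rw [h0, h] at hvf; simp at hvf; exact hv0 hvf
    have key : ∀ f : Plane, Δ.AnisoAt B z f h H → cr f v = 0 → ⟪f, v⟫ ≠ 0 →
        ∃ d, Δ.IsRight B z f H d ∧ segment ℝ z d ⊆ frontier Ω ∧
          ∀ s, Δ.IsRight B z f H s → s ≠ d → s ∈ Δ.innerNbrs z := by
      intro f A' hf0 hfv
      obtain ⟨d, hd, hdf⟩ : ∃ d, Δ.IsRight B z f H d ∧ segment ℝ z d ⊆ frontier Ω := by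
        rcases lt_or_gt_of_ne hfv with hlt | hlt
        · refine ⟨w', A'.isRight_of_cr hw' ?_ ?_, hwf'⟩
          · rw [hwl', cr_smul_right, show cr f (-v) = -cr f v by simp [cr]; ring, hf0]; simp
          · rw [hwl', real_inner_smul_right, inner_neg_right]; nlinarith
        · refine ⟨w, A'.isRight_of_cr hw ?_ ?_, hwf⟩
          · rw [hwl, cr_smul_right, hf0, mul_zero]
          · rw [hwl, real_inner_smul_right]; exact mul_pos hl hlt
      refine ⟨d, hd, hdf, fun s hs hne => mem_innerNbrs.2 ⟨hs.mem, fun hsf => hne ?_⟩⟩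
      obtain ⟨t, ht⟩ := hpar hsf
      obtain ⟨t', ht'⟩ := hpar hdf
      refine A'.right_eq_of_cr hs hd ?_
      rw [ht, ht', cr_smul_left, cr_smul_right, show cr v v = 0 by simp [cr]; ring]; simp
    rintro f (rfl | rfl)
    · exact key f A h0 hξv
    · refine key (-e) A.neg ?_ ?_
      · rw [show cr (-e) v = -cr e v by simp [cr]; ring, h0, neg_zero]
      · rw [inner_neg_left]; exact neg_ne_zero.2 hξv

end AnisoAt
end Triangulation

/-! ### The jump terms of one node -/

lemma norm_normalize_sub_le {u v : Plane} (hv : v ≠ 0) :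
    ‖u‖ * ‖‖u‖⁻¹ • u - ‖v‖⁻¹ • v‖ ≤ 2 * ‖u - v‖ := by
  rcases eq_or_ne u 0 with rfl | hu
  · simp
  have hu' := norm_pos_iff.2 hu
  have hv' := norm_pos_iff.2 hv
  have e1 : ‖u‖ • (‖u‖⁻¹ • u - ‖v‖⁻¹ • v) = (u - v) + (‖v‖ - ‖u‖) • (‖v‖⁻¹ • v) := by
    rw [smul_sub, smul_inv_smul₀ hu'.ne', sub_smul, smul_inv_smul₀ hv'.ne']
    abel
  calc ‖u‖ * ‖‖u‖⁻¹ • u - ‖v‖⁻¹ • v‖ = ‖‖u‖ • (‖u‖⁻¹ • u - ‖v‖⁻¹ • v)‖ := by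
        rw [norm_smul, norm_norm]
    _ ≤ ‖u - v‖ + ‖(‖v‖ - ‖u‖) • (‖v‖⁻¹ • v)‖ := by rw [e1]; exact norm_add_le _ _
    _ ≤ ‖u - v‖ + ‖u - v‖ := by
        rw [norm_smul, norm_smul, norm_inv, norm_norm, inv_mul_cancel₀ hv'.ne', mul_one,
          norm_eq_abs]
        exact add_le_add_right (by rw [norm_sub_rev u v]; exact abs_norm_sub_norm_le _ _) _
    _ = _ := by ring

namespace Triangulation

namespace AnisoAt
variable (A : Δ.AnisoAt B z e h H)
include A

lemma norm_mul_edgeDir_sub_le (hc : Δ.IsRight B z e H c) :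
    ‖c - z‖ * ‖edgeDir z c - e‖ ≤ 2 * B * h := by
  have hp := hc.pos
  have h0 : ⟪e, c - z⟫ • e ≠ 0 := by
    intro h
    have := congrArg norm h
    rw [norm_smul, A.norm_e, norm_zero, mul_one, Real.norm_of_nonneg hp.le] at this
    exact hp.ne' this
  have h1 := norm_normalize_sub_le (u := c - z) h0
  have h2 : ‖⟪e, c - z⟫ • e‖⁻¹ • ⟪e, c - z⟫ • e = e := by
    rw [norm_smul, A.norm_e, mul_one, Real.norm_of_nonneg hp.le, inv_smul_smul₀ hp.ne']
  rw [h2] at h1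
  have h3 : ‖c - z - ⟪e, c - z⟫ • e‖ = |cr e (c - z)| := by
    have h4 : c - z - ⟪e, c - z⟫ • e = cr e (c - z) • rot e := by
      conv_lhs => rw [frame_decomp A.norm_e (c - z)]
      rw [inner_frame A.norm_e]; abel
    have h5 : ‖rot e‖ = 1 := by
      have := cr_rot_self e
      have h6 := norm_sq_eq e
      rw [A.norm_e] at h6
      have h7 : ‖rot e‖ ^ 2 = 1 := by rw [norm_sq_eq]; simp [rot]; linarith
      nlinarith [norm_nonneg (rot e)]
    rw [h4, norm_smul, h5, mul_one, norm_eq_abs]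
  rw [h3] at h1
  have := A.abs_eta_le hc.mem
  have h6 : ‖c - z‖ * ‖edgeDir z c - e‖ ≤ 2 * |cr e (c - z)| := h1
  linarith

/-- All moments on the long edges of an anisotropic patch are close to the moments of one vector. -/
lemma exists_vector {a : Plane → ℝ} (hM : Δ.MomentBounds B z e h H a δ)
    (hy : Δ.IsRight B z e H y) (hc : c ∈ Δ.nbrs z) (hl : H ≤ B * ‖c - z‖) :
    ‖a y • e - a c • edgeDir z c‖ ≤ 3 * B * δ := by
  obtain ⟨_, hB, hh, _⟩ := A.pos
  have hδ : 0 ≤ δ := (abs_nonneg _).trans (hM.right y y hy hy)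
  have hle := hM.le c hc
  have key : ∀ f : Plane, Δ.AnisoAt B z f h H → Δ.IsRight B z f H c →
      |a c| * ‖edgeDir z c - f‖ ≤ 2 * B * δ := by
    intro f A' hcf
    have h1 := A'.norm_mul_edgeDir_sub_le hcf
    have hcz : 0 < ‖c - z‖ := by
      by_contra hcon
      have := A.H_pos
      nlinarith [norm_nonneg (c - z)]
    refine le_of_mul_le_mul_left ?_ (mul_pos hh hcz)
    calc h * ‖c - z‖ * (|a c| * ‖edgeDir z c - f‖) =
          (|a c| * h) * (‖c - z‖ * ‖edgeDir z c - f‖) := by ring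
      _ ≤ (‖c - z‖ * δ) * (2 * B * h) := by gcongr
      _ = _ := by ring
  have hBδ : δ ≤ B * δ := by nlinarith
  rcases A.right_or_left hc hl with h | h
  · have e1 : a y • e - a c • edgeDir z c = (a y - a c) • e - a c • (edgeDir z c - e) := by module
    rw [e1]
    refine (_root_.norm_sub_le _ _).trans ?_
    rw [norm_smul, norm_smul, A.norm_e, mul_one, norm_eq_abs, norm_eq_abs]
    have := hM.right y c hy h
    have := key e A h
    linarith
  · have e1 : a y • e - a c • edgeDir z c = (a y + a c) • e - a c • (edgeDir z c - -e) := by module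
    rw [e1]
    refine (_root_.norm_sub_le _ _).trans ?_
    rw [norm_smul, norm_smul, A.norm_e, mul_one, norm_eq_abs, norm_eq_abs]
    have := hM.opposite y c hy h
    have := key (-e) A.neg h
    linarith

open scoped Classical in
/-- The jump terms of an interior node: a part that consists of moments of the vector `V` on the
short edges remains. -/
lemma abs_sum_jump_le (hΩ : IsOpen Ω) (huh : Δ.IsFE uh)
    (hin : ∀ s ∈ Δ.nbrs z, s ∈ Δ.innerNbrs z) {a : Plane → ℝ}
    (hM : Δ.MomentBounds B z e h H a δ) {V : Plane}
    (hV : ∀ c ∈ Δ.nbrs z, H ≤ B * ‖c - z‖ → ‖V - a c • edgeDir z c‖ ≤ 3 * B * δ) (hδ : 0 ≤ δ) :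
    |∑ s ∈ Δ.innerNbrs z, (a s * Δ.jump uh z s +
      if ‖s - z‖ ≤ B * h then Δ.jump uh z s * ⟪edgeDir z s, V⟫ else 0)| ≤
      3 * B ^ 2 * δ * Δ.maxJump uh z := by
  obtain ⟨_, hB, hh, _⟩ := A.pos
  have h0 : ∑ s ∈ Δ.innerNbrs z, Δ.jump uh z s * ⟪edgeDir z s, V⟫ = 0 :=
    sum_jump_inner hΩ huh (fun s hs => hs) fun a b hT _ hb => absurd (hin b hT.swap.mem_nbrs) hb
  have h1 : ∑ s ∈ Δ.innerNbrs z, (a s * Δ.jump uh z s +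
      if ‖s - z‖ ≤ B * h then Δ.jump uh z s * ⟪edgeDir z s, V⟫ else 0) =
      ∑ s ∈ Δ.innerNbrs z, ((a s * Δ.jump uh z s +
      if ‖s - z‖ ≤ B * h then Δ.jump uh z s * ⟪edgeDir z s, V⟫ else 0) -
      Δ.jump uh z s * ⟪edgeDir z s, V⟫) := by
    rw [Finset.sum_sub_distrib, h0, sub_zero]
  have hmj := maxJump_nonneg (Δ := Δ) (v := uh) z
  have h2 : ∀ s ∈ Δ.innerNbrs z, |(a s * Δ.jump uh z s +
      if ‖s - z‖ ≤ B * h then Δ.jump uh z s * ⟪edgeDir z s, V⟫ else 0) -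
      Δ.jump uh z s * ⟪edgeDir z s, V⟫| ≤ 3 * B * δ * Δ.maxJump uh z := by
    intro s hs
    have hsn := (mem_innerNbrs.1 hs).1
    have hj := abs_jump_le (v := uh) hs
    by_cases hsh : ‖s - z‖ ≤ B * h
    · rw [if_pos hsh, add_sub_cancel_right, abs_mul]
      have h3 : |a s| ≤ 3 * B * δ := by
        refine le_of_mul_le_mul_right ((hM.le s hsn).trans ?_) hh
        have := mul_le_mul_of_nonneg_right hsh hδ
        have : 0 ≤ B * h * δ := by positivity
        linarith
      exact mul_le_mul h3 hj (abs_nonneg _) (by positivity)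
    · rw [if_neg hsh, add_zero]
      have hl := (A.short_or_long hsn).resolve_left hsh
      have hne := (mem_nbrs_edge hsn).2.1
      have e1 : a s * Δ.jump uh z s - Δ.jump uh z s * ⟪edgeDir z s, V⟫ =
          -(⟪edgeDir z s, V - a s • edgeDir z s⟫ * Δ.jump uh z s) := by
        rw [inner_sub_right, real_inner_smul_right, real_inner_self_eq_norm_sq, norm_edgeDir hne]
        ring
      rw [e1, abs_neg, abs_mul]
      refine mul_le_mul ?_ hj (abs_nonneg _) (by positivity)
      refine (abs_real_inner_le_norm _ _).trans ?_
      rw [norm_edgeDir hne, one_mul]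
      exact hV s hsn hl
  rw [h1]
  refine (Finset.abs_sum_le_sum_abs _ _).trans ((Finset.sum_le_card_nsmul _ _ _ h2).trans ?_)
  rw [nsmul_eq_mul]
  have h3 : ((Δ.innerNbrs z).card : ℝ) ≤ B :=
    le_trans (by exact_mod_cast Finset.card_filter_le _ _) A.card_le
  calc _ ≤ B * (3 * B * δ * Δ.maxJump uh z) := by gcongr
    _ = _ := by ring

/-- The moments at a node with boundary edges along the patch. -/
lemma abs_edgeMoment_le_of_parallel (hΩ : IsOpen Ω) (hg : Sob (closure Ω) g Dg)
    (hg0 : ∀ x ∈ frontier Ω, g x = 0)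
    (hpar : ∀ f ∈ ({e, -e} : Set Plane), ∃ d, Δ.IsRight B z f H d ∧ segment ℝ z d ⊆ frontier Ω ∧
      ∀ s, Δ.IsRight B z f H s → s ≠ d → s ∈ Δ.innerNbrs z) (hs : s ∈ Δ.nbrs z) :
    |edgeMoment g 0 z s| ≤ B ^ 3 * Δ.gradL1 Dg z := by
  obtain ⟨hBp, hb, hh, hH⟩ := A.pos
  have hlong : ∀ c ∈ Δ.nbrs z, H ≤ B * ‖c - z‖ → ∫ t in 0..1, |g (lineMap z c t)| ≤
        B ^ 3 / H * Δ.gradL1 Dg z := by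
    intro c hc hl
    have key : ∀ f ∈ ({e, -e} : Set Plane), Δ.AnisoAt B z f h H → Δ.IsRight B z f H c →
        ∫ t in 0..1, |g (lineMap z c t)| ≤ B ^ 3 / H * Δ.gradL1 Dg z := by
      intro f hf A' hcf
      obtain ⟨d, hd, hdf, hin⟩ := hpar f hf
      refine le_trans (le_of_eq ?_) (A'.right_edge_dist hΩ hg hd hin hcf)
      refine intervalIntegral.integral_congr fun t ht => ?_
      rw [uIcc_of_le zero_le_one] at ht
      simp [hg0 _ (hdf (lineMap_mem_segment ht))]
    rcases A.right_or_left hc hl with h | h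
    · exact key e (by simp) A h
    · exact key (-e) (by simp) A.neg h
  have hcs := continuousOn_nbr_edge hg.continuousOn hs
  set D := Δ.gradL1 Dg z
  have hD := Δ.gradL1_nonneg Dg z
  have h1 : |rayMean g 0 z s| ≤ ∫ t in 0..1, |g (lineMap z s t)| := by
    have := abs_integral_hat_le hcs
    simpa only [rayMean, sub_zero] using this
  rw [edgeMoment_eq, abs_mul, abs_norm]
  rcases A.short_or_long hs with hsh | hsh
  · obtain ⟨c, hT⟩ := exists_isTri_of_mem_nbrs hs
    have h2 := hlong c hT.swap.mem_nbrs (A.partner_long hT hsh).1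
    have h3 := A.edge_sub_le_of_short hg hT
    have h4 := integral_abs_sub_le_add hcs (continuousOn_nbr_edge hg.continuousOn hT.swap.mem_nbrs)
      (continuousOn_const (c := (0 : ℝ)))
    simp only [sub_zero] at h4
    have h5 : B ^ 3 / H * D ≤ 1 / h * D := mul_le_mul_of_nonneg_right (A.div_H_le (k := 3) (by norm_num)) hD
    have h6 : |rayMean g 0 z s| ≤ (B + 1) / h * D := by
      have : (B + 1) / h * D = B / h * D + 1 / h * D := by ring
      linarith
    calc _ ≤ (B * h) * ((B + 1) / h * D) := mul_le_mul hsh h6 (abs_nonneg _) (by positivity)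
      _ = (B * (B + 1)) * D := by field_simp
      _ ≤ _ := by gcongr; nlinarith [mul_pos hBp hBp]
  · have h2 := h1.trans (hlong s hs hsh)
    calc _ ≤ H * (B ^ 3 / H * D) := mul_le_mul (A.norm_sub_le hs) h2 (abs_nonneg _) hH.le
      _ = _ := by field_simp

end AnisoAt
end Triangulation

namespace Triangulation

namespace AnisoAt
variable (A : Δ.AnisoAt B z e h H)
include A

lemma abs_sub_mul_inner_le (hc : Δ.IsRight B z e H c) {a a' D : ℝ}
    (h1 : |a - a'| ≤ B ^ 8 * D) (hAd : |a'| ≤ H * (B / h * D)) (hD : 0 ≤ D) :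
    |a - a' * ⟪edgeDir z c, e⟫| ≤ 2 * B ^ 8 * D := by
  obtain ⟨hBp, hb, hh, hH⟩ := A.pos
  have h2 := A.norm_mul_edgeDir_sub_le hc
  have h3 : |1 - ⟪edgeDir z c, e⟫| ≤ ‖edgeDir z c - e‖ := by
    have e1 : 1 - ⟪edgeDir z c, e⟫ = -⟪edgeDir z c - e, e⟫ := by
      rw [inner_sub_left, real_inner_self_eq_norm_sq, A.norm_e]; ring
    rw [e1, abs_neg]
    have := abs_real_inner_le_norm (edgeDir z c - e) e
    rwa [A.norm_e, mul_one] at this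
  have h4 : H * ‖edgeDir z c - e‖ ≤ 2 * B ^ 2 * h := by
    calc _ ≤ (B * ‖c - z‖) * ‖edgeDir z c - e‖ :=
          mul_le_mul_of_nonneg_right hc.long (norm_nonneg _)
      _ = B * (‖c - z‖ * ‖edgeDir z c - e‖) := by ring
      _ ≤ B * (2 * B * h) := by gcongr
      _ = _ := by ring
  have h5 : |a' * (1 - ⟪edgeDir z c, e⟫)| ≤ 2 * B ^ 3 * D := by
    rw [abs_mul]
    calc _ ≤ (H * (B / h * D)) * ‖edgeDir z c - e‖ :=
          mul_le_mul hAd h3 (abs_nonneg _) (by positivity)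
      _ = (H * ‖edgeDir z c - e‖) * (B / h * D) := by ring
      _ ≤ (2 * B ^ 2 * h) * (B / h * D) := by gcongr
      _ = _ := by field_simp
  have e1 : a - a' * ⟪edgeDir z c, e⟫ = (a - a') + a' * (1 - ⟪edgeDir z c, e⟫) := by ring
  have h6 : 2 * B ^ 3 * D ≤ B ^ 8 * D := by
    gcongr ?_ * _
    have := A.B_pow_le 4 8 (by norm_num)
    have : 0 < B ^ 3 := by positivity
    nlinarith
  rw [e1]
  refine (abs_add_le _ _).trans ?_
  linarith

open scoped Classical in
/-- The jump terms on one side of a node with boundary edges across the patch. The sum of the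
projections of the jumps vanishes, so that only differences of the moments enter. -/
lemma abs_sum_right_le (hΩ : IsOpen Ω) (huh : Δ.IsFE uh)
    (hg : Sob (closure Ω) g Dg) (hg0 : ∀ x ∈ frontier Ω, g x = 0)
    (hort : ∀ s ∈ Δ.nbrs z, segment ℝ z s ⊆ frontier Ω → ⟪e, s - z⟫ = 0)
    (hshort : ∀ s ∈ Δ.nbrs z, ‖s - z‖ ≤ B * h → segment ℝ z s ⊆ frontier Ω) :
    |∑ s ∈ (Δ.nbrs z).filter (fun s => Δ.IsRight B z e H s), edgeMoment g 0 z s * Δ.jump uh z s| ≤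
      B ^ 10 * Δ.gradL1 Dg z * Δ.maxJump uh z := by
  obtain ⟨hBp, hb, hh, hH⟩ := A.pos
  have hmj := maxJump_nonneg (Δ := Δ) (v := uh) z
  set D := Δ.gradL1 Dg z
  have hD := Δ.gradL1_nonneg Dg z
  set X := (Δ.nbrs z).filter (fun s => Δ.IsRight B z e H s)
  rcases X.eq_empty_or_nonempty with h0 | ⟨c₀, hc₀⟩
  · rw [h0, Finset.sum_empty, abs_zero]; positivity
  have hXr : ∀ s ∈ X, Δ.IsRight B z e H s := fun s hs => (Finset.mem_filter.1 hs).2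
  have hinr : ∀ c, Δ.IsRight B z e H c → c ∈ Δ.innerNbrs z := fun c hc =>
    mem_innerNbrs.2 ⟨hc.mem, fun hcf => hc.pos.ne' (hort c hc.mem hcf)⟩
  obtain ⟨d, s, hd, hT, hs⟩ := A.exists_right_short hΩ hinr (hXr c₀ hc₀)
  have hsf := hshort s hT.mem_nbrs hs
  have hdL : ∫ t in 0..1, |g (lineMap z d t)| ≤ B / h * D := by
    refine le_trans (le_of_eq ?_) (A.edge_sub_le_of_short hg hT.swap)
    refine intervalIntegral.integral_congr fun t ht => ?_
    rw [uIcc_of_le zero_le_one] at ht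
    simp [hg0 _ (hsf (lineMap_mem_segment ht))]
  have hcd := continuousOn_nbr_edge hg.continuousOn hd.mem
  have hcL : ∀ c, Δ.IsRight B z e H c → ∫ t in 0..1, |g (lineMap z c t) - 0| ≤ B ^ 5 / h * D := by
    intro c hc
    have h1 := integral_abs_sub_le_add (continuousOn_nbr_edge hg.continuousOn hc.mem) hcd
      (continuousOn_const (c := (0 : ℝ)))
    have h2 := A.right_edge_dist hΩ hg hd (fun c hc _ => hinr c hc) hc
    have h3 : B ^ 3 / H * D ≤ 1 / h * D :=
      mul_le_mul_of_nonneg_right (A.div_H_le (k := 3) (by norm_num)) hD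
    have h4 : 1 / h * D + B / h * D ≤ B ^ 5 / h * D := by
      have : 1 / h * D + B / h * D = (1 + B) * (D / h) := by ring
      rw [this, show B ^ 5 / h * D = B ^ 5 * (D / h) by ring]
      gcongr ?_ * _
      have := A.B_pow_le 2 5 (by norm_num)
      nlinarith
    simp only [sub_zero] at h1 ⊢
    linarith
  have hAd : |edgeMoment g 0 z d| ≤ H * (B / h * D) := by
    rw [edgeMoment_eq, abs_mul, abs_norm]
    refine mul_le_mul (A.norm_sub_le hd.mem) ?_ (abs_nonneg _) hH.le
    have := abs_integral_hat_le hcd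
    refine le_trans ?_ (this.trans hdL)
    simp only [rayMean, sub_zero, le_refl]
  have hzero : ∑ s ∈ X, Δ.jump uh z s * ⟪edgeDir z s, e⟫ = 0 := by
    refine sum_jump_inner hΩ huh (fun s hs => hinr s (hXr s hs)) fun a b hab ha hb' => ?_
    have hbn := hab.swap.mem_nbrs
    have hbs : ‖b - z‖ ≤ B * h := by
      refine (A.short_or_long hbn).resolve_right fun hl => hb' ?_
      exact Finset.mem_filter.2 ⟨hbn, (A.same_side hab (hXr a ha) hl).1⟩
    have hbf := hshort b hbn hbs
    have h1 := hort b hbn hbf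
    have h2 : uh b - uh z = ⟪elemGrad uh {z, a, b}, b - z⟫ :=
      huh.sub_eq hab.mem_triangles (subset_convexHull ℝ _ (by simp))
        (subset_convexHull ℝ _ (by simp))
    rw [huh.boundary b (hbf (right_mem_segment ℝ z b)),
      huh.boundary z (hbf (left_mem_segment ℝ z b)), sub_zero] at h2
    have h3 := frame_decomp A.norm_e (b - z)
    rw [h1, zero_smul, zero_add] at h3
    have hη : cr e (b - z) ≠ 0 := by
      intro h4
      rw [h4, zero_smul] at h3
      exact hab.hzb (sub_eq_zero.1 h3).symm
    rw [h3, real_inner_smul_right] at h2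
    have h4 := (mul_eq_zero.1 h2.symm).resolve_left hη
    rw [inner_eq] at h4 ⊢
    simp [rot] at h4 ⊢
    linarith
  have hdecomp : ∑ s ∈ X, edgeMoment g 0 z s * Δ.jump uh z s =
      ∑ s ∈ X, (edgeMoment g 0 z s - edgeMoment g 0 z d * ⟪edgeDir z s, e⟫) * Δ.jump uh z s := by
    have h1 : ∑ s ∈ X, edgeMoment g 0 z d * ⟪edgeDir z s, e⟫ * Δ.jump uh z s = 0 := by
      have h2 := congrArg (fun t => edgeMoment g 0 z d * t) hzero
      simp only [mul_zero, Finset.mul_sum] at h2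
      exact (sum_congr rfl fun s _ => by ring).trans h2
    simp only [sub_mul, Finset.sum_sub_distrib, h1, sub_zero]
  have hterm : ∀ c ∈ X, |(edgeMoment g 0 z c - edgeMoment g 0 z d * ⟪edgeDir z c, e⟫) *
      Δ.jump uh z c| ≤ 2 * B ^ 8 * D * Δ.maxJump uh z := by
    intro c hc
    have hcr := hXr c hc
    rw [abs_mul]
    refine mul_le_mul ?_ (abs_jump_le (hinr c hcr)) (abs_nonneg _) (by positivity)
    have h1 := A.right_moment_sub_le hΩ hg (k := 0) hcr hd (fun s hs _ => hinr s hs) (hcL c hcr)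
    exact A.abs_sub_mul_inner_le hcr h1 hAd hD
  rw [hdecomp]
  refine (Finset.abs_sum_le_sum_abs _ _).trans ((Finset.sum_le_card_nsmul _ _ _ hterm).trans ?_)
  rw [nsmul_eq_mul]
  have h3 : (X.card : ℝ) ≤ B := le_trans (by exact_mod_cast Finset.card_filter_le _ _) A.card_le
  calc _ ≤ B * (2 * B ^ 8 * D * Δ.maxJump uh z) := by gcongr
    _ = 2 * (B ^ 9 * D * Δ.maxJump uh z) := by ring
    _ ≤ B * (B ^ 9 * D * Δ.maxJump uh z) := by gcongr; linarith
    _ = _ := by ring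

/-- The jump terms of a node with boundary edges across the patch. -/
lemma abs_sum_jump_le_of_orthogonal (hΩ : IsOpen Ω) (huh : Δ.IsFE uh)
    (hg : Sob (closure Ω) g Dg) (hg0 : ∀ x ∈ frontier Ω, g x = 0)
    (hort : ∀ s ∈ Δ.nbrs z, segment ℝ z s ⊆ frontier Ω → ⟪e, s - z⟫ = 0)
    (hshort : ∀ s ∈ Δ.nbrs z, ‖s - z‖ ≤ B * h → segment ℝ z s ⊆ frontier Ω) :
    |∑ s ∈ Δ.innerNbrs z, edgeMoment g 0 z s * Δ.jump uh z s| ≤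
      2 * B ^ 10 * Δ.gradL1 Dg z * Δ.maxJump uh z := by
  classical
  have h1 := A.abs_sum_right_le hΩ huh hg hg0 hort hshort
  have h2 := A.neg.abs_sum_right_le hΩ huh hg hg0
    (fun s hs hsf => by rw [inner_neg_left, hort s hs hsf, neg_zero]) hshort
  have h3 : Δ.innerNbrs z = (Δ.nbrs z).filter (fun s => Δ.IsRight B z e H s) ∪
      (Δ.nbrs z).filter (fun s => Δ.IsRight B z (-e) H s) := by
    ext s
    rw [mem_innerNbrs, Finset.mem_union, mem_filter, mem_filter]
    constructor
    · rintro ⟨hs, hsf⟩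
      have hl := (A.short_or_long hs).resolve_left fun h => hsf (hshort s hs h)
      rcases A.right_or_left hs hl with h | h
      · exact Or.inl ⟨hs, h⟩
      · exact Or.inr ⟨hs, h⟩
    · rintro (⟨hs, h⟩ | ⟨hs, h⟩)
      · exact ⟨hs, fun hsf => h.pos.ne' (hort s hs hsf)⟩
      · refine ⟨hs, fun hsf => h.pos.ne' ?_⟩
        rw [inner_neg_left, hort s hs hsf, neg_zero]
  have h4 : Disjoint ((Δ.nbrs z).filter (fun s => Δ.IsRight B z e H s))
      ((Δ.nbrs z).filter (fun s => Δ.IsRight B z (-e) H s)) := by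
    rw [Finset.disjoint_filter]
    intro s _ hr hl
    have := hl.pos
    rw [inner_neg_left] at this
    linarith [hr.pos]
  rw [h3, Finset.sum_union h4]
  refine (abs_add_le _ _).trans ?_
  linarith

/-- The difference of the moments on the two long edges of a triangle with the short edge `zs`. -/
lemma abs_edgeMoment_sub_le (hg : Sob (closure Ω) g Dg) {k' : ℝ}
    (hle : ∀ c ∈ Δ.nbrs z, |edgeMoment g k z c| * h ≤ ‖c - z‖ * δ)
    (hT : Δ.IsTri z s c) (hs : ‖s - z‖ ≤ B * h) :
    |edgeMoment g k z c - edgeMoment g k' s c + ‖c - s‖ * ((k - k') / 2)| ≤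
      B * δ + B ^ 2 * Δ.gradL1 Dg z := by
  obtain ⟨hB, _, hh, hH⟩ := A.pos
  have hcn := hT.swap.mem_nbrs
  have hcn' : c ∈ Δ.nbrs s := hT.swap'.swap.mem_nbrs
  have hcz := continuousOn_nbr_edge hg.continuousOn hcn
  have hcs := continuousOn_nbr_edge hg.continuousOn hcn'
  set D := Δ.gradL1 Dg z
  have hcr := hT.swap.swap'.cr_ne
  have hcl : convexHull ℝ {c, z, s} ⊆ closure Ω := by
    rw [triple_rotate, ← cell_eq]; exact cell_subset_closure hT.mem
  -- both edges are parametrized from their common endpoint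
  have h1 : |rayMean g k z c - (rayMean g k' s c - (k - k') / 2)| ≤ B ^ 2 / H * D := by
    rw [← rayMean_sub hcs]
    have e1 : rayMean g k z c - rayMean g k s c = ∫ t in 0..1, (1 - t) *
        (g (lineMap z c t) - g (lineMap s c t)) := by
      rw [rayMean, rayMean, ← intervalIntegral.integral_sub]
      · exact intervalIntegral.integral_congr fun t _ => by ring
      · exact intervalIntegrable_of_Icc (ContinuousOn.mul (by fun_prop) (hcz.sub continuousOn_const))
      · exact intervalIntegrable_of_Icc (ContinuousOn.mul (by fun_prop) (hcs.sub continuousOn_const))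
    rw [e1]
    refine (abs_integral_hat_le (hcz.sub hcs)).trans ?_
    have h2 := (hg.mono hcl).edge_sub hcr
    have h3 : ∫ t in 0..1, |g (lineMap z c t) - g (lineMap s c t)| =
        ∫ t in 0..1, |g (lineMap c z t) - g (lineMap c s t)| := by
      rw [← integral_reflect]
      exact intervalIntegral.integral_congr fun t _ => by simp only [lineMap_reflect]
    change (∫ t in 0..1, |g (lineMap z c t) - g (lineMap s c t)|) ≤ _
    rw [h3]
    refine h2.trans ?_
    have h4 : ∫ x in convexHull ℝ {c, z, s}, ‖Dg x‖ ≤ D := by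
      refine setIntegral_patch_mono hT.mem_star hg.integrableOn.norm (fun _ => norm_nonneg _) ?_
      rw [triple_rotate, cell_eq]
    have h5 : |cr (z - c) (s - c)| = |cr (s - z) (c - z)| := by rw [cr_rotate]
    rw [h5, norm_sub_rev z s, div_eq_mul_inv]
    calc ‖s - z‖ * |cr (s - z) (c - z)|⁻¹ * ∫ x in convexHull ℝ {c, z, s}, ‖Dg x‖
        ≤ (B * h) * (B / (h * H)) * D := by
          refine mul_le_mul (by gcongr; exact A.inv_cr_le hT) h4
            (integral_nonneg fun _ => norm_nonneg _) (by positivity)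
      _ = _ := by field_simp
  have hcs' : ‖c - s‖ ≤ H := A.dist_le _ (mem_patch_of_mem_nbrs hcn).1 _ (mem_patch_of_mem_nbrs hT.mem_nbrs).1
  have h2 : |(‖c - z‖ - ‖c - s‖) * rayMean g k z c| ≤ B * δ := by
    have h3 := hle c hcn
    rw [edgeMoment_eq, abs_mul, abs_norm, mul_assoc] at h3
    have hp : 0 < ‖c - z‖ := norm_pos_iff.2 (sub_ne_zero.2 hT.hzb.symm)
    have h4 := le_of_mul_le_mul_left h3 hp
    have h5 : |‖c - z‖ - ‖c - s‖| ≤ B * h := by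
      refine (abs_norm_sub_norm_le _ _).trans ?_
      rw [sub_sub_sub_cancel_left]; exact hs
    rw [abs_mul]
    calc _ ≤ (B * h) * |rayMean g k z c| := mul_le_mul_of_nonneg_right h5 (abs_nonneg _)
      _ = B * (|rayMean g k z c| * h) := by ring
      _ ≤ _ := by gcongr
  have h3 : |‖c - s‖ * (rayMean g k z c - (rayMean g k' s c - (k - k') / 2))| ≤ B ^ 2 * D := by
    rw [abs_mul, abs_norm]
    calc _ ≤ H * (B ^ 2 / H * D) := mul_le_mul hcs' h1 (abs_nonneg _) hH.le
      _ = _ := by field_simp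
  have e1 : edgeMoment g k z c - edgeMoment g k' s c + ‖c - s‖ * ((k - k') / 2) =
      (‖c - z‖ - ‖c - s‖) * rayMean g k z c +
        ‖c - s‖ * (rayMean g k z c - (rayMean g k' s c - (k - k') / 2)) := by
    rw [edgeMoment_eq, edgeMoment_eq]; ring
  rw [e1]
  exact (abs_add_le _ _).trans (by gcongr)

/-- The vectors at the two endpoints of a short edge. -/
lemma norm_vector_sub_le (hΩ : IsOpen Ω) (hg : Sob (closure Ω) g Dg) {h' H' : ℝ}
    (A' : Δ.AnisoAt B s e' h' H') (hs : s ∈ Δ.innerNbrs z) (hsh : ‖s - z‖ ≤ B * h)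
    (hsh' : ‖s - z‖ ≤ B * h') {k' δ' : ℝ}
    (hM : Δ.MomentBounds B z e h H (edgeMoment g k z) δ)
    (hopp : ∀ c b, Δ.IsRight B s e' H' c → Δ.IsRight B s (-e') H' b →
      |edgeMoment g k' s c + edgeMoment g k' s b| ≤ δ') {V V' : Plane}
    (hV : ∀ c ∈ Δ.nbrs z, H ≤ B * ‖c - z‖ → ‖V - edgeMoment g k z c • edgeDir z c‖ ≤ 3 * B * δ)
    (hV' : ∀ c ∈ Δ.nbrs s, H' ≤ B * ‖c - s‖ → ‖V' - edgeMoment g k' s c • edgeDir s c‖ ≤ 3 * B * δ')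
    (hD : Δ.gradL1 Dg z ≤ δ) : ‖V - V'‖ ≤ B ^ 4 * (δ + δ') := by
  obtain ⟨hBp, hB, hh, _⟩ := A.pos
  have hD0 := Δ.gradL1_nonneg Dg z
  have hδ : 0 ≤ δ := hD0.trans hD
  obtain ⟨c, b, hTc, hTb, hc, hb⟩ := A.short_two_sides hΩ hs hsh
  have hTc' := hTc.swap'
  have hTb' := hTb.swap'
  have hsh'' : ‖z - s‖ ≤ B * h' := by rwa [norm_sub_rev]
  have hlc := (A'.partner_long hTc' hsh'').1
  have hlb := (A'.partner_long hTb' hsh'').1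
  have hcn' := hTc'.swap.mem_nbrs
  have hbn' := hTb'.swap.mem_nbrs
  -- the two edges lie on opposite sides of `s`, too
  have hsides : |edgeMoment g k' s c + edgeMoment g k' s b| ≤ δ' := by
    have hneg : ∀ v w : Plane, cr (-v) w = -cr v w := fun v w => by simp [cr]; ring
    have hη := A.short_eta hTc hsh
    have hη' := A'.short_eta hTc' hsh''
    have s1 := A.sign_cr hsh hη hc
    have s2 := A.neg.sign_cr hsh (by rwa [hneg, abs_neg]) hb
    rw [hneg] at s2
    have hrot : ∀ x : Plane, cr (z - s) (x - s) = -cr (s - z) (x - z) := fun x => by simp [cr]; ring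
    have same : ∀ f : Plane, Δ.AnisoAt B s f h' H' → h' ≤ 2 * B * |cr f (z - s)| →
        Δ.IsRight B s f H' c → Δ.IsRight B s f H' b → False := by
      intro f A'' hη'' h1 h2
      have t1 := A''.sign_cr hsh'' hη'' h1
      have t2 := A''.sign_cr hsh'' hη'' h2
      rw [hrot] at t1 t2
      have p := mul_pos_of_neg_of_neg s1 s2
      have q := mul_pos_of_neg_of_neg t1 t2
      have r1 : 0 ≤ cr e (s - z) ^ 2 := sq_nonneg _
      have r2 : 0 ≤ cr f (z - s) ^ 2 := sq_nonneg _
      have p' : cr (s - z) (c - z) * cr (s - z) (b - z) < 0 := by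
        by_contra hcon
        push Not at hcon
        nlinarith [mul_nonneg hcon r1]
      nlinarith [mul_nonneg (neg_nonneg.2 p'.le) r2]
    rcases A'.right_or_left hcn' hlc with h1 | h1 <;> rcases A'.right_or_left hbn' hlb with h2 | h2
    · exact (same e' A' hη' h1 h2).elim
    · exact hopp c b h1 h2
    · rw [add_comm]; exact hopp b c h2 h1
    · exact (same (-e') A'.neg (by rwa [hneg, abs_neg]) h1 h2).elim
  have hδ' : 0 ≤ δ' := (abs_nonneg _).trans hsides
  have m1 := abs_le.1 (A.abs_edgeMoment_sub_le hg (k' := k') hM.le hTc hsh)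
  have m2 := abs_le.1 (A.abs_edgeMoment_sub_le hg (k' := k') hM.le hTb hsh)
  have m3 := abs_le.1 (hM.opposite c b hc hb)
  have m4 := abs_le.1 hsides
  set D := Δ.gradL1 Dg z
  set Ac := edgeMoment g k z c
  set Ab := edgeMoment g k z b
  set Sc := edgeMoment g k' s c
  set Sb := edgeMoment g k' s b
  have hBδ : 10 * δ ≤ B * δ := by gcongr
  have hB2 : 10 * (B * δ) ≤ B ^ 2 * δ := by
    rw [show B ^ 2 * δ = B * (B * δ) by ring]
    gcongr
  have hB2D : B ^ 2 * D ≤ B ^ 2 * δ := by gcongr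
  have hdiff : |Ac - Sc| ≤ 5 * B ^ 2 * δ + δ' := by
    have p1 : 0 ≤ ‖c - s‖ := norm_nonneg _
    have p2 : 0 ≤ ‖b - s‖ := norm_nonneg _
    set κ := (k - k') / 2
    have t1 : |(‖c - s‖ + ‖b - s‖) * κ| ≤ 2 * (B * δ + B ^ 2 * D) + δ + δ' := by
      rw [abs_le]; constructor <;> linarith
    have t2 : |‖c - s‖ * κ| ≤ |(‖c - s‖ + ‖b - s‖) * κ| := by
      rw [abs_mul, abs_mul, abs_of_nonneg p1, abs_of_nonneg (add_nonneg p1 p2)]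
      exact mul_le_mul_of_nonneg_right (by linarith) (abs_nonneg _)
    have t3 := abs_le.1 (t2.trans t1)
    rw [abs_le]; constructor <;> linarith
  have hdir : |Ac| * ‖edgeDir z c - edgeDir s c‖ ≤ 2 * B * δ := by
    have hcz : 0 < ‖c - z‖ := norm_pos_iff.2 (sub_ne_zero.2 hTc.hzb.symm)
    have h1 := norm_normalize_sub_le (u := c - z) (v := c - s) (sub_ne_zero.2 hTc.hab.symm)
    rw [sub_sub_sub_cancel_left] at h1
    have h2 : ‖c - z‖ * ‖edgeDir z c - edgeDir s c‖ ≤ 2 * (B * h) := h1.trans (by linarith)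
    refine le_of_mul_le_mul_left ?_ (mul_pos hh hcz)
    calc h * ‖c - z‖ * (|Ac| * ‖edgeDir z c - edgeDir s c‖) =
          (|Ac| * h) * (‖c - z‖ * ‖edgeDir z c - edgeDir s c‖) := by ring
      _ ≤ (‖c - z‖ * δ) * (2 * (B * h)) :=
          mul_le_mul (hM.le c hc.mem) h2 (by positivity) (by positivity)
      _ = _ := by ring
  have e1 : V - V' = (V - Ac • edgeDir z c) - (V' - Sc • edgeDir s c) +
      Ac • (edgeDir z c - edgeDir s c) + (Ac - Sc) • edgeDir s c := by module
  have n1 := hV c hc.mem hc.long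
  have n2 := hV' c hcn' hlc
  have hne : s ≠ c := hTc.hab
  have n3 : ‖V - V'‖ ≤ 3 * B * δ + 3 * B * δ' + 2 * B * δ + (5 * B ^ 2 * δ + δ') := by
    rw [e1]
    refine (norm_add_le _ _).trans (add_le_add ((norm_add_le _ _).trans (add_le_add
      ((_root_.norm_sub_le _ _).trans (by gcongr)) ?_)) ?_)
    · rw [norm_smul, norm_eq_abs]; exact hdir
    · rw [norm_smul, norm_eq_abs, norm_edgeDir hne, mul_one]; exact hdiff
  have q1 : 6 * B ^ 2 * δ ≤ B ^ 4 * δ := by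
    gcongr ?_ * _
    rw [show B ^ 4 = B ^ 2 * B ^ 2 by ring]
    gcongr; nlinarith
  have q2 : (3 * B + 1) * δ' ≤ B ^ 4 * δ' := by
    gcongr ?_ * _
    have := A.B_pow_le 2 4 (by norm_num)
    nlinarith
  linarith

end AnisoAt
end Triangulation

/-! ### The shape of anisotropic patches -/

/-- A bound of the cosines of the angles opposite the longest edges: these angles are at least
`π / 3` and at most `α₀`. -/
noncomputable def cosBound (α₀ : ℝ) : ℝ := max (1 / 2) (-Real.cos (max α₀ 0))

lemma cosBound_sq_lt_one {α₀ : ℝ} (hα₀ : α₀ < Real.pi) : cosBound α₀ ^ 2 < 1 := by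
  have h1 : -1 < Real.cos (max α₀ 0) := by
    rw [← Real.cos_pi]
    exact Real.cos_lt_cos_of_nonneg_of_le_pi (le_max_right _ _) le_rfl (max_lt hα₀ Real.pi_pos)
  have h2 : cosBound α₀ < 1 := max_lt (by norm_num) (by linarith)
  have h3 : 1 / 2 ≤ cosBound α₀ := le_max_left _ _
  nlinarith

lemma neg_cosBound_mul_le {α₀ : ℝ} (hα₀ : α₀ < Real.pi) (h : EuclideanGeometry.angle a b c ≤ α₀) :
    -(cosBound α₀ * (‖a - b‖ * ‖c - b‖)) ≤ ⟪a - b, c - b⟫ := by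
  rw [EuclideanGeometry.angle, vsub_eq_sub, vsub_eq_sub] at h
  rw [← InnerProductGeometry.cos_angle_mul_norm_mul_norm (a - b) (c - b), ← neg_mul]
  gcongr ?_ * _
  have h1 : Real.cos (max α₀ 0) ≤ Real.cos (InnerProductGeometry.angle (a - b) (c - b)) :=
    Real.cos_le_cos_of_nonneg_of_le_pi (InnerProductGeometry.angle_nonneg _ _)
      (max_lt hα₀ Real.pi_pos).le (h.trans (le_max_left _ _))
  have h2 : -Real.cos (max α₀ 0) ≤ cosBound α₀ := le_max_right _ _
  linarith

lemma norm_sq_mul_norm_sq (v w : Plane) : ‖v‖ ^ 2 * ‖w‖ ^ 2 = ⟪v, w⟫ ^ 2 + cr v w ^ 2 := by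
  rw [norm_sq_eq, norm_sq_eq, inner_eq, cr]; ring

/-- The shortest edge of a triangle with the longest edge `pq`. -/
lemma shortest_edge_le {α₀ : ℝ} (h1 : ‖p - r‖ ≤ ‖q - r‖) (h2 : ‖q - r‖ ≤ ‖p - q‖)
    (hang : -(cosBound α₀ * (‖p - r‖ * ‖q - r‖)) ≤ ⟪p - r, q - r⟫) :
    (1 - cosBound α₀ ^ 2) * (‖p - r‖ * ‖p - q‖) ^ 2 ≤ 4 * cr (p - r) (q - r) ^ 2 ∧
      ‖p - q‖ ≤ 2 * ‖q - r‖ := by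
  have hc : 1 / 2 ≤ cosBound α₀ := le_max_left _ _
  have h3 : ‖p - q‖ ≤ 2 * ‖q - r‖ := by
    have := _root_.norm_sub_le (p - r) (q - r)
    rw [sub_sub_sub_cancel_right] at this
    linarith
  refine ⟨?_, h3⟩
  have h4 : ‖p - q‖ ^ 2 = ‖p - r‖ ^ 2 - 2 * ⟪p - r, q - r⟫ + ‖q - r‖ ^ 2 := by
    rw [← norm_sub_sq_real, sub_sub_sub_cancel_right]
  have h5 := norm_sq_mul_norm_sq (p - r) (q - r)
  have n1 := norm_nonneg (p - r)
  have n2 := norm_nonneg (q - r)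
  set l := ‖p - r‖
  set m := ‖q - r‖
  set L := ‖p - q‖
  have h6 : ⟪p - r, q - r⟫ ≤ cosBound α₀ * (l * m) := by
    have h7 : m ^ 2 ≤ L ^ 2 := by gcongr
    have h8 : 2 * ⟪p - r, q - r⟫ ≤ l * m := by nlinarith
    have h9 : 0 ≤ l * m := by positivity
    nlinarith
  have h7 : ⟪p - r, q - r⟫ ^ 2 ≤ (cosBound α₀ * (l * m)) ^ 2 := sq_le_sq' (by linarith) h6
  by_cases hneg : 1 - cosBound α₀ ^ 2 ≤ 0
  · exact (mul_nonpos_of_nonpos_of_nonneg hneg (sq_nonneg _)).trans (by positivity)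
  · push Not at hneg
    have h8 : (l * L) ^ 2 ≤ 4 * (l ^ 2 * m ^ 2) := by
      have : (l * L) ^ 2 ≤ (l * (2 * m)) ^ 2 :=
        pow_le_pow_left₀ (by positivity) (by gcongr) 2
      nlinarith
    have h9 := mul_le_mul_of_nonneg_left h8 hneg.le
    nlinarith

namespace Triangulation

lemma IsTri.area_eq (h : Δ.IsTri z a b) : 2 * area {z, a, b} = |cr (a - z) (b - z)| := by
  rw [area, cell_eq, volume_triangle h.cr_ne]; ring

lemma le_maxEdge (hx : x ∈ T) (hy : y ∈ T) : ‖x - y‖ ≤ maxEdge T := by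
  rw [← dist_eq_norm]
  exact Metric.dist_le_diam_of_mem T.finite_toSet.isBounded hx hy

lemma maxEdge_le (h1 : ‖a - z‖ ≤ L) (h2 : ‖b - z‖ ≤ L) (h3 : ‖a - b‖ ≤ L) :
    maxEdge {z, a, b} ≤ L := by
  have hL := (norm_nonneg _).trans h1
  refine Metric.diam_le_of_forall_dist_le hL ?_
  intro x hx y hy
  simp only [Finset.coe_insert, Finset.coe_singleton, Set.mem_insert_iff, Set.mem_singleton_iff] at hx hy
  rw [dist_eq_norm]
  rcases hx with rfl | rfl | rfl <;> rcases hy with rfl | rfl | rfl <;>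
    first | (rw [sub_self, norm_zero]; exact hL) | assumption | (rw [norm_sub_rev]; assumption)

lemma card_nbrs_le (z : Plane) : (Δ.nbrs z).card ≤ 2 * (Δ.star z).card := by
  classical
  have h1 : Δ.nbrs z ⊆ (Δ.star z).biUnion fun T => T.erase z := by
    intro s hs
    obtain ⟨b, hb⟩ := exists_isTri_of_mem_nbrs hs
    exact Finset.mem_biUnion.2 ⟨_, hb.mem_star, Finset.mem_erase.2 ⟨hb.hza.symm, by simp⟩⟩
  refine (Finset.card_le_card h1).trans ?_
  rw [mul_comm]
  refine Finset.card_biUnion_le_card_mul _ _ _ fun T hT => ?_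
  have h2 := Δ.mem_star.1 hT
  rw [Finset.card_erase_of_mem h2.2, h2.1.2]

lemma exists_mem_star (hz : z ∈ Δ.nodes) : ∃ T, T ∈ Δ.star z := by
  obtain ⟨T, hT, hzT⟩ := Δ.mem_nodes.1 hz
  exact ⟨T, Δ.mem_star.2 ⟨Δ.mem_triangles.1 hT, hzT⟩⟩

lemma norm_sub_le_bigH (hx : x ∈ Δ.patch z) (hy : y ∈ Δ.patch z) : ‖x - y‖ ≤ Δ.bigH z := by
  rw [← dist_eq_norm]
  exact Metric.dist_le_diam_of_mem (isCompact_patch z).isBounded hx hy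

lemma maxEdge_le_bigH (hT : T ∈ Δ.star z) : maxEdge T ≤ Δ.bigH z :=
  Metric.diam_mono ((subset_convexHull ℝ _).trans (cell_subset_patch hT)) (isCompact_patch z).isBounded

lemma maxEdge_pos (hT : T ∈ Δ.star z) : 0 < maxEdge T := by
  obtain ⟨a, b, hab, rfl⟩ := exists_isTri_of_mem_star hT
  exact (norm_pos_iff.2 (sub_ne_zero.2 hab.hza.symm)).trans_le (le_maxEdge (by simp) (by simp))

lemma area_le_patchArea (hT : T ∈ Δ.star z) : area T ≤ Δ.patchArea z :=
  measureReal_mono (cell_subset_patch hT) (isCompact_patch z).measure_ne_top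

lemma bigH_pos (hz : z ∈ Δ.nodes) : 0 < Δ.bigH z := by
  obtain ⟨T, hT⟩ := exists_mem_star hz
  exact (maxEdge_pos hT).trans_le (maxEdge_le_bigH hT)

lemma patchArea_pos (hz : z ∈ Δ.nodes) : 0 < Δ.patchArea z := by
  obtain ⟨T, hT⟩ := exists_mem_star hz
  refine lt_of_lt_of_le ?_ (area_le_patchArea hT)
  obtain ⟨a, b, hab, rfl⟩ := exists_isTri_of_mem_star hT
  have := hab.area_eq
  have := abs_pos.2 hab.cr_ne
  linarith

lemma smallH_pos (hz : z ∈ Δ.nodes) : 0 < Δ.smallH z := div_pos (patchArea_pos hz) (bigH_pos hz)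

lemma smallH_mul_bigH (hz : z ∈ Δ.nodes) : Δ.smallH z * Δ.bigH z = Δ.patchArea z :=
  div_mul_cancel₀ _ (bigH_pos hz).ne'

lemma one_le_of_isAdmissible {α₀ K : ℝ} (h : Δ.IsAdmissible α₀ K) (hz : z ∈ Δ.nodes) : 1 ≤ K := by
  obtain ⟨T, hT⟩ := exists_mem_star hz
  refine le_trans ?_ (h.card_star z hz)
  exact_mod_cast Finset.card_pos.2 ⟨T, hT⟩

/-- A frame along the longer side of the rectangle around the patch. -/
lemma exists_frame {α₀ K : ℝ} (h : Δ.IsAdmissible α₀ K) (hz : z ∈ Δ.nodes) :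
    ∃ e : Plane, ‖e‖ = 1 ∧ (∀ x ∈ Δ.patch z, |cr e (x - z)| ≤ 2 * K * Δ.smallH z) ∧
      (z ∈ frontier Ω → ¬ IsCorner Ω z → ∀ s ∈ Δ.nbrs z, segment ℝ z s ⊆ frontier Ω →
        ⟪e, s - z⟫ = 0 ∨ cr e (s - z) = 0) := by
  obtain ⟨p, e, a, b, he, ha, hb, hR, hab, hor⟩ := h.orientation z hz
  have hK := one_le_of_isAdmissible h hz
  have hh := smallH_pos hz
  have hzp : z ∈ Δ.patch z := by
    obtain ⟨T, hT⟩ := exists_mem_star hz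
    exact cell_subset_patch hT (subset_convexHull ℝ _ (Δ.mem_star.1 hT).2)
  have he2 : e 0 ^ 2 + e 1 ^ 2 = 1 := by rw [← norm_sq_eq, he]; norm_num
  have hcr : ∀ v : Plane, cr (rot e) v = -⟪e, v⟫ := fun v => by simp [cr, rot, inner_eq]; ring
  have hin : ∀ v : Plane, ⟪v, rot e⟫ = cr e v := fun v => by simp [cr, rot, inner_eq]; ring
  have hsub : ∀ x ∈ Δ.patch z, ∀ y ∈ Δ.patch z, |cr e (x - y)| ≤ b ∧ |⟪e, x - y⟫| ≤ a := by
    intro x hx y hy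
    obtain ⟨s, hs, t, ht, rfl⟩ := hR hx
    obtain ⟨s', hs', t', ht', rfl⟩ := hR hy
    have e1 : cr e (p + s • e + t • rot e - (p + s' • e + t' • rot e)) = t - t' := by
      simp [cr, rot]; linear_combination (t - t') * he2
    have e2 : ⟪e, p + s • e + t • rot e - (p + s' • e + t' • rot e)⟫ = s - s' := by
      simp [inner_eq, rot]; linear_combination (s - s') * he2
    rw [e1, e2, abs_le, abs_le]
    refine ⟨⟨?_, ?_⟩, ?_, ?_⟩ <;> linarith [hs.1, hs.2, ht.1, ht.2, hs'.1, hs'.2, ht'.1, ht'.2]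
  have hHab : Δ.bigH z ≤ a + b := by
    refine Metric.diam_le_of_forall_dist_le (by positivity) fun x hx y hy => ?_
    have h1 := hsub x hx y hy
    rw [dist_eq_norm]
    refine (sq_le_sq₀ (norm_nonneg _) (by positivity)).1 ?_
    rw [frame_norm_sq he, ← sq_abs, ← sq_abs (cr e _)]
    have := pow_le_pow_left₀ (abs_nonneg _) h1.1 2
    have := pow_le_pow_left₀ (abs_nonneg _) h1.2 2
    nlinarith
  rw [← smallH_mul_bigH hz] at hab
  have key : ∀ {c d : ℝ}, 0 < c → 0 < d → c ≤ d → c * d ≤ K * (Δ.smallH z * Δ.bigH z) →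
      Δ.bigH z ≤ c + d → c ≤ 2 * K * Δ.smallH z := by
    intro c d hc hd hcd h1 h2
    have h3 : Δ.bigH z ≤ 2 * d := by linarith
    have h4 : c * d ≤ (2 * K * Δ.smallH z) * d := by
      have : K * Δ.smallH z * Δ.bigH z ≤ K * Δ.smallH z * (2 * d) :=
        mul_le_mul_of_nonneg_left h3 (by positivity)
      linarith
    exact le_of_mul_le_mul_right h4 hd
  rcases le_total b a with hle | hle
  · refine ⟨e, he, fun x hx => (hsub x hx z hzp).1.trans (key hb ha hle (by linarith) (by linarith)), ?_⟩
    intro hzf hc s hs hsf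
    rcases hor hzf hc s hs hsf with h | h
    · left; rwa [real_inner_comm]
    · right; rwa [hin] at h
  · refine ⟨rot e, by rw [norm_rot, he], fun x hx => ?_, ?_⟩
    · rw [hcr, abs_neg]
      exact (hsub x hx z hzp).2.trans (key ha hb hle hab hHab)
    · intro hzf hc s hs hsf
      rcases hor hzf hc s hs hsf with h | h
      · right; rw [hcr, real_inner_comm, h, neg_zero]
      · left; rwa [real_inner_comm]

/-- The constant of the anisotropic patches, in terms of `α₀` and `K`. -/
noncomputable def anisoConst (α₀ K : ℝ) : ℝ :=
  10 + 2 * |K| + K ^ 2 + 2 * |K| / sqrt (1 - cosBound α₀ ^ 2)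

/-- The edges of a triangle at an anisotropic node. -/
lemma anisotropic_edges {α₀ K D : ℝ} (hα₀ : α₀ < Real.pi) (hK : 1 ≤ K) (hh : 0 < h)
    (hD : D = ‖p - q‖) (hD0 : 0 < D) (hcr : |cr (p - r) (q - r)| ≤ K * h * D) (hHD : H ≤ K * D)
    (h1 : ‖p - r‖ ≤ ‖q - r‖) (h2 : ‖q - r‖ ≤ ‖p - q‖)
    (hang : -(cosBound α₀ * (‖p - r‖ * ‖q - r‖)) ≤ ⟪p - r, q - r⟫) :
    ‖p - r‖ ≤ anisoConst α₀ K * h ∧ H ≤ anisoConst α₀ K * ‖q - r‖ ∧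
      H ≤ anisoConst α₀ K * ‖p - q‖ := by
  obtain ⟨h3, h4⟩ := shortest_edge_le h1 h2 hang
  have hσ : 0 < 1 - cosBound α₀ ^ 2 := by linarith [cosBound_sq_lt_one hα₀]
  have hσ' := Real.sqrt_pos.2 hσ
  have hKa : |K| = K := abs_of_nonneg (by linarith)
  have hfrac : 0 ≤ 2 * K / sqrt (1 - cosBound α₀ ^ 2) := by positivity
  have hB : 2 * K / sqrt (1 - cosBound α₀ ^ 2) ≤ anisoConst α₀ K := by
    rw [anisoConst, hKa]; nlinarith
  have hB2 : 2 * K ≤ anisoConst α₀ K := by rw [anisoConst, hKa]; nlinarith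
  refine ⟨?_, ?_, ?_⟩
  · have h5 : sqrt (1 - cosBound α₀ ^ 2) * (‖p - r‖ * D) ≤ 2 * (K * h * D) := by
      refine (sq_le_sq₀ (by positivity) (by positivity)).1 ?_
      rw [mul_pow, sq_sqrt hσ.le, hD]
      refine h3.trans ?_
      have := pow_le_pow_left₀ (abs_nonneg _) hcr 2
      rw [sq_abs, hD] at this
      rw [mul_pow]; linarith
    have h6 : ‖p - r‖ ≤ 2 * K / sqrt (1 - cosBound α₀ ^ 2) * h := by
      rw [div_mul_eq_mul_div, le_div_iff₀ hσ']
      refine le_of_mul_le_mul_right ?_ hD0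
      linarith
    exact h6.trans (by gcongr)
  · calc H ≤ K * (2 * ‖q - r‖) := hHD.trans (by gcongr; rw [hD]; exact h4)
      _ = 2 * K * ‖q - r‖ := by ring
      _ ≤ _ := mul_le_mul_of_nonneg_right hB2 (norm_nonneg _)
  · calc H ≤ K * ‖p - q‖ := by rw [← hD]; exact hHD
      _ ≤ _ := mul_le_mul_of_nonneg_right (by linarith) (norm_nonneg _)

/-- The vector `e` is the direction of a side of the rectangle around the patch, which is aligned with the
boundary; the maximum angle condition separates short and long edges. -/
lemma exists_anisoAt {α₀ K c₀ : ℝ} (hα₀ : α₀ < Real.pi) (h : Δ.IsAdmissible α₀ K)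
    (hz : z ∈ Δ.nodes) (ha : Δ.IsAnisotropic c₀ K z) (hc₀ : c₀ * anisoConst α₀ K ^ 12 ≤ 1) :
    ∃ e : Plane, Δ.AnisoAt (anisoConst α₀ K) z e (Δ.smallH z) (Δ.bigH z) ∧
      (z ∈ frontier Ω → ¬ IsCorner Ω z → ∀ s ∈ Δ.nbrs z, segment ℝ z s ⊆ frontier Ω →
        ⟪e, s - z⟫ = 0 ∨ cr e (s - z) = 0) := by
  obtain ⟨e, he, hη, hor⟩ := exists_frame h hz
  have hK := one_le_of_isAdmissible h hz
  have hH := bigH_pos hz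
  have hh := smallH_pos hz
  have hKa : |K| = K := abs_of_nonneg (by linarith)
  have hfrac : 0 ≤ 2 * K / sqrt (1 - cosBound α₀ ^ 2) := by positivity
  have hB2 : 2 * K ≤ anisoConst α₀ K := by rw [anisoConst, hKa]; nlinarith
  have hBK : K ^ 2 ≤ anisoConst α₀ K := by rw [anisoConst, hKa]; nlinarith
  have hB10 : 10 ≤ anisoConst α₀ K := by rw [anisoConst, hKa]; nlinarith
  have hT : ∀ a b, Δ.IsTri z a b → |cr (a - z) (b - z)| ≤ K * Δ.smallH z * maxEdge {z, a, b} ∧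
      Δ.smallH z * Δ.bigH z ≤ K ^ 2 * |cr (a - z) (b - z)| ∧ Δ.bigH z ≤ K * maxEdge {z, a, b} := by
    intro a b hab
    obtain ⟨⟨h1, h2⟩, -, h4⟩ := ha.2 _ hab.mem_star
    have hD := maxEdge_pos hab.mem_star
    rw [minHeight, hab.area_eq] at h1 h2
    rw [div_le_iff₀ hD] at h1
    have h5 : Δ.smallH z * maxEdge {z, a, b} ≤ K * |cr (a - z) (b - z)| := by
      rwa [← mul_div_assoc, le_div_iff₀ hD] at h2
    refine ⟨h1, ?_, h4⟩
    calc _ ≤ Δ.smallH z * (K * maxEdge {z, a, b}) := by gcongr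
      _ = K * (Δ.smallH z * maxEdge {z, a, b}) := by ring
      _ ≤ K * (K * |cr (a - z) (b - z)|) := by gcongr
      _ = _ := by ring
  refine ⟨e, ⟨hB10, he, hh, ?_, ?_, fun x hx y hy => norm_sub_le_bigH hx hy, fun x hx => ?_,
    fun a b hab => ?_, fun a b hab => ?_⟩, hor⟩
  · have h1 : anisoConst α₀ K ^ 12 * Δ.smallH z ≤ anisoConst α₀ K ^ 12 * (c₀ * Δ.bigH z) :=
      mul_le_mul_of_nonneg_left ha.1.le (by positivity)
    have h2 := mul_le_mul_of_nonneg_right hc₀ hH.le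
    linarith
  · have h1 : ((Δ.nbrs z).card : ℝ) ≤ 2 * ((Δ.star z).card : ℝ) := by exact_mod_cast card_nbrs_le z
    linarith [h.card_star z hz]
  · exact (hη x hx).trans (by gcongr)
  · exact (hT a b hab).2.1.trans (mul_le_mul_of_nonneg_right hBK (abs_nonneg _))
  -- each triangle at `z` has one short and two long edges: six orders of the three lengths
  · obtain ⟨h1, -, h3⟩ := hT a b hab
    have hD := maxEdge_pos hab.mem_star
    have hin := Δ.star_subset hab.mem_star
    have ang := fun {x y w : Plane} (hx : x ∈ ({z, a, b} : Finset Plane)) (hy : y ∈ ({z, a, b} : Finset Plane))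
      (hw : w ∈ ({z, a, b} : Finset Plane)) (h1 : x ≠ y) (h2 : y ≠ w) (h3 : x ≠ w) =>
      neg_cosBound_mul_le hα₀ (h.maxAngle _ hin x hx y hy w hw h1 h2 h3)
    have l1 : ‖a - z‖ ≤ maxEdge {z, a, b} := le_maxEdge (by simp) (by simp)
    have l2 : ‖b - z‖ ≤ maxEdge {z, a, b} := le_maxEdge (by simp) (by simp)
    have l3 : ‖a - b‖ ≤ maxEdge {z, a, b} := le_maxEdge (by simp) (by simp)
    have mz : z ∈ ({z, a, b} : Finset Plane) := by simp
    have ma : a ∈ ({z, a, b} : Finset Plane) := by simp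
    have mb : b ∈ ({z, a, b} : Finset Plane) := by simp
    have key := fun {p q r : Plane} (hL : maxEdge {z, a, b} = ‖p - q‖)
      (hc : |cr (p - r) (q - r)| = |cr (a - z) (b - z)|) (k1 : ‖p - r‖ ≤ ‖q - r‖)
      (k2 : ‖q - r‖ ≤ ‖p - q‖) (hang : -(cosBound α₀ * (‖p - r‖ * ‖q - r‖)) ≤ ⟪p - r, q - r⟫) =>
      anisotropic_edges hα₀ hK hh hL hD (by rw [hc]; exact h1) h3 k1 k2 hang
    have c1 : |cr (b - z) (a - z)| = |cr (a - z) (b - z)| := by rw [cr_comm, abs_neg]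
    have c2 : |cr (z - a) (b - a)| = |cr (a - z) (b - z)| := by
      rw [← abs_neg]; congr 1; simp [cr]; ring
    have c3 : |cr (b - a) (z - a)| = |cr (a - z) (b - z)| := by congr 1; simp [cr]; ring
    have c4 : |cr (z - b) (a - b)| = |cr (a - z) (b - z)| := by congr 1; simp [cr]; ring
    have c5 : |cr (a - b) (z - b)| = |cr (a - z) (b - z)| := by
      rw [← abs_neg]; congr 1; simp [cr]; ring
    have nz := hab.hza
    have nb := hab.hzb
    have nab := hab.hab
    rcases le_total ‖a - z‖ ‖b - z‖ with o1 | o1 <;> rcases le_total ‖a - z‖ ‖a - b‖ with o2 | o2 <;>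
      rcases le_total ‖b - z‖ ‖a - b‖ with o3 | o3
    · -- the longest edge is `ab`, the shortest one `az`
      have hL := le_antisymm (maxEdge_le o2 o3 le_rfl) l3
      obtain ⟨k1, k2, k3⟩ := key (p := a) (q := b) (r := z) hL rfl o1 o3 (ang ma mz mb nz.symm nb nab)
      exact Or.inr (Or.inl ⟨k1, k2, k3⟩)
    · have hL := le_antisymm (maxEdge_le o1 le_rfl o3) l2
      obtain ⟨k1, k2, k3⟩ := key (p := z) (q := b) (r := a) (by rw [hL, norm_sub_rev]) c2
        (by rw [norm_sub_rev z, norm_sub_rev b]; exact o2) (by rw [norm_sub_rev b, norm_sub_rev z]; exact o3)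
        (ang mz ma mb nz nab nb)
      rw [norm_sub_rev z] at k1 k3
      rw [norm_sub_rev b] at k2
      exact Or.inr (Or.inl ⟨k1, k3, k2⟩)
    · have hL := le_antisymm (maxEdge_le o1 le_rfl (o2.trans o1)) l2
      obtain ⟨k1, k2, k3⟩ := key (p := b) (q := z) (r := a) hL c3
        (by rw [norm_sub_rev b, norm_sub_rev z]; exact o2) (by rw [norm_sub_rev z]; exact o1)
        (ang mb ma mz nab.symm nz.symm nb.symm)
      rw [norm_sub_rev b] at k1
      rw [norm_sub_rev z] at k2
      exact Or.inl ⟨k1, k2, k3⟩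
    · have hL := le_antisymm (maxEdge_le o1 le_rfl o3) l2
      obtain ⟨k1, k2, k3⟩ := key (p := b) (q := z) (r := a) hL c3
        (by rw [norm_sub_rev b, norm_sub_rev z]; exact o2) (by rw [norm_sub_rev z]; exact o1)
        (ang mb ma mz nab.symm nz.symm nb.symm)
      rw [norm_sub_rev b] at k1
      rw [norm_sub_rev z] at k2
      exact Or.inl ⟨k1, k2, k3⟩
    · have hL := le_antisymm (maxEdge_le o2 o3 le_rfl) l3
      obtain ⟨k1, k2, k3⟩ := key (p := b) (q := a) (r := z) (by rw [hL, norm_sub_rev]) c1 o1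
        (by rw [norm_sub_rev b]; exact o2) (ang mb mz ma nb.symm nz nab.symm)
      rw [norm_sub_rev b] at k3
      exact Or.inr (Or.inr ⟨k1, k2, k3⟩)
    · have hL := le_antisymm (maxEdge_le o2 (o1.trans o2) le_rfl) l3
      obtain ⟨k1, k2, k3⟩ := key (p := b) (q := a) (r := z) (by rw [hL, norm_sub_rev]) c1 o1
        (by rw [norm_sub_rev b]; exact o2) (ang mb mz ma nb.symm nz nab.symm)
      rw [norm_sub_rev b] at k3
      exact Or.inr (Or.inr ⟨k1, k2, k3⟩)
    · have hL := le_antisymm (maxEdge_le le_rfl o1 o2) l1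
      obtain ⟨k1, k2, k3⟩ := key (p := z) (q := a) (r := b) (by rw [hL, norm_sub_rev]) c4
        (by rw [norm_sub_rev z]; exact o3) (by rw [norm_sub_rev z]; exact o2)
        (ang mz mb ma nb nab.symm nz)
      rw [norm_sub_rev z] at k1 k3
      exact Or.inr (Or.inr ⟨k1, k3, k2⟩)
    · have hL := le_antisymm (maxEdge_le le_rfl o1 o2) l1
      obtain ⟨k1, k2, k3⟩ := key (p := a) (q := z) (r := b) hL c5
        (by rw [norm_sub_rev z]; exact o3) (by rw [norm_sub_rev z]; exact o1)
        (ang ma mb mz nab nb.symm nz.symm)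
      rw [norm_sub_rev z] at k2
      exact Or.inl ⟨k1, k3, k2⟩

namespace AnisoAt
variable (A : Δ.AnisoAt B z e h H)
include A

lemma mono {B' : ℝ} (hB : B ≤ B') (hs : B' ^ 12 * h ≤ H) : Δ.AnisoAt B' z e h H := by
  have hh := A.h_pos
  have le : ∀ {x : ℝ}, 0 ≤ x → B * x ≤ B' * x := fun hx => mul_le_mul_of_nonneg_right hB hx
  have n := fun v : Plane => norm_nonneg v
  refine ⟨A.hB.trans hB, A.norm_e, hh, hs, A.card_le.trans hB, A.dist_le,
    fun x hx => (A.eta_le x hx).trans (le hh.le), fun a b h => (A.cr_ge a b h).trans (le (abs_nonneg _)),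
    fun a b h => ?_⟩
  rcases A.cases a b h with h | h | h
  · exact Or.inl ⟨h.1.trans (le hh.le), h.2.1.trans (le (n _)), h.2.2.trans (le (n _))⟩
  · exact Or.inr (Or.inl ⟨h.1.trans (le hh.le), h.2.1.trans (le (n _)), h.2.2.trans (le (n _))⟩)
  · exact Or.inr (Or.inr ⟨h.1.trans (le hh.le), h.2.1.trans (le (n _)), h.2.2.trans (le (n _))⟩)

/-- The frame may be aligned with any long edge. -/
lemma rotate (hy : y ∈ Δ.nbrs z) (hl : H ≤ B * ‖y - z‖)
    (hs : (B ^ 3) ^ 12 * h ≤ H) : Δ.AnisoAt (B ^ 3) z (edgeDir z y) h H := by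
  obtain ⟨_, hB, hh, hH⟩ := A.pos
  have hp : 0 < ‖y - z‖ := norm_pos_iff.2 (sub_ne_zero.2 (mem_nbrs_edge hy).2.1.symm)
  have hd := norm_edgeDir (mem_nbrs_edge hy).2.1
  have A' := A.mono (B' := B ^ 3) (by have := A.B_pow_le 1 3 (by norm_num); linarith) hs
  refine { A' with norm_e := hd, eta_le := fun x hx => ?_ }
  have h1 : |cr e (edgeDir z y)| * H ≤ B ^ 2 * h := by
    rw [edgeDir, cr_smul_right, abs_mul, abs_inv, abs_norm]
    have h2 := A.abs_eta_le hy
    calc ‖y - z‖⁻¹ * |cr e (y - z)| * H ≤ ‖y - z‖⁻¹ * (B * h) * (B * ‖y - z‖) := by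
          refine mul_le_mul (by gcongr) hl hH.le (by positivity)
      _ = _ := by field_simp
  rw [frame_cr A.norm_e]
  have h2 : |⟪e, edgeDir z y⟫ * cr e (x - z)| ≤ B * h := by
    rw [abs_mul]
    have h3 := abs_frame_inner_le A.norm_e (edgeDir z y)
    rw [hd] at h3
    calc _ ≤ 1 * (B * h) := mul_le_mul h3 (A.eta_le x hx) (abs_nonneg _) zero_le_one
      _ = _ := one_mul _
  have h3 : |cr e (edgeDir z y) * ⟪e, x - z⟫| ≤ B ^ 2 * h := by
    rw [abs_mul]
    refine (mul_le_mul_of_nonneg_left ?_ (abs_nonneg _)).trans h1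
    exact (abs_frame_inner_le A.norm_e _).trans (A.dist_le _ hx _ (mem_patch_of_mem_nbrs hy).2)
  have h4 : B * h + B ^ 2 * h ≤ B ^ 3 * h := by
    rw [← add_mul]
    gcongr ?_ * _
    have : 0 < B * B := by positivity
    nlinarith
  refine (abs_sub _ _).trans ?_
  linarith

lemma longest_long (hz : z ∈ Δ.nodes)
    (hmax : ∀ s ∈ Δ.nbrs z, dist z s ≤ dist z y) : H ≤ B * ‖y - z‖ := by
  obtain ⟨T, hT⟩ := exists_mem_star hz
  obtain ⟨a, b, hab, -⟩ := exists_isTri_of_mem_star hT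
  have key : ∀ s ∈ Δ.nbrs z, H ≤ B * ‖s - z‖ → H ≤ B * ‖y - z‖ := fun s hs hl => by
    have := hmax s hs
    rw [dist_comm, dist_eq_norm, dist_comm, dist_eq_norm] at this
    exact hl.trans (mul_le_mul_of_nonneg_left this A.B_pos.le)
  rcases A.cases a b hab with h | h | h
  · exact key a hab.mem_nbrs h.2.1
  · exact key b hab.swap.mem_nbrs h.2.1
  · exact key a hab.mem_nbrs h.2.1

/-- The threshold `κ` separates short and long edges. -/
lemma lt_dist_iff {κ : ℝ} (hκ : B ≤ κ) (hκh : κ * B * h < H) (hs : s ∈ Δ.nbrs z) :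
    κ * h < dist z s ↔ H ≤ B * ‖s - z‖ := by
  have hh := A.h_pos
  rw [dist_comm, dist_eq_norm]
  refine ⟨fun hlt => (A.short_or_long hs).resolve_left fun hsh => ?_, fun hl => ?_⟩
  · have := mul_le_mul_of_nonneg_right hκ hh.le
    linarith
  · refine lt_of_mul_lt_mul_left ?_ A.B_pos.le
    linarith

end AnisoAt
end Triangulation

/-! ### Local energies -/

namespace Triangulation

/-- The contribution of the patch of `z` to `Θ`. -/
noncomputable def localTheta (Δ : Triangulation Ω) (ε : ℝ) (g : Plane → ℝ) (Dg : Plane → Plane) (z : Plane) : ℝ :=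
  ε ^ 2 * (∫ x in Δ.patch z, ‖Dg x‖ ^ 2) +
    (1 + ε ^ 2 * (Δ.bigH z ^ 2)⁻¹) * ∫ x in Δ.patch z, g x ^ 2

/-- The weight of the jumps in the patch of `z`. -/
noncomputable def localMass (Δ : Triangulation Ω) (ε : ℝ) (z : Plane) : ℝ :=
  min (Δ.patchArea z) (ε * Δ.bigH z)

/-- The quantity that bounds the moments of `g` in the patch of `z`. -/
noncomputable def localError (Δ : Triangulation Ω) (ε : ℝ) (g : Plane → ℝ) (Dg : Plane → Plane) (z : Plane) : ℝ :=
  sqrt (Δ.localTheta ε g Dg z * Δ.localMass ε z) / ε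

lemma localTheta_nonneg (z : Plane) : 0 ≤ Δ.localTheta ε g Dg z := by rw [localTheta]; positivity

lemma localMass_nonneg (hε : 0 < ε) (z : Plane) : 0 ≤ Δ.localMass ε z :=
  le_min measureReal_nonneg (mul_nonneg hε.le Metric.diam_nonneg)

lemma localError_nonneg (hε : 0 < ε) (z : Plane) : 0 ≤ Δ.localError ε g Dg z :=
  div_nonneg (Real.sqrt_nonneg _) hε.le

lemma localError_sq (hε : 0 < ε) (z : Plane) :
    Δ.localError ε g Dg z ^ 2 = Δ.localTheta ε g Dg z * Δ.localMass ε z / ε ^ 2 := by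
  rw [localError, div_pow, sq_sqrt (mul_nonneg (localTheta_nonneg z) (localMass_nonneg hε z))]

/-- Square integrability of `g` and of its gradient. -/
structure SqIntegrable (Ω : Set Plane) (g : Plane → ℝ) (Dg : Plane → Plane) : Prop where
  memLp : MemLp g 2 (volume.restrict (closure Ω))
  memLp_grad : MemLp Dg 2 (volume.restrict (closure Ω))

namespace SqIntegrable

lemma restrict (h : SqIntegrable Ω g Dg) (z : Plane) :
    MemLp g 2 (volume.restrict (Δ.patch z)) ∧ MemLp Dg 2 (volume.restrict (Δ.patch z)) :=
  ⟨h.memLp.mono_measure (Measure.restrict_mono_set _ (patch_subset_closure z)),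
    h.memLp_grad.mono_measure (Measure.restrict_mono_set _ (patch_subset_closure z))⟩

lemma integrable (h : SqIntegrable Ω g Dg) (z : Plane) :
    Integrable (fun x => g x ^ 2) (volume.restrict (Δ.patch z)) ∧
      Integrable (fun x => ‖Dg x‖ ^ 2) (volume.restrict (Δ.patch z)) := by
  refine ⟨(h.restrict z).1.integrable_sq, ?_⟩
  exact (memLp_two_iff_integrable_sq_norm (h.restrict z).2.aestronglyMeasurable).1 (h.restrict z).2

/-- Young's inequality for the gradient of `g²`. -/
lemma integral_grad_sq_le (h : SqIntegrable Ω g Dg) (z : Plane) (ht : 0 < t) :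
    ∫ x in Δ.patch z, ‖(2 * g x) • Dg x‖ ≤
      (∫ x in Δ.patch z, g x ^ 2) / t + t * ∫ x in Δ.patch z, ‖Dg x‖ ^ 2 := by
  obtain ⟨h1, h2⟩ := h.integrable (Δ := Δ) z
  rw [← integral_div, ← integral_const_mul, ← integral_add (h1.div_const t) (h2.const_mul t)]
  refine integral_mono_of_nonneg (ae_of_all _ fun _ => norm_nonneg _)
    ((h1.div_const t).add (h2.const_mul t)) (ae_of_all _ fun x => ?_)
  simp only [norm_smul, norm_mul, Real.norm_ofNat, norm_eq_abs]
  rw [div_add' _ _ _ ht.ne', le_div_iff₀ ht, ← sq_abs (g x)]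
  nlinarith [sq_nonneg (|g x| - t * ‖Dg x‖)]

lemma integral_norm_grad_sq_le (h : SqIntegrable Ω g Dg) (z : Plane) :
    Δ.gradL1 Dg z ^ 2 ≤ Δ.patchArea z * ∫ x in Δ.patch z, ‖Dg x‖ ^ 2 := by
  have hfin : IsFiniteMeasure (volume.restrict (Δ.patch z)) :=
    ⟨by rw [Measure.restrict_apply_univ]; exact (isCompact_patch z).measure_lt_top⟩
  obtain ⟨-, h2⟩ := h.integrable (Δ := Δ) z
  have h3 : Integrable (fun x => ‖Dg x‖) (volume.restrict (Δ.patch z)) :=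
    ((h.restrict z).2.integrable (by norm_num)).norm
  set D := Δ.gradL1 Dg z
  set N := ∫ x in Δ.patch z, ‖Dg x‖ ^ 2
  have key : ∀ t : ℝ, 2 * t * D ≤ N + t ^ 2 * Δ.patchArea z := by
    intro t
    have h4 : ∫ x in Δ.patch z, 2 * t * ‖Dg x‖ ≤ ∫ x in Δ.patch z, (‖Dg x‖ ^ 2 + t ^ 2) :=
      integral_mono (h3.const_mul _) (h2.add (integrable_const _)) fun x => by
        simp only
        nlinarith [sq_nonneg (‖Dg x‖ - t)]
    rw [integral_const_mul, integral_add h2 (integrable_const _), integral_const, smul_eq_mul,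
      measureReal_restrict_apply MeasurableSet.univ, Set.univ_inter] at h4
    rw [patchArea]; linarith
  -- the discriminant of a nonnegative quadratic polynomial
  have := discrim_le_zero (a := Δ.patchArea z) (b := -2 * D) (c := N) fun t => by
    have := key t; nlinarith
  rw [discrim] at this
  nlinarith

/-- If `h_z ≤ ε`, the gradient of `g` is under control. -/
lemma integral_grad_le_localError (h : SqIntegrable Ω g Dg) (hz : z ∈ Δ.nodes) (hε : 0 < ε)
    (hle : Δ.smallH z ≤ ε) : Δ.gradL1 Dg z ≤ Δ.localError ε g Dg z := by
  refine (sq_le_sq₀ (integral_nonneg fun _ => norm_nonneg _) (localError_nonneg hε z)).1 ?_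
  have h1 := h.integral_norm_grad_sq_le (Δ := Δ) z
  have hH := bigH_pos hz
  have hm : Δ.localMass ε z = Δ.patchArea z := by
    rw [localMass, min_eq_left]
    rw [← smallH_mul_bigH hz]
    gcongr
  have hω := patchArea_pos hz
  rw [localError_sq hε, hm, localTheta, le_div_iff₀ (by positivity)]
  have h2 : 0 ≤ (1 + ε ^ 2 * (Δ.bigH z ^ 2)⁻¹) * ∫ x in Δ.patch z, g x ^ 2 := by positivity
  have h3 := mul_le_mul_of_nonneg_right h1 (sq_nonneg ε)
  nlinarith [mul_nonneg h2 hω.le]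

/-- If `ε ≲ h_z`, the terms of the trace inequality are under control. -/
lemma traceTerm_le_localError (h : SqIntegrable Ω g Dg) (hz : z ∈ Δ.nodes) (hε : 0 < ε) (hL : 1 ≤ L) (hle : ε ≤ L * Δ.smallH z) :
    Δ.bigH z * Δ.traceTerm (Δ.smallH z) z g Dg ≤ 2 * L ^ 2 * Δ.localError ε g Dg z ^ 2 := by
  have hH := bigH_pos hz
  have hh := smallH_pos hz
  have h1 := h.integral_grad_sq_le (Δ := Δ) z hε
  rw [traceTerm, localError_sq hε, localTheta]
  have hN : 0 ≤ ∫ x in Δ.patch z, g x ^ 2 := integral_nonneg fun _ => sq_nonneg _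
  set N := ∫ x in Δ.patch z, g x ^ 2
  set M := ∫ x in Δ.patch z, ‖Dg x‖ ^ 2
  set H := Δ.bigH z
  set h' := Δ.smallH z
  have hm : ε * H ≤ L * Δ.localMass ε z := by
    rw [localMass, ← smallH_mul_bigH hz, mul_min_of_nonneg _ _ (by linarith)]
    refine le_min ?_ ?_
    · rw [← mul_assoc]; gcongr
    · have : 0 ≤ ε * H := by positivity
      nlinarith
  have h2 : N / h' ≤ L * (N / ε) := by
    rw [← mul_div_assoc, div_le_div_iff₀ hh hε]
    nlinarith
  have hQ : 0 ≤ N / ε + ε * M := by positivity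
  have h3 : N / h' + ∫ x in Δ.patch z, ‖(2 * g x) • Dg x‖ ≤ 2 * L * (N / ε + ε * M) := by
    have : 0 ≤ ε * M := by positivity
    nlinarith [div_nonneg hN hε.le]
  have h4 : ε * (N / ε + ε * M) ≤ ε ^ 2 * M + (1 + ε ^ 2 * (H ^ 2)⁻¹) * N := by
    have : 0 ≤ ε ^ 2 * (H ^ 2)⁻¹ * N := by positivity
    rw [mul_add, mul_div_cancel₀ _ hε.ne']
    nlinarith
  have h5 : (ε * (N / ε + ε * M)) * (ε * H) ≤
      (ε ^ 2 * M + (1 + ε ^ 2 * (H ^ 2)⁻¹) * N) * (L * Δ.localMass ε z) :=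
    mul_le_mul h4 hm (by positivity) (by positivity)
  calc H * (N / h' + ∫ x in Δ.patch z, ‖(2 * g x) • Dg x‖)
      ≤ H * (2 * L * (N / ε + ε * M)) := by gcongr
    _ = 2 * L * ((ε * (N / ε + ε * M)) * (ε * H)) / ε ^ 2 := by field_simp
    _ ≤ 2 * L * ((ε ^ 2 * M + (1 + ε ^ 2 * (H ^ 2)⁻¹) * N) * (L * Δ.localMass ε z)) / ε ^ 2 := by
        gcongr
    _ = _ := by ring

end SqIntegrable

/-! ### Regular nodes -/

lemma norm_sub_sq_le_of_isRegular {M : ℝ} (hr : Δ.IsRegular M z)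
    (hT : Δ.IsTri z a b) : maxEdge {z, a, b} ^ 2 ≤ M * |cr (a - z) (b - z)| := by
  have h1 := hr _ hT.mem_star
  have hD := maxEdge_pos hT.mem_star
  rw [minHeight, hT.area_eq, ← mul_div_assoc, le_div_iff₀ hD] at h1
  rwa [sq]

lemma bigH_sq_le_of_isRegular {M : ℝ} (hz : z ∈ Δ.nodes) (hr : Δ.IsRegular M z) :
    0 < M ∧ Δ.bigH z ^ 2 ≤ 8 * M * Δ.patchArea z := by
  have hM : ∀ {a b}, Δ.IsTri z a b → 0 < M := fun {a b} hT => by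
    have h1 := norm_sub_sq_le_of_isRegular hr hT
    have h2 := maxEdge_pos hT.mem_star
    by_contra hcon
    push Not at hcon
    have := mul_nonpos_of_nonpos_of_nonneg hcon (abs_nonneg (cr (a - z) (b - z)))
    have : 0 < maxEdge {z, a, b} ^ 2 := by positivity
    linarith
  have hMp : 0 < M := by
    obtain ⟨T, hT⟩ := exists_mem_star hz
    obtain ⟨a, b, hab, -⟩ := exists_isTri_of_mem_star hT
    exact hM hab
  refine ⟨hMp, ?_⟩
  have hω := patchArea_pos hz
  have hrad : ∀ x ∈ Δ.patch z, ‖x - z‖ ≤ sqrt (2 * M * Δ.patchArea z) := by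
    intro x hx
    obtain ⟨T, hT, hxT⟩ : ∃ T ∈ Δ.star z, x ∈ cell T := by simpa [patch] using hx
    obtain ⟨a, b, hab, rfl⟩ := exists_isTri_of_mem_star hT
    have h1 : ‖x - z‖ ≤ maxEdge {z, a, b} := by
      rw [← dist_eq_norm, maxEdge, ← convexHull_diam]
      exact Metric.dist_le_diam_of_mem (isCompact_cell _).isBounded hxT
        (subset_convexHull ℝ _ (by simp))
    refine h1.trans (Real.le_sqrt_of_sq_le ?_)
    have h2 := norm_sub_sq_le_of_isRegular hr hab
    have h3 := area_le_patchArea hT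
    rw [← hab.area_eq] at h2
    nlinarith
  have h1 : Δ.bigH z ≤ 2 * sqrt (2 * M * Δ.patchArea z) := by
    refine Metric.diam_le_of_forall_dist_le (by positivity) fun x hx y hy => ?_
    have := dist_triangle_right x y z
    rw [dist_eq_norm x z, dist_eq_norm y z] at this
    linarith [hrad x hx, hrad y hy]
  have h2 := pow_le_pow_left₀ (bigH_pos hz).le h1 2
  rw [mul_pow, sq_sqrt (by positivity)] at h2
  linarith

/-- The moments at a regular node. -/
lemma abs_edgeMoment_le_of_isRegular (h : SqIntegrable Ω g Dg) (hc : ContinuousOn g (closure Ω))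
    (hg : SobSq Ω g Dg) (hε : 0 < ε) {M : ℝ} (hz : z ∈ Δ.nodes) (hr : Δ.IsRegular M z) (hs : s ∈ Δ.nbrs z) :
    |edgeMoment g 0 z s| ≤ 4 * (M + 1) * Δ.localError ε g Dg z := by
  obtain ⟨hM, hHω⟩ := bigH_sq_le_of_isRegular hz hr
  have hH := bigH_pos hz
  have hω := patchArea_pos hz
  have hE := localError_nonneg (Δ := Δ) (g := g) (Dg := Dg) hε z
  obtain ⟨b, hT⟩ := exists_isTri_of_mem_nbrs hs
  have hcl : convexHull ℝ {z, s, b} ⊆ closure Ω := by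
    rw [← cell_eq]; exact cell_subset_closure hT.mem
  have h1 := (hg.mono hcl).trace hT.cr_ne
  simp only [abs_of_nonneg (sq_nonneg (g _))] at h1
  have hN : 0 ≤ ∫ x in Δ.patch z, g x ^ 2 := integral_nonneg fun _ => sq_nonneg _
  have m1 : ∫ x in convexHull ℝ {z, s, b}, g x ^ 2 ≤ ∫ x in Δ.patch z, g x ^ 2 :=
    setIntegral_patch_mono hT.mem_star (hg.continuousOn.integrableOn_compact Δ.isCompact_closure_of)
      (fun _ => sq_nonneg _) (by rw [cell_eq])
  have m2 : ∫ x in convexHull ℝ {z, s, b}, ‖(2 * g x) • Dg x‖ ≤ ∫ x in Δ.patch z, ‖(2 * g x) • Dg x‖ :=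
    setIntegral_patch_mono hT.mem_star hg.integrableOn.norm (fun _ => norm_nonneg _)
      (by rw [cell_eq])
  have hcr := abs_pos.2 hT.cr_ne
  have hTs : ‖s - z‖ ^ 2 ≤ M * |cr (s - z) (b - z)| :=
    (pow_le_pow_left₀ (norm_nonneg _) (le_maxEdge (by simp) (by simp)) 2).trans
      (norm_sub_sq_le_of_isRegular hr hT)
  have hbH : ‖b - z‖ ≤ Δ.bigH z :=
    norm_sub_le_bigH (mem_patch_of_mem_nbrs hT.swap.mem_nbrs).1 (mem_patch_of_mem_nbrs hs).2
  have hsq : edgeMoment g 0 z s ^ 2 ≤ M * ((∫ x in Δ.patch z, g x ^ 2) +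
      Δ.bigH z * ∫ x in Δ.patch z, ‖(2 * g x) • Dg x‖) := by
    rw [edgeMoment_eq, mul_pow]
    have h2 := (rayMean_sq_le (continuousOn_nbr_edge hc hs)).trans h1
    calc _ ≤ (M * |cr (s - z) (b - z)|) * (|cr (s - z) (b - z)|⁻¹ *
          ((∫ x in convexHull ℝ {z, s, b}, g x ^ 2) +
            ‖b - z‖ * ∫ x in convexHull ℝ {z, s, b}, ‖(2 * g x) • Dg x‖)) :=
          mul_le_mul hTs h2 (sq_nonneg _) (by positivity)
      _ = M * ((∫ x in convexHull ℝ {z, s, b}, g x ^ 2) +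
            ‖b - z‖ * ∫ x in convexHull ℝ {z, s, b}, ‖(2 * g x) • Dg x‖) := by field_simp
      _ ≤ _ := by
          refine mul_le_mul_of_nonneg_left (add_le_add m1 ?_) hM.le
          exact mul_le_mul hbH m2 (integral_nonneg fun _ => norm_nonneg _) hH.le
  refine abs_le_of_sq_le_sq ?_ (by positivity)
  refine hsq.trans ?_
  rw [mul_pow, localError_sq hε]
  set N := ∫ x in Δ.patch z, g x ^ 2
  set P := ∫ x in Δ.patch z, ‖Dg x‖ ^ 2
  set S := ∫ x in Δ.patch z, ‖(2 * g x) • Dg x‖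
  set H := Δ.bigH z
  set m := Δ.localMass ε z with hm
  set X := Δ.localTheta ε g Dg z
  have hX : X = ε ^ 2 * P + (1 + ε ^ 2 * (H ^ 2)⁻¹) * N := rfl
  have hm0 : 0 ≤ m := localMass_nonneg hε z
  have hX0 : 0 ≤ X := localTheta_nonneg z
  -- the parameter in Young's inequality is the smaller one of `ε` and `H`
  obtain ⟨t, ht, htε, htH, h5⟩ : ∃ t, 0 < t ∧ t ≤ ε ∧ t ≤ H ∧ ε ^ 2 * (P + (t ^ 2)⁻¹ * N) ≤ X := by
    rcases le_total ε H with h | h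
    · refine ⟨ε, hε, le_rfl, h, ?_⟩
      have : 0 ≤ ε ^ 2 * (H ^ 2)⁻¹ * N := by positivity
      rw [mul_add, mul_inv_cancel_left₀ (by positivity)]; linarith
    · exact ⟨H, hH, h, le_rfl, by linarith⟩
  have h4 : N + H * S ≤ 2 * (t * H) * (P + (t ^ 2)⁻¹ * N) := by
    have h6 := mul_le_mul_of_nonneg_left (h.integral_grad_sq_le (Δ := Δ) z ht) hH.le
    have h7 : N ≤ H * (N / t) := by rw [← mul_div_assoc, le_div_iff₀ ht]; nlinarith
    have h8 : 2 * (t * H) * (P + (t ^ 2)⁻¹ * N) = 2 * (H * (N / t + t * P)) := by field_simp; ring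
    have : 0 ≤ H * (t * P) := by positivity
    linarith
  have h9 : t * H ≤ 8 * (M + 1) * m := by
    rw [hm, localMass, mul_min_of_nonneg _ _ (by positivity)]
    have : t * H ≤ ε * H := by gcongr
    have : 0 < ε * H := by positivity
    refine le_min (by nlinarith) ?_
    change _ ≤ _ * (ε * H)
    nlinarith
  calc M * (N + H * S) ≤ M * (2 * (t * H) * (P + (t ^ 2)⁻¹ * N)) := by gcongr
    _ = 2 * M * ((t * H) * (ε ^ 2 * (P + (t ^ 2)⁻¹ * N))) / ε ^ 2 := by field_simp
    _ ≤ 2 * (M + 1) * ((8 * (M + 1) * m) * X) / ε ^ 2 := by gcongr; linarith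
    _ = _ := by ring

end Triangulation

/-! ### The estimate of the jump residual -/

/-- The constant `B` of all anisotropic patches in the coordinates along their longest edges. -/
noncomputable def nodeConst (α₀ K : ℝ) : ℝ := Triangulation.anisoConst α₀ K ^ 3

namespace Triangulation

/-- The assumptions on the mesh, the constants and `g` under which the jump residual is
estimated. -/
structure JumpSetting (Δ : Triangulation Ω) (α₀ K M κ c₀ ε : ℝ) (g : Plane → ℝ) (Dg : Plane → Plane) :
    Prop where
  isOpen : IsOpen Ω
  angle_lt : α₀ < Real.pi
  admissible : Δ.IsAdmissible α₀ K
  node_cases : ∀ z ∈ Δ.nodes, Δ.IsAnisotropic c₀ K z ∨ Δ.IsRegular M z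
  corner : ∀ z ∈ Δ.nodes, IsCorner Ω z → Δ.IsRegular M z
  le_kappa : nodeConst α₀ K ≤ κ
  c₀_small : c₀ * nodeConst α₀ K ^ 12 ≤ 1
  kappa_small : κ * nodeConst α₀ K * c₀ ≤ 1
  ε_pos : 0 < ε
  sob : Sob (closure Ω) g Dg
  sob_sq : SobSq Ω g Dg
  sq : SqIntegrable Ω g Dg
  boundary : ∀ x ∈ frontier Ω, g x = 0

lemma mem_innerNbrs_of_not_mem_frontier (hz : z ∉ frontier Ω) :
    ∀ s ∈ Δ.nbrs z, s ∈ Δ.innerNbrs z := fun s hs =>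
  mem_innerNbrs.2 ⟨hs, fun h => hz (h (left_mem_segment ℝ z s))⟩

lemma exists_longest (hz : z ∈ Δ.nodes) : ∃ y ∈ Δ.nbrs z, ∀ s ∈ Δ.nbrs z, dist z s ≤ dist z y := by
  obtain ⟨T, hT⟩ := exists_mem_star hz
  obtain ⟨a, b, hab, -⟩ := exists_isTri_of_mem_star hT
  exact (Δ.nbrs z).exists_max_image (dist z) ⟨a, hab.mem_nbrs⟩

lemma nodes_of_mem_nbrs (hs : s ∈ Δ.nbrs z) : s ∈ Δ.nodes := by
  classical
  exact (Finset.mem_filter.1 hs).1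

namespace JumpSetting
variable {α₀ K M κ c₀ ε : ℝ}
  (S : Δ.JumpSetting α₀ K M κ c₀ ε g Dg)
include S

lemma const_le (hz : z ∈ Δ.nodes) : 1 ≤ K ∧ 10 ≤ anisoConst α₀ K ∧
    anisoConst α₀ K ≤ nodeConst α₀ K ∧ 2 * K ≤ nodeConst α₀ K ∧ K ^ 2 ≤ nodeConst α₀ K := by
  have hK := one_le_of_isAdmissible S.admissible hz
  have h0 : 0 ≤ 2 * |K| / sqrt (1 - cosBound α₀ ^ 2) := by positivity
  have h1 : 10 + 2 * K + K ^ 2 ≤ anisoConst α₀ K := by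
    rw [anisoConst, abs_of_nonneg (by linarith : 0 ≤ K)] at *; linarith
  have h2 : anisoConst α₀ K ≤ nodeConst α₀ K :=
    le_self_pow₀ (by nlinarith : 1 ≤ anisoConst α₀ K) (by norm_num : 3 ≠ 0)
  exact ⟨hK, by nlinarith, h2, by nlinarith, by nlinarith⟩

lemma card_innerNbrs_le (hz : z ∈ Δ.nodes) : ((Δ.innerNbrs z).card : ℝ) ≤ nodeConst α₀ K := by
  classical
  have h1 : ((Δ.innerNbrs z).card : ℝ) ≤ (Δ.nbrs z).card := by
    exact_mod_cast Finset.card_le_card (Finset.filter_subset _ _)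
  have h2 : ((Δ.nbrs z).card : ℝ) ≤ 2 * (Δ.star z).card := by exact_mod_cast Δ.card_nbrs_le z
  linarith [S.admissible.card_star z hz, (S.const_le hz).2.2.2.1]

lemma anisotropic (hz : z ∈ Δ.nodes) (hr : ¬ Δ.IsRegular M z) : Δ.IsAnisotropic c₀ K z :=
  (S.node_cases z hz).resolve_right hr

/-- A frame of the patch that is adapted to the boundary. -/
lemma exists_frame (hz : z ∈ Δ.nodes) (hr : ¬ Δ.IsRegular M z) :
    ∃ e : Plane, Δ.AnisoAt (anisoConst α₀ K) z e (Δ.smallH z) (Δ.bigH z) ∧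
      nodeConst α₀ K ^ 12 * Δ.smallH z ≤ Δ.bigH z ∧
      (z ∈ frontier Ω → ∀ s ∈ Δ.nbrs z, segment ℝ z s ⊆ frontier Ω →
        ⟪e, s - z⟫ = 0 ∨ cr e (s - z) = 0) := by
  obtain ⟨hK, h10, hle, -, -⟩ := S.const_le hz
  have ha := S.anisotropic hz hr
  have hH := bigH_pos hz
  have hc : 0 < c₀ := by
    by_contra hcon
    push Not at hcon
    nlinarith [ha.1, smallH_pos hz]
  have hc' : c₀ * anisoConst α₀ K ^ 12 ≤ 1 :=
    (mul_le_mul_of_nonneg_left (pow_le_pow_left₀ (by linarith) hle 12) hc.le).trans S.c₀_small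
  obtain ⟨e, A, hor⟩ := exists_anisoAt S.angle_lt S.admissible hz ha hc'
  refine ⟨e, A, ?_, fun hzf => hor hzf fun hcor => hr (S.corner z hz hcor)⟩
  have hB : 0 ≤ nodeConst α₀ K ^ 12 := pow_nonneg (by linarith) _
  calc _ ≤ nodeConst α₀ K ^ 12 * (c₀ * Δ.bigH z) := by gcongr; exact ha.1.le
    _ = c₀ * nodeConst α₀ K ^ 12 * Δ.bigH z := by ring
    _ ≤ 1 * Δ.bigH z := by gcongr; exact S.c₀_small
    _ = _ := one_mul _

/-- The frame along a longest edge, in which the averages are defined. -/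
lemma anisoAt_longest (hz : z ∈ Δ.nodes) (hr : ¬ Δ.IsRegular M z) (hy : y ∈ Δ.nbrs z)
    (hmax : ∀ s ∈ Δ.nbrs z, dist z s ≤ dist z y) :
    Δ.AnisoAt (nodeConst α₀ K) z (edgeDir z y) (Δ.smallH z) (Δ.bigH z) ∧
      Δ.IsRight (nodeConst α₀ K) z (edgeDir z y) (Δ.bigH z) y ∧
      ∀ s ∈ Δ.nbrs z, κ * Δ.smallH z < dist z s ↔ Δ.bigH z ≤ nodeConst α₀ K * ‖s - z‖ := by
  obtain ⟨hK, h10, hle, -, -⟩ := S.const_le hz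
  obtain ⟨e, A, hs, -⟩ := S.exists_frame hz hr
  have hl := A.longest_long hz hmax
  have A' := A.rotate hy hl hs
  have hB : 0 < nodeConst α₀ K := by linarith
  have hκ : 0 < κ := hB.trans_le S.le_kappa
  refine ⟨A', ?_, fun s hs => A'.lt_dist_iff S.le_kappa ?_ hs⟩
  · refine AnisoAt.isRight_longest ?_ hy (hl.trans (mul_le_mul_of_nonneg_right hle (norm_nonneg _))) rfl
    rw [← norm_pos_iff, norm_edgeDir (mem_nbrs_edge hy).2.1]; exact zero_lt_one
  · calc κ * nodeConst α₀ K * Δ.smallH z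
        < κ * nodeConst α₀ K * (c₀ * Δ.bigH z) :=
          mul_lt_mul_of_pos_left (S.anisotropic hz hr).1 (by positivity)
      _ = κ * nodeConst α₀ K * c₀ * Δ.bigH z := by ring
      _ ≤ 1 * Δ.bigH z := mul_le_mul_of_nonneg_right S.kappa_small (bigH_pos hz).le
      _ = _ := one_mul _

lemma exists_isAverageFamily : ∃ gbar : Plane → ℝ, Δ.IsAverageFamily κ M g gbar := by
  have : ∀ z, ∃ k : ℝ, z ∈ Δ.nodes → ((z ∈ frontier Ω ∨ Δ.IsRegular M z) → k = 0) ∧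
      (¬ (z ∈ frontier Ω ∨ Δ.IsRegular M z) → Δ.IsNodeAverage κ g z k) := fun z => by
    by_cases h : z ∈ Δ.nodes ∧ ¬ (z ∈ frontier Ω ∨ Δ.IsRegular M z)
    · obtain ⟨hz, hn⟩ := h
      obtain ⟨hzf, hr⟩ := not_or.1 hn
      obtain ⟨y, hy, hmax⟩ := exists_longest hz
      obtain ⟨A, hyr, hlong⟩ := S.anisoAt_longest hz hr hy hmax
      obtain ⟨k, sm, sp, h1, h2⟩ := A.exists_average S.isOpen (mem_innerNbrs_of_not_mem_frontier hzf)
        hlong S.sob.continuousOn hyr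
      exact ⟨k, fun _ => ⟨fun h => absurd h hn, fun _ => ⟨y, hy, hmax, sm, sp, h1, h2⟩⟩⟩
    · exact ⟨0, fun hz => ⟨fun _ => rfl, fun hn => absurd ⟨hz, hn⟩ h⟩⟩
  choose gbar h using this
  exact ⟨gbar, fun z hz => h z hz⟩

variable (hgb : Δ.IsAverageFamily κ M g gbar)
include hgb

lemma averageRays (hz : z ∈ Δ.nodes) (hzf : z ∉ frontier Ω) (hr : ¬ Δ.IsRegular M z) :
    ∃ e y, Δ.AnisoAt (nodeConst α₀ K) z e (Δ.smallH z) (Δ.bigH z) ∧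
      Δ.IsRight (nodeConst α₀ K) z e (Δ.bigH z) y ∧
      ∃ x x' d d', Δ.AverageRays (nodeConst α₀ K) z e (Δ.bigH z) g (gbar z) x x' d d' := by
  obtain ⟨y, hy, hmax, sm, sp, h1, h2⟩ := (hgb z hz).2 (not_or.2 ⟨hzf, hr⟩)
  obtain ⟨A, hyr, hlong⟩ := S.anisoAt_longest hz hr hy hmax
  exact ⟨edgeDir z y, y, A, hyr, A.averageRays S.isOpen (mem_innerNbrs_of_not_mem_frontier hzf) hlong
    S.sob.continuousOn hyr h1 h2⟩

omit hgb in
lemma boundary_cases (hz : z ∈ Δ.nodes) (hzf : z ∈ frontier Ω) (hr : ¬ Δ.IsRegular M z) :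
    ∃ e, Δ.AnisoAt (nodeConst α₀ K) z e (Δ.smallH z) (Δ.bigH z) ∧
    ((∀ f ∈ ({e, -e} : Set Plane), ∃ d, Δ.IsRight (nodeConst α₀ K) z f (Δ.bigH z) d ∧
      segment ℝ z d ⊆ frontier Ω ∧
      ∀ s, Δ.IsRight (nodeConst α₀ K) z f (Δ.bigH z) s → s ≠ d → s ∈ Δ.innerNbrs z) ∨
    ((∀ s ∈ Δ.nbrs z, segment ℝ z s ⊆ frontier Ω → ⟪e, s - z⟫ = 0) ∧
      ∀ s ∈ Δ.nbrs z, ‖s - z‖ ≤ nodeConst α₀ K * Δ.smallH z → segment ℝ z s ⊆ frontier Ω)) := by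
  obtain ⟨e, A, hs, hor⟩ := S.exists_frame hz hr
  have A' := A.mono (S.const_le hz).2.2.1 hs
  exact ⟨e, A', A'.boundary_cases hz hzf (fun hcor => hr (S.corner z hz hcor)) (hor hzf) S.isOpen⟩

/-- The moments at an anisotropic node, if the patch is not thin in comparison with `ε`. -/
lemma abs_edgeMoment_le (hz : z ∈ Δ.nodes) (hr : ¬ Δ.IsRegular M z) (hε : ε ≤ K ^ 2 * Δ.smallH z) (hs : s ∈ Δ.nbrs z) :
    |edgeMoment g (gbar z) z s| ≤ nodeConst α₀ K ^ 6 * Δ.localError ε g Dg z := by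
  obtain ⟨hK, h10, hle, -, hK2⟩ := S.const_le hz
  have hE := localError_nonneg (Δ := Δ) (g := g) (Dg := Dg) S.ε_pos z
  have key : edgeMoment g (gbar z) z s ^ 2 ≤
      nodeConst α₀ K ^ 5 * (Δ.bigH z * Δ.traceTerm (Δ.smallH z) z g Dg) := by
    by_cases hzf : z ∈ frontier Ω
    · rw [(hgb z hz).1 (Or.inl hzf)]
      obtain ⟨e, A, h⟩ := S.boundary_cases hz hzf hr
      refine A.sq_edgeMoment_le_of_boundary S.isOpen S.sob.continuousOn S.sob_sq S.boundary ?_ hs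
      intro f hf c c' hc hc' hci hci'
      rcases h with h | h
      · obtain ⟨d, -, -, hd⟩ := h f hf
        have : ∀ {c}, Δ.IsRight (nodeConst α₀ K) z f (Δ.bigH z) c → c ∉ Δ.innerNbrs z → c = d :=
          fun hc hci => by_contra fun hne => hci (hd _ hc hne)
        rw [this hc hci, this hc' hci']
      · refine absurd (mem_innerNbrs.2 ⟨hc.mem, fun hcf => hc.pos.ne' ?_⟩) hci
        rcases hf with rfl | rfl
        · exact h.1 c hc.mem hcf
        · rw [inner_neg_left, h.1 c hc.mem hcf, neg_zero]
    · obtain ⟨e, y, A, hy, x, x', d, d', hR⟩ := S.averageRays hgb hz hzf hr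
      exact A.sq_edgeMoment_le_of_average S.isOpen (mem_innerNbrs_of_not_mem_frontier hzf)
        S.sob.continuousOn S.sob_sq S.boundary hR hs
  refine abs_le_of_sq_le_sq (key.trans ?_) (mul_nonneg (pow_nonneg (by linarith) _) hE)
  have h1 := S.sq.traceTerm_le_localError hz S.ε_pos (one_le_pow₀ hK) hε
  have hB : 10 ≤ nodeConst α₀ K := h10.trans hle
  set B := nodeConst α₀ K
  set E := Δ.localError ε g Dg z
  calc _ ≤ B ^ 5 * (2 * (K ^ 2) ^ 2 * E ^ 2) := by gcongr
    _ ≤ B ^ 5 * (B ^ 3 * B ^ 2 * E ^ 2) := by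
        gcongr
        nlinarith [pow_le_pow_left₀ (by norm_num) hB 3]
    _ = B ^ 10 * E ^ 2 := by ring
    _ ≤ B ^ 12 * E ^ 2 := by
        refine mul_le_mul_of_nonneg_right (pow_le_pow_right₀ (by linarith) (by norm_num)) (sq_nonneg _)
    _ = _ := by ring

omit hgb in
/-- The mesh sizes of neighbouring anisotropic nodes are comparable. -/
lemma smallH_le (hz : z ∈ Δ.nodes) (hr : ¬ Δ.IsRegular M z) (hs : s ∈ Δ.nbrs z)
    (hrs : ¬ Δ.IsRegular M s) : Δ.smallH s ≤ nodeConst α₀ K * Δ.smallH z ∧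
      Δ.smallH s ≤ K ^ 2 * Δ.smallH z := by
  obtain ⟨hK, -, -, -, hK2⟩ := S.const_le hz
  obtain ⟨b, hT⟩ := exists_isTri_of_mem_nbrs hs
  have h1 := ((S.anisotropic hz hr).2 _ hT.mem_star).1.1
  have h2 := ((S.anisotropic (nodes_of_mem_nbrs hs) hrs).2 {z, s, b}
    (Δ.mem_star.2 ⟨⟨hT.mem, hT.card⟩, by simp⟩)).1.2
  have h3 : Δ.smallH s ≤ K ^ 2 * Δ.smallH z := by
    have := mul_le_mul_of_nonneg_left h1 (by linarith : 0 ≤ K)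
    linarith
  exact ⟨h3.trans (mul_le_mul_of_nonneg_right hK2 (smallH_pos hz).le), h3⟩

omit hgb in
/-- An edge that is short at one end is short at the other, as the widths of the two patches are comparable
and there is a gap between short and long edges. -/
lemma short_symm (hz : z ∈ Δ.nodes) (hr : ¬ Δ.IsRegular M z) (hs : s ∈ Δ.nbrs z)
    (hrs : ¬ Δ.IsRegular M s) (h : ‖s - z‖ ≤ nodeConst α₀ K * Δ.smallH z) :
    ‖s - z‖ ≤ nodeConst α₀ K * Δ.smallH s := by
  have hsn := nodes_of_mem_nbrs hs
  obtain ⟨e, A, h1, -⟩ := S.exists_frame hsn hrs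
  have A' := A.mono (S.const_le hz).2.2.1 h1
  have hB := A'.hB
  have h2 := (S.smallH_le hsn hrs (nbrs_symm hs) hr).1
  rcases A'.short_or_long (nbrs_symm hs) with h3 | h3
  · rwa [norm_sub_rev] at h3
  · exfalso
    rw [norm_sub_rev] at h3
    have hh := A'.h_pos
    set B := nodeConst α₀ K
    have h4 : B ^ 12 * Δ.smallH s ≤ B ^ 3 * Δ.smallH s := by
      refine A'.small.trans (h3.trans ?_)
      calc B * ‖s - z‖ ≤ B * (B * (B * Δ.smallH s)) := by gcongr; exact h.trans (by gcongr)
        _ = _ := by ring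
    have h5 : B ^ 3 < B ^ 12 := pow_lt_pow_right₀ (by linarith) (by norm_num)
    nlinarith

end JumpSetting

/-- An interior anisotropic node with a patch that is thin in comparison with `ε`. The moments on
the edges of such a patch are not small, but on the long edges they are the components of one
vector, up to small errors. -/
def IsThin (Δ : Triangulation Ω) (M ε : ℝ) (z : Plane) : Prop :=
  z ∉ frontier Ω ∧ ¬ Δ.IsRegular M z ∧ Δ.smallH z ≤ ε

/-- `V` represents the moments on the long edges of a thin patch; it vanishes at the other nodes. -/
structure IsMomentVector (Δ : Triangulation Ω) (B M ε : ℝ) (g : Plane → ℝ) (Dg : Plane → Plane)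
    (k : ℝ) (z V : Plane) : Prop where
  thin : Δ.IsThin M ε z → ∃ e y, Δ.AnisoAt B z e (Δ.smallH z) (Δ.bigH z) ∧
    Δ.MomentBounds B z e (Δ.smallH z) (Δ.bigH z) (edgeMoment g k z)
      (B ^ 11 * Δ.gradL1 Dg z) ∧
    Δ.IsRight B z e (Δ.bigH z) y ∧ V = edgeMoment g k z y • e
  eq_zero : ¬ Δ.IsThin M ε z → V = 0

namespace JumpSetting
variable {α₀ K M κ c₀ ε : ℝ}
  (S : Δ.JumpSetting α₀ K M κ c₀ ε g Dg) (hgb : Δ.IsAverageFamily κ M g gbar)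
include S hgb

lemma exists_isMomentVector (hz : z ∈ Δ.nodes) :
    ∃ V, Δ.IsMomentVector (nodeConst α₀ K) M ε g Dg (gbar z) z V := by
  by_cases h : Δ.IsThin M ε z
  · obtain ⟨e, y, A, hy, x, x', d, d', hR⟩ := S.averageRays hgb hz h.1 h.2.1
    exact ⟨_, fun _ => ⟨e, y, A, A.interior_bounds S.isOpen (mem_innerNbrs_of_not_mem_frontier h.1)
      S.sob hR.right hR.left hR.mem hR.mem' hR.inner_eq hR.inner_eq' hR.average, hy, rfl⟩,
      fun hn => absurd h hn⟩
  · exact ⟨0, fun hn => absurd hn h, fun _ => rfl⟩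

open scoped Classical in
/-- The residual of a node, after the addition of the terms of the short edges. -/
lemma abs_sum_le (huh : Δ.IsFE uh) (hz : z ∈ Δ.nodes) {V : Plane}
    (hV : Δ.IsMomentVector (nodeConst α₀ K) M ε g Dg (gbar z) z V) :
    |∑ s ∈ Δ.innerNbrs z, (edgeMoment g (gbar z) z s * Δ.jump uh z s +
      if ‖s - z‖ ≤ nodeConst α₀ K * Δ.smallH z then Δ.jump uh z s * ⟪edgeDir z s, V⟫ else 0)| ≤
      nodeConst α₀ K ^ 14 * (|M| + 1) * (Δ.localError ε g Dg z * Δ.maxJump uh z) := by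
  obtain ⟨hK, h10, hle, hK1, hK2⟩ := S.const_le hz
  have hB : 10 ≤ nodeConst α₀ K := h10.trans hle
  set B := nodeConst α₀ K
  have hE := localError_nonneg (Δ := Δ) (g := g) (Dg := Dg) S.ε_pos z
  set E := Δ.localError ε g Dg z with hEdef
  have hJ := Δ.maxJump_nonneg (v := uh) z
  have hEJ : 0 ≤ E * Δ.maxJump uh z := mul_nonneg hE hJ
  have hpow : ∀ {k : ℕ}, k ≤ 13 → 3 * B ^ k ≤ B ^ 14 * (|M| + 1) := fun {k} hk => by
    have h1 : B ^ k ≤ B ^ 13 := pow_le_pow_right₀ (by linarith) hk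
    have h3 : 0 < B ^ 13 := by positivity
    nlinarith [abs_nonneg M, mul_nonneg (by positivity : 0 ≤ B ^ 14) (abs_nonneg M)]
  have hfin : ∀ {k : ℕ} {a : ℝ}, k ≤ 13 → a ≤ 3 * B ^ k * (E * Δ.maxJump uh z) →
      a ≤ B ^ 14 * (|M| + 1) * (E * Δ.maxJump uh z) := fun hk h =>
    h.trans (mul_le_mul_of_nonneg_right (hpow hk) hEJ)
  -- a thin inner patch: the vector represents the moments up to the gradient term
  by_cases ht : Δ.IsThin M ε z
  · obtain ⟨e, y, A, hM, hy, rfl⟩ := hV.thin ht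
    have hD := S.sq.integral_grad_le_localError hz S.ε_pos ht.2.2
    have hD0 := Δ.gradL1_nonneg Dg z
    refine hfin le_rfl ((A.abs_sum_jump_le S.isOpen huh (mem_innerNbrs_of_not_mem_frontier ht.1) hM
      (fun c hc hl => A.exists_vector hM hy hc hl) (by positivity)).trans ?_)
    calc 3 * B ^ 2 * (B ^ 11 * Δ.gradL1 Dg z) * Δ.maxJump uh z
        ≤ 3 * B ^ 2 * (B ^ 11 * E) * Δ.maxJump uh z := by gcongr
      _ = _ := by ring
  -- otherwise `V = 0`, and only the moments themselves remain
  simp only [hV.eq_zero ht, inner_zero_right, mul_zero, ite_self, add_zero]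
  have hcard := S.card_innerNbrs_le hz
  have hsum : ∀ {c : ℝ}, 0 ≤ c → (∀ s ∈ Δ.nbrs z, |edgeMoment g (gbar z) z s| ≤ c * E) →
      |∑ s ∈ Δ.innerNbrs z, edgeMoment g (gbar z) z s * Δ.jump uh z s| ≤
        B * c * (E * Δ.maxJump uh z) := fun {c} hc h => by
    refine (Finset.abs_sum_le_sum_abs _ _).trans ((Finset.sum_le_card_nsmul _ _
      (c * (E * Δ.maxJump uh z)) fun s hs => ?_).trans ?_)
    · rw [abs_mul, ← mul_assoc]
      exact mul_le_mul (h s (mem_innerNbrs.1 hs).1) (abs_jump_le hs) (abs_nonneg _) (by positivity)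
    · rw [nsmul_eq_mul, mul_assoc]
      gcongr
  by_cases hr : Δ.IsRegular M z
  · rw [(hgb z hz).1 (Or.inr hr)] at hsum ⊢
    refine (hsum (c := 4 * (|M| + 1)) (by positivity) fun s hs => ?_).trans ?_
    · refine (abs_edgeMoment_le_of_isRegular S.sq S.sob.continuousOn S.sob_sq S.ε_pos hz hr hs).trans ?_
      gcongr; linarith [le_abs_self M]
    · gcongr ?_ * _
      have h1 : B ^ 2 ≤ B ^ 14 := pow_le_pow_right₀ (by linarith) (by norm_num)
      have h2 : B * 4 ≤ B ^ 14 := by nlinarith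
      nlinarith [abs_nonneg M]
  by_cases hε : ε < Δ.smallH z
  · refine hfin (k := 7) (by norm_num) ((hsum (c := B ^ 6) (by positivity) fun s hs => ?_).trans ?_)
    · refine S.abs_edgeMoment_le hgb hz hr ?_ hs
      have := one_le_pow₀ (n := 2) hK
      nlinarith [smallH_pos hz]
    · gcongr ?_ * _
      have : 0 ≤ B ^ 7 := by positivity
      linarith [pow_succ' B 6]
  -- a thin patch at the boundary
  have hzf : z ∈ frontier Ω := by_contra fun h => ht ⟨h, hr, not_lt.1 hε⟩
  have hD := S.sq.integral_grad_le_localError hz S.ε_pos (not_lt.1 hε)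
  rw [(hgb z hz).1 (Or.inl hzf)] at hsum ⊢
  obtain ⟨e, A, h | h⟩ := S.boundary_cases hz hzf hr
  · refine hfin (k := 4) (by norm_num) ((hsum (c := B ^ 3) (by positivity) fun s hs => ?_).trans ?_)
    · exact (A.abs_edgeMoment_le_of_parallel S.isOpen S.sob S.boundary h hs).trans
        (by gcongr)
    · gcongr ?_ * _
      have : 0 ≤ B ^ 4 := by positivity
      linarith [pow_succ' B 3]
  · refine hfin (k := 10) (by norm_num)
      ((A.abs_sum_jump_le_of_orthogonal S.isOpen huh S.sob S.boundary h.1 h.2).trans ?_)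
    calc 2 * B ^ 10 * Δ.gradL1 Dg z * Δ.maxJump uh z
        ≤ 3 * B ^ 10 * E * Δ.maxJump uh z := by gcongr; norm_num
      _ = _ := by ring

omit hgb in
/-- A regular neighbour bounds the aspect ratio of the patch. -/
lemma abs_edgeMoment_le_of_isRegular_nbr (hz : z ∈ Δ.nodes) (ht : Δ.IsThin M ε z)
    (hs : s ∈ Δ.nbrs z) (hrs : Δ.IsRegular M s) (hB : 0 ≤ B)
    (hM : Δ.MomentBounds B z e (Δ.smallH z) (Δ.bigH z) (edgeMoment g k z)
      (B ^ 11 * Δ.gradL1 Dg z)) (hy : y ∈ Δ.nbrs z) :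
    |edgeMoment g k z y| ≤ K ^ 2 * |M| * B ^ 11 * Δ.localError ε g Dg z := by
  have hK := (S.const_le hz).1
  have hh := smallH_pos hz
  have hD := S.sq.integral_grad_le_localError hz S.ε_pos ht.2.2
  obtain ⟨b, hT⟩ := exists_isTri_of_mem_nbrs hs
  have h1 := (S.anisotropic hz ht.2.1).2 _ hT.mem_star
  have h2 := hrs {z, s, b} (Δ.mem_star.2 ⟨⟨hT.mem, hT.card⟩, by simp⟩)
  have h3 : minHeight {z, s, b} ≤ K * Δ.smallH z := h1.1.1
  have h0 : 0 ≤ minHeight {z, s, b} :=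
    div_nonneg (mul_nonneg zero_le_two measureReal_nonneg) Metric.diam_nonneg
  have h4 : Δ.bigH z ≤ K ^ 2 * |M| * Δ.smallH z := by
    calc Δ.bigH z ≤ K * maxEdge {z, s, b} := h1.2.2
      _ ≤ K * (|M| * minHeight {z, s, b}) := by
          refine mul_le_mul_of_nonneg_left (h2.trans ?_) (by linarith)
          gcongr; exact le_abs_self M
      _ ≤ K * (|M| * (K * Δ.smallH z)) := by gcongr
      _ = _ := by ring
  have h6 : ‖y - z‖ ≤ Δ.bigH z := norm_sub_le_bigH (mem_patch_of_mem_nbrs hy).1 (mem_patch_of_mem_nbrs hy).2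
  refine le_of_mul_le_mul_right ((hM.le y hy).trans ?_) hh
  calc ‖y - z‖ * (B ^ 11 * Δ.gradL1 Dg z)
      ≤ (K ^ 2 * |M| * Δ.smallH z) * (B ^ 11 * Δ.localError ε g Dg z) :=
        mul_le_mul (h6.trans h4) (by gcongr) (by positivity)
          (by positivity)
    _ = _ := by ring

/-- The vectors of two nodes that are connected by a short edge are close to each other. -/
lemma norm_sub_le (hz : z ∈ Δ.nodes) (ht : Δ.IsThin M ε z) {V V' : Plane} (hs : s ∈ Δ.innerNbrs z)
    (hsh : ‖s - z‖ ≤ nodeConst α₀ K * Δ.smallH z)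
    (hV : Δ.IsMomentVector (nodeConst α₀ K) M ε g Dg (gbar z) z V)
    (hV' : Δ.IsMomentVector (nodeConst α₀ K) M ε g Dg (gbar s) s V') :
    ‖V - V'‖ ≤ nodeConst α₀ K ^ 15 * (|M| + 1) *
      (Δ.localError ε g Dg z + Δ.localError ε g Dg s) := by
  obtain ⟨hK, h10, hle, hK1, hK2⟩ := S.const_le hz
  have hsn := (mem_innerNbrs.1 hs).1
  have hsN := nodes_of_mem_nbrs hsn
  obtain ⟨e, y, A, hM, hy, hVe⟩ := hV.thin ht
  have hB := A.hB
  set B := nodeConst α₀ K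
  have hE := localError_nonneg (Δ := Δ) (g := g) (Dg := Dg) S.ε_pos z
  have hE' := localError_nonneg (Δ := Δ) (g := g) (Dg := Dg) S.ε_pos s
  have hD := S.sq.integral_grad_le_localError hz S.ε_pos ht.2.2
  have hD0 := Δ.gradL1_nonneg Dg
  have hVn : ‖V‖ = |edgeMoment g (gbar z) z y| := by
    rw [hVe, norm_smul, A.norm_e, mul_one, norm_eq_abs]
  set E := Δ.localError ε g Dg z
  set E' := Δ.localError ε g Dg s
  have hpow : ∀ {k : ℕ}, k ≤ 15 → B ^ k ≤ B ^ 15 := fun hk => pow_le_pow_right₀ (by linarith) hk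
  have hpos : 0 < B ^ 15 := by positivity
  have hM0 := abs_nonneg M
  have hzero : ∀ {c : ℝ}, c ≤ B ^ 15 * (|M| + 1) → |edgeMoment g (gbar z) z y| ≤ c * E → V' = 0 →
      ‖V - V'‖ ≤ B ^ 15 * (|M| + 1) * (E + E') := fun {c} hc h h0 => by
    rw [h0, sub_zero, hVn, mul_add]
    exact (h.trans (by gcongr)).trans (le_add_of_nonneg_right (by positivity))
  by_cases hrs : Δ.IsRegular M s
  · -- a regular neighbour bounds the aspect ratio of the patch
    refine hzero (c := K ^ 2 * |M| * B ^ 11) ?_ ?_ (hV'.eq_zero fun h => h.2.1 hrs)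
    · calc K ^ 2 * |M| * B ^ 11 ≤ B * |M| * B ^ 11 := by gcongr
        _ = B ^ 12 * |M| := by ring
        _ ≤ _ := mul_le_mul (hpow (by norm_num)) (by linarith) hM0 hpos.le
    · exact S.abs_edgeMoment_le_of_isRegular_nbr hz ht hsn hrs (by linarith) hM hy.mem
  by_cases hεs : ε < Δ.smallH s
  · refine hzero (c := B ^ 6) ?_ (S.abs_edgeMoment_le hgb hz ht.2.1
      (hεs.le.trans (S.smallH_le hz ht.2.1 hsn hrs).2) hy.mem) (hV'.eq_zero fun h => ?_)
    · have := hpow (k := 6) (by norm_num)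
      nlinarith
    · exact absurd h.2.2 (not_le.2 hεs)
  have hDs : _ ≤ E' := S.sq.integral_grad_le_localError hsN S.ε_pos (not_lt.1 hεs)
  have hsh' := S.short_symm hz ht.2.1 hsn hrs hsh
  have h1B : ∀ k : ℕ, 1 ≤ B ^ k := fun k => one_le_pow₀ (by linarith)
  suffices h : ‖V - V'‖ ≤ B ^ 4 * (B ^ 11 * Δ.gradL1 Dg z +
      B ^ 11 * Δ.gradL1 Dg s) by
    refine h.trans ?_
    calc _ = B ^ 15 * 1 * (Δ.gradL1 Dg z + Δ.gradL1 Dg s) := by ring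
      _ ≤ _ := mul_le_mul (by gcongr; linarith) (by gcongr)
          (add_nonneg (hD0 z) (hD0 s)) (by positivity)
  have hmain := fun {e' : Plane} {k' : ℝ}
      (A' : Δ.AnisoAt B s e' (Δ.smallH s) (Δ.bigH s)) (hopp : ∀ c b,
        Δ.IsRight B s e' (Δ.bigH s) c → Δ.IsRight B s (-e') (Δ.bigH s) b →
        |edgeMoment g k' s c + edgeMoment g k' s b| ≤ B ^ 11 * Δ.gradL1 Dg s) =>
    A.norm_vector_sub_le S.isOpen S.sob A' hs hsh hsh' hM hopp (V := V) (V' := V')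
      (by rw [hVe]; exact fun c hc hl => A.exists_vector hM hy hc hl)
  have hDle : ∀ z, Δ.gradL1 Dg z ≤ B ^ 11 * Δ.gradL1 Dg z := fun z =>
    le_mul_of_one_le_left (hD0 z) (h1B 11)
  by_cases hsf : s ∈ frontier Ω
  · have hV0 : V' = 0 := hV'.eq_zero fun h => h.1 hsf
    obtain ⟨e', A', h | h⟩ := S.boundary_cases hsN hsf hrs
    · have hm := fun {c} (hc : c ∈ Δ.nbrs s) =>
        A'.abs_edgeMoment_le_of_parallel S.isOpen S.sob S.boundary h hc
      have h2 : 2 * B ^ 3 ≤ B ^ 11 := by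
        have := pow_le_pow_right₀ (by linarith : 1 ≤ B) (by norm_num : 4 ≤ 11)
        nlinarith [h1B 3, pow_succ B 3]
      have h3 := mul_le_mul_of_nonneg_right h2 (hD0 s)
      have h4 : 0 ≤ B ^ 3 * Δ.gradL1 Dg s := mul_nonneg (by positivity) (hD0 s)
      refine hmain A' (k' := 0) (fun c b hc hb => ?_) (fun c hc hl => ?_) (hDle z)
      · refine (abs_add_le _ _).trans ?_
        linarith [hm hc.mem, hm hb.mem]
      · rw [hV0, zero_sub, norm_neg, norm_smul, norm_edgeDir (mem_nbrs_edge hc).2.1, mul_one,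
          norm_eq_abs]
        refine (hm hc).trans ?_
        nlinarith
    · -- in this case all short edges lie on the boundary
      refine absurd (h.2 z (nbrs_symm hsn) ?_) (mem_innerNbrs.1 (innerNbrs_symm hs)).2
      rwa [norm_sub_rev]
  · obtain ⟨e', y', A', hM', hy', hVe'⟩ := hV'.thin ⟨hsf, hrs, not_lt.1 hεs⟩
    exact hmain A' hM'.opposite (by rw [hVe']; exact fun c hc hl => A'.exists_vector hM' hy' hc hl)
      (hDle z)

end JumpSetting
end Triangulation

namespace Triangulation

lemma sum_innerNbrs_comm (F : Plane → Plane → ℝ) :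
    ∑ z ∈ Δ.nodes, ∑ s ∈ Δ.innerNbrs z, F s z = ∑ z ∈ Δ.nodes, ∑ s ∈ Δ.innerNbrs z, F z s := by
  refine Finset.sum_comm' fun z s => ⟨fun h => ?_, fun h => ?_⟩
  · exact ⟨innerNbrs_symm h.2, nodes_of_mem_nbrs (mem_innerNbrs.1 h.2).1⟩
  · exact ⟨nodes_of_mem_nbrs (mem_innerNbrs.1 h.1).1, innerNbrs_symm h.1⟩

lemma sum_localTheta_le (hn : volume (frontier Ω) = 0)
    (hg : SqIntegrable Ω g Dg) : ∑ z ∈ Δ.nodes, Δ.localTheta ε g Dg z ≤ 3 * Δ.theta ε g Dg := by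
  have h1 := sum_integral_patch (Δ := Δ) hn (g := fun x => ‖Dg x‖ ^ 2)
    ((memLp_two_iff_integrable_sq_norm hg.memLp_grad.aestronglyMeasurable).1 hg.memLp_grad)
  have h2 : 0 ≤ ∑ z ∈ Δ.nodes, (1 + ε ^ 2 * (Δ.bigH z ^ 2)⁻¹) * ∫ x in Δ.patch z, g x ^ 2 :=
    Finset.sum_nonneg fun z _ => mul_nonneg (by positivity) (integral_nonneg fun _ => sq_nonneg _)
  simp only [localTheta, theta]
  rw [Finset.sum_add_distrib, ← Finset.mul_sum, h1]
  linarith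

namespace JumpSetting
variable {α₀ K M κ c₀ ε : ℝ}
  (S : Δ.JumpSetting α₀ K M κ c₀ ε g Dg)
  (hgb : Δ.IsAverageFamily κ M g gbar)
include S hgb

open scoped Classical in
/-- The terms of a short edge, which are added at both of its endpoints, almost cancel, because the
unit vectors along the edge from its endpoints are opposite. -/
lemma abs_pair_le {V : Plane → Plane}
    (hV : ∀ z ∈ Δ.nodes, Δ.IsMomentVector (nodeConst α₀ K) M ε g Dg (gbar z) z (V z))
    {F : Plane → Plane → ℝ} (hF : F = fun z s => if ‖s - z‖ ≤ nodeConst α₀ K * Δ.smallH z then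
      Δ.jump uh z s * ⟪edgeDir z s, V z⟫ else 0) (hs : s ∈ Δ.innerNbrs z) :
    |F z s + F s z| ≤ nodeConst α₀ K ^ 15 * (|M| + 1) *
      (Δ.localError ε g Dg z * Δ.maxJump uh z + Δ.localError ε g Dg s * Δ.maxJump uh s) := by
  have key : ∀ {z s}, s ∈ Δ.innerNbrs z → Δ.IsThin M ε z →
      ‖s - z‖ ≤ nodeConst α₀ K * Δ.smallH z → |F z s + F s z| ≤ nodeConst α₀ K ^ 15 * (|M| + 1) *
        (Δ.localError ε g Dg z * Δ.maxJump uh z + Δ.localError ε g Dg s * Δ.maxJump uh s) := by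
    intro z s hs ht hsh
    have hsn := (mem_innerNbrs.1 hs).1
    have hzN := nodes_of_mem_nbrs (nbrs_symm hsn)
    have hsN := nodes_of_mem_nbrs hsn
    -- unless `V s = 0`, the edge is short at `s` as well
    have h1 : F s z = -(Δ.jump uh z s * ⟪edgeDir z s, V s⟫) := by
      by_cases hshs : ‖z - s‖ ≤ nodeConst α₀ K * Δ.smallH s
      · simp only [hF]
        rw [if_pos hshs, jump_comm hsn, edgeDir_comm, inner_neg_left, mul_neg]
      · have h0 : V s = 0 := (hV s hsN).eq_zero fun h => hshs <| by
          rw [norm_sub_rev]; exact S.short_symm hzN ht.2.1 hsn h.2.1 hsh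
        simp only [hF]
        rw [if_neg hshs, h0, inner_zero_right, mul_zero, neg_zero]
    have h2 : F z s + F s z = Δ.jump uh z s * ⟪edgeDir z s, V z - V s⟫ := by
      rw [h1, inner_sub_right]
      simp only [hF]
      rw [if_pos hsh]; ring
    have h3 := S.norm_sub_le hgb hzN ht hs hsh (hV z hzN) (hV s hsN)
    have hE := localError_nonneg (Δ := Δ) (g := g) (Dg := Dg) S.ε_pos z
    have hE' := localError_nonneg (Δ := Δ) (g := g) (Dg := Dg) S.ε_pos s
    have hC : 0 ≤ nodeConst α₀ K ^ 15 * (|M| + 1) :=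
      mul_nonneg (pow_nonneg (by linarith [S.const_le hzN]) _) (by positivity)
    have h4 : |Δ.jump uh z s| ≤ Δ.maxJump uh z := abs_jump_le hs
    have h5 : |Δ.jump uh z s| ≤ Δ.maxJump uh s := by
      rw [← jump_comm hsn]; exact abs_jump_le (innerNbrs_symm hs)
    rw [h2, abs_mul]
    calc |Δ.jump uh z s| * |⟪edgeDir z s, V z - V s⟫|
        ≤ |Δ.jump uh z s| * (nodeConst α₀ K ^ 15 * (|M| + 1) *
          (Δ.localError ε g Dg z + Δ.localError ε g Dg s)) := by
          refine mul_le_mul_of_nonneg_left (le_trans ?_ h3) (abs_nonneg _)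
          exact abs_frame_inner_le (norm_edgeDir (mem_nbrs_edge hsn).2.1) _
      _ = nodeConst α₀ K ^ 15 * (|M| + 1) * (Δ.localError ε g Dg z * |Δ.jump uh z s| +
          Δ.localError ε g Dg s * |Δ.jump uh z s|) := by ring
      _ ≤ _ := mul_le_mul_of_nonneg_left (add_le_add (by gcongr)
          (by gcongr)) hC
  have hzero : ∀ {z s}, s ∈ Δ.nbrs z → ¬ (Δ.IsThin M ε z ∧ ‖s - z‖ ≤ nodeConst α₀ K * Δ.smallH z) →
      F z s = 0 := by
    intro z s hs h
    simp only [hF]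
    split_ifs with hsh
    · rw [(hV z (nodes_of_mem_nbrs (nbrs_symm hs))).eq_zero fun ht => h ⟨ht, hsh⟩, inner_zero_right,
        mul_zero]
    · rfl
  have hsn := (mem_innerNbrs.1 hs).1
  by_cases h : Δ.IsThin M ε z ∧ ‖s - z‖ ≤ nodeConst α₀ K * Δ.smallH z
  · exact key hs h.1 h.2
  by_cases h' : Δ.IsThin M ε s ∧ ‖z - s‖ ≤ nodeConst α₀ K * Δ.smallH s
  · have := key (innerNbrs_symm hs) h'.1 h'.2
    rwa [add_comm, add_comm (_ * Δ.maxJump uh s)] at this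
  · rw [hzero hsn h, hzero (nbrs_symm hsn) h', add_zero, abs_zero]
    have hC : 0 ≤ nodeConst α₀ K := by linarith [S.const_le (nodes_of_mem_nbrs hsn)]
    have hE := localError_nonneg (Δ := Δ) (g := g) (Dg := Dg) S.ε_pos
    have hJ := Δ.maxJump_nonneg (v := uh)
    have := mul_nonneg (hE z) (hJ z)
    have := mul_nonneg (hE s) (hJ s)
    positivity

/-- The terms of the short edges, which `abs_sum_le` adds, are subtracted again; they occur in pairs. -/
lemma abs_sum_sum_le (huh : Δ.IsFE uh) :
    |∑ z ∈ Δ.nodes, ∑ s ∈ Δ.innerNbrs z, edgeMoment g (gbar z) z s * Δ.jump uh z s| ≤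
      2 * nodeConst α₀ K ^ 16 * (|M| + 1) *
        ∑ z ∈ Δ.nodes, Δ.localError ε g Dg z * Δ.maxJump uh z := by
  classical
  have hV : ∀ z, ∃ V, z ∈ Δ.nodes → Δ.IsMomentVector (nodeConst α₀ K) M ε g Dg (gbar z) z V := by
    intro z
    by_cases hz : z ∈ Δ.nodes
    · obtain ⟨V, h⟩ := S.exists_isMomentVector hgb hz
      exact ⟨V, fun _ => h⟩
    · exact ⟨0, fun h => absurd h hz⟩
  choose V hV using hV
  set B := nodeConst α₀ K
  obtain ⟨F, hF⟩ : ∃ F : Plane → Plane → ℝ, F = fun z s => if ‖s - z‖ ≤ B * Δ.smallH z then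
    Δ.jump uh z s * ⟪edgeDir z s, V z⟫ else 0 := ⟨_, rfl⟩
  set a : Plane → ℝ := fun z => Δ.localError ε g Dg z * Δ.maxJump uh z
  have ha0 : ∀ z, 0 ≤ a z := fun z => mul_nonneg (localError_nonneg S.ε_pos z) (Δ.maxJump_nonneg z)
  have hB : ∀ z ∈ Δ.nodes, 10 ≤ B := fun z hz => (S.const_le hz).2.1.trans (S.const_le hz).2.2.1
  have h1 : |∑ z ∈ Δ.nodes, ∑ s ∈ Δ.innerNbrs z,
      (edgeMoment g (gbar z) z s * Δ.jump uh z s + F z s)| ≤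
      ∑ z ∈ Δ.nodes, B ^ 14 * (|M| + 1) * a z := by
    refine (Finset.abs_sum_le_sum_abs _ _).trans (Finset.sum_le_sum fun z hz => ?_)
    rw [hF]
    exact S.abs_sum_le hgb huh hz (hV z hz)
  have h2 : |∑ z ∈ Δ.nodes, ∑ s ∈ Δ.innerNbrs z, (F z s + F s z)| ≤
      ∑ z ∈ Δ.nodes, ∑ s ∈ Δ.innerNbrs z, B ^ 15 * (|M| + 1) * (a z + a s) := by
    refine (Finset.abs_sum_le_sum_abs _ _).trans (Finset.sum_le_sum fun z hz => ?_)
    exact (Finset.abs_sum_le_sum_abs _ _).trans (Finset.sum_le_sum fun s hs =>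
      S.abs_pair_le hgb hV hF hs)
  have h3 : ∑ z ∈ Δ.nodes, ∑ s ∈ Δ.innerNbrs z, B ^ 15 * (|M| + 1) * a z ≤
      ∑ z ∈ Δ.nodes, B ^ 16 * (|M| + 1) * a z := by
    refine Finset.sum_le_sum fun z hz => ?_
    have := hB z hz
    have h4 : 0 ≤ B ^ 15 * (|M| + 1) * a z := mul_nonneg (by positivity) (ha0 z)
    rw [Finset.sum_const, nsmul_eq_mul]
    calc _ ≤ B * (B ^ 15 * (|M| + 1) * a z) :=
          mul_le_mul_of_nonneg_right (S.card_innerNbrs_le hz) h4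
      _ = _ := by ring
  have h4 : ∑ z ∈ Δ.nodes, B ^ 14 * (|M| + 1) * a z ≤ ∑ z ∈ Δ.nodes, B ^ 16 * (|M| + 1) * a z := by
    refine Finset.sum_le_sum fun z hz => mul_le_mul_of_nonneg_right (mul_le_mul_of_nonneg_right ?_
      (by positivity)) (ha0 z)
    exact pow_le_pow_right₀ (by linarith [hB z hz]) (by norm_num)
  simp only [mul_add (B ^ 15 * (|M| + 1)), Finset.sum_add_distrib] at h1 h2
  rw [sum_innerNbrs_comm F, sum_innerNbrs_comm (fun z _ => B ^ 15 * (|M| + 1) * a z)] at h2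
  have h5 : ∑ z ∈ Δ.nodes, B ^ 16 * (|M| + 1) * a z = B ^ 16 * (|M| + 1) * Δ.nodes.sum a :=
    (Finset.mul_sum _ _ _).symm
  rw [abs_le] at h1 h2 ⊢
  constructor <;> linarith [h1.1, h1.2, h2.1, h2.2]

lemma abs_jumpResidual_le (hn : volume (frontier Ω) = 0) (huh : Δ.IsFE uh) :
    |Δ.jumpResidual ε uh g gbar| ≤ 4 * nodeConst α₀ K ^ 16 * (|M| + 1) *
      sqrt (Δ.theta ε g Dg * ∑ z ∈ Δ.nodes,
        min (Δ.patchArea z) (ε * Δ.bigH z) * (ε * Δ.maxJump uh z) ^ 2) := by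
  have hε := S.ε_pos
  have h1 : ε ^ 2 * ∑ z ∈ Δ.nodes, Δ.localError ε g Dg z * Δ.maxJump uh z =
      ∑ z ∈ Δ.nodes, sqrt (Δ.localTheta ε g Dg z) *
        sqrt (Δ.localMass ε z * (ε * Δ.maxJump uh z) ^ 2) := by
    rw [Finset.mul_sum]
    refine sum_congr rfl fun z _ => ?_
    rw [localError, Real.sqrt_mul (localTheta_nonneg z), Real.sqrt_mul (localMass_nonneg hε z),
      Real.sqrt_sq (mul_nonneg hε.le (Δ.maxJump_nonneg z))]
    field_simp
  have hX : ∀ z, 0 ≤ Δ.localMass ε z * (ε * Δ.maxJump uh z) ^ 2 := fun z =>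
    mul_nonneg (localMass_nonneg hε z) (sq_nonneg _)
  have h2 := Real.sum_sqrt_mul_sqrt_le Δ.nodes (localTheta_nonneg (Δ := Δ) (ε := ε) (g := g) (Dg := Dg)) hX
  have hΘ := sum_localTheta_le (Δ := Δ) (ε := ε) hn S.sq
  have hΘ0 : 0 ≤ Δ.theta ε g Dg := by
    have : 0 ≤ ∑ z ∈ Δ.nodes, Δ.localTheta ε g Dg z := Finset.sum_nonneg fun z _ => localTheta_nonneg z
    linarith
  have h3 : sqrt (∑ z ∈ Δ.nodes, Δ.localTheta ε g Dg z) ≤ 2 * sqrt (Δ.theta ε g Dg) := by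
    refine Real.sqrt_le_iff.2 ⟨by positivity, ?_⟩
    rw [mul_pow, sq_sqrt hΘ0]; linarith
  have hC : 0 ≤ 2 * nodeConst α₀ K ^ 16 * (|M| + 1) := by
    have : 0 ≤ nodeConst α₀ K ^ 16 := Even.pow_nonneg (by decide) _
    positivity
  rw [jumpResidual_eq_sum, abs_mul, abs_of_nonneg (sq_nonneg ε)]
  calc _ ≤ ε ^ 2 * (2 * nodeConst α₀ K ^ 16 * (|M| + 1) *
        ∑ z ∈ Δ.nodes, Δ.localError ε g Dg z * Δ.maxJump uh z) :=
        mul_le_mul_of_nonneg_left (S.abs_sum_sum_le hgb huh) (sq_nonneg ε)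
    _ = 2 * nodeConst α₀ K ^ 16 * (|M| + 1) *
        (ε ^ 2 * ∑ z ∈ Δ.nodes, Δ.localError ε g Dg z * Δ.maxJump uh z) := by ring
    _ ≤ 2 * nodeConst α₀ K ^ 16 * (|M| + 1) * (2 * sqrt (Δ.theta ε g Dg) *
        sqrt (∑ z ∈ Δ.nodes, Δ.localMass ε z * (ε * Δ.maxJump uh z) ^ 2)) := by
        rw [h1]
        exact mul_le_mul_of_nonneg_left
          (h2.trans (mul_le_mul_of_nonneg_right h3 (Real.sqrt_nonneg _))) hC
    _ = _ := by rw [Real.sqrt_mul hΘ0]; simp only [localMass]; ring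

end JumpSetting
end Triangulation
end AnisoFEM

open AnisoFEM in
theorem mainTheorem3 (α₀ K : ℝ) (hα₀ : α₀ < Real.pi) :
    -- edges with `|S| ≤ κ h_z` count as short, for a sufficiently large `κ`;
    -- `c₀` is sufficiently small
    ∃ κ₀ : ℝ, ∀ κ : ℝ, κ₀ ≤ κ → ∃ c₁ : ℝ, 0 < c₁ ∧ ∀ c₀ : ℝ, 0 < c₀ → c₀ ≤ c₁ →
    ∀ (M : ℝ) (Ω : Set Plane), IsPolygonalDomain Ω →
    ∀ (f : Plane → ℝ → ℝ) (Cf : ℝ), IsReaction Ω f Cf →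
    ∃ C : ℝ, 0 < C ∧
    ∀ ε : ℝ, 0 < ε → ε ≤ 1 → 1 ≤ Cf + ε ^ 2 →
    ∀ 𝒯 : Triangulation Ω, 𝒯.IsAdmissible α₀ K →
    (∀ z ∈ 𝒯.nodes, 𝒯.IsAnisotropic c₀ K z ∨ 𝒯.IsRegular M z) →
    (∀ z ∈ 𝒯.nodes, IsCorner Ω z → 𝒯.IsRegular M z) →
    ∀ (u : Plane → ℝ) (Du : Plane → Plane), IsSolution Ω f ε u Du →
    ∀ uh : Plane → ℝ, 𝒯.IsDiscreteSolution f ε uh →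
    let err : ℝ := energyNorm ε Ω (fun x => uh x - u x) (fun x => gradient uh x - Du x)
    0 < err →
    ∀ Gh : Plane → ℝ, 𝒯.IsFE Gh →
    let G : Plane → ℝ := fun x => (uh x - u x) / err
    let DG : Plane → Plane := fun x => err⁻¹ • (gradient uh x - Du x)
    let g : Plane → ℝ := fun x => G x - Gh x
    let Dg : Plane → Plane := fun x => DG x - gradient Gh x
    (∀ gbar : Plane → ℝ, (∀ z ∈ 𝒯.nodes, z ∈ frontier Ω → gbar z = 0) →
      err ≤ C * (𝒯.jumpResidual ε uh g gbar + 𝒯.interiorResidual f uh g gbar +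
        𝒯.quadError f uh G)) ∧
    (∃ gbar : Plane → ℝ, 𝒯.IsAverageFamily κ M g gbar) ∧
    ∀ gbar : Plane → ℝ, 𝒯.IsAverageFamily κ M g gbar →
      |𝒯.jumpResidual ε uh g gbar| ≤
        C * Real.sqrt (𝒯.theta ε g Dg * ∑ z ∈ 𝒯.nodes,
          min (𝒯.patchArea z) (ε * 𝒯.bigH z) * (ε * 𝒯.maxJump uh z) ^ 2) := by
  have hB : 0 < nodeConst α₀ K := by
    rw [nodeConst, Triangulation.anisoConst]; positivity
  refine ⟨nodeConst α₀ K, fun κ hκ => ?_⟩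
  have hκ0 : 0 < κ := hB.trans_le hκ
  refine ⟨min (nodeConst α₀ K ^ 12)⁻¹ (κ * nodeConst α₀ K)⁻¹, by positivity,
    fun c₀ hc0 hc₀ M Ω hP f Cf hf => ?_⟩
  obtain ⟨C, hC, hpart⟩ := Triangulation.exists_error_le hP hf
  refine ⟨C + 4 * nodeConst α₀ K ^ 16 * (|M| + 1), by positivity, ?_⟩
  intro ε hε hε1 hCf 𝒯 hadm hcases hcor u Du hu uh huh err herr Gh hGh G DG g Dg
  have hn := hP.volume_frontier
  have hm : MemH10 Ω g Dg := by
    have h1 := (((huh.isFE.memH10 hP).sub hu.memH10).const_smul err⁻¹).sub (hGh.memH10 hP)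
    refine (funext fun x => ?_ : g = fun x => err⁻¹ * (uh x - u x) - Gh x) ▸ h1
    simp only [g, G]; rw [div_eq_inv_mul]
  have hc : ContinuousOn g (closure Ω) :=
    ((huh.isFE.continuousOn.sub hu.continuousOn).div_const err).sub hGh.continuousOn
  have S : 𝒯.JumpSetting α₀ K M κ c₀ ε g Dg :=
    { isOpen := hP.isOpen
      angle_lt := hα₀
      admissible := hadm
      node_cases := hcases
      corner := hcor
      le_kappa := hκ
      c₀_small := by
        have := hc₀.trans (min_le_left _ _)
        rwa [← one_div, le_div_iff₀ (by positivity)] at this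
      kappa_small := by
        have := hc₀.trans (min_le_right _ _)
        rwa [← one_div, le_div_iff₀ (by positivity), mul_comm] at this
      ε_pos := hε
      sob := Sob.of_memH10 hP.isBounded hn hc hm
      sob_sq := Sob.sq_of_memH10 hP.isBounded hn hc hm
      sq := ⟨by rw [restrict_closure_eq hn]; exact hm.memLp,
        by rw [restrict_closure_eq hn]; exact hm.memLp_grad⟩
      boundary := fun x hx => by
        simp only [g, G, huh.isFE.boundary x hx, hu.boundary x hx, hGh.boundary x hx, sub_zero,
          zero_div] }
  have hS := Real.sqrt_nonneg (𝒯.theta ε g Dg * ∑ z ∈ 𝒯.nodes,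
    min (𝒯.patchArea z) (ε * 𝒯.bigH z) * (ε * 𝒯.maxJump uh z) ^ 2)
  refine ⟨fun gbar hgbar => ?_, S.exists_isAverageFamily, fun gbar hgbar =>
    (S.abs_jumpResidual_le hgbar hn huh.isFE).trans (mul_le_mul_of_nonneg_right (by linarith) hS)⟩
  have h1 := hpart ε hCf 𝒯 u Du hu uh huh err rfl herr Gh gbar hGh hgbar
  -- the sum of the residuals is positive, so that the constant may be increased
  have h2 := pos_of_mul_pos_right (herr.trans_le h1) hC.le
  exact h1.trans (mul_le_mul_of_nonneg_right (le_add_of_nonneg_right (by positivity)) h2.le)
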